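/- Let $P=\mathbb C[x_1,\dots,x_e]_{(x_1,\dots,x_e)}$ with maximal ideal $\mathfrak m$, and let $A=P/I$ be a QL-ring. This means that $I$ is a prime ideal with a standard basis $f_1,\dots,f_n$ whose members all have order $2$, that the relation module $\{(p_1,\dots,p_n)\in P^n : \sum p_if_i=0\}$ has a standard basis $r^1,\dots,r^s$ whose members all have order $1$, and that the initial forms $\operatorname{in}(f_i)$ are linearly independent over $\mathbb C$, as are the $\operatorname{in}(r^i)$. (A standard basis of a submodule $N$ of a finite free $P$-module $L$ is a finite set of generators of $N$ whose initial forms generate $\bigoplus_i(\mathfrak m^iL\cap N+\mathfrak m^{i+1}L)/\mathfrak m^{i+1}L$ over the associated graded ring.) Write $\mathfrak m$ also for the maximal ideal of $A$, let $\pi:\widehat X=\operatorname{Proj}\bigoplus_i\mathfrak m^i\to X=\operatorname{Spec}A$ be the blow-up, $C\subset\widehat X$ the exceptional divisor, with ideal sheaf $\mathcal I_C=\mathfrak m\mathcal O_{\widehat X}$, and $M$ the blow-up of $\operatorname{Spec}P$ in $\mathfrak m$, which contains $\widehat X$ as the strict transform of $X$. Let $T^i(R/S;-)$ be the cotangent cohomology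 of an $S$-algebra $R$. Let $\mathcal F^i=\mathcal T^i_{\pi^{-1}A}(\mathcal O_{\widehat X})$ be the sheaf on $\widehat X$ with sections $T^i(A/\mathbb C;\mathcal O(V))$ over affine open $V$, let $N_A(\mathcal O_{\widehat X})=\mathcal T^1_{\pi^{-1}A/\pi^{-1}P}(\mathcal O_{\widehat X})$ be the sheaf with sections $T^1(A/P;\mathcal O(V))$, and let $\mathcal T^i_{\widehat X}$ be the sheaf with sections $T^i(\mathcal O(V)/\mathbb C;\mathcal O(V))$. Let $\mathcal N_{\widehat X/M}$ be the normal sheaf, $\Theta_{\widehat X}$ the tangent sheaf, $\operatorname{Der}_C(\widehat X)\subseteq\Theta_{\widehat X}$ the subsheaf of derivations $D$ with $D(\mathcal I_C)\subseteq\mathcal I_C$, and $\mathcal A^1_{C/\widehat X}$ the cokernel of the map $\Theta_{\widehat X}\to\mathcal O_C(C)$ given by $D\mapsto D(x)\otimes\frac1x \bmod x$ where $x$ is a local equation of $C$. Then there are, as sheaves of $\mathcal O_{\widehat X}$-modules: (i) an isomorphism $\mathcal F^0\cong\operatorname{Der}_C(\widehat X)(C)$; (ii) an isomorphism $N_A(\mathcal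 O_{\widehat X})\cong\mathcal N_{\widehat X/M}(2C)$; (iii) an exact sequence $0\to\mathcal A^1_{C/\widehat X}(C)\to\mathfrak m\mathcal F^1\to\mathcal T^1_{\widehat X}(C)\to0$; (iv) an isomorphism $\mathfrak m\mathcal F^2\cong\mathcal T^2_{\widehat X}(2C)$; consequently, if $\mathcal T^2_{\widehat X}$ vanishes outside a finite closed subset of $\widehat X$ (for example, if $X$ is a rational surface singularity with $e\ge4$, where $\widehat X$ has only isolated singularities), then $\mathfrak m\mathcal F^2\cong\mathcal T^2_{\widehat X}$. -/

import Mathlib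

open CategoryTheory AlgebraicGeometry TopologicalSpace

namespace QLSing

noncomputable section

/-! ### Blow-ups -/

section Rees
variable {R S : Type} [CommRing R] [CommRing S]

/-- The degree `n` part `Iⁿtⁿ` of the Rees algebra `⨁ Iⁿtⁿ ⊆ R[t]`. -/
def reesPiece (I : Ideal R) (n : ℕ) : Submodule R (reesAlgebra I) where
  carrier := {p | ∀ i, i ≠ n → (p : Polynomial R).coeff i = 0}
  add_mem' hp hq i hi := by simp [hp i hi, hq i hi]
  zero_mem' i _ := by simp
  smul_mem' c p hp i hi := by simp [hp i hi]

/-- The homogeneous component of degree `n`. -/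
def reesComponent {I : Ideal R} (p : reesAlgebra I) (n : ℕ) : reesPiece I n :=
  ⟨⟨Polynomial.monomial n ((p : Polynomial R).coeff n), reesAlgebra.monomial_mem.mpr (p.2 n)⟩,
    fun _ hi => Polynomial.coeff_monomial_of_ne _ hi⟩

theorem reesComponent_coeff {I : Ideal R} (x : DirectSum ℕ fun n => reesPiece I n) (n : ℕ) :
    ((DirectSum.coeAddMonoidHom (reesPiece I) x : reesAlgebra I) : Polynomial R).coeff n =
      ((x n : reesAlgebra I) : Polynomial R).coeff n := by
  induction x using DirectSum.induction_on with
  | zero => simp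
  | of i y =>
    rw [DirectSum.coeAddMonoidHom_of]
    by_cases h : n = i
    · subst h; simp
    · rw [DirectSum.of_eq_of_ne _ _ _ h]
      simpa using y.2 n h
  | add x y hx hy => simp [hx, hy]

instance reesGrading (I : Ideal R) : GradedAlgebra (reesPiece I) where
  one_mem i hi := by simp [Polynomial.coeff_one, hi]
  mul_mem a b p q hp hq i hi := by
    change ((p : Polynomial R) * (q : Polynomial R)).coeff i = 0
    rw [Polynomial.coeff_mul]
    refine Finset.sum_eq_zero fun x hx => ?_
    have hx' := Finset.HasAntidiagonal.mem_antidiagonal.mp hx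
    by_cases h1 : x.1 = a
    · rw [hq x.2 (by omega), mul_zero]
    · rw [hp x.1 h1, zero_mul]
  decompose' p := DirectSum.mk (fun n => reesPiece I n) (p : Polynomial R).support
    fun n => reesComponent p n
  left_inv p := by
    refine Subtype.ext (Polynomial.ext fun n => ?_)
    rw [reesComponent_coeff]
    by_cases h : n ∈ (p : Polynomial R).support
    · rw [DirectSum.mk_apply_of_mem h]
      exact Polynomial.coeff_monomial_same _ _
    · rw [DirectSum.mk_apply_of_notMem h]
      simpa using (Polynomial.notMem_support_iff.mp h).symm
  right_inv x := by
    refine DFinsupp.ext fun n => Subtype.ext (Subtype.ext (Polynomial.ext fun i => ?_))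
    have key := reesComponent_coeff x n
    by_cases h : n ∈ ((DirectSum.coeAddMonoidHom (reesPiece I) x : reesAlgebra I) :
        Polynomial R).support
    · rw [DirectSum.mk_apply_of_mem h]
      change (Polynomial.monomial n _).coeff i = _
      by_cases hi : i = n
      · subst hi; rw [Polynomial.coeff_monomial_same, key]
      · rw [Polynomial.coeff_monomial_of_ne _ hi]
        exact ((x n).2 i hi).symm
    · rw [DirectSum.mk_apply_of_notMem h]
      by_cases hi : i = n
      · subst hi
        rw [Polynomial.notMem_support_iff.mp h] at key
        simpa using key
      · simpa using ((x n).2 i hi).symm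

/-- The blow-up `Proj (⨁ Iⁿ)` of `Spec R` in the ideal `I`. -/
def blowup (I : Ideal R) : Scheme.{0} := Proj (reesPiece I)

/-- The structure morphism `π` of the blow-up. -/
def blowupπ (I : Ideal R) : blowup I ⟶ Spec (.of R) :=
  Proj.toSpecZero (reesPiece I) ≫ Spec.map (CommRingCat.ofHom (algebraMap R (reesPiece I 0)))

/-- The graded ring map `⨁ Iⁿ → ⨁ (I S)ⁿ` induced by a ring map `φ : R → S`. -/
def reesMap (φ : R →+* S) (I : Ideal R) :
    reesPiece I →+*ᵍ reesPiece (I.map φ) where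
  toRingHom := ((Polynomial.mapRingHom φ).comp (reesAlgebra I).val.toRingHom).codRestrict
    (reesAlgebra (I.map φ)) fun p i => by
      have h := Ideal.mem_map_of_mem φ (p.2 i)
      rw [Ideal.map_pow] at h
      simpa using h
  map_mem {n p} hp i hi := by
    change (Polynomial.map φ (p : Polynomial R)).coeff i = 0
    rw [Polynomial.coeff_map, hp i hi, map_zero]

theorem irrelevant_le_map_reesMap {φ : R →+* S} (hφ : Function.Surjective φ) (I : Ideal R) :
    HomogeneousIdeal.irrelevant (reesPiece (I.map φ)) ≤
      (HomogeneousIdeal.irrelevant (reesPiece I)).map (reesMap φ I) := by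
  refine (HomogeneousIdeal.irrelevant_le (𝒜 := reesPiece (I.map φ))).mpr fun i hi x hx => ?_
  have hx2 := x.2 i
  rw [← Ideal.map_pow, Ideal.mem_map_iff_of_surjective φ hφ] at hx2
  obtain ⟨a, ha, hax⟩ := hx2
  refine Ideal.subset_span ⟨⟨Polynomial.monomial i a, reesAlgebra.monomial_mem.mpr ha⟩, ?_, ?_⟩
  · exact HomogeneousIdeal.mem_irrelevant_of_mem _ hi
      (fun j hj => Polynomial.coeff_monomial_of_ne _ hj)
  · refine Subtype.ext (Polynomial.ext fun j => ?_)
    change (Polynomial.map φ (Polynomial.monomial i a)).coeff j = _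
    rw [Polynomial.map_monomial]
    by_cases hj : j = i
    · subst hj; rw [Polynomial.coeff_monomial_same, hax]
    · rw [Polynomial.coeff_monomial_of_ne _ hj]; exact (hx j hj).symm

/-- For surjective `φ : R → S`, the morphism of blow-ups `Bl_{IS} Spec S → Bl_I Spec R`
(the inclusion of the strict transform). -/
def blowupMap {φ : R →+* S} (hφ : Function.Surjective φ) (I : Ideal R) :
    blowup (I.map φ) ⟶ blowup I :=
  Proj.map (reesMap φ I) (irrelevant_le_map_reesMap hφ I)
end Rees

/-! ### Cotangent cohomology -/

section Cotangent

variable {k R R' B B' : Type} [CommRing k] [CommRing R] [CommRing R'] [CommRing B] [CommRing B']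

/-- The surjection `k[X_r : r ∈ R] → R`, `X_r ↦ r`, from the polynomial ring on the set `R`. -/
def presEval (ι : k →+* R) : MvPolynomial R k →+* R :=
  MvPolynomial.eval₂Hom ι id

/-- The ideal `I` of the presentation `R = k[X_r : r ∈ R]/I`. -/
def presIdeal (ι : k →+* R) : Ideal (MvPolynomial R k) :=
  RingHom.ker (presEval ι)

/-- `D : R → B` is a `k`-derivation, for the ring maps `ι : k → R` and `φ : R → B`. -/
structure IsDer (ι : k →+* R) (φ : R →+* B) (D : R → B) : Prop where
  map_add : ∀ a b, D (a + b) = D a + D b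
  map_mul : ∀ a b, D (a * b) = φ a * D b + φ b * D a
  map_base : ∀ c, D (ι c) = 0

/-- `T⁰(R/k; B) = Der_k(R, B)`, as a `B`-module. -/
def T0 (ι : k →+* R) (φ : R →+* B) : Submodule B (R → B) where
  carrier := {D | IsDer ι φ D}
  add_mem' {D E} hD hE :=
    ⟨fun a b => by simp only [Pi.add_apply, hD.map_add, hE.map_add]; ring,
     fun a b => by simp only [Pi.add_apply, hD.map_mul, hE.map_mul]; ring,
     fun c => by simp only [Pi.add_apply, hD.map_base, hE.map_base, add_zero]⟩
  zero_mem' := ⟨fun _ _ => by simp, fun _ _ => by simp, fun _ => rfl⟩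
  smul_mem' b D hD :=
    ⟨fun a b => by simp only [Pi.smul_apply, smul_eq_mul, hD.map_add]; ring,
     fun a b => by simp only [Pi.smul_apply, smul_eq_mul, hD.map_mul]; ring,
     fun c => by simp only [Pi.smul_apply, hD.map_base, smul_zero]⟩

/-- `Hom_P(I, B) = Hom_R(I/I², B)` for the presentation `R = P/I` above; `P` acts on `B` through
`P → R → B`. -/
abbrev T1Hom (ι : k →+* R) (φ : R →+* B) : Type :=
  presIdeal ι →ₛₗ[φ.comp (presEval ι)] B

/-- The image of `Der_k(P, B) → Hom_P(I, B)`. -/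
def T1Triv (ι : k →+* R) (φ : R →+* B) : Submodule B (T1Hom ι φ) where
  carrier := {ψ | ∃ D ∈ T0 (MvPolynomial.C (σ := R)) (φ.comp (presEval ι)),
    ∀ f : presIdeal ι, ψ f = D f}
  add_mem' := by
    rintro ψ χ ⟨D, hD, h⟩ ⟨E, hE, h'⟩
    exact ⟨D + E, add_mem hD hE, fun f => by rw [LinearMap.add_apply, h, h']; rfl⟩
  zero_mem' := ⟨0, zero_mem _, fun _ => rfl⟩
  smul_mem' := by
    rintro b ψ ⟨D, hD, h⟩
    exact ⟨b • D, Submodule.smul_mem _ _ hD, fun f => by rw [LinearMap.smul_apply, h]; rfl⟩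

/-- `T¹(R/k; B)`, the cokernel of `Der_k(P, B) → Hom_R(I/I², B)`. -/
def T1 (ι : k →+* R) (φ : R →+* B) : Type := T1Hom ι φ ⧸ T1Triv ι φ

instance (ι : k →+* R) (φ : R →+* B) : AddCommGroup (T1 ι φ) :=
  inferInstanceAs (AddCommGroup (T1Hom ι φ ⧸ T1Triv ι φ))

instance (ι : k →+* R) (φ : R →+* B) : Module B (T1 ι φ) :=
  inferInstanceAs (Module B (T1Hom ι φ ⧸ T1Triv ι φ))

/-- The free `P`-module `F` on the set `I`. -/
abbrev presFree (ι : k →+* R) : Type := presIdeal ι →₀ MvPolynomial R k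

/-- The map `j : F → P` that sends the basis element of `f ∈ I` to `f`. -/
def presMap (ι : k →+* R) : presFree ι →ₗ[MvPolynomial R k] MvPolynomial R k :=
  Finsupp.linearCombination _ Subtype.val

/-- The module of relations `Rel = ker (j : F → P)`. -/
def presRel (ι : k →+* R) : Submodule (MvPolynomial R k) (presFree ι) :=
  LinearMap.ker (presMap ι)

/-- The submodule `Rel₀` of trivial relations, generated by the `j(x) y - j(y) x`. -/
def presRel₀ (ι : k →+* R) : Submodule (MvPolynomial R k) (presFree ι) :=
  Submodule.span _ {z | ∃ x y, z = presMap ι x • y - presMap ι y • x}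

/-- The module `Rel/Rel₀`, as a submodule of `F/Rel₀`. -/
def presRelQuot (ι : k →+* R) : Submodule (MvPolynomial R k) (presFree ι ⧸ presRel₀ ι) :=
  (presRel ι).map (presRel₀ ι).mkQ

/-- `Hom_R(Rel/Rel₀, B)`. -/
abbrev T2Hom (ι : k →+* R) (φ : R →+* B) : Type :=
  presRelQuot ι →ₛₗ[φ.comp (presEval ι)] B

/-- The image of `Hom_R(F/Rel₀ ⊗ R, B) = Hom_P(F/Rel₀, B) → Hom_R(Rel/Rel₀, B)`. -/
def T2Triv (ι : k →+* R) (φ : R →+* B) : Submodule B (T2Hom ι φ) where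
  carrier := {ψ | ∃ χ : (presFree ι ⧸ presRel₀ ι) →ₛₗ[φ.comp (presEval ι)] B,
    ∀ r : presRelQuot ι, ψ r = χ r}
  add_mem' := by
    rintro ψ χ ⟨D, h⟩ ⟨E, h'⟩
    exact ⟨D + E, fun r => by rw [LinearMap.add_apply, h, h', LinearMap.add_apply]⟩
  zero_mem' := ⟨0, fun _ => rfl⟩
  smul_mem' := by
    rintro b ψ ⟨D, h⟩
    exact ⟨b • D, fun r => by rw [LinearMap.smul_apply, h, LinearMap.smul_apply]⟩

/-- `T²(R/k; B)`, the cokernel of `Hom_R(F/Rel₀ ⊗ R, B) → Hom_R(Rel/Rel₀, B)`. -/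
def T2 (ι : k →+* R) (φ : R →+* B) : Type := T2Hom ι φ ⧸ T2Triv ι φ

instance (ι : k →+* R) (φ : R →+* B) : AddCommGroup (T2 ι φ) :=
  inferInstanceAs (AddCommGroup (T2Hom ι φ ⧸ T2Triv ι φ))

instance (ι : k →+* R) (φ : R →+* B) : Module B (T2 ι φ) :=
  inferInstanceAs (Module B (T2Hom ι φ ⧸ T2Triv ι φ))

/-! ### Functoriality in the coefficients -/

/-- Composition of `Hom_P(N, B)` with `β : B → B'`. -/
def homCoeff {P N : Type} [CommRing P] [AddCommGroup N] [Module P N] {σ : P →+* B} {σ' : P →+* B'}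
    (β : B →+* B') (h : β.comp σ = σ') : (N →ₛₗ[σ] B) →ₛₗ[β] (N →ₛₗ[σ'] B') where
  toFun ψ :=
    { toFun := fun n => β (ψ n)
      map_add' := fun a b => by rw [map_add, map_add]
      map_smul' := fun p n => by
        rw [LinearMap.map_smulₛₗ, smul_eq_mul, map_mul, smul_eq_mul, ← h, RingHom.comp_apply] }
  map_add' ψ χ := LinearMap.ext fun n => map_add β _ _
  map_smul' b ψ := LinearMap.ext fun n => map_mul β _ _

theorem comp_presEval {ι : k →+* R} {φ : R →+* B} {φ' : R →+* B'} {β : B →+* B'}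
    (h : β.comp φ = φ') : β.comp (φ.comp (presEval ι)) = φ'.comp (presEval ι) := by
  rw [← RingHom.comp_assoc, h]

theorem T0_comp {ι : k →+* R} {φ : R →+* B} {φ' : R →+* B'} {β : B →+* B'}
    (h : β.comp φ = φ') {D : R → B} (hD : D ∈ T0 ι φ) : (fun a => β (D a)) ∈ T0 ι φ' where
  map_add a b := by rw [IsDer.map_add hD, map_add]
  map_mul a b := by rw [IsDer.map_mul hD, map_add, map_mul, map_mul, ← h]; rfl
  map_base c := by rw [IsDer.map_base hD, map_zero]

/-- `T¹(R/k; B) → T¹(R/k; B')`. -/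
def T1.coeff (ι : k →+* R) {φ : R →+* B} {φ' : R →+* B'} (β : B →+* B') (h : β.comp φ = φ') :
    T1 ι φ →ₛₗ[β] T1 ι φ' :=
  Submodule.mapQ (T1Triv ι φ) (T1Triv ι φ') (homCoeff β (comp_presEval h)) <| by
    rintro ψ ⟨D, hD, hψ⟩
    exact ⟨fun p => β (D p), T0_comp (comp_presEval h) hD, fun f => congrArg β (hψ f)⟩

/-- `T²(R/k; B) → T²(R/k; B')`. -/
def T2.coeff (ι : k →+* R) {φ : R →+* B} {φ' : R →+* B'} (β : B →+* B') (h : β.comp φ = φ') :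
    T2 ι φ →ₛₗ[β] T2 ι φ' :=
  Submodule.mapQ (T2Triv ι φ) (T2Triv ι φ') (homCoeff β (comp_presEval h)) <| by
    rintro ψ ⟨χ, hχ⟩
    exact ⟨homCoeff β (comp_presEval h) χ, fun r => congrArg β (hχ r)⟩

/-! ### Functoriality in the ring -/

/-- Composition of `Hom_{P'}(N', B)` with a homomorphism `N → N'` over `α : P → P'`. -/
def homPull {P P' N N' : Type} [CommRing P] [CommRing P'] [AddCommGroup N] [Module P N]
    [AddCommGroup N'] [Module P' N'] {α : P →+* P'} {σ : P →+* B} {σ' : P' →+* B}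
    (h : σ'.comp α = σ) (g : N →ₛₗ[α] N') : (N' →ₛₗ[σ'] B) →ₗ[B] (N →ₛₗ[σ] B) where
  toFun ψ :=
    { toFun := fun n => ψ (g n)
      map_add' := fun a b => by rw [map_add, map_add]
      map_smul' := fun p n => by
        rw [LinearMap.map_smulₛₗ, LinearMap.map_smulₛₗ, ← h, RingHom.comp_apply] }
  map_add' _ _ := rfl
  map_smul' _ _ := rfl

variable {ι : k →+* R} {ι' : k →+* R'} {α : R →+* R'} {φ : R →+* B} {φ' : R' →+* B}

/-- `k[X_r : r ∈ R] → k[X_r : r ∈ R']`, `X_r ↦ X_{α r}`. -/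
def presRename (k : Type) [CommRing k] (α : R →+* R') : MvPolynomial R k →+* MvPolynomial R' k :=
  (MvPolynomial.rename α).toRingHom

theorem presEval_comp_rename (hα : α.comp ι = ι') :
    (presEval ι').comp (presRename k α) = α.comp (presEval ι) := by
  subst hα
  refine MvPolynomial.ringHom_ext (fun c => ?_) fun r => ?_ <;>
    simp [presEval, presRename]

theorem comp_presEval_rename (hα : α.comp ι = ι') (h : φ'.comp α = φ) :
    (φ'.comp (presEval ι')).comp (presRename k α) = φ.comp (presEval ι) := by
  rw [RingHom.comp_assoc, presEval_comp_rename hα, ← RingHom.comp_assoc, h]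

/-- The induced map of ideals `I → I'`. -/
def presIdealMap (hα : α.comp ι = ι') : presIdeal ι →ₛₗ[presRename k α] presIdeal ι' where
  toFun f := ⟨presRename k α f, by
    have hf : presEval ι f = 0 := f.2
    have := congrArg (fun g => g (f : MvPolynomial R k)) (presEval_comp_rename hα)
    simpa [presIdeal, RingHom.mem_ker, hf] using this⟩
  map_add' f g := Subtype.ext (map_add _ _ _)
  map_smul' p f := Subtype.ext (map_mul _ _ _)

/-- The induced map of free modules `F → F'`. -/
def presFreeMap (hα : α.comp ι = ι') : presFree ι →ₛₗ[presRename k α] presFree ι' where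
  toFun z := z.sum fun f p => Finsupp.single (presIdealMap hα f) (presRename k α p)
  map_add' z w := Finsupp.sum_add_index' (by simp) (by simp)
  map_smul' p z := by
    rw [Finsupp.sum_smul_index' (by simp), Finsupp.smul_sum]
    simp

theorem presMap_freeMap (hα : α.comp ι = ι') (z : presFree ι) :
    presMap ι' (presFreeMap hα z) = presRename k α (presMap ι z) := by
  induction z using Finsupp.induction_linear with
  | zero => simp
  | add z w hz hw => simp [hz, hw]
  | single f p => simp [presMap, presFreeMap, presIdealMap]

/-- The induced map `F/Rel₀ → F'/Rel₀'`. -/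
def presFreeQuotMap (hα : α.comp ι = ι') :
    (presFree ι ⧸ presRel₀ ι) →ₛₗ[presRename k α] (presFree ι' ⧸ presRel₀ ι') :=
  Submodule.mapQ _ _ (presFreeMap hα) <| Submodule.span_le.mpr <| by
    rintro _ ⟨x, y, rfl⟩
    refine Submodule.subset_span ⟨presFreeMap hα x, presFreeMap hα y, ?_⟩
    simp [presMap_freeMap]

/-- The induced map `Rel/Rel₀ → Rel'/Rel₀'`. -/
def presRelQuotMap (hα : α.comp ι = ι') : presRelQuot ι →ₛₗ[presRename k α] presRelQuot ι' :=
  (presFreeQuotMap hα).restrict (p := presRelQuot ι) (q := presRelQuot ι') <| by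
    rintro _ ⟨z, hz, rfl⟩
    have hz' : presMap ι z = 0 := hz
    refine ⟨presFreeMap hα z, ?_, rfl⟩
    change presMap ι' _ = 0
    rw [presMap_freeMap, hz', map_zero]

/-- `T¹(R'/k; B) → T¹(R/k; B)` for a homomorphism `α : R → R'` of `k`-algebras. -/
def T1.pull (hα : α.comp ι = ι') (h : φ'.comp α = φ) : T1 ι' φ' →ₗ[B] T1 ι φ :=
  Submodule.mapQ (T1Triv ι' φ') (T1Triv ι φ) (homPull (comp_presEval_rename hα h) (presIdealMap hα)) <| by
    rintro ψ ⟨D, hD, hψ⟩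
    refine ⟨fun p => D (presRename k α p), ⟨fun a b => ?_, fun a b => ?_, fun c => ?_⟩,
      fun f => hψ _⟩
    · rw [map_add, IsDer.map_add hD]
    · rw [map_mul, IsDer.map_mul hD, ← comp_presEval_rename hα h]; rfl
    · have : presRename k α (MvPolynomial.C c) = MvPolynomial.C c := by simp [presRename]
      rw [this, IsDer.map_base hD]

/-- `T²(R'/k; B) → T²(R/k; B)` for a homomorphism `α : R → R'` of `k`-algebras. -/
def T2.pull (hα : α.comp ι = ι') (h : φ'.comp α = φ) : T2 ι' φ' →ₗ[B] T2 ι φ :=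
  Submodule.mapQ (T2Triv ι' φ') (T2Triv ι φ) (homPull (comp_presEval_rename hα h) (presRelQuotMap hα)) <| by
    rintro ψ ⟨χ, hχ⟩
    exact ⟨homPull (comp_presEval_rename hα h) (presFreeQuotMap hα) χ, fun r => hχ _⟩

end Cotangent

/-! ### Sheaves given on a family of open sets -/

section Gluing

/-- Restriction of functions. -/
abbrev resHom {Y : Scheme.{0}} {U V : Y.Opens} (h : V ≤ U) : Γ(Y, U) →+* Γ(Y, V) :=
  (Y.presheaf.map (homOfLE h).op).hom

theorem resHom_comp {Y : Scheme.{0}} {U V W : Y.Opens} (h : V ≤ U) (h' : W ≤ V) :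
    (resHom h').comp (resHom h) = resHom (h'.trans h) := by
  rw [← CommRingCat.hom_comp, ← Functor.map_comp]; rfl

theorem resHom_resHom {Y : Scheme.{0}} {U V W : Y.Opens} (h : V ≤ U) (h' : W ≤ V) (r : Γ(Y, U)) :
    resHom h' (resHom h r) = resHom (h'.trans h) r :=
  DFunLike.congr_fun (resHom_comp h h') r

theorem resHom_self {Y : Scheme.{0}} {U : Y.Opens} (h : U ≤ U) (r : Γ(Y, U)) :
    resHom h r = r := by
  simp [resHom]

/-- A family of open subsets of `Y`, with an order relation that implies inclusion. -/
structure OpenFamily (Y : Scheme.{0}) where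
  K : Type
  le : K → K → Prop
  opens : K → Y.Opens
  mono : ∀ {a b}, le a b → opens a ≤ opens b

/-- The family of all affine open subsets. -/
abbrev affineFamily (Y : Scheme.{0}) : OpenFamily Y where
  K := Y.affineOpens
  le a b := a.1 ≤ b.1
  opens a := a.1
  mono h := h

/-- Data for a sheaf of modules on `Y` that is given on the members of a family of open sets: a
module on each member of the family, and, for `a ≤ b`, the relation between the elements of the
module on `opens b` and their restrictions in the module on `opens a`. -/
structure LocalData {Y : Scheme.{0}} (𝒦 : OpenFamily Y) where
  obj : 𝒦.K → Type
  [grp : ∀ a, AddCommGroup (obj a)]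
  [mod : ∀ a, Module Γ(Y, 𝒦.opens a) (obj a)]
  compat : ∀ {a b}, 𝒦.le a b → obj b → obj a → Prop
  compat_zero : ∀ {a b} (h : 𝒦.le a b), compat h 0 0
  compat_add : ∀ {a b} (h : 𝒦.le a b) {s s' t t'}, compat h s t → compat h s' t' →
    compat h (s + s') (t + t')
  compat_smul : ∀ {a b} (h : 𝒦.le a b) (r : Γ(Y, 𝒦.opens b)) {s t}, compat h s t →
    compat h (r • s) (resHom (𝒦.mono h) r • t)

attribute [instance] LocalData.grp LocalData.mod

namespace LocalData

variable {Y : Scheme.{0}} {𝒦 : OpenFamily Y} (G : LocalData 𝒦)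

/-- Sections over `U`: the compatible families of elements, over all members of the family of open
sets that are contained in `U`. -/
structure Sec (U : Y.Opens) where
  val : ∀ a, 𝒦.opens a ≤ U → G.obj a
  property : ∀ {a b} (h : 𝒦.le a b) (hb : 𝒦.opens b ≤ U),
    G.compat h (val b hb) (val a ((𝒦.mono h).trans hb))

variable {G}

@[ext] theorem Sec.ext {U : Y.Opens} {s t : G.Sec U} (h : ∀ a ha, s.val a ha = t.val a ha) :
    s = t := by
  cases s; cases t
  congr
  exact funext fun a => funext fun ha => h a ha

instance (U : Y.Opens) : Zero (G.Sec U) := ⟨⟨fun _ _ => 0, fun h _ => G.compat_zero h⟩⟩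

instance (U : Y.Opens) : Add (G.Sec U) :=
  ⟨fun s t => ⟨fun a ha => s.val a ha + t.val a ha,
    fun h hb => G.compat_add h (s.property h hb) (t.property h hb)⟩⟩

instance (U : Y.Opens) : SMul Γ(Y, U) (G.Sec U) :=
  ⟨fun r s => ⟨fun a ha => resHom ha r • s.val a ha, fun h hb => by
    have := G.compat_smul h (resHom hb r) (s.property h hb)
    rwa [resHom_resHom] at this⟩⟩

instance (U : Y.Opens) : Neg (G.Sec U) :=
  ⟨fun s => ⟨fun a ha => - s.val a ha, fun h hb => by
    have := G.compat_smul h (-1) (s.property h hb)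
    simpa using this⟩⟩

@[simp] theorem Sec.zero_val {U : Y.Opens} (a) (ha : 𝒦.opens a ≤ U) : (0 : G.Sec U).val a ha = 0 :=
  rfl
@[simp] theorem Sec.add_val {U : Y.Opens} (s t : G.Sec U) (a) (ha) :
    (s + t).val a ha = s.val a ha + t.val a ha := rfl
@[simp] theorem Sec.neg_val {U : Y.Opens} (s : G.Sec U) (a) (ha) :
    (-s).val a ha = -s.val a ha := rfl
@[simp] theorem Sec.smul_val {U : Y.Opens} (r : Γ(Y, U)) (s : G.Sec U) (a) (ha) :
    (r • s).val a ha = resHom ha r • s.val a ha := rfl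

instance (U : Y.Opens) : AddCommGroup (G.Sec U) where
  add_assoc s t u := Sec.ext fun a ha => add_assoc _ _ _
  zero_add s := Sec.ext fun a ha => zero_add _
  add_zero s := Sec.ext fun a ha => add_zero _
  add_comm s t := Sec.ext fun a ha => add_comm _ _
  neg_add_cancel s := Sec.ext fun a ha => neg_add_cancel _
  nsmul := nsmulRec
  zsmul := zsmulRec

instance (U : Y.Opens) : Module Γ(Y, U) (G.Sec U) where
  one_smul s := Sec.ext fun a ha => by simp
  mul_smul r r' s := Sec.ext fun a ha => by simp [mul_smul]
  smul_zero r := Sec.ext fun a ha => by simp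
  smul_add r s t := Sec.ext fun a ha => by simp
  add_smul r r' s := Sec.ext fun a ha => by simp [add_smul]
  zero_smul s := Sec.ext fun a ha => by simp

/-- Restriction of sections. -/
def Sec.res {U V : Y.Opens} (h : V ≤ U) : G.Sec U →+ G.Sec V where
  toFun s := ⟨fun a ha => s.val a (ha.trans h), fun hab hb => s.property hab (hb.trans h)⟩
  map_zero' := rfl
  map_add' _ _ := rfl

theorem Sec.res_smul {U V : Y.Opens} (h : V ≤ U) (r : Γ(Y, U)) (s : G.Sec U) :
    Sec.res h (r • s) = resHom h r • Sec.res h s :=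
  Sec.ext fun a ha => by
    change resHom (ha.trans h) r • _ = resHom ha (resHom h r) • _
    rw [resHom_resHom]; rfl

variable (G)

instance (U : Y.Opensᵒᵖ) : Module (Y.ringCatSheaf.obj.obj U) (G.Sec U.unop) :=
  inferInstanceAs (Module Γ(Y, U.unop) (G.Sec U.unop))

/-- The presheaf of `𝒪_Y`-modules `U ↦ Sec U`. -/
def presheaf : Y.PresheafOfModules where
  obj U := ModuleCat.of (Y.ringCatSheaf.obj.obj U) (G.Sec U.unop)
  map {U V} f := ModuleCat.semilinearMapAddEquiv (Y.ringCatSheaf.obj.map f).hom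
    (ModuleCat.of (Y.ringCatSheaf.obj.obj U) (G.Sec U.unop))
    (ModuleCat.of (Y.ringCatSheaf.obj.obj V) (G.Sec V.unop))
    { toFun := Sec.res (leOfHom f.unop)
      map_add' := map_add _
      map_smul' := fun r s => Sec.res_smul _ r s }
  map_id U := by ext; rfl
  map_comp f g := by ext; rfl

/-- A homomorphism of local data: homomorphisms of modules that respect the relations. -/
structure Hom (G G' : LocalData 𝒦) where
  app : ∀ a, G.obj a →ₗ[Γ(Y, 𝒦.opens a)] G'.obj a
  compat : ∀ {a b} (h : 𝒦.le a b) {s t}, G.compat h s t → G'.compat h (app b s) (app a t)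

/-- The induced map on sections. -/
def Hom.sec {G G' : LocalData 𝒦} (f : Hom G G') (U : Y.Opens) :
    G.Sec U →ₗ[Γ(Y, U)] G'.Sec U where
  toFun s := ⟨fun a ha => f.app a (s.val a ha), fun h hb => f.compat h (s.property h hb)⟩
  map_add' _ _ := Sec.ext fun _ _ => map_add _ _ _
  map_smul' _ _ := Sec.ext fun _ _ => map_smul _ _ _

/-- The induced map of presheaves. -/
def Hom.presheaf {G G' : LocalData 𝒦} (f : Hom G G') : G.presheaf ⟶ G'.presheaf where
  app U := ModuleCat.ofHom (X := G.Sec U.unop) (Y := G'.Sec U.unop)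
    { toFun := f.sec U.unop
      map_add' := map_add _
      map_smul' := map_smul (f.sec U.unop) }
  naturality _ := rfl

end LocalData

/-- The sheaf of `𝒪_Y`-modules associated with a presheaf of modules. -/
def sheafify (Y : Scheme.{0}) : Y.PresheafOfModules ⥤ Y.Modules :=
  PresheafOfModules.sheafification (𝟙 Y.ringCatSheaf.obj)

/-- The sheaf of `𝒪_Y`-modules given by local data. -/
def LocalData.sheaf {Y : Scheme.{0}} {𝒦 : OpenFamily Y} (G : LocalData 𝒦) : Y.Modules :=
  (sheafify Y).obj G.presheaf

end Gluing

section Sheaves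

variable {k A : Type} [CommRing k] [CommRing A] {Y : Scheme.{0}}

/-- The ring map `A → Γ(Y, U)` of a scheme `π : Y → Spec A`. -/
def toSec (π : Y ⟶ Spec (.of A)) (U : Y.Opens) : A →+* Γ(Y, U) :=
  (resHom le_top).comp ((Scheme.ΓSpecIso (.of A)).inv ≫ π.appTop).hom

theorem resHom_comp_toSec (π : Y ⟶ Spec (.of A)) {U V : Y.Opens} (h : V ≤ U) :
    (resHom h).comp (toSec π U) = toSec π V := by
  rw [toSec, ← RingHom.comp_assoc, resHom_comp]; rfl

theorem resHom_comp_toSec_comp (ι : k →+* A) (π : Y ⟶ Spec (.of A)) {U V : Y.Opens} (h : V ≤ U) :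
    (resHom h).comp ((toSec π U).comp ι) = (toSec π V).comp ι := by
  rw [← RingHom.comp_assoc, resHom_comp_toSec]

/-! ### The sheaves `𝒯ⁱ_{π⁻¹A/π⁻¹k}(𝒪_Y)` -/

/-- `V ↦ T⁰(A/k; 𝒪(V))`. -/
def relT0Data (ι : k →+* A) (π : Y ⟶ Spec (.of A)) : LocalData (affineFamily Y) where
  obj V := T0 ι (toSec π V.1)
  compat h D E := ∀ a, resHom h (D.1 a) = E.1 a
  compat_zero _ _ := map_zero _
  compat_add _ _ _ _ _ H H' a := (map_add _ _ _).trans (congrArg₂ _ (H a) (H' a))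
  compat_smul _ _ _ _ H a := (map_mul _ _ _).trans (congrArg _ (H a))

/-- `V ↦ T¹(A/k; 𝒪(V))`. -/
def relT1Data (ι : k →+* A) (π : Y ⟶ Spec (.of A)) : LocalData (affineFamily Y) where
  obj V := T1 ι (toSec π V.1)
  compat h s t := T1.coeff ι (resHom h) (resHom_comp_toSec π h) s = t
  compat_zero _ := LinearMap.map_zero _
  compat_add _ _ _ _ _ H H' := by rw [map_add, H, H']
  compat_smul _ _ _ _ H := by rw [LinearMap.map_smulₛₗ, H]

/-- `V ↦ T²(A/k; 𝒪(V))`. -/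
def relT2Data (ι : k →+* A) (π : Y ⟶ Spec (.of A)) : LocalData (affineFamily Y) where
  obj V := T2 ι (toSec π V.1)
  compat h s t := T2.coeff ι (resHom h) (resHom_comp_toSec π h) s = t
  compat_zero _ := LinearMap.map_zero _
  compat_add _ _ _ _ _ H H' := by rw [map_add, H, H']
  compat_smul _ _ _ _ H := by rw [LinearMap.map_smulₛₗ, H]

/-! ### The tangent sheaf and the sheaves `𝒯ⁱ_Y` -/

/-- `V ↦ Der_k(𝒪(V))`: the tangent sheaf. -/
def thetaData (ι : k →+* A) (π : Y ⟶ Spec (.of A)) : LocalData (affineFamily Y) where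
  obj V := T0 ((toSec π V.1).comp ι) (RingHom.id Γ(Y, V.1))
  compat h D E := ∀ a, resHom h (D.1 a) = E.1 (resHom h a)
  compat_zero _ _ := map_zero _
  compat_add _ _ _ _ _ H H' a := (map_add _ _ _).trans (congrArg₂ _ (H a) (H' a))
  compat_smul _ _ _ _ H a := (map_mul _ _ _).trans (congrArg _ (H a))

/-- `V ↦ T¹(𝒪(V)/k; 𝒪(V))`. Elements for `V` and `W ⊆ V` are compatible if their images in
`T¹(𝒪(V)/k; 𝒪(W))` are equal. -/
def absT1Data (ι : k →+* A) (π : Y ⟶ Spec (.of A)) : LocalData (affineFamily Y) where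
  obj V := T1 ((toSec π V.1).comp ι) (RingHom.id Γ(Y, V.1))
  compat {_ V} h s t :=
    T1.coeff ((toSec π V.1).comp ι) (φ' := resHom h) (resHom h) (RingHom.comp_id _) s =
      T1.pull (resHom_comp_toSec_comp ι π h) (RingHom.id_comp _) t
  compat_zero _ := by rw [map_zero, map_zero]
  compat_add _ _ _ _ _ H H' := by rw [map_add, map_add, H, H']
  compat_smul _ _ _ _ H := by rw [LinearMap.map_smulₛₗ, map_smul, H]

/-- `V ↦ T²(𝒪(V)/k; 𝒪(V))`. Elements for `V` and `W ⊆ V` are compatible if their images in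
`T²(𝒪(V)/k; 𝒪(W))` are equal. -/
def absT2Data (ι : k →+* A) (π : Y ⟶ Spec (.of A)) : LocalData (affineFamily Y) where
  obj V := T2 ((toSec π V.1).comp ι) (RingHom.id Γ(Y, V.1))
  compat {_ V} h s t :=
    T2.coeff ((toSec π V.1).comp ι) (φ' := resHom h) (resHom h) (RingHom.comp_id _) s =
      T2.pull (resHom_comp_toSec_comp ι π h) (RingHom.id_comp _) t
  compat_zero _ := by rw [map_zero, map_zero]
  compat_add _ _ _ _ _ H H' := by rw [map_add, map_add, H, H']
  compat_smul _ _ _ _ H := by rw [LinearMap.map_smulₛₗ, map_smul, H]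

/-! ### The ideal sheaf of the exceptional divisor `C`, twists by `C` -/

variable (π : Y ⟶ Spec (.of A)) (m : Ideal A)

/-- Sections over the affine open set `V` of the ideal sheaf `ℐ_C = m 𝒪_Y`. -/
def excIdeal (V : Y.Opens) : Ideal Γ(Y, V) := m.map (toSec π V)

theorem map_excIdeal {U V : Y.Opens} (h : V ≤ U) :
    (excIdeal π m U).map (resHom h) = excIdeal π m V := by
  rw [excIdeal, Ideal.map_map, resHom_comp_toSec]; rfl

theorem excIdeal_pow_le_comap {U V : Y.Opens} (h : V ≤ U) (n : ℕ) :
    excIdeal π m U ^ n ≤ (excIdeal π m V ^ n).comap (resHom h) := by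
  rw [← Ideal.map_le_iff_le_comap, Ideal.map_pow, map_excIdeal]

theorem excIdeal_le_comap {U V : Y.Opens} (h : V ≤ U) :
    excIdeal π m U ≤ (excIdeal π m V).comap (resHom h) := by
  rw [← Ideal.map_le_iff_le_comap, map_excIdeal]

/-- `V ↦ Hom(ℐ_C(V)ⁿ, M(V))`. -/
def twistData (n : ℕ) (M : Y.Modules) : LocalData (affineFamily Y) where
  obj V := ↥(excIdeal π m V.1 ^ n) →ₗ[Γ(Y, V.1)] Γ(M, V.1)
  compat {_ V} h ψ χ := ∀ f : ↥(excIdeal π m V.1 ^ n),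
    M.presheaf.map (homOfLE h).op (ψ f) =
      χ ⟨resHom h f.1, excIdeal_pow_le_comap π m h n f.2⟩
  compat_zero _ _ := map_zero _
  compat_add _ _ _ _ _ H H' f := (map_add _ _ _).trans (congrArg₂ _ (H f) (H' f))
  compat_smul _ _ _ _ H f := (Scheme.Modules.map_smul M _ _ _).trans (congrArg _ (H f))

/-- The twist `M(nC) = M ⊗ 𝒪(nC) = ℋom(ℐ_Cⁿ, M)`. -/
def twist (n : ℕ) (M : Y.Modules) : Y.Modules := (twistData π m n M).sheaf

theorem map_mem_excIdeal_smul (M : Y.Modules) {U V : Y.Opens} (h : V ≤ U) {x : Γ(M, U)}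
    (hx : x ∈ (excIdeal π m U • ⊤ : Submodule Γ(Y, U) Γ(M, U))) :
    M.presheaf.map (homOfLE h).op x ∈ (excIdeal π m V • ⊤ : Submodule Γ(Y, V) Γ(M, V)) := by
  refine Submodule.smul_induction_on hx (fun r hr x _ => ?_) fun x y hx hy => ?_
  · rw [Scheme.Modules.map_smul]
    exact Submodule.smul_mem_smul (excIdeal_le_comap π m h hr) trivial
  · rw [map_add]
    exact add_mem hx hy

/-- The submodules `m M(U) ⊆ M(U)`. -/
def idealMulSub (M : Y.Modules) : PresheafOfModules.Submodule M.val where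
  obj U := (excIdeal π m U.unop • ⊤ : Submodule Γ(Y, U.unop) Γ(M, U.unop))
  map f _ hx := map_mem_excIdeal_smul π m M (leOfHom f.unop) hx

/-- The subsheaf `m M` of `M`. -/
def idealMul (M : Y.Modules) : Y.Modules :=
  (sheafify Y).obj (idealMulSub π m M).toPresheafOfModules

/-! ### `Der_C(Y)` and `𝒜¹_{C/Y}` -/

/-- `V ↦ {D ∈ Der_k(𝒪(V)) : D(ℐ_C) ⊆ ℐ_C}`. -/
def derCData (ι : k →+* A) : LocalData (affineFamily Y) where
  obj V := ({
    carrier := {D | ∀ a ∈ excIdeal π m V.1, D a ∈ excIdeal π m V.1} ∩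
      T0 ((toSec π V.1).comp ι) (RingHom.id Γ(Y, V.1))
    add_mem' := fun H H' => ⟨fun a ha => add_mem (H.1 a ha) (H'.1 a ha), add_mem H.2 H'.2⟩
    zero_mem' := ⟨fun _ _ => zero_mem _, zero_mem _⟩
    smul_mem' := fun r _ H =>
      ⟨fun a ha => Ideal.mul_mem_left _ r (H.1 a ha), Submodule.smul_mem _ r H.2⟩ } :
    Submodule Γ(Y, V.1) (Γ(Y, V.1) → Γ(Y, V.1)))
  compat h D E := ∀ a, resHom h (D.1 a) = E.1 (resHom h a)
  compat_zero _ _ := map_zero _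
  compat_add _ _ _ _ _ H H' a := (map_add _ _ _).trans (congrArg₂ _ (H a) (H' a))
  compat_smul _ _ _ _ H a := (map_mul _ _ _).trans (congrArg _ (H a))

/-- `V ↦ Hom(ℐ_C(V), 𝒪_C(V))`: the sheaf `𝒪_C(C) = ℋom(ℐ_C, 𝒪_C)`. -/
def normalCData : LocalData (affineFamily Y) where
  obj V := ↥(excIdeal π m V.1) →ₗ[Γ(Y, V.1)] Γ(Y, V.1) ⧸ excIdeal π m V.1
  compat {_ V} h ψ χ := ∀ f : ↥(excIdeal π m V.1),
    Ideal.quotientMap _ (resHom h) (excIdeal_le_comap π m h) (ψ f) =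
      χ ⟨resHom h f.1, excIdeal_le_comap π m h f.2⟩
  compat_zero _ _ := map_zero _
  compat_add _ _ _ _ _ H H' f := (map_add _ _ _).trans (congrArg₂ _ (H f) (H' f))
  compat_smul _ _ _ _ H f := by
    rw [LinearMap.smul_apply, LinearMap.smul_apply, ← H f, Algebra.smul_def, Algebra.smul_def,
      map_mul]
    rfl

/-- The map `Der_k(𝒪(V)) → Hom(ℐ_C(V), 𝒪_C(V))` that sends `D` to `f ↦ D(f) mod ℐ_C`. -/
def thetaToNormalCApp (ι : k →+* A) (V : Y.Opens) :
    T0 ((toSec π V).comp ι) (RingHom.id Γ(Y, V)) →ₗ[Γ(Y, V)]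
      ↥(excIdeal π m V) →ₗ[Γ(Y, V)] Γ(Y, V) ⧸ excIdeal π m V where
  toFun D :=
    { toFun := fun f => Ideal.Quotient.mk _ (D.1 f.1)
      map_add' := fun f g => by
        rw [← map_add]; exact congrArg _ (IsDer.map_add D.2 f.1 g.1)
      map_smul' := fun r f => by
        have h1 : D.1 (r * f.1) = r * D.1 f.1 + f.1 * D.1 r := IsDer.map_mul D.2 r f.1
        change Ideal.Quotient.mk _ (D.1 (r * f.1)) = _
        rw [h1, map_add, Ideal.Quotient.eq_zero_iff_mem.mpr (Ideal.mul_mem_right _ _ f.2),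
          add_zero]
        rfl }
  map_add' _ _ := rfl
  map_smul' _ _ := rfl

/-- The map `Θ_Y → 𝒪_C(C)`; where `x` is an equation of `C`, it is `D ↦ D(x) ⊗ 1/x mod x`. -/
def thetaToNormalC (ι : k →+* A) : LocalData.Hom (thetaData ι π) (normalCData π m) where
  app V := thetaToNormalCApp π m ι V.1
  compat _ _ _ H f := congrArg (Ideal.Quotient.mk _) (H f.1)

/-- `𝒜¹_{C/Y}`, the cokernel of `Θ_Y → 𝒪_C(C)`. -/
def sheafA1 (ι : k →+* A) : Y.Modules :=
  Limits.cokernel ((sheafify Y).map (thetaToNormalC π m ι).presheaf)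

/-! ### Normal sheaves -/

/-- The inverse images in `Y` of the affine open subsets of `M`, for `j : Y → M`. -/
abbrev preimageFamily {M : Scheme.{0}} (j : Y ⟶ M) : OpenFamily Y where
  K := M.affineOpens
  le a b := a.1 ≤ b.1
  opens a := j ⁻¹ᵁ a.1
  mono h := (Opens.map j.base).monotone h

/-- `W ↦ Hom_{𝒪(W)}(𝒥(W), 𝒪_Y(j⁻¹W))` for the ideal sheaf `𝒥 = ker (𝒪_M → j_* 𝒪_Y)` of a closed
embedding `j : Y → M`. -/
def normalData {M : Scheme.{0}} (j : Y ⟶ M) : LocalData (preimageFamily j) where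
  obj W := ↥(RingHom.ker (j.app W.1).hom) →ₛₗ[(j.app W.1).hom] Γ(Y, j ⁻¹ᵁ W.1)
  compat {W V} h ψ χ := ∀ (f : ↥(RingHom.ker (j.app V.1).hom))
    (g : ↥(RingHom.ker (j.app W.1).hom)), g.1 = resHom h f.1 →
      resHom ((preimageFamily j).mono h) (ψ f) = χ g
  compat_zero _ _ _ _ := map_zero _
  compat_add _ _ _ _ _ H H' f g e := (map_add _ _ _).trans (congrArg₂ _ (H f g e) (H' f g e))
  compat_smul _ _ _ _ H f g e := (map_mul _ _ _).trans (congrArg _ (H f g e))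

end Sheaves

/-! ### QL-rings -/

section QLRing

/-- The maximal ideal `(x₁, …, x_e)` of the polynomial ring. -/
def originIdeal (e : ℕ) : Ideal (MvPolynomial (Fin e) ℂ) :=
  RingHom.ker (MvPolynomial.constantCoeff (σ := Fin e) (R := ℂ))

instance (e : ℕ) : (originIdeal e).IsPrime := RingHom.ker_isPrime _

/-- The regular local ring `P = ℂ[x₁, …, x_e]_(x₁, …, x_e)`. -/
def LocPoly (e : ℕ) : Type := Localization.AtPrime (originIdeal e)

instance (e : ℕ) : CommRing (LocPoly e) :=
  inferInstanceAs (CommRing (Localization.AtPrime (originIdeal e)))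

instance (e : ℕ) : IsLocalRing (LocPoly e) :=
  inferInstanceAs (IsLocalRing (Localization.AtPrime (originIdeal e)))

instance (e : ℕ) : Algebra ℂ (LocPoly e) :=
  inferInstanceAs (Algebra ℂ (Localization.AtPrime (originIdeal e)))

variable {P M : Type} [CommRing P] [IsLocalRing P] [AddCommGroup M] [Module P M]

/-- `ord z = d`, i.e. `z ∈ mᵈM` and `z ∉ mᵈ⁺¹M`. -/
def HasOrd (z : M) (d : ℕ) : Prop :=
  z ∈ (IsLocalRing.maximalIdeal P ^ d • ⊤ : Submodule P M) ∧
    z ∉ (IsLocalRing.maximalIdeal P ^ (d + 1) • ⊤ : Submodule P M)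

/-- `v` is a standard basis of `N ⊆ M`, all of whose members have order `d`: the `v j` generate `N`
and their initial forms, which lie in degree `d`, generate the submodule
`⨁ᵢ (mⁱM ∩ N + mⁱ⁺¹M)/mⁱ⁺¹M` of the associated graded module, that is, the initial form of an
element of `mⁱM ∩ N` is a combination of them with coefficients of degree `i - d`. -/
structure IsStandardBasis (N : Submodule P M) (d : ℕ) {t : ℕ} (v : Fin t → M) : Prop where
  span_eq : Submodule.span P (Set.range v) = N
  ord_eq : ∀ j, HasOrd (P := P) (v j) d
  initial : ∀ i, ∀ z ∈ N, z ∈ (IsLocalRing.maximalIdeal P ^ i • ⊤ : Submodule P M) →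
    if d ≤ i then
      ∃ a : Fin t → P, (∀ j, a j ∈ IsLocalRing.maximalIdeal P ^ (i - d)) ∧
        z - ∑ j, a j • v j ∈ (IsLocalRing.maximalIdeal P ^ (i + 1) • ⊤ : Submodule P M)
    else z ∈ (IsLocalRing.maximalIdeal P ^ (i + 1) • ⊤ : Submodule P M)

/-- The initial forms, in `mᵈM/mᵈ⁺¹M ⊆ M/mᵈ⁺¹M`, of the `v j` of order `d` are linearly
independent over `ℂ`. -/
def InitialIndependent [Algebra ℂ P] [Module ℂ M] [IsScalarTower ℂ P M] (d : ℕ) {t : ℕ}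
    (v : Fin t → M) : Prop :=
  LinearIndependent ℂ fun j =>
    (Submodule.Quotient.mk (v j) : M ⧸ (IsLocalRing.maximalIdeal P ^ (d + 1) • ⊤ : Submodule P M))

/-- The relation module of `f₁, …, f_n`. -/
def relModule {n : ℕ} (f : Fin n → P) : Submodule P (Fin n → P) :=
  LinearMap.ker (Fintype.linearCombination P f)

/-- `P/I` is a QL-ring: `I` is a prime ideal with a standard basis of quadratic elements, whose
relation module has a standard basis of linear elements, with linearly independent initial
forms. -/
structure IsQL {e : ℕ} (I : Ideal (LocPoly e)) : Prop where
  isPrime : I.IsPrime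
  exists_basis : ∃ (n s : ℕ) (f : Fin n → LocPoly e) (r : Fin s → Fin n → LocPoly e),
    IsStandardBasis (P := LocPoly e) I 2 f ∧ IsStandardBasis (relModule f) 1 r ∧
    InitialIndependent (P := LocPoly e) 2 f ∧ InitialIndependent (P := LocPoly e) 1 r

end QLRing

/-! ### The blow-up of a QL-singularity -/

section Main

variable {e : ℕ} (I : Ideal (LocPoly e))

/-- The ring `A = P/I`. -/
def RingA : Type := LocPoly e ⧸ I

instance : CommRing (RingA I) := inferInstanceAs (CommRing (LocPoly e ⧸ I))

/-- The projection `P → A`. -/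
def projA : LocPoly e →+* RingA I := Ideal.Quotient.mk I

theorem projA_surjective : Function.Surjective (projA I) := Ideal.Quotient.mk_surjective

/-- The structure map `ℂ → A`. -/
def baseC : ℂ →+* RingA I := (projA I).comp (algebraMap ℂ (LocPoly e))

/-- The maximal ideal `m` of `A`. -/
def maxA : Ideal (RingA I) := (IsLocalRing.maximalIdeal (LocPoly e)).map (projA I)

/-- The blow-up `X̂` of `X = Spec A` in `m`. -/
abbrev Xhat : Scheme.{0} := blowup (maxA I)

/-- The blow-up morphism `π : X̂ → Spec A`. -/
def piX : Xhat I ⟶ Spec (.of (RingA I)) := blowupπ (maxA I)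

/-- The embedding of `X̂` in the blow-up `M` of `Spec P`. -/
def embX : Xhat I ⟶ blowup (IsLocalRing.maximalIdeal (LocPoly e)) :=
  blowupMap (projA_surjective I) _

/-- `ℱ⁰ = 𝒯⁰_{π⁻¹A}(𝒪_X̂)`. -/
def F0 : (Xhat I).Modules := (relT0Data (baseC I) (piX I)).sheaf

/-- `ℱ¹ = 𝒯¹_{π⁻¹A}(𝒪_X̂)`. -/
def F1 : (Xhat I).Modules := (relT1Data (baseC I) (piX I)).sheaf

/-- `ℱ² = 𝒯²_{π⁻¹A}(𝒪_X̂)`. -/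
def F2 : (Xhat I).Modules := (relT2Data (baseC I) (piX I)).sheaf

/-- `N_A(𝒪_X̂) = 𝒯¹_{π⁻¹A/π⁻¹P}(𝒪_X̂)`. -/
def NA : (Xhat I).Modules := (relT1Data (projA I) (piX I)).sheaf

/-- The normal sheaf `𝒩_{X̂/M}`. -/
def normalSheaf : (Xhat I).Modules := (normalData (embX I)).sheaf

/-- `Der_C(X̂)`. -/
def derC : (Xhat I).Modules := (derCData (piX I) (maxA I) (baseC I)).sheaf

/-- `𝒜¹_{C/X̂}`. -/
def A1 : (Xhat I).Modules := sheafA1 (piX I) (maxA I) (baseC I)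

/-- `𝒯¹_X̂`. -/
def TX1 : (Xhat I).Modules := (absT1Data (baseC I) (piX I)).sheaf

/-- `𝒯²_X̂`. -/
def TX2 : (Xhat I).Modules := (absT2Data (baseC I) (piX I)).sheaf

/-- The twist `G(nC)` of a sheaf `G` on `X̂`. -/
abbrev twistC (n : ℕ) (G : (Xhat I).Modules) : (Xhat I).Modules := twist (piX I) (maxA I) n G

/-- The subsheaf `mG` of a sheaf `G` on `X̂`. -/
abbrev mMul (G : (Xhat I).Modules) : (Xhat I).Modules := idealMul (piX I) (maxA I) G

/-- The sheaf `G` vanishes outside a finite closed subset. -/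
def HasFiniteSupport {Y : Scheme.{0}} (G : Y.Modules) : Prop :=
  ∃ Z : Set Y, Z.Finite ∧ IsClosed Z ∧ ∀ U : Y.Opens, Disjoint (U : Set Y) Z → Subsingleton Γ(G, U)

end Main

end

end QLSing

namespace QLSing
noncomputable section

/-! ### Extension of semilinear maps and derivations along localization-like maps -/

section Extension

variable {k P P' B N N' : Type} [CommRing k] [CommRing P] [CommRing P'] [CommRing B]
  [AddCommGroup N] [Module P N] [AddCommGroup N'] [Module P' N']

open nonZeroDivisors

theorem eq_of_mul_nzd {B : Type} [CommRing B] {s a b : B} (hs : s ∈ B⁰) (h : s * a = s * b) :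
    a = b :=
  (mul_cancel_left_mem_nonZeroDivisors hs).mp h

theorem semilinear_ext (γ : P →+* P') {σ' : P' →+* B} {σ : P →+* B} (h : σ'.comp γ = σ)
    {g : N →ₛₗ[γ] N'} {φ ψ : N' →ₛₗ[σ'] B}
    (hN : ∀ z, ∃ s n, σ s ∈ B⁰ ∧ γ s • z = g n) (hφ : ∀ n, φ (g n) = ψ (g n)) : φ = ψ := by
  refine LinearMap.ext fun z => ?_
  obtain ⟨s, n, hs, hz⟩ := hN z
  refine eq_of_mul_nzd hs ?_
  have h1 := congrArg φ hz
  have h2 := congrArg ψ hz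
  rw [LinearMap.map_smulₛₗ, smul_eq_mul, ← RingHom.comp_apply, h] at h1 h2
  rw [h1, h2, hφ]

/-- Semilinear maps into modules extend along `g : N → N'` if fractions have values. -/
theorem exists_semilinear_extension' {W : Type} [AddCommGroup W] [Module B W] (γ : P →+* P')
    (σ' : P' →+* B) {σ : P →+* B}
    (h : σ'.comp γ = σ) (g : N →ₛₗ[γ] N') (φ : N →ₛₗ[σ] W) (hker : ∀ n, g n = 0 → φ n = 0)
    (hP : ∀ p', ∃ s p, IsSMulRegular W (σ s) ∧ γ s * p' = γ p)
    (hN : ∀ z, ∃ s n b, IsSMulRegular W (σ s) ∧ γ s • z = g n ∧ σ s • b = φ n) :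
    ∃ φ' : N' →ₛₗ[σ'] W, ∀ n, φ' (g n) = φ n := by
  have hσ : ∀ p, σ' (γ p) = σ p := fun p => by rw [← h]; rfl
  choose s n b hs hn hb using hN
  have key : ∀ z t m, γ t • z = g m → σ t • b z = φ m := by
    intro z t m hm
    refine hs z ?_
    have h1 : g (t • n z - s z • m) = 0 := by
      rw [map_sub, LinearMap.map_smulₛₗ, LinearMap.map_smulₛₗ, ← hn, ← hm, smul_comm, sub_self]
    have h2 := hker _ h1
    rw [map_sub, LinearMap.map_smulₛₗ, LinearMap.map_smulₛₗ, sub_eq_zero, ← hb] at h2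
    change σ (s z) • _ = σ (s z) • _
    rw [← h2, smul_comm]
  have hreg : ∀ {t t'}, IsSMulRegular W (σ t) → IsSMulRegular W (σ t') →
      IsSMulRegular W (σ (t * t')) := fun h h' => by rw [map_mul]; exact h.mul h'
  refine ⟨{ toFun := b, map_add' := fun z w => ?_, map_smul' := fun p' z => ?_ }, fun m => ?_⟩
  · have h1 := key (z + w) (s z * s w) (s w • n z + s z • n w) (by
      rw [map_add, LinearMap.map_smulₛₗ, LinearMap.map_smulₛₗ, ← hn, ← hn, smul_add, map_mul,
        smul_smul, smul_smul, mul_comm])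
    refine hreg (hs z) (hs w) ?_
    change σ (s z * s w) • _ = σ (s z * s w) • _
    rw [h1, map_add, LinearMap.map_smulₛₗ, LinearMap.map_smulₛₗ, ← hb, ← hb, map_mul, smul_add,
      smul_smul, smul_smul, mul_comm (σ (s w))]
  · obtain ⟨t, p, ht, htp⟩ := hP p'
    have h1 := key (p' • z) (t * s z) (p • n z) (by
      rw [LinearMap.map_smulₛₗ, ← hn, smul_smul, smul_smul, map_mul, ← htp]
      congr 1; ring)
    refine hreg ht (hs z) ?_
    have h2 : σ t * σ' p' = σ p := by rw [← hσ, ← map_mul, htp, hσ]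
    change σ (t * s z) • _ = σ (t * s z) • _
    rw [h1, LinearMap.map_smulₛₗ, ← hb, ← h2, map_mul, smul_smul, smul_smul]
    congr 1; ring
  · have := key (g m) 1 m (by rw [map_one, one_smul])
    rwa [map_one, one_smul] at this

theorem isSMulRegular_of_nzd {s : B} (hs : s ∈ B⁰) : IsSMulRegular B s :=
  fun _ _ h => eq_of_mul_nzd hs h

theorem exists_semilinear_extension (γ : P →+* P') (σ' : P' →+* B) {σ : P →+* B}
    (h : σ'.comp γ = σ) (g : N →ₛₗ[γ] N') (φ : N →ₛₗ[σ] B) (hker : ∀ n, g n = 0 → φ n = 0)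
    (hP : ∀ p', ∃ s p, σ s ∈ B⁰ ∧ γ s * p' = γ p)
    (hN : ∀ z, ∃ s n b, σ s ∈ B⁰ ∧ γ s • z = g n ∧ σ s * b = φ n) :
    ∃ φ' : N' →ₛₗ[σ'] B, ∀ n, φ' (g n) = φ n := by
  refine exists_semilinear_extension' γ σ' h g φ hker (fun p' => ?_) fun z => ?_
  · obtain ⟨s, p, hs, hp⟩ := hP p'
    exact ⟨s, p, isSMulRegular_of_nzd hs, hp⟩
  · obtain ⟨s, n, b, hs, hp⟩ := hN z
    exact ⟨s, n, b, isSMulRegular_of_nzd hs, hp⟩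

theorem der_ext {κ : k →+* P'} (γ : P →+* P') {σ' : P' →+* B} {σ : P →+* B} (h : σ'.comp γ = σ)
    {D E : P' → B} (hD : IsDer κ σ' D) (hE : IsDer κ σ' E)
    (hP : ∀ z, ∃ s p, σ s ∈ B⁰ ∧ γ s * z = γ p) (he : ∀ p, D (γ p) = E (γ p)) : D = E := by
  refine funext fun z => ?_
  obtain ⟨s, p, hs, hz⟩ := hP z
  refine eq_of_mul_nzd hs ?_
  have h1 := hD.map_mul (γ s) z
  have h2 := hE.map_mul (γ s) z
  rw [hz, ← RingHom.comp_apply σ', h] at h1 h2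
  rw [he p, h2, he s] at h1
  exact (add_right_cancel h1).symm

theorem exists_der_extension {κ : k →+* P} {κ' : k →+* P'} (γ : P →+* P') (hκ : γ.comp κ = κ')
    (σ' : P' →+* B) {σ : P →+* B}
    (h : σ'.comp γ = σ) {E : P → B} (hE : IsDer κ σ E) (hker : ∀ p, γ p = 0 → E p = 0)
    (hP : ∀ z, ∃ s p b, σ s ∈ B⁰ ∧ γ s * z = γ p ∧ σ s * b = E p - σ' z * E s) :
    ∃ E' : P' → B, IsDer κ' σ' E' ∧ ∀ p, E' (γ p) = E p := by
  have hσ : ∀ p, σ' (γ p) = σ p := fun p => by rw [← h]; rfl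
  have hsub : ∀ a b, E (a - b) = E a - E b := fun a b => by
    have := hE.map_add (a - b) b
    rw [sub_add_cancel] at this
    rw [this, add_sub_cancel_right]
  choose s n b hs hn hb using hP
  have key : ∀ z t m, γ t * z = γ m → σ t * b z = E m - σ' z * E t := by
    intro z t m hm
    refine eq_of_mul_nzd (hs z) ?_
    have h1 : γ (t * n z - s z * m) = 0 := by
      rw [map_sub, map_mul, map_mul, ← hn, ← hm]; ring
    have h2 := hker _ h1
    rw [hsub, hE.map_mul, hE.map_mul] at h2
    have e1 : σ (n z) = σ (s z) * σ' z := by rw [← hσ, ← hn, map_mul, hσ]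
    have e2 : σ m = σ t * σ' z := by rw [← hσ, ← hm, map_mul, hσ]
    rw [e1, e2] at h2
    linear_combination σ t * hb z + h2
  refine ⟨b, ⟨fun z w => ?_, fun z w => ?_, fun c => ?_⟩, fun m => ?_⟩
  · refine eq_of_mul_nzd (mul_mem (hs z) (hs w)) ?_
    have h1 := key (z + w) (s z * s w) (s w * n z + s z * n w) (by
      rw [map_add, map_mul, map_mul, map_mul, ← hn, ← hn]; ring)
    rw [hE.map_add, hE.map_mul, hE.map_mul, hE.map_mul] at h1
    have e1 : σ (n z) = σ (s z) * σ' z := by rw [← hσ, ← hn, map_mul, hσ]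
    have e2 : σ (n w) = σ (s w) * σ' w := by rw [← hσ, ← hn, map_mul, hσ]
    rw [e1, e2, map_mul, map_add] at h1
    linear_combination h1 - σ (s w) * hb z - σ (s z) * hb w
  · refine eq_of_mul_nzd (mul_mem (hs z) (hs w)) ?_
    have h1 := key (z * w) (s z * s w) (n z * n w) (by
      rw [map_mul, map_mul, ← hn, ← hn]; ring)
    rw [hE.map_mul, hE.map_mul] at h1
    have e1 : σ (n z) = σ (s z) * σ' z := by rw [← hσ, ← hn, map_mul, hσ]
    have e2 : σ (n w) = σ (s w) * σ' w := by rw [← hσ, ← hn, map_mul, hσ]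
    rw [e1, e2, map_mul, map_mul] at h1
    linear_combination h1 - σ (s w) * σ' w * hb z - σ (s z) * σ' z * hb w
  · have := key (κ' c) 1 (κ c) (by rw [map_one, one_mul, ← hκ]; rfl)
    have e1 : E 1 = 0 := by have := hE.map_base 1; rwa [map_one] at this
    rwa [map_one, one_mul, hE.map_base, e1, mul_zero, sub_zero] at this
  · have := key (γ m) 1 m (by rw [map_one, one_mul])
    have e1 : E 1 = 0 := by have := hE.map_base 1; rwa [map_one] at this
    rwa [map_one, one_mul, e1, mul_zero, sub_zero] at this

end Extension

/-! ### Localizations of polynomial rings, liftings -/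

section IsLoc

variable {k S P P' Q R : Type} [CommRing k] [CommRing S] [CommRing P] [CommRing P'] [CommRing Q]
  [CommRing R]

/-- `P` is the localization of `S` in the elements that become units. -/
structure IsLoc (θ : S →+* P) : Prop where
  surj : ∀ z, ∃ s p, IsUnit (θ s) ∧ θ s * z = θ p
  ker : ∀ p, θ p = 0 → ∃ s, IsUnit (θ s) ∧ s * p = 0

theorem IsLoc.lift {θ : S →+* P} (hθ : IsLoc θ) (f : S →+* Q)
    (hf : ∀ s, IsUnit (θ s) → IsUnit (f s)) : ∃ l : P →+* Q, l.comp θ = f := by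
  let := θ.toAlgebra
  have hl : IsLocalization ((IsUnit.submonoid P).comap θ) P :=
    { map_units := fun y => y.2
      surj := fun z => by
        obtain ⟨s, p, hs, h⟩ := hθ.surj z
        exact ⟨(p, ⟨s, hs⟩), (mul_comm _ _).trans h⟩
      exists_of_eq := fun {x y} h => by
        obtain ⟨s, hs, h'⟩ := hθ.ker (x - y) (by rw [map_sub]; exact sub_eq_zero.mpr h)
        exact ⟨⟨s, hs⟩, by rw [mul_sub] at h'; exact sub_eq_zero.mp h'⟩ }
  have hg : ∀ y : (IsUnit.submonoid P).comap θ, IsUnit (f y) := fun y => hf _ y.2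
  exact ⟨IsLocalization.lift hg, IsLocalization.lift_comp hg⟩

theorem IsLoc.hom_ext {θ : S →+* P} (hθ : IsLoc θ) {f g : P →+* Q} (h : f.comp θ = g.comp θ) :
    f = g := by
  refine RingHom.ext fun z => ?_
  obtain ⟨s, p, hs, hz⟩ := hθ.surj z
  refine (hs.map f).mul_left_cancel ?_
  have e : ∀ p, f (θ p) = g (θ p) := fun p => DFunLike.congr_fun h p
  rw [← map_mul, hz, e, ← hz, map_mul, e]

theorem IsLoc.comp {θ : S →+* P} {γ : P →+* P'} (hθ : IsLoc θ) (hγ : IsLoc γ) :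
    IsLoc (γ.comp θ) where
  surj z := by
    obtain ⟨s, p, hs, hz⟩ := hγ.surj z
    obtain ⟨s₁, p₁, hs₁, h₁⟩ := hθ.surj s
    obtain ⟨s₂, p₂, hs₂, h₂⟩ := hθ.surj p
    refine ⟨p₁ * s₂, s₁ * p₂, ?_, ?_⟩
    · rw [RingHom.comp_apply, map_mul, ← h₁, map_mul, map_mul]
      exact ((hs₁.map γ).mul hs).mul (hs₂.map γ)
    · simp only [RingHom.comp_apply, map_mul, ← h₁, ← h₂]
      rw [← hz]; ring
  ker p hp := by
    obtain ⟨s, hs, h⟩ := hγ.ker _ hp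
    obtain ⟨s₁, p₁, hs₁, h₁⟩ := hθ.surj s
    obtain ⟨t, ht, h'⟩ := hθ.ker (p₁ * p) (by rw [map_mul, ← h₁, mul_assoc, h, mul_zero])
    refine ⟨t * p₁, ?_, by rw [mul_assoc, h']⟩
    simp only [RingHom.comp_apply, map_mul, ← h₁]
    exact (ht.map γ).mul ((hs₁.map γ).mul hs)

/-- The localization of `S` in the elements that `f` maps to units. -/
abbrev LocAt (f : S →+* R) : Type := Localization ((IsUnit.submonoid R).comap f)

/-- The map `S → LocAt f`. -/
abbrev toLocAt (f : S →+* R) : S →+* LocAt f := algebraMap S _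

/-- The map `LocAt f → R`. -/
def fromLocAt (f : S →+* R) : LocAt f →+* R :=
  IsLocalization.lift (M := (IsUnit.submonoid R).comap f) (g := f) fun y => y.2

theorem fromLocAt_comp (f : S →+* R) : (fromLocAt f).comp (toLocAt f) = f :=
  IsLocalization.lift_comp _

theorem fromLocAt_apply (f : S →+* R) (s : S) : fromLocAt f (toLocAt f s) = f s :=
  DFunLike.congr_fun (fromLocAt_comp f) s

theorem isUnit_toLocAt {f : S →+* R} {s : S} (h : IsUnit (f s)) : IsUnit (toLocAt f s) :=
  IsLocalization.map_units _ (⟨s, h⟩ : (IsUnit.submonoid R).comap f)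

theorem exists_toLocAt (f : S →+* R) (z : LocAt f) :
    ∃ s p, IsUnit (f s) ∧ toLocAt f s * z = toLocAt f p := by
  obtain ⟨⟨p, s⟩, h⟩ := IsLocalization.surj ((IsUnit.submonoid R).comap f) z
  exact ⟨s, p, s.2, (mul_comm _ _).trans h⟩

theorem exists_of_toLocAt (f : S →+* R) (p : S) (h : toLocAt f p = 0) :
    ∃ s, IsUnit (f s) ∧ s * p = 0 := by
  obtain ⟨s, hs⟩ := (IsLocalization.map_eq_zero_iff ((IsUnit.submonoid R).comap f) _ p).mp h
  exact ⟨s, s.2, hs⟩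

theorem isLoc_toLocAt (f : S →+* R) : IsLoc (toLocAt f) where
  surj z := by
    obtain ⟨s, p, hs, h⟩ := exists_toLocAt f z
    exact ⟨s, p, isUnit_toLocAt hs, h⟩
  ker p h := by
    obtain ⟨s, hs, h⟩ := exists_of_toLocAt f p h
    exact ⟨s, isUnit_toLocAt hs, h⟩

theorem isUnit_of_fromLocAt (f : S →+* R) (z : LocAt f) (h : IsUnit (fromLocAt f z)) :
    IsUnit z := by
  obtain ⟨s, p, hs, hz⟩ := exists_toLocAt f z
  have h1 : IsUnit (f p) := by
    rw [← fromLocAt_apply, ← hz, map_mul, fromLocAt_apply]; exact hs.mul h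
  exact isUnit_of_mul_isUnit_right (hz ▸ isUnit_toLocAt h1)

/-- `P` is the localization of a polynomial ring over `k`. -/
def IsLocPoly (κ : k →+* P) : Prop :=
  ∃ (τ : Type) (θ : MvPolynomial τ k →+* P), θ.comp MvPolynomial.C = κ ∧ IsLoc θ

theorem IsLocPoly.comp {κ : k →+* P} (h : IsLocPoly κ) {γ : P →+* P'} (hγ : IsLoc γ) :
    IsLocPoly (γ.comp κ) := by
  obtain ⟨τ, θ, rfl, hθ⟩ := h
  exact ⟨τ, γ.comp θ, rfl, hθ.comp hγ⟩

theorem IsLocPoly.exists_lift {κ : k →+* P} (h : IsLocPoly κ) (q : Q →+* R)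
    (hq : Function.Surjective q) (hloc : ∀ a, IsUnit (q a) → IsUnit a) (κQ : k →+* Q)
    (g : P →+* R) (hg : g.comp κ = q.comp κQ) : ∃ l : P →+* Q, q.comp l = g ∧ l.comp κ = κQ := by
  obtain ⟨τ, θ, rfl, hθ⟩ := h
  choose c hc using fun t => hq (g (θ (MvPolynomial.X t)))
  have hf : q.comp (MvPolynomial.eval₂Hom κQ c) = g.comp θ := by
    refine MvPolynomial.ringHom_ext (fun a => ?_) fun t => ?_
    · simpa using (DFunLike.congr_fun hg a).symm
    · simp [hc]
  obtain ⟨l, hl⟩ := hθ.lift (MvPolynomial.eval₂Hom κQ c) fun s hs => hloc _ <| by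
    have := DFunLike.congr_fun hf s
    rw [RingHom.comp_apply] at this
    rw [this]; exact hs.map g
  refine ⟨l, hθ.hom_ext ?_, ?_⟩
  · rw [RingHom.comp_assoc, hl, hf]
  · rw [← RingHom.comp_assoc, hl]
    exact RingHom.ext fun a => by simp

end IsLoc

end
end QLSing

namespace QLSing
noncomputable section

/-! ### Presentations -/

section Pres

variable {k R R' R'' B B' : Type} [CommRing k] [CommRing R] [CommRing R'] [CommRing R'']
  [CommRing B] [CommRing B']

/-- A presentation `R = P/I` of a `k`-algebra, with a crossed module `j : M → P` of image `I` and
kernel `K`; for `M = F/Rel₀` the kernel is `Rel/Rel₀`. -/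
structure Pres (ι : k →+* R) where
  P : Type
  [ring : CommRing P]
  κ : k →+* P
  q : P →+* R
  comm : q.comp κ = ι
  surj : Function.Surjective q
  I : Ideal P
  mem_I : ∀ x, x ∈ I ↔ q x = 0
  M : Type
  [grp : AddCommGroup M]
  [mod : Module P M]
  j : M →ₗ[P] P
  peiffer : ∀ u w, j u • w = j w • u
  range_j : ∀ x, x ∈ I ↔ ∃ u, j u = x
  K : Submodule P M
  mem_K : ∀ r, r ∈ K ↔ j r = 0

attribute [instance] Pres.ring Pres.grp Pres.mod

variable {ι : k →+* R} {ι' : k →+* R'} {ι'' : k →+* R''}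

/-- Morphisms of presentations over a ring map `ρ`. -/
structure Lift (X : Pres ι) (X' : Pres ι') (ρ : R →+* R') where
  α : X.P →+* X'.P
  base : α.comp X.κ = X'.κ
  comm : X'.q.comp α = ρ.comp X.q
  m : X.M →ₛₗ[α] X'.M
  comm_m : ∀ u, X'.j (m u) = α (X.j u)

variable {X : Pres ι} {X' : Pres ι'} {X'' : Pres ι''} {ρ : R →+* R'} {ρ' : R' →+* R''}

theorem Lift.q_α (a : Lift X X' ρ) (p : X.P) : X'.q (a.α p) = ρ (X.q p) :=
  DFunLike.congr_fun a.comm p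

/-- The identity. -/
def Lift.id (X : Pres ι) : Lift X X (RingHom.id R) where
  α := RingHom.id _
  base := RingHom.id_comp _
  comm := by rw [RingHom.comp_id, RingHom.id_comp]
  m := LinearMap.id
  comm_m _ := rfl

/-- Composition. -/
def Lift.comp (b : Lift X' X'' ρ') (a : Lift X X' ρ) {ρ'' : R →+* R''} (h : ρ'.comp ρ = ρ'') :
    Lift X X'' ρ'' where
  α := b.α.comp a.α
  base := by rw [RingHom.comp_assoc, a.base, b.base]
  comm := by rw [← RingHom.comp_assoc, b.comm, RingHom.comp_assoc, a.comm, ← RingHom.comp_assoc, h]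
  m := { toFun := fun u => b.m (a.m u)
         map_add' := fun u w => by rw [map_add, map_add]
         map_smul' := fun p u => by rw [LinearMap.map_smulₛₗ, LinearMap.map_smulₛₗ]; rfl }
  comm_m u := (b.comm_m _).trans (congrArg b.α (a.comm_m u))

/-- The map of ideals. -/
def Lift.mapI (a : Lift X X' ρ) : X.I →ₛₗ[a.α] X'.I where
  toFun f := ⟨a.α f, by rw [X'.mem_I, a.q_α, (X.mem_I _).mp f.2, map_zero]⟩
  map_add' f g := Subtype.ext (map_add _ _ _)
  map_smul' p f := Subtype.ext (map_mul _ _ _)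

/-- The map of kernels. -/
def Lift.mapK (a : Lift X X' ρ) : X.K →ₛₗ[a.α] X'.K :=
  a.m.restrict (p := X.K) (q := X'.K) fun r hr => by
    rw [X'.mem_K, a.comm_m, (X.mem_K r).mp hr, map_zero]

/-- `Hom_P(I, B)`. -/
abbrev Pres.N1 (X : Pres ι) (φ : R →+* B) : Type := X.I →ₛₗ[φ.comp X.q] B

/-- `Hom_P(K, B)`. -/
abbrev Pres.N2 (X : Pres ι) (φ : R →+* B) : Type := X.K →ₛₗ[φ.comp X.q] B

/-- Restrictions to `I` of derivations of `P`. -/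
def Pres.Triv1 (X : Pres ι) (φ : R →+* B) : Submodule B (X.N1 φ) where
  carrier := {ψ | ∃ D ∈ T0 X.κ (φ.comp X.q), ∀ f : X.I, ψ f = D f}
  add_mem' := by
    rintro ψ χ ⟨D, hD, h⟩ ⟨E, hE, h'⟩
    exact ⟨D + E, add_mem hD hE, fun f => by rw [LinearMap.add_apply, h, h']; rfl⟩
  zero_mem' := ⟨0, zero_mem _, fun _ => rfl⟩
  smul_mem' := by
    rintro b ψ ⟨D, hD, h⟩
    exact ⟨b • D, Submodule.smul_mem _ _ hD, fun f => by rw [LinearMap.smul_apply, h]; rfl⟩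

/-- Restrictions to `K` of homomorphisms on `M`. -/
def Pres.Triv2 (X : Pres ι) (φ : R →+* B) : Submodule B (X.N2 φ) where
  carrier := {ψ | ∃ χ : X.M →ₛₗ[φ.comp X.q] B, ∀ r : X.K, ψ r = χ r}
  add_mem' := by
    rintro ψ χ ⟨D, h⟩ ⟨E, h'⟩
    exact ⟨D + E, fun r => by rw [LinearMap.add_apply, h, h', LinearMap.add_apply]⟩
  zero_mem' := ⟨0, fun _ => rfl⟩
  smul_mem' := by
    rintro b ψ ⟨D, h⟩
    exact ⟨b • D, fun r => by rw [LinearMap.smul_apply, h, LinearMap.smul_apply]⟩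

/-- `Hom_P(I, B)/Der_k(P, B)`. -/
abbrev Pres.C1 (X : Pres ι) (φ : R →+* B) : Type := X.N1 φ ⧸ X.Triv1 φ

/-- `Hom_P(K, B)/Hom_P(M, B)`. -/
abbrev Pres.C2 (X : Pres ι) (φ : R →+* B) : Type := X.N2 φ ⧸ X.Triv2 φ

variable {φ : R →+* B} {φ' : R' →+* B} {φ'' : R'' →+* B}

theorem Lift.scalar (a : Lift X X' ρ) (h : φ'.comp ρ = φ) :
    (φ'.comp X'.q).comp a.α = φ.comp X.q := by
  rw [RingHom.comp_assoc, a.comm, ← RingHom.comp_assoc, h]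

/-- Pull-back of homomorphisms on `I`. -/
def Lift.pull1 (a : Lift X X' ρ) (h : φ'.comp ρ = φ) : X'.N1 φ' →ₗ[B] X.N1 φ :=
  homPull (a.scalar h) a.mapI

/-- Pull-back of homomorphisms on `K`. -/
def Lift.pull2 (a : Lift X X' ρ) (h : φ'.comp ρ = φ) : X'.N2 φ' →ₗ[B] X.N2 φ :=
  homPull (a.scalar h) a.mapK

theorem Lift.pullDer (a : Lift X X' ρ) (h : φ'.comp ρ = φ) {D : X'.P → B}
    (hD : D ∈ T0 X'.κ (φ'.comp X'.q)) : (fun p => D (a.α p)) ∈ T0 X.κ (φ.comp X.q) where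
  map_add x y := by rw [map_add, IsDer.map_add hD]
  map_mul x y := by rw [map_mul, IsDer.map_mul hD, ← a.scalar h]; rfl
  map_base c := by
    rw [← RingHom.comp_apply, a.base, IsDer.map_base hD]

theorem Lift.pull1_triv (a : Lift X X' ρ) (h : φ'.comp ρ = φ) {ψ : X'.N1 φ'}
    (hψ : ψ ∈ X'.Triv1 φ') : a.pull1 h ψ ∈ X.Triv1 φ := by
  obtain ⟨D, hD, hψ⟩ := hψ
  exact ⟨fun p => D (a.α p), a.pullDer h hD, fun f => hψ _⟩

theorem Lift.pull2_triv (a : Lift X X' ρ) (h : φ'.comp ρ = φ) {ψ : X'.N2 φ'}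
    (hψ : ψ ∈ X'.Triv2 φ') : a.pull2 h ψ ∈ X.Triv2 φ := by
  obtain ⟨χ, hψ⟩ := hψ
  exact ⟨homPull (a.scalar h) a.m χ, fun f => hψ _⟩

/-- The induced map on classes. -/
def Lift.map1 (a : Lift X X' ρ) (h : φ'.comp ρ = φ) : X'.C1 φ' →ₗ[B] X.C1 φ :=
  Submodule.mapQ _ _ (a.pull1 h) fun _ hψ => a.pull1_triv h hψ

/-- The induced map on classes. -/
def Lift.map2 (a : Lift X X' ρ) (h : φ'.comp ρ = φ) : X'.C2 φ' →ₗ[B] X.C2 φ :=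
  Submodule.mapQ _ _ (a.pull2 h) fun _ hψ => a.pull2_triv h hψ

theorem Lift.map1_comp (b : Lift X' X'' ρ') (a : Lift X X' ρ) {ρ'' : R →+* R''}
    (h : ρ'.comp ρ = ρ'') (h₁ : φ'.comp ρ = φ) (h₂ : φ''.comp ρ' = φ') (h₃ : φ''.comp ρ'' = φ)
    (x : X''.C1 φ'') : (b.comp a h).map1 h₃ x = a.map1 h₁ (b.map1 h₂ x) := by
  obtain ⟨ψ, rfl⟩ := Submodule.Quotient.mk_surjective _ x
  rfl

theorem Lift.map2_comp (b : Lift X' X'' ρ') (a : Lift X X' ρ) {ρ'' : R →+* R''}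
    (h : ρ'.comp ρ = ρ'') (h₁ : φ'.comp ρ = φ) (h₂ : φ''.comp ρ' = φ') (h₃ : φ''.comp ρ'' = φ)
    (x : X''.C2 φ'') : (b.comp a h).map2 h₃ x = a.map2 h₁ (b.map2 h₂ x) := by
  obtain ⟨ψ, rfl⟩ := Submodule.Quotient.mk_surjective _ x
  rfl

/-! ### Homotopies -/

/-- Two lifts of the same map induce the same map on `C1`. -/
theorem Lift.map1_eq (a b : Lift X X' ρ) (h : φ'.comp ρ = φ) (x : X'.C1 φ') :
    a.map1 h x = b.map1 h x := by
  obtain ⟨ψ, rfl⟩ := Submodule.Quotient.mk_surjective _ x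
  refine (Submodule.Quotient.eq _).mpr ?_
  have hI : ∀ p, a.α p - b.α p ∈ X'.I := fun p => by
    rw [X'.mem_I, map_sub, a.q_α, b.q_α, sub_self]
  refine ⟨fun p => ψ ⟨_, hI p⟩, ⟨fun x y => ?_, fun x y => ?_, fun c => ?_⟩, fun f => ?_⟩
  · rw [← map_add]
    exact congrArg ψ (Subtype.ext (by simp only [map_add, Submodule.coe_add]; ring))
  · have e1 : φ.comp X.q = (φ'.comp X'.q).comp a.α := (a.scalar h).symm
    have e2 : φ.comp X.q = (φ'.comp X'.q).comp b.α := (b.scalar h).symm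
    conv_rhs => rw [e1]; arg 2; rw [← e1, e2]
    have h1 := LinearMap.map_smulₛₗ ψ (a.α x) ⟨_, hI y⟩
    have h2 := LinearMap.map_smulₛₗ ψ (b.α y) ⟨_, hI x⟩
    rw [smul_eq_mul] at h1 h2
    rw [RingHom.comp_apply, RingHom.comp_apply _ b.α, ← h1, ← h2, ← map_add]
    exact congrArg ψ (Subtype.ext (by
      simp only [map_mul, Submodule.coe_add, Submodule.coe_smul, smul_eq_mul]; ring))
  · have e : a.α (X.κ c) - b.α (X.κ c) = 0 := by
      rw [← RingHom.comp_apply, ← RingHom.comp_apply, a.base, b.base, sub_self]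
    exact (congrArg ψ (Subtype.ext e)).trans (map_zero ψ)
  · change ψ (a.mapI f) - ψ (b.mapI f) = _
    rw [← map_sub]; rfl

/-- The ring `P ⊕ M` of the crossed module `j : M → P`. -/
structure Cyl (X : Pres ι) where
  fst : X.P
  snd : X.M

namespace Cyl

@[ext] theorem ext' {x y : Cyl X} (h : x.fst = y.fst) (h' : x.snd = y.snd) : x = y := by
  cases x; cases y; cases h; cases h'; rfl

instance : Zero (Cyl X) := ⟨⟨0, 0⟩⟩
instance : One (Cyl X) := ⟨⟨1, 0⟩⟩
instance : Add (Cyl X) := ⟨fun x y => ⟨x.1 + y.1, x.2 + y.2⟩⟩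
instance : Neg (Cyl X) := ⟨fun x => ⟨-x.1, -x.2⟩⟩
instance : Mul (Cyl X) := ⟨fun x y => ⟨x.1 * y.1, x.1 • y.2 + y.1 • x.2 + X.j x.2 • y.2⟩⟩
@[simp] theorem zero_fst : (0 : Cyl X).fst = 0 := rfl
@[simp] theorem zero_snd : (0 : Cyl X).snd = 0 := rfl
@[simp] theorem one_fst : (1 : Cyl X).fst = 1 := rfl
@[simp] theorem one_snd : (1 : Cyl X).snd = 0 := rfl
@[simp] theorem add_fst (x y : Cyl X) : (x + y).fst = x.fst + y.fst := rfl
@[simp] theorem add_snd (x y : Cyl X) : (x + y).snd = x.snd + y.snd := rfl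
@[simp] theorem neg_fst (x : Cyl X) : (-x).fst = -x.fst := rfl
@[simp] theorem neg_snd (x : Cyl X) : (-x).snd = -x.snd := rfl
@[simp] theorem mul_fst (x y : Cyl X) : (x * y).fst = x.fst * y.fst := rfl
@[simp] theorem mul_snd (x y : Cyl X) :
    (x * y).snd = x.fst • y.snd + y.fst • x.snd + X.j x.snd • y.snd := rfl

theorem mul_comm' (x y : Cyl X) : x * y = y * x := by
  ext
  · simp [mul_comm]
  · simp only [mul_snd]
    rw [X.peiffer x.snd y.snd]; abel

instance : CommRing (Cyl X) where
  add_assoc x y z := by ext <;> simp [add_assoc]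
  zero_add x := by ext <;> simp
  add_zero x := by ext <;> simp
  add_comm x y := by ext <;> simp [add_comm]
  neg_add_cancel x := by ext <;> simp
  mul_comm := mul_comm'
  mul_assoc x y z := by
    ext
    · simp [mul_assoc]
    · simp only [mul_snd, mul_fst, map_add, map_smul, smul_add, add_smul, smul_smul, smul_eq_mul]
      rw [mul_comm z.fst, mul_comm z.fst, mul_comm z.fst, mul_comm (X.j x.snd) z.fst, mul_comm (X.j x.snd) y.fst]
      abel
  one_mul x := by ext <;> simp
  mul_one x := by ext <;> simp
  zero_mul x := by ext <;> simp
  mul_zero x := by ext <;> simp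
  left_distrib x y z := by
    ext
    · simp [mul_add]
    · simp only [mul_snd, add_fst, add_snd, smul_add, add_smul]; abel
  right_distrib x y z := by
    ext
    · simp [add_mul]
    · simp only [mul_snd, add_fst, add_snd, smul_add, add_smul, map_add]; abel
  nsmul := nsmulRec
  zsmul := zsmulRec

/-- The pairs of elements of `P` with the same image in `R`. -/
abbrev Sq (X : Pres ι) : Subring (X.P × X.P) :=
  (X.q.comp (RingHom.fst _ _)).eqLocus (X.q.comp (RingHom.snd _ _))

/-- `(p, u) ↦ (p, p + j u)`. -/
def toSq (X : Pres ι) : Cyl X →+* Sq X where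
  toFun x := ⟨(x.fst, x.fst + X.j x.snd), by
    change X.q x.fst = X.q (x.fst + X.j x.snd)
    rw [map_add, ((X.mem_I _).mp ((X.range_j _).mpr ⟨_, rfl⟩) : X.q (X.j x.snd) = 0), add_zero]⟩
  map_one' := Subtype.ext (Prod.ext rfl (by simp))
  map_zero' := Subtype.ext (Prod.ext rfl (by simp))
  map_add' x y := Subtype.ext (Prod.ext rfl (by simp; ring))
  map_mul' x y := Subtype.ext (Prod.ext rfl (by simp; ring))

theorem toSq_surjective : Function.Surjective (toSq X) := by
  rintro ⟨⟨p, p'⟩, h⟩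
  have h' : X.q p = X.q p' := h
  obtain ⟨u, hu⟩ := (X.range_j (p' - p)).mp ((X.mem_I _).mpr (by rw [map_sub, h', sub_self]))
  exact ⟨⟨p, u⟩, Subtype.ext (Prod.ext rfl (by simp [toSq, hu]))⟩

theorem isUnit_of_toSq (x : Cyl X) (h : IsUnit (toSq X x)) : IsUnit x := by
  have h1 : IsUnit x.fst := h.map ((RingHom.fst _ _).comp (Sq X).subtype)
  have h2 : IsUnit (x.fst + X.j x.snd) := h.map ((RingHom.snd _ _).comp (Sq X).subtype)
  obtain ⟨c, hc⟩ := h1.exists_right_inv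
  obtain ⟨d, hd⟩ := h2.exists_right_inv
  refine IsUnit.of_mul_eq_one ⟨c, -(c * d) • x.snd⟩ ?_
  ext
  · exact hc
  · have e : (x.fst * -(c * d) + c + X.j x.snd * -(c * d)) = 0 := by
      linear_combination -c * hd
    simp only [mul_snd, smul_smul, ← add_smul, one_snd, e, zero_smul]

end Cyl

/-- A homotopy between two lifts. -/
theorem Lift.exists_homotopy (a b : Lift X X' ρ) (hX : IsLocPoly X.κ) :
    ∃ h : X.P → X'.M, (∀ p, X'.j (h p) = a.α p - b.α p) ∧ (∀ p p', h (p + p') = h p + h p') ∧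
      ∀ p p', h (p * p') = a.α p • h p' + b.α p' • h p := by
  let g : X.P →+* Cyl.Sq X' := (b.α.prod a.α).codRestrict _ fun p => by
    change X'.q (b.α p) = X'.q (a.α p)
    rw [a.q_α, b.q_α]
  let κQ : k →+* Cyl X' :=
    { toFun := fun c => ⟨X'.κ c, 0⟩
      map_one' := by ext <;> simp
      map_zero' := by ext <;> simp
      map_add' := fun x y => by ext <;> simp
      map_mul' := fun x y => by ext <;> simp }
  obtain ⟨l, hl, hlκ⟩ := hX.exists_lift (Cyl.toSq X') Cyl.toSq_surjective Cyl.isUnit_of_toSq κQ g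
    (RingHom.ext fun c => Subtype.ext (Prod.ext
      (DFunLike.congr_fun b.base c)
      ((DFunLike.congr_fun a.base c).trans (by simp [κQ, Cyl.toSq]))))
  have e1 : ∀ p, (l p).fst = b.α p := fun p =>
    congrArg (fun z => z.1.1) (DFunLike.congr_fun hl p)
  have e2 : ∀ p, (l p).fst + X'.j (l p).snd = a.α p := fun p =>
    congrArg (fun z => z.1.2) (DFunLike.congr_fun hl p)
  refine ⟨fun p => (l p).snd, fun p => ?_, fun p p' => ?_, fun p p' => ?_⟩
  · rw [← e2, ← e1]; ring
  · change (l (p + p')).snd = _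
    rw [map_add]; rfl
  · change (l (p * p')).snd = _
    rw [map_mul, Cyl.mul_snd, ← e2 p, e1, e1, add_smul]; abel

/-- Two lifts of the same map induce the same map on `C2`. -/
theorem Lift.map2_eq (a b : Lift X X' ρ) (hX : IsLocPoly X.κ) (h : φ'.comp ρ = φ)
    (x : X'.C2 φ') : a.map2 h x = b.map2 h x := by
  obtain ⟨ψ, rfl⟩ := Submodule.Quotient.mk_surjective _ x
  refine (Submodule.Quotient.eq _).mpr ?_
  obtain ⟨η, hj, hadd, hmul⟩ := a.exists_homotopy b hX
  have hK : ∀ u, a.m u - b.m u - η (X.j u) ∈ X'.K := fun u => by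
    rw [X'.mem_K, map_sub, map_sub, a.comm_m, b.comm_m, hj, sub_self]
  have η0 : η 0 = 0 := by
    have := hadd 0 0
    rw [add_zero] at this
    exact left_eq_add.mp this
  refine ⟨{ toFun := fun u => ψ ⟨_, hK u⟩, map_add' := fun u w => ?_, map_smul' := fun p u => ?_ },
    fun r => ?_⟩
  · rw [← map_add]
    exact congrArg ψ (Subtype.ext (by simp only [map_add, hadd, Submodule.coe_add]; abel))
  · rw [← a.scalar h, RingHom.comp_apply, ← LinearMap.map_smulₛₗ]
    refine congrArg ψ (Subtype.ext ?_)
    have e : b.α (X.j u) • η p = (a.α p - b.α p) • b.m u := by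
      rw [← b.comm_m, X'.peiffer, hj]
    simp only [LinearMap.map_smulₛₗ, hmul, smul_eq_mul, Submodule.coe_smul, e, smul_sub, sub_smul,
      RingHom.id_apply]
    abel
  · change ψ (a.mapK r) - ψ (b.mapK r) = _
    rw [← map_sub]
    refine congrArg ψ (Subtype.ext ?_)
    change a.m r - b.m r = a.m r - b.m r - η (X.j r)
    rw [(X.mem_K _).mp r.2, η0, sub_zero]

end Pres

end
end QLSing

namespace QLSing
noncomputable section

section PresLoc

variable {k R R' R'' B B' : Type} [CommRing k] [CommRing R] [CommRing R'] [CommRing R'']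
  [CommRing B] [CommRing B'] {ι : k →+* R} {ι' : k →+* R'} {ι'' : k →+* R''}

/-! ### Presentations by free modules -/

/-- The trivial relations between the `v t`. -/
def freeRel₀ {P τ : Type} [CommRing P] (v : τ → P) : Submodule P (τ →₀ P) :=
  Submodule.span _ {z | ∃ x y, z = Finsupp.linearCombination P v x • y -
    Finsupp.linearCombination P v y • x}

theorem freeRel₀_le {P τ : Type} [CommRing P] (v : τ → P) :
    freeRel₀ v ≤ LinearMap.ker (Finsupp.linearCombination P v) := by
  refine Submodule.span_le.mpr ?_
  rintro _ ⟨x, y, rfl⟩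
  simp [mul_comm]

/-- The presentation `(P, F/Rel₀)`, where `F` is the free module on generators `v t` of the kernel
of `P → R`. -/
def freePres {P τ : Type} [CommRing P] (κ : k →+* P) (q : P →+* R) (h : q.comp κ = ι)
    (hq : Function.Surjective q) (v : τ → P) (hv : RingHom.ker q = Ideal.span (Set.range v)) :
    Pres ι where
  P := P
  κ := κ
  q := q
  comm := h
  surj := hq
  I := RingHom.ker q
  mem_I _ := Iff.rfl
  M := (τ →₀ P) ⧸ freeRel₀ v
  j := (freeRel₀ v).liftQ (Finsupp.linearCombination P v) (freeRel₀_le v)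
  peiffer u w := by
    obtain ⟨x, rfl⟩ := Submodule.Quotient.mk_surjective _ u
    obtain ⟨y, rfl⟩ := Submodule.Quotient.mk_surjective _ w
    exact (Submodule.Quotient.eq _).mpr (Submodule.subset_span ⟨x, y, rfl⟩)
  range_j x := by
    rw [hv, Ideal.span, ← Finsupp.range_linearCombination]
    constructor
    · rintro ⟨z, hz⟩
      exact ⟨Submodule.Quotient.mk z, hz⟩
    · rintro ⟨u, hu⟩
      obtain ⟨z, rfl⟩ := Submodule.Quotient.mk_surjective _ u
      exact ⟨z, hu⟩
  K := (LinearMap.ker (Finsupp.linearCombination P v)).map (freeRel₀ v).mkQ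
  mem_K r := by
    constructor
    · rintro ⟨z, hz, rfl⟩; exact hz
    · intro h
      obtain ⟨z, rfl⟩ := Submodule.Quotient.mk_surjective _ r
      exact ⟨z, h, rfl⟩

/-- Maps of the module `M` of a presentation can be lifted. -/
def Pres.HasModLift (X : Pres ι) : Prop :=
  ∀ ⦃R' : Type⦄ [CommRing R'] ⦃ι' : k →+* R'⦄ (X' : Pres ι') (α : X.P →+* X'.P),
    (∀ x ∈ X.I, α x ∈ X'.I) → ∃ m : X.M →ₛₗ[α] X'.M, ∀ u, X'.j (m u) = α (X.j u)

theorem freePres_hasModLift {P τ : Type} [CommRing P] {κ : k →+* P} {q : P →+* R}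
    {h : q.comp κ = ι} {hq : Function.Surjective q} {v : τ → P}
    {hv : RingHom.ker q = Ideal.span (Set.range v)} :
    (freePres κ q h hq v hv).HasModLift := by
  intro R' _ ι' X' (α : P →+* X'.P) hα
  have hvt : ∀ t, α (v t) ∈ X'.I := fun t => hα _ (by
    change v t ∈ RingHom.ker q
    rw [hv]; exact Ideal.subset_span ⟨t, rfl⟩)
  choose c hc using fun t => (X'.range_j _).mp (hvt t)
  let m₀ : (τ →₀ P) →ₛₗ[α] X'.M :=
    { toFun := fun z => z.sum fun t p => α p • c t
      map_add' := fun z w => Finsupp.sum_add_index' (by simp) (by simp [add_smul])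
      map_smul' := fun p z => by
        rw [Finsupp.sum_smul_index' (by simp), Finsupp.smul_sum]
        simp [mul_smul] }
  have hm₀ : ∀ z, X'.j (m₀ z) = α (Finsupp.linearCombination P v z) := fun z => by
    change X'.j (z.sum fun t p => α p • c t) = _
    rw [Finsupp.linearCombination_apply, Finsupp.sum, Finsupp.sum, map_sum, map_sum]
    simp [hc]
  have hle : freeRel₀ v ≤ LinearMap.ker m₀ := by
    refine Submodule.span_le.mpr ?_
    rintro _ ⟨x, y, rfl⟩
    change m₀ _ = 0
    rw [map_sub, LinearMap.map_smulₛₗ, LinearMap.map_smulₛₗ, ← hm₀, ← hm₀, X'.peiffer, sub_self]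
  refine ⟨(freeRel₀ v).liftQ m₀ hle, fun u => ?_⟩
  obtain ⟨x, rfl⟩ := Submodule.Quotient.mk_surjective _ u
  exact hm₀ x

/-- The presentation by the polynomial ring on the set `R` and the free module on the set `I`. -/
def canon (ι : k →+* R) : Pres ι :=
  freePres MvPolynomial.C (presEval ι) (RingHom.ext fun c => by simp [presEval])
    (fun r => ⟨MvPolynomial.X r, by simp [presEval]⟩) (Subtype.val : presIdeal ι → _)
    (by rw [Subtype.range_coe_subtype]; exact (Ideal.span_eq _).symm)

theorem canon_hasModLift : (canon ι).HasModLift := freePres_hasModLift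

theorem isLoc_id {P : Type} [CommRing P] : IsLoc (RingHom.id P) where
  surj z := ⟨1, z, by simp, by simp⟩
  ker p hp := ⟨1, by simp, by simpa using hp⟩

theorem isLocPoly_canon : IsLocPoly (canon ι).κ :=
  ⟨R, RingHom.id (MvPolynomial R k), RingHom.id_comp _, isLoc_id⟩

/-! ### Localization of presentations -/

theorem exists_loc {X : Pres ι} {ρ : R →+* R'} (hρ : IsLoc ρ) (z : LocAt (ρ.comp X.q))
    (hz : fromLocAt (ρ.comp X.q) z = 0) :
    ∃ s, ∃ p ∈ X.I, IsUnit (ρ (X.q s)) ∧ toLocAt (ρ.comp X.q) s * z = toLocAt _ p := by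
  obtain ⟨s, p, hs, h⟩ := exists_toLocAt _ z
  have h0 := fromLocAt_apply (ρ.comp X.q) p
  rw [← h, map_mul, hz, mul_zero] at h0
  obtain ⟨t, ht, htp⟩ := hρ.ker _ h0.symm
  obtain ⟨t, rfl⟩ := X.surj t
  refine ⟨t * s, t * p, ?_, ?_, ?_⟩
  · rw [X.mem_I, map_mul, htp]
  · rw [map_mul, map_mul]; exact ht.mul hs
  · rw [map_mul, mul_assoc, h, map_mul]

/-- The `LocAt`-linear extension of `j`. -/
def Pres.locJ (X : Pres ι) (ρ : R →+* R') :
    LocalizedModule ((IsUnit.submonoid R').comap (ρ.comp X.q)) X.M →ₗ[LocAt (ρ.comp X.q)]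
      LocAt (ρ.comp X.q) :=
  IsLocalizedModule.mapExtendScalars ((IsUnit.submonoid R').comap (ρ.comp X.q))
    (LocalizedModule.mkLinearMap _ X.M) (Algebra.linearMap X.P (LocAt (ρ.comp X.q)))
    (LocAt (ρ.comp X.q)) X.j

theorem Pres.locJ_mk (X : Pres ι) (ρ : R →+* R') (u : X.M) :
    X.locJ ρ (LocalizedModule.mkLinearMap _ X.M u) = toLocAt _ (X.j u) :=
  IsLocalizedModule.map_apply _ _ _ _ _

theorem exists_locM {P M : Type} [CommRing P] [AddCommGroup M] [Module P M] (S : Submonoid P)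
    (z : LocalizedModule S M) : ∃ s ∈ S, ∃ u,
      (algebraMap P (Localization S) s) • z = LocalizedModule.mkLinearMap S M u := by
  obtain ⟨⟨u, s⟩, h⟩ := IsLocalizedModule.surj S (LocalizedModule.mkLinearMap S M) z
  exact ⟨s, s.2, u, (algebraMap_smul (Localization S) (s : P) z).trans h⟩

/-- The localized presentation. -/
def Pres.loc (X : Pres ι) (ρ : R →+* R') (hρ : IsLoc ρ) (h : ρ.comp ι = ι') : Pres ι' where
  P := LocAt (ρ.comp X.q)
  κ := (toLocAt _).comp X.κ
  q := fromLocAt _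
  comm := by rw [← RingHom.comp_assoc, fromLocAt_comp, RingHom.comp_assoc, X.comm, h]
  surj r := by
    obtain ⟨s, p, hs, hr⟩ := hρ.surj r
    obtain ⟨s, rfl⟩ := X.surj s
    obtain ⟨p, rfl⟩ := X.surj p
    obtain ⟨c, hc⟩ := (isUnit_toLocAt (f := ρ.comp X.q) (s := s) hs).exists_right_inv
    refine ⟨c * toLocAt _ p, hs.mul_left_cancel ?_⟩
    have := congrArg (fromLocAt (ρ.comp X.q)) hc
    rw [map_mul, map_one, fromLocAt_apply, RingHom.comp_apply] at this
    rw [map_mul, ← mul_assoc, this, one_mul, hr, fromLocAt_apply]; rfl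
  I := RingHom.ker (fromLocAt _)
  mem_I _ := Iff.rfl
  M := LocalizedModule ((IsUnit.submonoid R').comap (ρ.comp X.q)) X.M
  j := X.locJ ρ
  peiffer u w := by
    obtain ⟨s, hs, u', hu⟩ := exists_locM _ u
    obtain ⟨t, ht, w', hw⟩ := exists_locM _ w
    have h1 := congrArg (LocalizedModule.mkLinearMap ((IsUnit.submonoid R').comap (ρ.comp X.q)) _)
      (X.peiffer u' w')
    rw [map_smul, map_smul, ← algebraMap_smul (LocAt (ρ.comp X.q)),
      ← algebraMap_smul (LocAt (ρ.comp X.q)) (X.j w'), ← hu, ← hw] at h1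
    have e1 := X.locJ_mk ρ u'
    have e2 := X.locJ_mk ρ w'
    rw [← hu, map_smul] at e1
    rw [← hw, map_smul] at e2
    rw [← e1, ← e2, smul_smul, smul_smul] at h1
    have hs' : IsUnit (toLocAt (ρ.comp X.q) s) := isUnit_toLocAt hs
    have ht' : IsUnit (toLocAt (ρ.comp X.q) t) := isUnit_toLocAt ht
    refine (hs'.mul ht').smul_left_cancel.mp ?_
    rw [smul_smul, smul_smul]
    refine Eq.trans (congrArg (· • w) ?_) (h1.trans (congrArg (· • u) ?_)) <;>
      simp only [smul_eq_mul] <;> ring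
  range_j z := by
    constructor
    · intro hz
      obtain ⟨s, p, hp, hs, hsp⟩ := exists_loc hρ z hz
      obtain ⟨u, rfl⟩ := (X.range_j p).mp hp
      obtain ⟨c, hc⟩ := (isUnit_toLocAt (f := ρ.comp X.q) (s := s) hs).exists_right_inv
      refine ⟨c • LocalizedModule.mkLinearMap _ X.M u, ?_⟩
      rw [map_smul, X.locJ_mk, ← hsp, smul_eq_mul, ← mul_assoc, mul_comm c, hc, one_mul]
    · rintro ⟨u, rfl⟩
      obtain ⟨s, hs, u', hu⟩ := exists_locM _ u
      have e1 := X.locJ_mk ρ u'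
      rw [← hu, map_smul] at e1
      have e2 := congrArg (fromLocAt (ρ.comp X.q)) e1
      rw [smul_eq_mul, map_mul, fromLocAt_apply, fromLocAt_apply, RingHom.comp_apply,
        RingHom.comp_apply, (X.mem_I _).mp ((X.range_j _).mpr ⟨u', rfl⟩), map_zero] at e2
      exact (IsUnit.mul_right_eq_zero hs).mp e2
  K := LinearMap.ker (X.locJ ρ)
  mem_K _ := Iff.rfl

variable {X : Pres ι} {X' : Pres ι'} {ρ : R →+* R'}

/-- The map to the localized presentation. -/
def Pres.toLoc (X : Pres ι) (ρ : R →+* R') (hρ : IsLoc ρ) (h : ρ.comp ι = ι') :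
    Lift X (X.loc ρ hρ h) ρ where
  α := toLocAt _
  base := rfl
  comm := fromLocAt_comp _
  m :=
    { toFun := LocalizedModule.mkLinearMap _ X.M
      map_add' := map_add _
      map_smul' := fun p u => by
        rw [map_smul]; exact (algebraMap_smul (LocAt (ρ.comp X.q)) p (LocalizedModule.mkLinearMap
          ((IsUnit.submonoid R').comap (ρ.comp X.q)) X.M u)).symm }
  comm_m u := X.locJ_mk ρ u

theorem Pres.loc_isLocPoly {hρ : IsLoc ρ} {h : ρ.comp ι = ι'} (hX : IsLocPoly X.κ) :
    IsLocPoly (X.loc ρ hρ h).κ :=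
  hX.comp (isLoc_toLocAt _)

theorem Pres.loc_hasModLift {hρ : IsLoc ρ} {h : ρ.comp ι = ι'} (hX : X.HasModLift) :
    (X.loc ρ hρ h).HasModLift := by
  intro R₁ _ ι₁ X₁ α hα
  let a := X.toLoc ρ hρ h
  obtain ⟨m, hm⟩ := hX X₁ (α.comp a.α) fun x hx => hα _ (a.mapI ⟨x, hx⟩).2
  have hu : ∀ s, IsUnit (ρ (X.q s)) → IsUnit (α (a.α s)) := fun s hs =>
    (isUnit_toLocAt (f := ρ.comp X.q) hs).map α
  have hreg : ∀ s, IsUnit (ρ (X.q s)) → IsSMulRegular X₁.M (α (a.α s)) := fun s hs =>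
    (hu s hs).isSMulRegular _
  obtain ⟨m', hm'⟩ := exists_semilinear_extension' a.α α (σ := α.comp a.α) rfl a.m m
    (fun u hu0 => by
      obtain ⟨s, hs⟩ := (IsLocalizedModule.eq_zero_iff
        ((IsUnit.submonoid R').comap (ρ.comp X.q)) (LocalizedModule.mkLinearMap _ X.M)).mp hu0
      have h1 : m ((s : X.P) • u) = 0 := by
        rw [show (s : X.P) • u = 0 from hs, map_zero]
      rw [LinearMap.map_smulₛₗ] at h1
      exact (hu s s.2).smul_eq_zero.mp h1)
    (fun z => by
      obtain ⟨s, p, hs, h⟩ := exists_toLocAt _ z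
      exact ⟨s, p, hreg s hs, h⟩)
    (fun z => by
      obtain ⟨s, hs, u, h⟩ := exists_locM _ z
      obtain ⟨c, hc⟩ := (hu s hs).exists_right_inv
      exact ⟨s, u, c • m u, hreg s hs, h, by
        rw [smul_smul, RingHom.comp_apply, hc, one_smul]⟩)
  refine ⟨m', fun z => ?_⟩
  obtain ⟨s, hs, u, h⟩ := exists_locM _ z
  refine (hu s hs).mul_left_cancel ?_
  have h' : a.α s • z = a.m u := h
  have e1 := congrArg m' h'
  rw [LinearMap.map_smulₛₗ] at e1
  have e2 := congrArg (X.loc ρ hρ ‹_›).j h'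
  rw [map_smul] at e2
  rw [← smul_eq_mul, ← map_smul]
  refine (congrArg X₁.j (e1.trans (hm' u))).trans ?_
  rw [hm, ← map_mul]
  refine congrArg α (Eq.trans (a.comm_m u).symm e2.symm)

end PresLoc

end
end QLSing

namespace QLSing
noncomputable section

section Compare

variable {k R R' B B' : Type} [CommRing k] [CommRing R] [CommRing R']
  [CommRing B] [CommRing B'] {ι : k →+* R} {ι' : k →+* R'}
  {X : Pres ι} {X' : Pres ι'} {ρ : R →+* R'} {φ : R →+* B} {φ' : R' →+* B}

open nonZeroDivisors

/-! ### Localization does not change `C1` and `C2` -/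

theorem toLoc_nzd (hφ : φ'.comp ρ = φ) {s : X.P}
    (hs : IsUnit (ρ.comp X.q s)) : (φ.comp X.q) s ∈ B⁰ := by
  rw [← hφ]
  exact IsUnit.mem_nonZeroDivisors (hs.map φ')

theorem toLoc_pull1_bijective (hρ : IsLoc ρ) (h : ρ.comp ι = ι') (hφ : φ'.comp ρ = φ) :
    Function.Bijective ((X.toLoc ρ hρ h).pull1 hφ) := by
  let a := X.toLoc ρ hρ h
  have hI : ∀ z : (X.loc ρ hρ h).I, ∃ s, ∃ p : X.I, IsUnit (ρ.comp X.q s) ∧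
      a.α s • z = a.mapI p := fun z => by
    obtain ⟨s, p, hp, hs, hsp⟩ := exists_loc hρ z.1 z.2
    exact ⟨s, ⟨p, hp⟩, hs, Subtype.ext hsp⟩
  constructor
  · intro ψ χ he
    refine semilinear_ext a.α (a.scalar hφ) (g := a.mapI) (fun z => ?_)
      fun n => DFunLike.congr_fun he n
    obtain ⟨s, p, hs, hsp⟩ := hI z
    exact ⟨s, p, toLoc_nzd hφ hs, hsp⟩
  · intro ψ
    obtain ⟨ψ', h'⟩ := exists_semilinear_extension a.α _ (a.scalar hφ) a.mapI ψ
      (fun n hn => by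
        obtain ⟨s, hs, hs'⟩ := exists_of_toLocAt (ρ.comp X.q) n (congrArg Subtype.val hn)
        have h1 : ψ (s • n) = 0 := by
          rw [show s • n = 0 from Subtype.ext hs', map_zero]
        rw [LinearMap.map_smulₛₗ, smul_eq_mul] at h1
        refine eq_of_mul_nzd (toLoc_nzd hφ hs) (h1.trans (mul_zero _).symm))
      (fun z => by
        obtain ⟨s, p, hs, h'⟩ := exists_toLocAt _ z
        exact ⟨s, p, toLoc_nzd hφ hs, h'⟩)
      (fun z => by
        obtain ⟨s, p, hs, hsp⟩ := hI z
        have hu : IsUnit ((φ.comp X.q) s) := by rw [← hφ]; exact hs.map φ'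
        obtain ⟨c, hc⟩ := hu.exists_right_inv
        exact ⟨s, p, c * ψ p, hu.mem_nonZeroDivisors, hsp, by rw [← mul_assoc, hc, one_mul]⟩)
    exact ⟨ψ', LinearMap.ext h'⟩

theorem toLoc_pull2_bijective (hρ : IsLoc ρ) (h : ρ.comp ι = ι') (hφ : φ'.comp ρ = φ) :
    Function.Bijective ((X.toLoc ρ hρ h).pull2 hφ) := by
  let a := X.toLoc ρ hρ h
  have hI : ∀ z : (X.loc ρ hρ h).K, ∃ s, ∃ p : X.K, IsUnit (ρ.comp X.q s) ∧
      a.α s • z = a.mapK p := fun z => by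
    obtain ⟨s, hs, u, hu⟩ := exists_locM _ z.1
    have h1 : a.m u ∈ (X.loc ρ hρ h).K := by
      have := (X.loc ρ hρ h).K.smul_mem (a.α s) z.2
      rwa [show a.α s • z.1 = a.m u from hu] at this
    rw [(X.loc ρ hρ h).mem_K, a.comm_m] at h1
    obtain ⟨t, ht, ht'⟩ := exists_of_toLocAt (ρ.comp X.q) _ h1
    refine ⟨t * s, ⟨t • u, ?_⟩, ?_, Subtype.ext ?_⟩
    · rw [X.mem_K, map_smul]; exact ht'
    · rw [map_mul]; exact ht.mul hs
    · change a.α (t * s) • z.1 = a.m (t • u)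
      rw [map_mul, mul_smul, show a.α s • z.1 = a.m u from hu, LinearMap.map_smulₛₗ]
  constructor
  · intro ψ χ he
    refine semilinear_ext a.α (a.scalar hφ) (g := a.mapK) (fun z => ?_)
      fun n => DFunLike.congr_fun he n
    obtain ⟨s, p, hs, hsp⟩ := hI z
    exact ⟨s, p, toLoc_nzd hφ hs, hsp⟩
  · intro ψ
    obtain ⟨ψ', h'⟩ := exists_semilinear_extension a.α _ (a.scalar hφ) a.mapK ψ
      (fun n hn => by
        obtain ⟨s, hs'⟩ := (IsLocalizedModule.eq_zero_iff
          ((IsUnit.submonoid R').comap (ρ.comp X.q)) (LocalizedModule.mkLinearMap _ X.M)).mp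
            (congrArg Subtype.val hn)
        have h1 : ψ ((s : X.P) • n) = 0 := by
          rw [show (s : X.P) • n = 0 from Subtype.ext hs', map_zero]
        rw [LinearMap.map_smulₛₗ, smul_eq_mul] at h1
        refine eq_of_mul_nzd (toLoc_nzd hφ s.2) (h1.trans (mul_zero _).symm))
      (fun z => by
        obtain ⟨s, p, hs, h'⟩ := exists_toLocAt _ z
        exact ⟨s, p, toLoc_nzd hφ hs, h'⟩)
      (fun z => by
        obtain ⟨s, p, hs, hsp⟩ := hI z
        have hu : IsUnit ((φ.comp X.q) s) := by rw [← hφ]; exact hs.map φ'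
        obtain ⟨c, hc⟩ := hu.exists_right_inv
        exact ⟨s, p, c * ψ p, hu.mem_nonZeroDivisors, hsp, by rw [← mul_assoc, hc, one_mul]⟩)
    exact ⟨ψ', LinearMap.ext h'⟩

theorem toLoc_pullDer (hρ : IsLoc ρ) (h : ρ.comp ι = ι') (hφ : φ'.comp ρ = φ) {D : X.P → B}
    (hD : IsDer X.κ (φ.comp X.q) D) :
    ∃ D', IsDer (X.loc ρ hρ h).κ (φ'.comp (X.loc ρ hρ h).q) D' ∧
      ∀ p, D' ((X.toLoc ρ hρ h).α p) = D p := by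
  let a := X.toLoc ρ hρ h
  refine exists_der_extension a.α a.base _ (a.scalar hφ) hD (fun p hp => ?_) fun z => ?_
  · obtain ⟨s, hs, hs'⟩ := exists_of_toLocAt (ρ.comp X.q) p hp
    have h1 := hD.map_mul s p
    have h0 : D 0 = 0 := by
      have := hD.map_base 0
      rwa [map_zero] at this
    have h2 : (φ.comp X.q) p = 0 := by
      rw [← a.scalar hφ, RingHom.comp_apply, hp, map_zero]
    rw [hs', h0, h2, zero_mul, add_zero] at h1
    exact eq_of_mul_nzd (toLoc_nzd hφ hs) (h1.symm.trans (mul_zero _).symm)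
  · obtain ⟨s, p, hs, hsp⟩ := exists_toLocAt (ρ.comp X.q) z
    have hu : IsUnit ((φ.comp X.q) s) := by rw [← hφ]; exact hs.map φ'
    obtain ⟨c, hc⟩ := hu.exists_right_inv
    exact ⟨s, p, c * _, hu.mem_nonZeroDivisors, hsp, by rw [← mul_assoc, hc, one_mul]⟩

theorem bijective_mapQ {M N : Type} [AddCommGroup M] [Module B M] [AddCommGroup N] [Module B N]
    {f : M →ₗ[B] N} (hf : Function.Bijective f) {p : Submodule B M} {q : Submodule B N}
    (h : p ≤ q.comap f) (h' : ∀ x, f x ∈ q → x ∈ p) : Function.Bijective (p.mapQ q f h) := by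
  constructor
  · refine (injective_iff_map_eq_zero _).mpr fun x hx => ?_
    obtain ⟨x, rfl⟩ := Submodule.Quotient.mk_surjective _ x
    rw [Submodule.mapQ_apply, Submodule.Quotient.mk_eq_zero] at hx
    exact (Submodule.Quotient.mk_eq_zero _).mpr (h' x hx)
  · intro y
    obtain ⟨y, rfl⟩ := Submodule.Quotient.mk_surjective _ y
    obtain ⟨x, rfl⟩ := hf.2 y
    exact ⟨Submodule.Quotient.mk x, rfl⟩

theorem toLoc_map1_bijective (hρ : IsLoc ρ) (h : ρ.comp ι = ι') (hφ : φ'.comp ρ = φ) :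
    Function.Bijective ((X.toLoc ρ hρ h).map1 hφ) := by
  refine bijective_mapQ (toLoc_pull1_bijective hρ h hφ) _ fun ψ hψ => ?_
  let a := X.toLoc ρ hρ h
  obtain ⟨D, hD, hψ⟩ := hψ
  obtain ⟨D', hD', h'⟩ := toLoc_pullDer hρ h hφ hD
  refine ⟨D', hD', fun z => ?_⟩
  obtain ⟨s, p, hp, hs, hsp⟩ := exists_loc hρ z.1 z.2
  have hsp' : a.α s * z.1 = a.α p := hsp
  refine eq_of_mul_nzd (toLoc_nzd hφ hs) ?_
  have h1 := hD'.map_mul (a.α s) z.1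
  have h2 := LinearMap.map_smulₛₗ ψ (a.α s) z
  have h3 : a.α s • z = a.mapI ⟨p, hp⟩ := Subtype.ext hsp'
  have h4 : (φ'.comp (X.loc ρ hρ h).q) z.1 = 0 := by
    rw [RingHom.comp_apply, ((X.loc ρ hρ h).mem_I _).mp z.2, map_zero]
  rw [h4, zero_mul, add_zero, hsp', h', ← RingHom.comp_apply, a.scalar hφ] at h1
  rw [h3, ← RingHom.comp_apply, a.scalar hφ, smul_eq_mul] at h2
  rw [← h1, ← h2]
  exact hψ ⟨p, hp⟩

theorem toLoc_map2_bijective (hρ : IsLoc ρ) (h : ρ.comp ι = ι') (hφ : φ'.comp ρ = φ) :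
    Function.Bijective ((X.toLoc ρ hρ h).map2 hφ) := by
  refine bijective_mapQ (toLoc_pull2_bijective hρ h hφ) _ fun ψ hψ => ?_
  let a := X.toLoc ρ hρ h
  obtain ⟨χ, hψ⟩ := hψ
  obtain ⟨χ', h'⟩ := exists_semilinear_extension a.α _ (a.scalar hφ) a.m χ
    (fun n hn => by
      obtain ⟨s, hs'⟩ := (IsLocalizedModule.eq_zero_iff
        ((IsUnit.submonoid R').comap (ρ.comp X.q)) (LocalizedModule.mkLinearMap _ X.M)).mp hn
      have h1 : χ ((s : X.P) • n) = 0 := by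
        rw [show (s : X.P) • n = 0 from hs', map_zero]
      rw [LinearMap.map_smulₛₗ, smul_eq_mul] at h1
      refine eq_of_mul_nzd (toLoc_nzd hφ s.2) (h1.trans (mul_zero _).symm))
    (fun z => by
      obtain ⟨s, p, hs, h'⟩ := exists_toLocAt _ z
      exact ⟨s, p, toLoc_nzd hφ hs, h'⟩)
    (fun z => by
      obtain ⟨s, hs, p, hsp⟩ := exists_locM _ z
      have hu : IsUnit ((φ.comp X.q) s) := by rw [← hφ]; exact IsUnit.map φ' hs
      obtain ⟨c, hc⟩ := hu.exists_right_inv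
      exact ⟨s, p, c * χ p, hu.mem_nonZeroDivisors, hsp, by rw [← mul_assoc, hc, one_mul]⟩)
  refine ⟨χ', fun z => ?_⟩
  have e : ψ = homPull (α := RingHom.id _) rfl (X.loc ρ hρ h).K.subtype χ' := by
    refine (toLoc_pull2_bijective hρ h hφ).1 (LinearMap.ext fun r => ?_)
    exact (hψ r).trans (h' r).symm
  exact DFunLike.congr_fun e z

/-! ### Independence of the presentation -/

/-- A presentation by a localized polynomial ring and a free module. -/
structure Pres.Good (X : Pres ι) : Prop where
  poly : IsLocPoly X.κ
  modLift : X.HasModLift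

theorem canon_good : (canon ι).Good := ⟨isLocPoly_canon, canon_hasModLift⟩

theorem Pres.Good.loc (hX : X.Good) (hρ : IsLoc ρ) (h : ρ.comp ι = ι') :
    (X.loc ρ hρ h).Good :=
  ⟨Pres.loc_isLocPoly hX.poly, Pres.loc_hasModLift hX.modLift⟩

/-- Units of `R` are represented by units of `P` only. -/
def Pres.IsLocal (X : Pres ι) : Prop := ∀ a, IsUnit (X.q a) → IsUnit a

theorem Pres.loc_isLocal {hρ : IsLoc ρ} {h : ρ.comp ι = ι'} : (X.loc ρ hρ h).IsLocal :=
  isUnit_of_fromLocAt _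

theorem Pres.Good.exists_lift_of (hX : X.Good) {α : X.P →+* X'.P}
    (hα : X'.q.comp α = ρ.comp X.q) (hκ : α.comp X.κ = X'.κ) : ∃ a : Lift X X' ρ, a.α = α := by
  obtain ⟨m, hm⟩ := hX.modLift X' α fun x hx => by
    rw [X'.mem_I, ← RingHom.comp_apply, hα, RingHom.comp_apply, (X.mem_I x).mp hx, map_zero]
  exact ⟨⟨α, hκ, hα, m, hm⟩, rfl⟩

theorem Pres.Good.exists_lift (hX : X.Good) (hX' : X'.IsLocal) (h : ρ.comp ι = ι') :
    Nonempty (Lift X X' ρ) := by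
  obtain ⟨α, hα, hκ⟩ := hX.poly.exists_lift X'.q X'.surj hX' X'.κ (ρ.comp X.q)
    (by rw [RingHom.comp_assoc, X.comm, X'.comm, h])
  obtain ⟨a, -⟩ := hX.exists_lift_of hα hκ
  exact ⟨a⟩

theorem exists_lift_canon (X' : Pres ι') (h : ρ.comp ι = ι') : Nonempty (Lift (canon ι) X' ρ) := by
  choose c hc using fun r => X'.surj (ρ r)
  obtain ⟨a, -⟩ := (canon_good (ι := ι)).exists_lift_of (X' := X') (ρ := ρ)
    (α := MvPolynomial.eval₂Hom X'.κ c)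
    (MvPolynomial.ringHom_ext (σ := R) (f := X'.q.comp (MvPolynomial.eval₂Hom X'.κ c))
      (g := ρ.comp (presEval ι)) (fun x => by
      have h1 := DFunLike.congr_fun X'.comm x
      have h2 : presEval ι (MvPolynomial.C x) = ι x := DFunLike.congr_fun (canon ι).comm x
      rw [RingHom.comp_apply, RingHom.comp_apply, h2, MvPolynomial.coe_eval₂Hom,
        MvPolynomial.eval₂_C]
      rw [RingHom.comp_apply] at h1
      rw [h1, ← h]; rfl) fun r => by
      have h2 : presEval ι (MvPolynomial.X r) = r := by
        simp [presEval]
      rw [RingHom.comp_apply, RingHom.comp_apply, h2, MvPolynomial.coe_eval₂Hom,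
        MvPolynomial.eval₂_X, hc])
    (RingHom.ext fun x => MvPolynomial.eval₂_C _ _ _)
  exact ⟨a⟩

theorem bijective_of_square {M N M' N' : Type} {f : M → N} {g : N → N'} {f' : M' → N'} {g' : M → M'}
    (hf : Function.Bijective f) (hg' : Function.Bijective g') (hf' : Function.Bijective f')
    (h : ∀ x, g (f x) = f' (g' x)) : Function.Bijective g := by
  have e : g ∘ f = f' ∘ g' := funext h
  exact (Function.Bijective.of_comp_iff _ hf).mp (e ▸ hf'.comp hg')

variable {Z : Pres ι}

theorem Lift.map_bijective_of_isLocal (hX : X.Good) (hZ : Z.Good) (hX' : X.IsLocal)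
    (a : Lift X Z (RingHom.id R)) :
    Function.Bijective (a.map1 (RingHom.comp_id φ)) ∧
      Function.Bijective (a.map2 (RingHom.comp_id φ)) := by
  obtain ⟨b⟩ := hZ.exists_lift hX' (RingHom.id_comp ι)
  have hi : (RingHom.id R).comp (RingHom.id R) = RingHom.id R := rfl
  have hφ : φ.comp (RingHom.id R) = φ := RingHom.comp_id φ
  refine ⟨Function.bijective_iff_has_inverse.mpr ⟨b.map1 hφ, fun x => ?_, fun x => ?_⟩,
    Function.bijective_iff_has_inverse.mpr ⟨b.map2 hφ, fun x => ?_, fun x => ?_⟩⟩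
  · rw [← Lift.map1_comp a b hi hφ hφ hφ, Lift.map1_eq _ (Lift.id Z)]
    obtain ⟨ψ, rfl⟩ := Submodule.Quotient.mk_surjective _ x; rfl
  · rw [← Lift.map1_comp b a hi hφ hφ hφ, Lift.map1_eq _ (Lift.id X)]
    obtain ⟨ψ, rfl⟩ := Submodule.Quotient.mk_surjective _ x; rfl
  · rw [← Lift.map2_comp a b hi hφ hφ hφ, Lift.map2_eq _ (Lift.id Z) hZ.poly]
    obtain ⟨ψ, rfl⟩ := Submodule.Quotient.mk_surjective _ x; rfl
  · rw [← Lift.map2_comp b a hi hφ hφ hφ, Lift.map2_eq _ (Lift.id X) hX.poly]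
    obtain ⟨ψ, rfl⟩ := Submodule.Quotient.mk_surjective _ x; rfl

/-- `C1` and `C2` do not depend on the presentation, and do not change under localization. -/
theorem Lift.map_bijective (hX : X.Good) (hX' : X'.Good) (hρ : IsLoc ρ) (a : Lift X X' ρ)
    (hφ : φ'.comp ρ = φ) :
    Function.Bijective (a.map1 hφ) ∧ Function.Bijective (a.map2 hφ) := by
  have h : ρ.comp ι = ι' := by rw [← X.comm, ← RingHom.comp_assoc, ← a.comm, RingHom.comp_assoc,
    a.base, X'.comm]
  have hi : (RingHom.id R').comp ι' = ι' := RingHom.id_comp ι'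
  have hφi : φ'.comp (RingHom.id R') = φ' := RingHom.comp_id φ'
  let c := X.toLoc ρ hρ h
  let d := X'.toLoc (RingHom.id R') isLoc_id hi
  obtain ⟨f⟩ := (hX.loc hρ h).exists_lift
    (Pres.loc_isLocal (X := X') (hρ := isLoc_id) (h := hi)) hi
  have hb := f.map_bijective_of_isLocal (φ := φ') (hX.loc hρ h) (hX'.loc isLoc_id hi)
    Pres.loc_isLocal
  have hr : (RingHom.id R').comp ρ = ρ := RingHom.id_comp ρ
  refine ⟨bijective_of_square (toLoc_map1_bijective isLoc_id hi hφi) hb.1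
    (toLoc_map1_bijective hρ h hφ) fun x => ?_,
    bijective_of_square (toLoc_map2_bijective isLoc_id hi hφi) hb.2
    (toLoc_map2_bijective hρ h hφ) fun x => ?_⟩
  · rw [← Lift.map1_comp d a hr hφ hφi hφ, ← Lift.map1_comp f c hr hφ hφi hφ, Lift.map1_eq]
  · rw [← Lift.map2_comp d a hr hφ hφi hφ, ← Lift.map2_comp f c hr hφ hφi hφ,
      Lift.map2_eq _ _ hX.poly]

/-! ### Representatives of classes in `T¹` and `T²` -/

/-- The class in `T¹(R/k; B)` of a homomorphism on `I`. -/
def Pres.cl1 (X : Pres ι) (φ : R →+* B) : X.N1 φ →ₗ[B] T1 ι φ :=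
  ((exists_lift_canon X (RingHom.id_comp ι)).some.map1 (RingHom.comp_id φ)).comp
    (X.Triv1 φ).mkQ

/-- The class in `T²(R/k; B)` of a homomorphism on `K`. -/
def Pres.cl2 (X : Pres ι) (φ : R →+* B) : X.N2 φ →ₗ[B] T2 ι φ :=
  ((exists_lift_canon X (RingHom.id_comp ι)).some.map2 (RingHom.comp_id φ)).comp
    (X.Triv2 φ).mkQ

theorem Pres.Good.cl1_surjective (hX : X.Good) : Function.Surjective (X.cl1 φ) := fun t => by
  obtain ⟨x, hx⟩ := (Lift.map_bijective canon_good hX isLoc_id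
    (exists_lift_canon X (RingHom.id_comp ι)).some (RingHom.comp_id φ)).1.2 t
  obtain ⟨ψ, rfl⟩ := Submodule.Quotient.mk_surjective _ x
  exact ⟨ψ, hx⟩

theorem Pres.Good.cl2_surjective (hX : X.Good) : Function.Surjective (X.cl2 φ) := fun t => by
  obtain ⟨x, hx⟩ := (Lift.map_bijective canon_good hX isLoc_id
    (exists_lift_canon X (RingHom.id_comp ι)).some (RingHom.comp_id φ)).2.2 t
  obtain ⟨ψ, rfl⟩ := Submodule.Quotient.mk_surjective _ x
  exact ⟨ψ, hx⟩

theorem Pres.Good.cl1_eq_zero (hX : X.Good) {ψ : X.N1 φ} :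
    X.cl1 φ ψ = 0 ↔ ψ ∈ X.Triv1 φ := by
  exact ((injective_iff_map_eq_zero' _).mp (Lift.map_bijective canon_good hX isLoc_id
    (exists_lift_canon X (RingHom.id_comp ι)).some (RingHom.comp_id φ)).1.1
      (Submodule.Quotient.mk ψ)).trans (Submodule.Quotient.mk_eq_zero _)

theorem Pres.Good.cl2_eq_zero (hX : X.Good) {ψ : X.N2 φ} :
    X.cl2 φ ψ = 0 ↔ ψ ∈ X.Triv2 φ := by
  exact ((injective_iff_map_eq_zero' _).mp (Lift.map_bijective canon_good hX isLoc_id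
    (exists_lift_canon X (RingHom.id_comp ι)).some (RingHom.comp_id φ)).2.1
      (Submodule.Quotient.mk ψ)).trans (Submodule.Quotient.mk_eq_zero _)

theorem Pres.cl1_coeff {φ : R →+* B} {φ' : R →+* B'} (β : B →+* B') (h : β.comp φ = φ')
    (h' : β.comp (φ.comp X.q) = φ'.comp X.q) (ψ : X.N1 φ) :
    T1.coeff ι β h (X.cl1 φ ψ) = X.cl1 φ' (homCoeff β h' ψ) := rfl

theorem Pres.cl2_coeff {φ : R →+* B} {φ' : R →+* B'} (β : B →+* B') (h : β.comp φ = φ')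
    (h' : β.comp (φ.comp X.q) = φ'.comp X.q) (ψ : X.N2 φ) :
    T2.coeff ι β h (X.cl2 φ ψ) = X.cl2 φ' (homCoeff β h' ψ) := rfl

/-- The map of canonical presentations. -/
def canonLift (h : ρ.comp ι = ι') : Lift (canon ι) (canon ι') ρ where
  α := presRename k ρ
  base := RingHom.ext fun c => by
    change presRename k ρ (MvPolynomial.C c) = MvPolynomial.C c
    simp [presRename]
  comm := presEval_comp_rename h
  m := presFreeQuotMap h
  comm_m u := by
    obtain ⟨z, rfl⟩ := Submodule.Quotient.mk_surjective _ u
    exact presMap_freeMap h z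

theorem Lift.cl1_pull (a : Lift X X' ρ) (h : ρ.comp ι = ι') (hφ : φ'.comp ρ = φ) (ψ : X'.N1 φ') :
    T1.pull h hφ (X'.cl1 φ' ψ) = X.cl1 φ (a.pull1 hφ ψ) := by
  let c := (exists_lift_canon X (RingHom.id_comp ι)).some
  let c' := (exists_lift_canon X' (RingHom.id_comp ι')).some
  change (canonLift h).map1 hφ (c'.map1 _ (Submodule.Quotient.mk ψ)) =
    c.map1 _ (a.map1 hφ (Submodule.Quotient.mk ψ))
  rw [← Lift.map1_comp c' (canonLift h) (RingHom.id_comp ρ) hφ _ hφ,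
    ← Lift.map1_comp a c (RingHom.comp_id ρ) _ hφ hφ, Lift.map1_eq]

theorem Lift.cl2_pull (a : Lift X X' ρ) (h : ρ.comp ι = ι') (hφ : φ'.comp ρ = φ) (ψ : X'.N2 φ') :
    T2.pull h hφ (X'.cl2 φ' ψ) = X.cl2 φ (a.pull2 hφ ψ) := by
  let c := (exists_lift_canon X (RingHom.id_comp ι)).some
  let c' := (exists_lift_canon X' (RingHom.id_comp ι')).some
  change (canonLift h).map2 hφ (c'.map2 _ (Submodule.Quotient.mk ψ)) =
    c.map2 _ (a.map2 hφ (Submodule.Quotient.mk ψ))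
  rw [← Lift.map2_comp c' (canonLift h) (RingHom.id_comp ρ) hφ _ hφ,
    ← Lift.map2_comp a c (RingHom.comp_id ρ) _ hφ hφ, Lift.map2_eq _ _ isLocPoly_canon]

theorem T1.pull_bijective (hρ : IsLoc ρ) (h : ρ.comp ι = ι') (hφ : φ'.comp ρ = φ) :
    Function.Bijective (T1.pull h hφ) :=
  (Lift.map_bijective canon_good canon_good hρ (canonLift h) hφ).1

theorem T2.pull_bijective (hρ : IsLoc ρ) (h : ρ.comp ι = ι') (hφ : φ'.comp ρ = φ) :
    Function.Bijective (T2.pull h hφ) :=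
  (Lift.map_bijective canon_good canon_good hρ (canonLift h) hφ).2

end Compare

end
end QLSing

namespace QLSing
noncomputable section

/-! ### Derivations of localized polynomial rings -/

section DerLoc

variable {k P B τ : Type} [CommRing k] [CommRing P] [CommRing B]

/-- A derivation as a ring map to the dual numbers. -/
def IsDer.toDual {κ : k →+* P} {σ : P →+* B} {D : P → B} (hD : IsDer κ σ D) :
    P →+* TrivSqZeroExt B B where
  toFun p := TrivSqZeroExt.inl (σ p) + TrivSqZeroExt.inr (D p)
  map_one' := by
    have := hD.map_base 1
    rw [RingHom.map_one] at this
    rw [this, RingHom.map_one]; simp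
  map_zero' := by
    have := hD.map_base 0
    rw [RingHom.map_zero] at this
    rw [this, RingHom.map_zero]; simp
  map_add' x y := by
    rw [hD.map_add, RingHom.map_add]
    exact TrivSqZeroExt.ext (by simp) (by simp)
  map_mul' x y := by
    rw [hD.map_mul, RingHom.map_mul]
    exact TrivSqZeroExt.ext (by simp) (by simp [mul_comm])

theorem IsDer.toDual_fst {κ : k →+* P} {σ : P →+* B} {D : P → B} (hD : IsDer κ σ D) (p : P) :
    (hD.toDual p).fst = σ p := by simp [IsDer.toDual]

theorem IsDer.toDual_snd {κ : k →+* P} {σ : P →+* B} {D : P → B} (hD : IsDer κ σ D) (p : P) :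
    (hD.toDual p).snd = D p := by simp [IsDer.toDual]

theorem isDer_of_toDual {κ : k →+* P} {σ : P →+* B} (l : P →+* TrivSqZeroExt B B)
    (hl : ∀ p, (l p).fst = σ p) (hκ : ∀ c, (l (κ c)).snd = 0) : IsDer κ σ fun p => (l p).snd where
  map_add x y := by rw [map_add, TrivSqZeroExt.snd_add]
  map_mul x y := by
    rw [map_mul, TrivSqZeroExt.snd_mul, hl, hl]
    simp [mul_comm]
  map_base := hκ

variable {θ : MvPolynomial τ k →+* P} (hθ : IsLoc θ)
include hθ

theorem IsLoc.der_ext {σ : P →+* B} {D E : P → B} (hD : IsDer (θ.comp MvPolynomial.C) σ D)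
    (hE : IsDer (θ.comp MvPolynomial.C) σ E)
    (h : ∀ t, D (θ (MvPolynomial.X t)) = E (θ (MvPolynomial.X t))) : D = E := by
  have e : hD.toDual = hE.toDual := hθ.hom_ext <| MvPolynomial.ringHom_ext
    (fun c => TrivSqZeroExt.ext (by
      rw [RingHom.comp_apply, RingHom.comp_apply, hD.toDual_fst, hE.toDual_fst]) (by
      rw [RingHom.comp_apply, RingHom.comp_apply, hD.toDual_snd, hE.toDual_snd]
      exact (hD.map_base c).trans (hE.map_base c).symm))
    (fun t => TrivSqZeroExt.ext (by
      rw [RingHom.comp_apply, RingHom.comp_apply, hD.toDual_fst, hE.toDual_fst]) (by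
      rw [RingHom.comp_apply, RingHom.comp_apply, hD.toDual_snd, hE.toDual_snd, h]))
  funext p
  rw [← hD.toDual_snd, e, hE.toDual_snd]

theorem IsLoc.exists_der (σ : P →+* B) (b : τ → B) :
    ∃ D, IsDer (θ.comp MvPolynomial.C) σ D ∧ ∀ t, D (θ (MvPolynomial.X t)) = b t := by
  let f : MvPolynomial τ k →+* TrivSqZeroExt B B := MvPolynomial.eval₂Hom
    ((TrivSqZeroExt.inlHom B B).comp (σ.comp (θ.comp MvPolynomial.C)))
    fun t => TrivSqZeroExt.inl (σ (θ (MvPolynomial.X t))) + TrivSqZeroExt.inr (b t)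
  let F : TrivSqZeroExt B B →+* B := (TrivSqZeroExt.fstHom ℤ B B).toRingHom
  have hF' : ∀ z, F z = z.fst := fun _ => rfl
  have hC : ∀ c, f (MvPolynomial.C c) = TrivSqZeroExt.inl (σ (θ (MvPolynomial.C c))) := fun c =>
    MvPolynomial.eval₂_C _ _ c
  have hX : ∀ t, f (MvPolynomial.X t) =
      TrivSqZeroExt.inl (σ (θ (MvPolynomial.X t))) + TrivSqZeroExt.inr (b t) := fun t =>
    MvPolynomial.eval₂_X _ _ t
  have hf : F.comp f = σ.comp θ := MvPolynomial.ringHom_ext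
    (fun c => by rw [RingHom.comp_apply, hC, hF', TrivSqZeroExt.fst_inl]; rfl)
    (fun t => by rw [RingHom.comp_apply, hX, hF']; simp)
  obtain ⟨l, hl⟩ := hθ.lift f fun s hs => by
    rw [TrivSqZeroExt.isUnit_iff_isUnit_fst]
    have : (f s).fst = σ (θ s) := DFunLike.congr_fun hf s
    rw [this]; exact hs.map σ
  have hF : F.comp l = σ := hθ.hom_ext (by rw [RingHom.comp_assoc, hl, hf])
  have hl' : ∀ p, l (θ p) = f p := fun p => DFunLike.congr_fun hl p
  refine ⟨_, isDer_of_toDual (κ := θ.comp MvPolynomial.C) (σ := σ) l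
    (fun p => DFunLike.congr_fun hF p) (fun c => ?_), fun t => ?_⟩
  · rw [RingHom.comp_apply, hl', hC, TrivSqZeroExt.snd_inl]
  · rw [hl', hX]; simp

end DerLoc

/-! ### Localization of the coefficients -/

section Away

variable {k R P N B B' : Type} [CommRing k] [CommRing R] [CommRing P] [CommRing B] [CommRing B']
  [AddCommGroup N] [Module P N]

/-- `B'` is the localization of `B` in `g`. -/
structure IsAway (β : B →+* B') (g : B) : Prop where
  unit : IsUnit (β g)
  surj : ∀ z, ∃ n b, β (g ^ n) * z = β b
  ker : ∀ b, β b = 0 → ∃ n, g ^ n * b = 0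

theorem IsAway.isLoc {β : B →+* B'} {g : B} (h : IsAway β g) : IsLoc β where
  surj z := by
    obtain ⟨n, b, hb⟩ := h.surj z
    exact ⟨g ^ n, b, by rw [map_pow]; exact h.unit.pow n, hb⟩
  ker b hb := by
    obtain ⟨n, hn⟩ := h.ker b hb
    exact ⟨g ^ n, by rw [map_pow]; exact h.unit.pow n, hn⟩

variable {β : B →+* B'} {g : B} (h : IsAway β g)
include h

theorem IsAway.surj_finset {ι : Type} (s : Finset ι) (z : ι → B') :
    ∃ n, ∃ b : ι → B, ∀ i ∈ s, β (b i) = β (g ^ n) * z i := by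
  choose m c hc using fun i => h.surj (z i)
  refine ⟨s.sup m, fun i => g ^ (s.sup m - m i) * c i, fun i hi => ?_⟩
  rw [map_mul, ← hc, ← mul_assoc, ← map_mul, ← pow_add, Nat.sub_add_cancel (Finset.le_sup hi)]

theorem IsAway.ker_finset {ι : Type} (s : Finset ι) (b : ι → B) (hb : ∀ i ∈ s, β (b i) = 0) :
    ∃ n, ∀ i ∈ s, g ^ n * b i = 0 := by
  have := fun i : s => h.ker (b i) (hb i i.2)
  choose m hm using this
  refine ⟨s.attach.sup m, fun i hi => ?_⟩
  have h1 := Finset.le_sup (f := m) (Finset.mem_attach s ⟨i, hi⟩)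
  rw [← Nat.sub_add_cancel h1, pow_add, mul_assoc, hm ⟨i, hi⟩, mul_zero]

variable {σ : P →+* B} {σ' : P →+* B'}

theorem IsAway.hom_inj [Module.Finite P N] (ψ : N →ₛₗ[σ] B) (hψ : ∀ x, β (ψ x) = 0) :
    ∃ n : ℕ, g ^ n • ψ = 0 := by
  obtain ⟨s, hs⟩ := Module.Finite.fg_top (R := P) (M := N)
  obtain ⟨n, hn⟩ := h.ker_finset s ψ fun i _ => hψ i
  refine ⟨n, LinearMap.ext fun x => ?_⟩
  have hx : x ∈ Submodule.span P (s : Set N) := by rw [hs]; trivial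
  induction hx using Submodule.span_induction with
  | mem x hx => exact hn x hx
  | zero => simp
  | add x y _ _ hx hy => rw [map_add, hx, hy]; simp
  | smul p x _ hx => rw [LinearMap.map_smulₛₗ, hx]; simp

theorem IsAway.hom_surj (hσ : β.comp σ = σ') [IsNoetherianRing P] [Module.Finite P N] (ψ : N →ₛₗ[σ'] B') :
    ∃ (n : ℕ) (χ : N →ₛₗ[σ] B), ∀ x, β (χ x) = β (g ^ n) * ψ x := by
  obtain ⟨r, f, hf⟩ := Module.Finite.exists_fin' P N
  obtain ⟨n, b, hb⟩ := h.surj_finset (Finset.univ : Finset (Fin r)) fun i => ψ (f (Pi.single i 1))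
  let χ₀ : (Fin r → P) →ₛₗ[σ] B :=
    { toFun := fun z => ∑ i, σ (z i) * b i
      map_add' := fun z w => by simp [add_mul, Finset.sum_add_distrib]
      map_smul' := fun p z => by simp [Finset.mul_sum, mul_assoc] }
  have hχ₀ : ∀ z, β (χ₀ z) = β (g ^ n) * ψ (f z) := fun z => by
    change β (∑ i, σ (z i) * b i) = _
    have hz : z = ∑ i, z i • (Pi.single i 1 : Fin r → P) := by
      funext j
      simp [Finset.sum_apply, Pi.single_apply]
    conv_rhs => rw [hz]
    simp only [map_sum, map_smul, LinearMap.map_smulₛₗ, Finset.mul_sum, map_mul]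
    refine Finset.sum_congr rfl fun i hi => ?_
    have e : β (σ (z i)) = σ' (z i) := DFunLike.congr_fun hσ _
    rw [hb i hi, smul_eq_mul, e]
    ring
  let χ₁ : LinearMap.ker f →ₛₗ[σ] B := χ₀.comp (LinearMap.ker f).subtype
  obtain ⟨m, hm⟩ := h.hom_inj χ₁ fun x => (hχ₀ x).trans (by
    rw [show f x = 0 from x.2, map_zero, mul_zero])
  obtain ⟨χ, hχ⟩ := exists_semilinear_extension (RingHom.id P) σ (σ := σ) rfl f (g ^ m • χ₀)
    (fun z hz => DFunLike.congr_fun hm ⟨z, hz⟩)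
    (fun p => ⟨1, p, by rw [map_one]; exact one_mem _, by simp⟩)
    (fun z => by
      obtain ⟨w, rfl⟩ := hf z
      exact ⟨1, w, (g ^ m • χ₀) w, by rw [map_one]; exact one_mem _, by simp, by simp⟩)
  refine ⟨m + n, χ, fun x => ?_⟩
  obtain ⟨w, rfl⟩ := hf x
  rw [hχ, LinearMap.smul_apply, smul_eq_mul, map_mul, hχ₀, pow_add, map_mul, mul_assoc]

end Away

/-! ### Finite presentations -/

section FinPres

variable {k R B B' : Type} [CommRing k] [CommRing R] [CommRing B] [CommRing B'] {ι : k →+* R}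

/-- `R` is a quotient of a Noetherian localization of a polynomial ring in finitely many
variables. -/
def FinPres (ι : k →+* R) : Prop :=
  ∃ (m : ℕ) (P : Type) (_ : CommRing P) (θ : MvPolynomial (Fin m) k →+* P) (q : P →+* R),
    IsNoetherianRing P ∧ IsLoc θ ∧ Function.Surjective q ∧ q.comp (θ.comp MvPolynomial.C) = ι

theorem FinPres.exists_pres (h : FinPres ι) : ∃ (X : Pres ι) (m : ℕ)
    (θ : MvPolynomial (Fin m) k →+* X.P), X.Good ∧ IsLoc θ ∧ θ.comp MvPolynomial.C = X.κ ∧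
    IsNoetherianRing X.P ∧ Module.Finite X.P X.I ∧ Module.Finite X.P X.M ∧
    Module.Finite X.P X.K := by
  obtain ⟨m, P, _, θ, q, hP, hθ, hq, hι⟩ := h
  obtain ⟨n, v, hv⟩ := Submodule.fg_iff_exists_fin_generating_family.mp
    (IsNoetherian.noetherian (RingHom.ker q))
  let X := freePres _ q hι hq v hv.symm
  have : Module.Finite P ((Fin n →₀ P) ⧸ freeRel₀ v) := inferInstance
  refine ⟨X, m, θ, ⟨⟨_, θ, rfl, hθ⟩, freePres_hasModLift⟩, hθ, rfl, hP, ?_, this, ?_⟩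
  · exact Module.IsNoetherian.finite P (RingHom.ker q)
  · have : IsNoetherian P ((Fin n →₀ P) ⧸ freeRel₀ v) := inferInstance
    exact Module.IsNoetherian.finite P
      ((LinearMap.ker (Finsupp.linearCombination P v)).map (freeRel₀ v).mkQ)

variable {φ : R →+* B} {φ' : R →+* B'} {β : B →+* B'} {g : B}

theorem IsAway.exists_der {P : Type} [CommRing P] {m : ℕ} {θ : MvPolynomial (Fin m) k →+* P}
    (hθ : IsLoc θ) (h : IsAway β g) {σ : P →+* B} {σ' : P →+* B'} (hσ : β.comp σ = σ')
    {D : P → B'} (hD : IsDer (θ.comp MvPolynomial.C) σ' D) :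
    ∃ (n : ℕ) (E : P → B), IsDer (θ.comp MvPolynomial.C) σ E ∧
      ∀ p, β (E p) = β (g ^ n) * D p := by
  obtain ⟨n, b, hb⟩ := h.surj_finset (Finset.univ : Finset (Fin m))
    fun i => D (θ (MvPolynomial.X i))
  obtain ⟨E, hE, hEb⟩ := hθ.exists_der σ b
  refine ⟨n, E, hE, fun p => ?_⟩
  have e := hθ.der_ext (T0_comp hσ (show E ∈ T0 _ σ from hE))
    ((T0 _ σ').smul_mem (β (g ^ n)) (show D ∈ T0 _ σ' from hD))
    fun t => by rw [hEb]; exact hb t (Finset.mem_univ t)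
  exact congrFun e p

theorem T1.coeff_inj (hι : FinPres ι) (hβ : IsAway β g) (hφ : β.comp φ = φ') (x : T1 ι φ)
    (hx : T1.coeff ι β hφ x = 0) : ∃ n : ℕ, g ^ n • x = 0 := by
  obtain ⟨X, m, θ, hX, hθ, hκ, -, hI, -, -⟩ := hι.exists_pres
  obtain ⟨ψ, rfl⟩ := hX.cl1_surjective x
  have hσ : β.comp (φ.comp X.q) = φ'.comp X.q := by rw [← RingHom.comp_assoc, hφ]
  rw [X.cl1_coeff β hφ hσ, hX.cl1_eq_zero] at hx
  obtain ⟨D, hD, hψ⟩ := hx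
  rw [← hκ] at hD
  obtain ⟨n, E, hE, hED⟩ := hβ.exists_der hθ hσ hD
  let χ : X.N1 φ :=
    { toFun := fun f => E f
      map_add' := fun f f' => hE.map_add _ _
      map_smul' := fun p f => by
        have := hE.map_mul p f
        rwa [show (φ.comp X.q) f = 0 by rw [RingHom.comp_apply, (X.mem_I _).mp f.2, map_zero],
          zero_mul, add_zero] at this }
  obtain ⟨N, hN⟩ := hβ.hom_inj (g ^ n • ψ - χ) fun f => by
    have : β (ψ f) = D f := hψ f
    rw [LinearMap.sub_apply, LinearMap.smul_apply, map_sub, smul_eq_mul, map_mul, this]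
    exact sub_eq_zero.mpr (hED f).symm
  refine ⟨N + n, ?_⟩
  rw [← map_smul, hX.cl1_eq_zero]
  rw [smul_sub, sub_eq_zero, smul_smul, ← pow_add] at hN
  rw [hN]
  refine ⟨g ^ N • E, Submodule.smul_mem _ _ ?_, fun f => rfl⟩
  rw [← hκ]; exact hE

theorem T1.coeff_surj (hι : FinPres ι) (hβ : IsAway β g) (hφ : β.comp φ = φ') (y : T1 ι φ') :
    ∃ (n : ℕ) (x : T1 ι φ), T1.coeff ι β hφ x = β (g ^ n) • y := by
  obtain ⟨X, m, θ, hX, hθ, hκ, _, _, -, -⟩ := hι.exists_pres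
  obtain ⟨ψ, rfl⟩ := hX.cl1_surjective y
  have hσ : β.comp (φ.comp X.q) = φ'.comp X.q := by rw [← RingHom.comp_assoc, hφ]
  obtain ⟨n, χ, hχ⟩ := hβ.hom_surj hσ ψ
  refine ⟨n, X.cl1 φ χ, ?_⟩
  rw [X.cl1_coeff β hφ hσ, ← map_smul]
  exact congrArg _ (LinearMap.ext hχ)

theorem T2.coeff_inj (hι : FinPres ι) (hβ : IsAway β g) (hφ : β.comp φ = φ') (x : T2 ι φ)
    (hx : T2.coeff ι β hφ x = 0) : ∃ n : ℕ, g ^ n • x = 0 := by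
  obtain ⟨X, m, θ, hX, hθ, hκ, _, hI, _, _⟩ := hι.exists_pres
  obtain ⟨ψ, rfl⟩ := hX.cl2_surjective x
  have hσ : β.comp (φ.comp X.q) = φ'.comp X.q := by rw [← RingHom.comp_assoc, hφ]
  rw [X.cl2_coeff β hφ hσ, hX.cl2_eq_zero] at hx
  obtain ⟨D, hψ⟩ := hx
  obtain ⟨n, E, hED⟩ := hβ.hom_surj hσ D
  let χ : X.N2 φ := E.comp X.K.subtype
  obtain ⟨N, hN⟩ := hβ.hom_inj (g ^ n • ψ - χ) fun f => by
    have : β (ψ f) = D f := hψ f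
    rw [LinearMap.sub_apply, LinearMap.smul_apply, map_sub, smul_eq_mul, map_mul, this]
    exact sub_eq_zero.mpr (hED f).symm
  refine ⟨N + n, ?_⟩
  rw [← map_smul, hX.cl2_eq_zero]
  rw [smul_sub, sub_eq_zero, smul_smul, ← pow_add] at hN
  rw [hN]
  exact ⟨g ^ N • E, fun f => rfl⟩

theorem T2.coeff_surj (hι : FinPres ι) (hβ : IsAway β g) (hφ : β.comp φ = φ') (y : T2 ι φ') :
    ∃ (n : ℕ) (x : T2 ι φ), T2.coeff ι β hφ x = β (g ^ n) • y := by
  obtain ⟨X, m, θ, hX, hθ, hκ, _, _, -, _⟩ := hι.exists_pres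
  obtain ⟨ψ, rfl⟩ := hX.cl2_surjective y
  have hσ : β.comp (φ.comp X.q) = φ'.comp X.q := by rw [← RingHom.comp_assoc, hφ]
  obtain ⟨n, χ, hχ⟩ := hβ.hom_surj hσ ψ
  refine ⟨n, X.cl2 φ χ, ?_⟩
  rw [X.cl2_coeff β hφ hσ, ← map_smul]
  exact congrArg _ (LinearMap.ext hχ)

theorem T0.coeff_inj (hι : FinPres ι) (hβ : IsAway β g) (x : T0 ι φ)
    (hx : ∀ a, β (x.1 a) = 0) : ∃ n : ℕ, g ^ n • x = 0 := by
  obtain ⟨X, m, θ, hX, hθ, hκ, -, -, -, -⟩ := hι.exists_pres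
  obtain ⟨n, hn⟩ := hβ.ker_finset (Finset.univ : Finset (Fin m))
    (fun i => x.1 (X.q (θ (MvPolynomial.X i)))) fun i _ => hx _
  refine ⟨n, Subtype.ext (funext fun a => ?_)⟩
  obtain ⟨p, rfl⟩ := X.surj a
  have hcomp : ∀ {D : R → B}, D ∈ T0 ι φ →
      IsDer (θ.comp MvPolynomial.C) (φ.comp X.q) fun p => D (X.q p) := fun {D} hD =>
    ⟨fun a b => by rw [map_add, IsDer.map_add hD], fun a b => by
      rw [map_mul, IsDer.map_mul hD]; rfl, fun c => by
      rw [hκ, ← RingHom.comp_apply, X.comm, IsDer.map_base hD]⟩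
  exact congrFun (hθ.der_ext (hcomp (g ^ n • x).2) (hcomp (zero_mem _))
    fun t => hn t (Finset.mem_univ t)) p

theorem T0.coeff_surj (hι : FinPres ι) (hβ : IsAway β g) (hφ : β.comp φ = φ') (y : T0 ι φ') :
    ∃ (n : ℕ) (x : T0 ι φ), ∀ a, β (x.1 a) = β (g ^ n) * y.1 a := by
  obtain ⟨X, m, θ, hX, hθ, hκ, -, hI, -, -⟩ := hι.exists_pres
  have hσ : β.comp (φ.comp X.q) = φ'.comp X.q := by rw [← RingHom.comp_assoc, hφ]
  obtain ⟨n, E, hE, hED⟩ := hβ.exists_der hθ hσ (D := fun p => y.1 (X.q p))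
    ⟨fun a b => by rw [map_add, IsDer.map_add y.2], fun a b => by
      rw [map_mul, IsDer.map_mul y.2]; rfl, fun c => by
      rw [hκ, ← RingHom.comp_apply, X.comm, IsDer.map_base y.2]⟩
  let χ : X.N1 φ :=
    { toFun := fun f => E f
      map_add' := fun f f' => hE.map_add _ _
      map_smul' := fun p f => by
        have := hE.map_mul p f
        rwa [show (φ.comp X.q) f = 0 by rw [RingHom.comp_apply, (X.mem_I _).mp f.2, map_zero],
          zero_mul, add_zero] at this }
  have h0 : y.1 0 = 0 := by
    have := IsDer.map_base y.2 0
    rwa [map_zero] at this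
  obtain ⟨N, hN⟩ := hβ.hom_inj χ fun f => (hED f).trans (by
    rw [(X.mem_I _).mp f.2, h0, mul_zero])
  have hc : ∀ p p', X.q p = X.q p' → g ^ N * E p = g ^ N * E p' := fun p p' hp => by
    have h1 := DFunLike.congr_fun hN ⟨p - p', by rw [X.mem_I, map_sub, hp, sub_self]⟩
    have h2 := hE.map_add (p - p') p'
    rw [sub_add_cancel] at h2
    rw [h2, mul_add]
    exact add_eq_right.mpr h1
  let s := Function.surjInv X.surj
  have hs : ∀ a, X.q (s a) = a := Function.surjInv_eq X.surj
  refine ⟨N + n, ⟨fun a => g ^ N * E (s a), ⟨fun a b => ?_, fun a b => ?_, fun c => ?_⟩⟩,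
    fun a => ?_⟩
  · rw [hc (s (a + b)) (s a + s b) (by rw [hs, map_add, hs, hs]), hE.map_add, mul_add]
  · rw [hc (s (a * b)) (s a * s b) (by rw [hs, map_mul, hs, hs]), hE.map_mul, RingHom.comp_apply,
      RingHom.comp_apply, hs, hs]; ring
  · rw [hc (s (ι c)) (X.κ c) (by rw [hs, ← RingHom.comp_apply, X.comm]), ← hκ, hE.map_base,
      mul_zero]
  · change β (g ^ N * E (s a)) = _
    rw [map_mul, hED, hs, pow_add, map_mul, mul_assoc]

end FinPres

end
end QLSing

namespace QLSing
noncomputable section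

/-! ### Open immersions of affine schemes -/

section Local

theorem bijective_of_span_eq_top {B M N : Type} [CommRing B] [AddCommGroup M] [Module B M]
    [AddCommGroup N] [Module B N] (F : M →ₗ[B] N) {S : Set B} (hS : Ideal.span S = ⊤)
    (hinj : ∀ g ∈ S, ∀ x, F x = 0 → ∃ n : ℕ, g ^ n • x = 0)
    (hsurj : ∀ g ∈ S, ∀ y, ∃ (n : ℕ) (x : M), F x = g ^ n • y) : Function.Bijective F := by
  have key : ∀ J : Ideal B, (∀ g ∈ S, ∃ n : ℕ, g ^ n ∈ J) → (1 : B) ∈ J := fun J hJ => by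
    by_contra h
    obtain ⟨m, hm, hJm⟩ := Ideal.exists_le_maximal J ((Ideal.ne_top_iff_one J).mpr h)
    refine hm.ne_top (top_le_iff.mp (hS ▸ Ideal.span_le.mpr fun g hg => ?_))
    obtain ⟨n, hn⟩ := hJ g hg
    exact hm.isPrime.mem_of_pow_mem n (hJm hn)
  constructor
  · refine (injective_iff_map_eq_zero F).mpr fun x hx => ?_
    have := key (LinearMap.ker (LinearMap.toSpanSingleton B M x)) fun g hg => hinj g hg x hx
    simpa using this
  · intro y
    have := key ((LinearMap.range F).comap (LinearMap.toSpanSingleton B N y)) fun g hg => by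
      obtain ⟨n, x, hx⟩ := hsurj g hg y
      exact ⟨n, x, hx⟩
    simpa using this

variable {B B' M N M' N' : Type} [CommRing B] [CommRing B'] [AddCommGroup M] [Module B M]
  [AddCommGroup N] [Module B N] [AddCommGroup M'] [Module B' M'] [AddCommGroup N'] [Module B' N']

theorem away_inj {β : B →+* B'} {g : B} (F : M →ₗ[B] N) (F' : M' →ₗ[B'] N') (cM : M →ₛₗ[β] M')
    (cN : N →ₛₗ[β] N') (h : ∀ x, cN (F x) = F' (cM x)) (hF' : Function.Injective F')
    (hM : ∀ x, cM x = 0 → ∃ n : ℕ, g ^ n • x = 0) (x : M) (hx : F x = 0) :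
    ∃ n : ℕ, g ^ n • x = 0 :=
  hM x <| hF' <| by rw [← h, hx, map_zero, map_zero]

theorem away_surj {β : B →+* B'} {g : B} (F : M →ₗ[B] N) (F' : M' →ₗ[B'] N') (cM : M →ₛₗ[β] M')
    (cN : N →ₛₗ[β] N') (h : ∀ x, cN (F x) = F' (cM x)) (hF' : Function.Surjective F')
    (hM : ∀ y, ∃ (n : ℕ) (x : M), cM x = β (g ^ n) • y)
    (hN : ∀ x, cN x = 0 → ∃ n : ℕ, g ^ n • x = 0) (y : N) :
    ∃ (n : ℕ) (x : M), F x = g ^ n • y := by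
  obtain ⟨z, hz⟩ := hF' (cN y)
  obtain ⟨n, x, hx⟩ := hM z
  obtain ⟨m, hm⟩ := hN (g ^ n • y - F x) (by
    rw [map_sub, LinearMap.map_smulₛₗ, h, hx, map_smul, hz, sub_self])
  refine ⟨m + n, g ^ m • x, ?_⟩
  rw [smul_sub, sub_eq_zero] at hm
  rw [map_smul, ← hm, smul_smul, pow_add]

end Local

section PullCover

variable {k R R' R'' B B' : Type} [CommRing k] [CommRing R] [CommRing R'] [CommRing R'']
  [CommRing B] [CommRing B'] {ι : k →+* R} {ι' : k →+* R'} {ι'' : k →+* R''}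
  {ρ : R →+* R'} {ρ' : R' →+* R''} {ρ'' : R →+* R''}
  {φ : R →+* B} {φ' : R' →+* B} {φ'' : R'' →+* B}

/-- `T⁰(R/k; B) → T⁰(R/k; B')`. -/
def T0.coeff (ι : k →+* R) {φ : R →+* B} {φ' : R →+* B'} (β : B →+* B') (h : β.comp φ = φ') :
    T0 ι φ →ₛₗ[β] T0 ι φ' where
  toFun D := ⟨fun a => β (D.1 a), T0_comp h D.2⟩
  map_add' _ _ := Subtype.ext (funext fun _ => map_add β _ _)
  map_smul' _ _ := Subtype.ext (funext fun _ => map_mul β _ _)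

/-- `T⁰(R'/k; B) → T⁰(R/k; B)` for a homomorphism `ρ : R → R'` of `k`-algebras. -/
def T0.pull (hρ : ρ.comp ι = ι') (h : φ'.comp ρ = φ) : T0 ι' φ' →ₗ[B] T0 ι φ where
  toFun D := ⟨fun a => D.1 (ρ a), ⟨fun a b => by rw [map_add, IsDer.map_add D.2],
    fun a b => by rw [map_mul, IsDer.map_mul D.2, ← h]; rfl,
    fun c => by rw [← RingHom.comp_apply, hρ, IsDer.map_base D.2]⟩⟩
  map_add' D E := rfl
  map_smul' b D := rfl

theorem T0.pull_bijective (hi : IsLoc ρ) (hρ : ρ.comp ι = ι') (h : φ'.comp ρ = φ) :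
    Function.Bijective (T0.pull hρ h) := by
  have hφ : ∀ a, φ' (ρ a) = φ a := fun a => DFunLike.congr_fun h a
  have hu : ∀ {s}, IsUnit (ρ s) → IsUnit (φ s) := fun {s} hs => by rw [← hφ]; exact hs.map φ'
  constructor
  · refine fun D E hDE => Subtype.ext (der_ext ρ h D.2 E.2 (fun z => ?_)
      fun p => congrFun (congrArg Subtype.val hDE) p)
    obtain ⟨s, p, hs, hp⟩ := hi.surj z
    exact ⟨s, p, (hu hs).mem_nonZeroDivisors, hp⟩
  · intro D
    suffices H : ∃ E, IsDer ι' φ' E ∧ ∀ p, E (ρ p) = D.1 p by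
      obtain ⟨E, hE, hED⟩ := H
      exact ⟨⟨E, hE⟩, Subtype.ext (funext hED)⟩
    refine exists_der_extension ρ hρ φ' h D.2 (fun p hp => ?_) fun z => ?_
    · obtain ⟨s, hs, hsp⟩ := hi.ker p hp
      have h1 := IsDer.map_mul D.2 s p
      have h0 := IsDer.map_base D.2 0
      rw [map_zero] at h0
      rw [hsp, h0, ← hφ p, hp, map_zero, zero_mul, add_zero] at h1
      exact (hu hs).mul_left_cancel (by rw [← h1, mul_zero])
    · obtain ⟨s, p, hs, hp⟩ := hi.surj z
      obtain ⟨c, hc⟩ := (hu hs).exists_right_inv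
      exact ⟨s, p, c * (D.1 p - φ' z * D.1 s), (hu hs).mem_nonZeroDivisors, hp, by
        rw [← mul_assoc, hc, one_mul]⟩

theorem T1.coeff_pull {β : B →+* B'} {ψ : R →+* B'} {ψ' : R' →+* B'} (hρ : ρ.comp ι = ι')
    (h : φ'.comp ρ = φ) (h' : ψ'.comp ρ = ψ) (e : β.comp φ = ψ) (e' : β.comp φ' = ψ')
    (t : T1 ι' φ') :
    T1.coeff ι β e (T1.pull hρ h t) = T1.pull hρ h' (T1.coeff ι' β e' t) := by
  obtain ⟨x, rfl⟩ := Submodule.Quotient.mk_surjective _ t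
  rfl

theorem T2.coeff_pull {β : B →+* B'} {ψ : R →+* B'} {ψ' : R' →+* B'} (hρ : ρ.comp ι = ι')
    (h : φ'.comp ρ = φ) (h' : ψ'.comp ρ = ψ) (e : β.comp φ = ψ) (e' : β.comp φ' = ψ')
    (t : T2 ι' φ') :
    T2.coeff ι β e (T2.pull hρ h t) = T2.pull hρ h' (T2.coeff ι' β e' t) := by
  obtain ⟨x, rfl⟩ := Submodule.Quotient.mk_surjective _ t
  rfl

theorem T1.pull_pull (hρ : ρ.comp ι = ι') (hρ' : ρ'.comp ι' = ι'') (hρ'' : ρ''.comp ι = ι'')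
    (e : ρ'.comp ρ = ρ'') (h : φ'.comp ρ = φ) (h' : φ''.comp ρ' = φ') (h'' : φ''.comp ρ'' = φ)
    (t : T1 ι'' φ'') : T1.pull hρ h (T1.pull hρ' h' t) = T1.pull hρ'' h'' t := by
  obtain ⟨x, rfl⟩ := canon_good.cl1_surjective t
  rw [(canonLift hρ').cl1_pull, (canonLift hρ).cl1_pull,
    ((canonLift hρ').comp (canonLift hρ) e).cl1_pull]
  rfl

theorem T2.pull_pull (hρ : ρ.comp ι = ι') (hρ' : ρ'.comp ι' = ι'') (hρ'' : ρ''.comp ι = ι'')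
    (e : ρ'.comp ρ = ρ'') (h : φ'.comp ρ = φ) (h' : φ''.comp ρ' = φ') (h'' : φ''.comp ρ'' = φ)
    (t : T2 ι'' φ'') : T2.pull hρ h (T2.pull hρ' h' t) = T2.pull hρ'' h'' t := by
  obtain ⟨x, rfl⟩ := canon_good.cl2_surjective t
  rw [(canonLift hρ').cl2_pull, (canonLift hρ).cl2_pull,
    ((canonLift hρ').comp (canonLift hρ) e).cl2_pull]
  rfl

theorem T1.coeff_coeff {B'' : Type} [CommRing B''] {β : B →+* B'} {β' : B' →+* B''}
    {β'' : B →+* B''} (e : β'.comp β = β'') {ψ : R →+* B} {ψ' : R →+* B'} {ψ'' : R →+* B''}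
    (h : β.comp ψ = ψ') (h' : β'.comp ψ' = ψ'') (h'' : β''.comp ψ = ψ'') (t : T1 ι ψ) :
    T1.coeff ι β' h' (T1.coeff ι β h t) = T1.coeff ι β'' h'' t := by
  subst e
  obtain ⟨x, rfl⟩ := Submodule.Quotient.mk_surjective _ t
  rfl

theorem T2.coeff_coeff {B'' : Type} [CommRing B''] {β : B →+* B'} {β' : B' →+* B''}
    {β'' : B →+* B''} (e : β'.comp β = β'') {ψ : R →+* B} {ψ' : R →+* B'} {ψ'' : R →+* B''}
    (h : β.comp ψ = ψ') (h' : β'.comp ψ' = ψ'') (h'' : β''.comp ψ = ψ'') (t : T2 ι ψ) :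
    T2.coeff ι β' h' (T2.coeff ι β h t) = T2.coeff ι β'' h'' t := by
  subst e
  obtain ⟨x, rfl⟩ := Submodule.Quotient.mk_surjective _ t
  rfl

/-- `Spec R' → Spec R` is an open immersion: `Spec R'` is covered by basic open sets that are
localizations of `R`. -/
def IsOpenLoc (ρ : R →+* R') : Prop :=
  ∃ S : Set R', Ideal.span S = ⊤ ∧ ∀ g ∈ S, ∃ (L : Type) (_ : CommRing L) (β : R' →+* L),
    IsAway β g ∧ IsLoc (β.comp ρ)

variable {σ : R →+* R'}

theorem T0.pull_bijective_of_isOpenLoc (hi : IsOpenLoc ρ) (hρ : ρ.comp ι = ι') (hι : FinPres ι)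
    (hι' : FinPres ι') (h : (RingHom.id R').comp ρ = σ) : Function.Bijective (T0.pull hρ h) := by
  obtain ⟨S, hS, H⟩ := hi
  refine bijective_of_span_eq_top _ hS (fun g hg => ?_) fun g hg => ?_
  all_goals
    obtain ⟨L, _, β, hβ, hL⟩ := H g hg
    have hbij : Function.Bijective (T0.pull (φ' := β.comp (RingHom.id R')) (φ := β.comp σ) hρ
        (by rw [← h]; rfl)) := by
      have h1 := T0.pull_bijective (φ' := RingHom.id L) (φ := β.comp σ) hL
        (ι := ι) rfl (by rw [← h]; rfl)
      have h2 := T0.pull_bijective (φ' := RingHom.id L) (φ := β.comp (RingHom.id R')) hβ.isLoc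
        (ι' := (β.comp ρ).comp ι) (ι := ι') (by rw [← hρ]; rfl) rfl
      exact (Function.Bijective.of_comp_iff _ h2).mp h1
  · exact away_inj (T0.pull hρ h) _ (T0.coeff ι' β rfl) (T0.coeff ι β rfl) (fun x => rfl) hbij.1
      fun x hx => T0.coeff_inj hι' hβ x (congrFun (congrArg Subtype.val hx))
  · exact away_surj (T0.pull hρ h) _ (T0.coeff ι' β rfl) (T0.coeff ι β rfl) (fun x => rfl) hbij.2
      (fun y => by
        obtain ⟨n, x, hx⟩ := T0.coeff_surj hι' hβ rfl y
        exact ⟨n, x, Subtype.ext (funext hx)⟩)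
      fun x hx => T0.coeff_inj hι hβ x (congrFun (congrArg Subtype.val hx))

theorem T1.pull_bijective_of_isOpenLoc (hi : IsOpenLoc ρ) (hρ : ρ.comp ι = ι') (hι : FinPres ι)
    (hι' : FinPres ι') (h : (RingHom.id R').comp ρ = σ) : Function.Bijective (T1.pull hρ h) := by
  obtain ⟨S, hS, H⟩ := hi
  refine bijective_of_span_eq_top _ hS (fun g hg => ?_) fun g hg => ?_
  all_goals
    obtain ⟨L, _, β, hβ, hL⟩ := H g hg
    have e : (β.comp (RingHom.id R')).comp ρ = β.comp σ := by rw [← h]; rfl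
    have hbij : Function.Bijective (T1.pull hρ e) := by
      have h1 := T1.pull_bijective (φ' := RingHom.id L) (φ := β.comp σ) hL
        (ι := ι) rfl (by rw [← h]; rfl)
      have h2 := T1.pull_bijective (φ' := RingHom.id L) (φ := β.comp (RingHom.id R')) hβ.isLoc
        (ι' := (β.comp ρ).comp ι) (ι := ι') (by rw [← hρ]; rfl) rfl
      refine (Function.Bijective.of_comp_iff _ h2).mp ?_
      convert h1 using 1
      exact funext fun t => T1.pull_pull _ _ _ rfl _ _ _ t
  · exact away_inj (T1.pull hρ h) _ (T1.coeff ι' β rfl) (T1.coeff ι β rfl)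
      (T1.coeff_pull hρ h e rfl rfl) hbij.1 (T1.coeff_inj hι' hβ rfl)
  · exact away_surj (T1.pull hρ h) _ (T1.coeff ι' β rfl) (T1.coeff ι β rfl)
      (T1.coeff_pull hρ h e rfl rfl) hbij.2 (T1.coeff_surj hι' hβ rfl) (T1.coeff_inj hι hβ rfl)

theorem T2.pull_bijective_of_isOpenLoc (hi : IsOpenLoc ρ) (hρ : ρ.comp ι = ι') (hι : FinPres ι)
    (hι' : FinPres ι') (h : (RingHom.id R').comp ρ = σ) : Function.Bijective (T2.pull hρ h) := by
  obtain ⟨S, hS, H⟩ := hi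
  refine bijective_of_span_eq_top _ hS (fun g hg => ?_) fun g hg => ?_
  all_goals
    obtain ⟨L, _, β, hβ, hL⟩ := H g hg
    have e : (β.comp (RingHom.id R')).comp ρ = β.comp σ := by rw [← h]; rfl
    have hbij : Function.Bijective (T2.pull hρ e) := by
      have h1 := T2.pull_bijective (φ' := RingHom.id L) (φ := β.comp σ) hL
        (ι := ι) rfl (by rw [← h]; rfl)
      have h2 := T2.pull_bijective (φ' := RingHom.id L) (φ := β.comp (RingHom.id R')) hβ.isLoc
        (ι' := (β.comp ρ).comp ι) (ι := ι') (by rw [← hρ]; rfl) rfl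
      refine (Function.Bijective.of_comp_iff _ h2).mp ?_
      convert h1 using 1
      exact funext fun t => T2.pull_pull _ _ _ rfl _ _ _ t
  · exact away_inj (T2.pull hρ h) _ (T2.coeff ι' β rfl) (T2.coeff ι β rfl)
      (T2.coeff_pull hρ h e rfl rfl) hbij.1 (T2.coeff_inj hι' hβ rfl)
  · exact away_surj (T2.pull hρ h) _ (T2.coeff ι' β rfl) (T2.coeff ι β rfl)
      (T2.coeff_pull hρ h e rfl rfl) hbij.2 (T2.coeff_surj hι' hβ rfl) (T2.coeff_inj hι hβ rfl)

end PullCover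

/-! ### Affine open subsets -/

section Affine

variable {Y : Scheme.{0}}

theorem isAway_of_isLocalization {R L : Type} [CommRing R] [CommRing L] [Algebra R L] (g : R)
    [IsLocalization.Away g L] : IsAway (algebraMap R L) g where
  unit := IsLocalization.Away.algebraMap_isUnit g
  surj z := by
    obtain ⟨n, b, h⟩ := IsLocalization.Away.surj g z
    exact ⟨n, b, by rw [map_pow, mul_comm, h]⟩
  ker b hb := by
    obtain ⟨⟨_, n, rfl⟩, hc⟩ := (IsLocalization.map_eq_zero_iff (Submonoid.powers g) L b).mp hb
    exact ⟨n, hc⟩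

theorem isAway_basicOpen {U : Y.Opens} (hU : IsAffineOpen U) (g : Γ(Y, U)) :
    IsAway (resHom (Y.basicOpen_le g)) g :=
  let := (resHom (Y.basicOpen_le g)).toAlgebra
  have : IsLocalization.Away g Γ(Y, Y.basicOpen g) := hU.isLocalization_basicOpen g
  isAway_of_isLocalization g

theorem isOpenLoc_resHom {U V : Y.Opens} (hU : IsAffineOpen U) (hV : IsAffineOpen V) (h : V ≤ U) :
    IsOpenLoc (resHom h) := by
  refine ⟨{g | ∃ f : Γ(Y, U), Y.basicOpen f = Y.basicOpen g}, ?_, ?_⟩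
  · rw [← hV.iSup_basicOpen_eq_self_iff]
    refine le_antisymm (iSup_le fun g => Y.basicOpen_le _) fun x hx => ?_
    obtain ⟨f, g, e, hxf⟩ := exists_basicOpen_le_affine_inter hU hV x ⟨h hx, hx⟩
    refine Opens.mem_iSup.mpr ⟨⟨g, f, e⟩, e ▸ hxf⟩
  · rintro g ⟨f, e⟩
    refine ⟨Γ(Y, Y.basicOpen g), inferInstance, resHom (Y.basicOpen_le g), isAway_basicOpen hV g, ?_⟩
    rw [resHom_comp]
    have h2 := (isAway_basicOpen hU f).isLoc
    have : ∀ (W : Y.Opens) (hW : W ≤ U), Y.basicOpen f = W → IsLoc (resHom hW) := by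
      rintro W hW rfl; exact h2
    exact this _ _ e

end Affine

end
end QLSing

namespace QLSing
noncomputable section

/-! ### Sections of sheaves of modules -/

section Sections

variable {Y : Scheme.{0}} {M N K : Y.Modules}

/-- Restriction of sections of a sheaf of modules. -/
def mres (M : Y.Modules) {U V : Y.Opens} (h : V ≤ U) : Γ(M, U) →+ Γ(M, V) :=
  (M.presheaf.map (homOfLE h).op).hom

theorem mres_smul {U V : Y.Opens} (h : V ≤ U) (r : Γ(Y, U)) (x : Γ(M, U)) :
    mres M h (r • x) = resHom h r • mres M h x :=
  Scheme.Modules.map_smul M _ _ _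

theorem mres_mres {U V W : Y.Opens} (h : V ≤ U) (h' : W ≤ V) (x : Γ(M, U)) :
    mres M h' (mres M h x) = mres M (h'.trans h) x := by
  have : M.presheaf.map (homOfLE (h'.trans h)).op =
    M.presheaf.map (homOfLE h).op ≫ M.presheaf.map (homOfLE h').op := by
    rw [← Functor.map_comp]; rfl
  exact (DFunLike.congr_fun (congrArg AddCommGrpCat.Hom.hom this) x).symm

theorem mres_self {U : Y.Opens} (h : U ≤ U) (x : Γ(M, U)) : mres M h x = x := by
  have : M.presheaf.map (homOfLE h).op = 𝟙 _ := M.presheaf.map_id _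
  exact DFunLike.congr_fun (congrArg AddCommGrpCat.Hom.hom this) x

theorem app_mres (f : M ⟶ N) {U V : Y.Opens} (h : V ≤ U) (x : Γ(M, U)) :
    f.app V (mres M h x) = mres N h (f.app U x) :=
  DFunLike.congr_fun (congrArg AddCommGrpCat.Hom.hom (f.mapPresheaf.naturality (homOfLE h).op)) x

theorem sec_ext {U : Y.Opens} {s t : Γ(M, U)}
    (h : ∀ x ∈ U, ∃ (V : Y.Opens) (hV : V ≤ U), x ∈ V ∧ mres M hV s = mres M hV t) : s = t := by
  choose V hV hx e using h
  refine TopCat.Sheaf.eq_of_locally_eq' ⟨M.presheaf, M.isSheaf⟩ (fun x : U => V x.1 x.2) U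
    (fun x => homOfLE (hV x.1 x.2)) (fun x hxU => ?_) s t fun x => e x.1 x.2
  exact Opens.mem_iSup.mpr ⟨⟨x, hxU⟩, hx x hxU⟩

theorem sec_glue {U : Y.Opens} {ι : Type} (V : ι → Y.Opens) (hV : ∀ i, V i ≤ U)
    (hU : ∀ x ∈ U, ∃ i, x ∈ V i) (s : ∀ i, Γ(M, V i))
    (h : ∀ i j, mres M (U := V i) (V := V i ⊓ V j) inf_le_left (s i) =
      mres M (U := V j) (V := V i ⊓ V j) inf_le_right (s j)) :
    ∃ t : Γ(M, U), ∀ i, mres M (hV i) t = s i := by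
  obtain ⟨t, ht, -⟩ := TopCat.Sheaf.existsUnique_gluing' ⟨M.presheaf, M.isSheaf⟩ V U
    (fun i => homOfLE (hV i)) (fun x hx => by
      obtain ⟨i, hi⟩ := hU x hx
      exact Opens.mem_iSup.mpr ⟨i, hi⟩) s fun i j => h i j
  exact ⟨t, ht⟩

/-- A morphism of sheaves of modules from maps of sections. -/
def mkHom (f : ∀ U : Y.Opens, Γ(M, U) →ₗ[Γ(Y, U)] Γ(N, U))
    (hf : ∀ {U V : Y.Opens} (h : V ≤ U) x, f V (mres M h x) = mres N h (f U x)) : M ⟶ N where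
  val :=
    { app := fun U => ModuleCat.ofHom (X := M.val.obj U) (Y := N.val.obj U)
        { toFun := fun x => f U.unop x
          map_add' := (f U.unop).map_add
          map_smul' := (f U.unop).map_smul }
      naturality := fun {U V} i => by
        ext x
        exact hf (leOfHom i.unop) x }

theorem exists_hom (R : ∀ U : Y.Opens, Γ(M, U) → Γ(N, U) → Prop)
    (hadd : ∀ {U m m' n n'}, R U m n → R U m' n' → R U (m + m') (n + n'))
    (hsmul : ∀ {U m n} (r : Γ(Y, U)), R U m n → R U (r • m) (r • n))
    (hres : ∀ {U V m n} (h : V ≤ U), R U m n → R V (mres M h m) (mres N h n))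
    (hfun : ∀ {U n}, R U 0 n → n = 0)
    (htot : ∀ U (m : Γ(M, U)), ∀ x ∈ U, ∃ (V : Y.Opens) (h : V ≤ U), x ∈ V ∧
      ∃ n, R V (mres M h m) n) :
    ∃ f : M ⟶ N, ∀ U m n, R U m n → f.app U m = n := by
  have huniq : ∀ {U m n n'}, R U m n → R U m n' → n = n' := fun {U m n n'} h h' => by
    have := hadd h (hsmul (-1) h')
    rw [neg_one_smul, neg_one_smul, add_neg_cancel] at this
    exact eq_of_sub_eq_zero (by rw [sub_eq_add_neg]; exact hfun this)
  let R' : ∀ U : Y.Opens, Γ(M, U) → Γ(N, U) → Prop := fun U m n =>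
    ∀ x ∈ U, ∃ (V : Y.Opens) (h : V ≤ U), x ∈ V ∧ R V (mres M h m) (mres N h n)
  have hR' : ∀ {U m n}, R U m n → R' U m n := fun {U m n} h x hx =>
    ⟨U, le_rfl, hx, hres le_rfl h⟩
  have huniq' : ∀ {U m n n'}, R' U m n → R' U m n' → n = n' := fun {U m n n'} h h' =>
    sec_ext fun x hx => by
      obtain ⟨V, hV, hxV, hr⟩ := h x hx
      obtain ⟨V', hV', hxV', hr'⟩ := h' x hx
      refine ⟨V ⊓ V', inf_le_left.trans hV, ⟨hxV, hxV'⟩,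
        huniq (m := mres M (inf_le_left.trans hV) m) ?_ ?_⟩
      · have := hres (inf_le_left : V ⊓ V' ≤ V) hr
        rwa [mres_mres, mres_mres] at this
      · have := hres (inf_le_right : V ⊓ V' ≤ V') hr'
        rwa [mres_mres, mres_mres] at this
  have hex : ∀ U m, ∃ n, R' U m n := fun U m => by
    choose V hV hx n hn using htot U m
    obtain ⟨t, ht⟩ := sec_glue (M := N) (fun x : U => V x.1 x.2) (fun x => hV x.1 x.2)
      (fun x hxU => ⟨⟨x, hxU⟩, hx x hxU⟩) (fun x => n x.1 x.2) fun x y => by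
        have h1 := hres (inf_le_left : V x.1 x.2 ⊓ V y.1 y.2 ≤ _) (hn x.1 x.2)
        have h2 := hres (inf_le_right : V x.1 x.2 ⊓ V y.1 y.2 ≤ _) (hn y.1 y.2)
        rw [mres_mres] at h1 h2
        exact huniq h1 h2
    exact ⟨t, fun x hxU => ⟨V x hxU, hV x hxU, hx x hxU, by
      rw [ht ⟨x, hxU⟩]; exact hn x hxU⟩⟩
  choose F hF using hex
  refine ⟨mkHom (fun U => ⟨⟨F U, fun m m' => huniq' (hF U _) fun x hx => ?_⟩,
    fun r m => huniq' (hF U _) fun x hx => ?_⟩) fun {U V} h m => huniq' (hF V _) fun x hx => ?_,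
    fun U m n h => huniq' (hF U m) (hR' h)⟩
  · obtain ⟨V, hV, hxV, hr⟩ := hF U m x hx
    obtain ⟨V', hV', hxV', hr'⟩ := hF U m' x hx
    refine ⟨V ⊓ V', inf_le_left.trans hV, ⟨hxV, hxV'⟩, ?_⟩
    have h1 := hres (inf_le_left : V ⊓ V' ≤ V) hr
    have h2 := hres (inf_le_right : V ⊓ V' ≤ V') hr'
    rw [mres_mres, mres_mres] at h1 h2
    rw [map_add, map_add]
    exact hadd h1 h2
  · obtain ⟨V, hV, hxV, hr⟩ := hF U m x hx
    refine ⟨V, hV, hxV, ?_⟩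
    change R V _ (mres N hV (r • F U m))
    rw [mres_smul, mres_smul]
    exact hsmul _ hr
  · obtain ⟨V', hV', hxV', hr⟩ := hF U m x (h hx)
    refine ⟨V ⊓ V', inf_le_left, ⟨hx, hxV'⟩, ?_⟩
    have h1 := hres (inf_le_right : V ⊓ V' ≤ V') hr
    rw [mres_mres, mres_mres] at h1
    rw [mres_mres]
    change R _ _ (mres N _ (mres N h (F U m)))
    rw [mres_mres]
    exact h1

/-- Every section of `N` is locally in the image of `f`. -/
def LocSurj (f : M ⟶ N) : Prop :=
  ∀ (U : Y.Opens) (n : Γ(N, U)), ∀ x ∈ U, ∃ (V : Y.Opens) (h : V ≤ U), x ∈ V ∧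
    ∃ m, f.app V m = mres N h n

/-- `f` is injective on sections. -/
def SecInj (f : M ⟶ N) : Prop := ∀ (U : Y.Opens) (m : Γ(M, U)), f.app U m = 0 → m = 0

theorem hom_ext_sec {f g : M ⟶ N} (h : ∀ U (m : Γ(M, U)), f.app U m = g.app U m) : f = g := by
  refine Scheme.Modules.hom_ext f g fun U => ?_
  ext m
  exact h U m

theorem SecInj.mono {f : M ⟶ N} (h : SecInj f) : Mono f where
  right_cancellation {Z} g k e := hom_ext_sec fun U z => by
    refine eq_of_sub_eq_zero (h U _ ?_)
    rw [map_sub, sub_eq_zero]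
    exact DFunLike.congr_fun (congrArg AddCommGrpCat.Hom.hom (congrArg (fun t => t.app U) e)) z

theorem LocSurj.epi {f : M ⟶ N} (h : LocSurj f) : Epi f where
  left_cancellation {Z} g k e := hom_ext_sec fun U n => sec_ext fun x hx => by
    obtain ⟨V, hV, hxV, m, hm⟩ := h U n x hx
    refine ⟨V, hV, hxV, ?_⟩
    rw [← app_mres, ← app_mres, ← hm]
    exact DFunLike.congr_fun (congrArg AddCommGrpCat.Hom.hom (congrArg (fun t => t.app V) e)) m

theorem SecInj.eq {f : M ⟶ N} (h : SecInj f) {U : Y.Opens} {m m' : Γ(M, U)}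
    (e : f.app U m = f.app U m') : m = m' :=
  eq_of_sub_eq_zero (h U _ (by rw [map_sub, e, sub_self]))

theorem SecInj.exists_lift {i : M ⟶ N} (h : SecInj i) (g : K ⟶ N)
    (hg : ∀ (U : Y.Opens) (k : Γ(K, U)), ∀ x ∈ U, ∃ (V : Y.Opens) (hV : V ≤ U), x ∈ V ∧
      ∃ m, i.app V m = mres N hV (g.app U k)) : ∃ l : K ⟶ M, l ≫ i = g := by
  obtain ⟨l, hl⟩ := exists_hom (M := K) (N := M) (fun U k m => i.app U m = g.app U k)
    (fun {U m m' n n'} e e' => by rw [map_add, map_add, e, e'])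
    (fun {U m n} r e => by rw [Scheme.Modules.Hom.app_smul, Scheme.Modules.Hom.app_smul, e])
    (fun {U V m n} hV e => by rw [app_mres, app_mres, e])
    (fun {U n} e => h U n (by rw [e, map_zero]))
    (fun U k x hx => by
      obtain ⟨V, hV, hxV, m, hm⟩ := hg U k x hx
      exact ⟨V, hV, hxV, m, by rw [hm, app_mres]⟩)
  refine ⟨l, hom_ext_sec fun U k => sec_ext fun x hx => ?_⟩
  obtain ⟨V, hV, hxV, m, hm⟩ := hg U k x hx
  refine ⟨V, hV, hxV, ?_⟩
  have h1 := hl V (mres K hV k) m (by rw [hm, app_mres])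
  change mres N hV (i.app U (l.app U k)) = _
  rw [← app_mres, ← app_mres, h1, hm]

theorem isIso_of_sec {f : M ⟶ N} (hi : SecInj f) (hs : LocSurj f) : IsIso f := by
  obtain ⟨l, hl⟩ := hi.exists_lift (𝟙 N) fun U n x hx => hs U n x hx
  have := hi.mono
  exact ⟨l, by rw [← cancel_mono f, Category.assoc, hl, Category.comp_id, Category.id_comp], hl⟩

theorem shortExact_of_sec {f : M ⟶ N} {g : N ⟶ K} (w : f ≫ g = 0) (hi : SecInj f) (hs : LocSurj g)
    (he : ∀ (U : Y.Opens) (n : Γ(N, U)), g.app U n = 0 → ∀ x ∈ U,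
      ∃ (V : Y.Opens) (h : V ≤ U), x ∈ V ∧ ∃ m, f.app V m = mres N h n) :
    (ShortComplex.mk f g w).ShortExact := by
  have hf := hi.mono
  have hg := hs.epi
  have H : ∀ {Z : Y.Modules} (k : Z ⟶ N) (_ : k ≫ g = 0), ∃ l : Z ⟶ M, l ≫ f = k := fun {Z} k hk =>
    hi.exists_lift k fun U z => he U _
      (DFunLike.congr_fun (congrArg AddCommGrpCat.Hom.hom (congrArg (fun t => t.app U) hk)) z)
  exact
    { exact := ShortComplex.exact_of_f_is_kernel _ (Limits.KernelFork.IsLimit.ofι f w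
        (fun k hk => (H k hk).choose) (fun k hk => (H k hk).choose_spec)
        (fun k hk l hl => by
          rw [← cancel_mono f]
          exact hl.trans (H k hk).choose_spec.symm))
      mono_f := hf
      epi_g := hg }

end Sections

/-! ### Sheafification -/

section Sheafify

variable {Y : Scheme.{0}} (F : Y.PresheafOfModules)

/-- Restriction of sections of a presheaf of modules. -/
def pres (F : Y.PresheafOfModules) {U V : Y.Opens} (h : V ≤ U) :
    F.obj (.op U) →+ F.obj (.op V) :=
  (F.presheaf.map (homOfLE h).op).hom

/-- The map from the sections of a presheaf to the sections of the associated sheaf. -/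
def toSh (U : Y.Opens) : F.obj (.op U) →+ Γ((sheafify Y).obj F, U) :=
  ((CategoryTheory.toSheafify (Opens.grothendieckTopology Y) F.presheaf).app (.op U)).hom

theorem toSh_smul (U : Y.Opens) (r : Y.ringCatSheaf.obj.obj (.op U)) (s : F.obj (.op U)) :
    toSh F U (r • s) = (show Γ(Y, U) from r) • toSh F U s :=
  (((PresheafOfModules.sheafificationAdjunction (𝟙 Y.ringCatSheaf.obj)).unit.app F).app
    (.op U)).hom.map_smul r s

theorem toSh_res {U V : Y.Opens} (h : V ≤ U) (s : F.obj (.op U)) :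
    toSh F V (pres F h s) = mres _ h (toSh F U s) :=
  DFunLike.congr_fun (congrArg AddCommGrpCat.Hom.hom ((CategoryTheory.toSheafify
    (Opens.grothendieckTopology Y) F.presheaf).naturality (homOfLE h).op)) s

theorem toSh_map {F G : Y.PresheafOfModules} (f : F ⟶ G) (U : Y.Opens) (s : F.obj (.op U)) :
    ((sheafify Y).map f).app U (toSh F U s) = toSh G U (f.app (.op U) s) := by
  have := (PresheafOfModules.sheafificationAdjunction (𝟙 Y.ringCatSheaf.obj)).unit.naturality f
  have h := congrArg (fun t => (PresheafOfModules.toPresheaf _).map t) this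
  exact (DFunLike.congr_fun (congrArg AddCommGrpCat.Hom.hom (congr_app h (.op U))) s).symm

theorem toSh_inj {U : Y.Opens} (s : F.obj (.op U)) (h : toSh F U s = 0) :
    ∀ x ∈ U, ∃ (V : Y.Opens) (hV : V ≤ U), x ∈ V ∧ pres F hV s = 0 := by
  have := Presheaf.equalizerSieve_mem (Opens.grothendieckTopology Y)
    (CategoryTheory.toSheafify (Opens.grothendieckTopology Y) F.presheaf) (X := .op U) s 0
    (h.trans (map_zero (toSh F U)).symm)
  intro x hx
  obtain ⟨V, i, hi, hxV⟩ := this x hx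
  exact ⟨V, leOfHom i, hxV, hi.trans (map_zero (pres F (leOfHom i)))⟩

theorem toSh_surj {U : Y.Opens} (z : Γ((sheafify Y).obj F, U)) :
    ∀ x ∈ U, ∃ (V : Y.Opens) (hV : V ≤ U), x ∈ V ∧ ∃ s, toSh F V s = mres _ hV z := by
  have := Presheaf.imageSieve_mem (Opens.grothendieckTopology Y)
    (CategoryTheory.toSheafify (Opens.grothendieckTopology Y) F.presheaf) (U := .op U) z
  intro x hx
  obtain ⟨V, i, ⟨s, hs⟩, hxV⟩ := this x hx
  exact ⟨V, leOfHom i, hxV, s, hs⟩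

/-- The morphism from the associated sheaf of a presheaf `F` to a sheaf. -/
theorem exists_hom_sheafify (N : Y.Modules) (f : ∀ U : Y.Opens, F.obj (.op U) →+ Γ(N, U))
    (hf : ∀ (U : Y.Opens) (r : Y.ringCatSheaf.obj.obj (.op U)) s,
      f U (r • s) = (show Γ(Y, U) from r) • f U s)
    (hres : ∀ {U V : Y.Opens} (h : V ≤ U) s, f V (pres F h s) = mres N h (f U s)) :
    ∃ g : (sheafify Y).obj F ⟶ N, ∀ U s, g.app U (toSh F U s) = f U s := by
  obtain ⟨g, hg⟩ := exists_hom (M := (sheafify Y).obj F) (N := N)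
    (fun U m n => ∃ s, toSh F U s = m ∧ f U s = n)
    (by rintro U _ _ _ _ ⟨s, rfl, rfl⟩ ⟨t, rfl, rfl⟩; exact ⟨s + t, map_add _ _ _, map_add _ _ _⟩)
    (by
      rintro U _ _ r ⟨s, rfl, rfl⟩
      exact ⟨(show Y.ringCatSheaf.obj.obj (.op U) from r) • s, toSh_smul F U _ _, hf U _ _⟩)
    (by rintro U V _ _ h ⟨s, rfl, rfl⟩; exact ⟨pres F h s, toSh_res F h s, hres h s⟩)
    (by
      rintro U _ ⟨s, hs, rfl⟩
      refine sec_ext fun x hx => ?_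
      obtain ⟨V, hV, hxV, h0⟩ := toSh_inj F s hs x hx
      exact ⟨V, hV, hxV, by rw [← hres, h0, map_zero, map_zero]⟩)
    (fun U m x hx => by
      obtain ⟨V, hV, hxV, s, hs⟩ := toSh_surj F m x hx
      exact ⟨V, hV, hxV, f V s, s, hs, rfl⟩)
  exact ⟨g, fun U s => hg U _ _ ⟨s, rfl, rfl⟩⟩

variable {M N : Y.Modules}

theorem exists_sub_incl (S : PresheafOfModules.Submodule M.val) :
    ∃ i : (sheafify Y).obj S.toPresheafOfModules ⟶ M,
      (∀ U s, i.app U (toSh S.toPresheafOfModules U s) = s.1) ∧ SecInj i ∧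
      ∀ (U : Y.Opens) (z : Γ(M, U)), (∀ x ∈ U, ∃ (V : Y.Opens) (h : V ≤ U), x ∈ V ∧
        mres M h z ∈ S.obj (.op V)) → ∃ y, i.app U y = z := by
  obtain ⟨i, hi⟩ := exists_hom_sheafify S.toPresheafOfModules M
    (fun U => (S.obj (.op U)).subtype.toAddMonoidHom) (fun U r s => rfl) (fun h s => rfl)
  replace hi : ∀ U (s : S.obj (.op U)), i.app U (toSh S.toPresheafOfModules U s) = s.1 := hi
  have hinj : SecInj i := fun U m hm => sec_ext fun x hx => by
    obtain ⟨V, hV, hxV, s, hs⟩ := toSh_surj _ m x hx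
    refine ⟨V, hV, hxV, ?_⟩
    have h1 := hi V s
    rw [hs, app_mres, hm, map_zero] at h1
    have h2 : s = 0 := Subtype.ext h1.symm
    rw [← hs, h2, map_zero, map_zero]
  refine ⟨i, hi, hinj, fun U z hz => ?_⟩
  choose V hV hx hm using hz
  obtain ⟨t, ht⟩ := sec_glue (M := (sheafify Y).obj S.toPresheafOfModules)
    (fun x : U => V x.1 x.2) (fun x => hV x.1 x.2)
    (fun x hxU => ⟨⟨x, hxU⟩, hx x hxU⟩) (fun x => toSh _ _ ⟨_, hm x.1 x.2⟩) fun x y => hinj.eq (by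
      rw [app_mres, app_mres, hi, hi]
      exact (mres_mres _ _ _).trans (mres_mres _ _ _).symm)
  refine ⟨t, sec_ext fun x hxU => ⟨V x hxU, hV x hxU, hx x hxU, ?_⟩⟩
  rw [← app_mres, ht ⟨x, hxU⟩, hi]

/-- The presheaf of sections of `N` that are locally in the image of `f`. -/
def locRange (f : M ⟶ N) : PresheafOfModules.Submodule N.val where
  obj U :=
    { carrier := {n | ∀ x ∈ U.unop, ∃ (V : Y.Opens) (h : V ≤ U.unop), x ∈ V ∧
        ∃ m, f.app V m = mres N h n}
      add_mem' := fun {n n'} hn hn' x hx => by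
        obtain ⟨V, hV, hxV, m, hm⟩ := hn x hx
        obtain ⟨V', hV', hxV', m', hm'⟩ := hn' x hx
        refine ⟨V ⊓ V', inf_le_left.trans hV, ⟨hxV, hxV'⟩,
          mres M inf_le_left m + mres M inf_le_right m', ?_⟩
        rw [map_add, app_mres, app_mres, hm, hm']
        exact (congrArg₂ _ (mres_mres _ _ _) (mres_mres _ _ _)).trans (map_add _ _ _).symm
      zero_mem' := fun x hx => ⟨U.unop, le_rfl, hx, 0, (map_zero _).trans (map_zero _).symm⟩
      smul_mem' := fun r n hn x hx => by
        obtain ⟨V, hV, hxV, m, hm⟩ := hn x hx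
        refine ⟨V, hV, hxV, resHom hV (show Γ(Y, U.unop) from r) • m, ?_⟩
        rw [Scheme.Modules.Hom.app_smul, hm]
        exact (mres_smul hV (show Γ(Y, U.unop) from r) (show Γ(N, U.unop) from n)).symm }
  map {U W} g n hn x hx := by
    obtain ⟨V, hV, hxV, m, hm⟩ := hn x (leOfHom g.unop hx)
    refine ⟨V ⊓ W.unop, inf_le_right, ⟨hxV, hx⟩, mres M inf_le_left m, ?_⟩
    rw [app_mres, hm]
    exact (mres_mres hV inf_le_left (show Γ(N, U.unop) from n)).trans
      (mres_mres (leOfHom g.unop) inf_le_right (show Γ(N, U.unop) from n)).symm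

theorem locSurj_of_epi (f : M ⟶ N) [Epi f] : LocSurj f := by
  obtain ⟨i, hi, hinj, hsurj⟩ := exists_sub_incl (locRange f)
  obtain ⟨l, hl⟩ := hinj.exists_lift f fun U k x hx => by
    obtain ⟨y, hy⟩ := hsurj U (f.app U k) fun x hx => ⟨U, le_rfl, hx,
      fun x hx => ⟨U, le_rfl, hx, k, by rw [mres_self, mres_self]⟩⟩
    exact ⟨U, le_rfl, hx, y, by rw [hy, mres_self]⟩
  have := hinj.mono
  have : Epi (l ≫ i) := by rw [hl]; infer_instance
  have := epi_of_epi l i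
  have := isIso_of_mono_of_epi i
  intro U n x hx
  obtain ⟨y, hy⟩ : ∃ y, i.app U y = n := by
    refine ⟨(inv i).app U n, ?_⟩
    exact DFunLike.congr_fun (congrArg AddCommGrpCat.Hom.hom
      (congrArg (fun t : N ⟶ N => t.app U) (IsIso.inv_hom_id i))) n
  obtain ⟨V, hV, hxV, s, hs⟩ := toSh_surj _ y x hx
  obtain ⟨V', hV', hxV', m, hm⟩ := s.2 x hxV
  refine ⟨V', hV'.trans hV, hxV', m, hm.trans ?_⟩
  have h1 := hi V s
  rw [hs, app_mres, hy] at h1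
  have h2 : s.1 = mres N hV n := h1.symm
  rw [h2]
  exact mres_mres _ _ _

theorem locExact_cokernel (f : M ⟶ N) (U : Y.Opens) (n : Γ(N, U))
    (hn : (Limits.cokernel.π f).app U n = 0) : ∀ x ∈ U, ∃ (V : Y.Opens) (h : V ≤ U), x ∈ V ∧
      ∃ m, f.app V m = mres N h n := by
  let S : PresheafOfModules.Submodule N.val :=
    { obj := fun U => LinearMap.ker ((Limits.cokernel.π f).val.app U).hom
      map := fun {U V} g n hn => by
        have := app_mres (Limits.cokernel.π f) (leOfHom g.unop) n
        exact this.trans ((congrArg (mres (Limits.cokernel f) (leOfHom g.unop))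
          (show (Limits.cokernel.π f).app U.unop n = 0 from hn)).trans (map_zero _)) }
  obtain ⟨i, hi, hinj, hsurj⟩ := exists_sub_incl S
  have hz : i ≫ Limits.cokernel.π f = 0 := hom_ext_sec fun U y => sec_ext fun x hx => by
    obtain ⟨V, hV, hxV, s, hs⟩ := toSh_surj _ y x hx
    refine ⟨V, hV, hxV, ?_⟩
    change mres _ hV ((Limits.cokernel.π f).app U (i.app U y)) = mres _ hV 0
    rw [← app_mres, ← app_mres, ← hs, hi, map_zero]
    exact s.2
  let k : (sheafify Y).obj S.toPresheafOfModules ⟶ Limits.kernel (Limits.cokernel.π f) :=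
    Limits.kernel.lift _ i hz
  have hk : k ≫ Limits.kernel.ι _ = i := Limits.kernel.lift_ι _ _ _
  obtain ⟨y, hy⟩ := hsurj U n fun x hx => ⟨U, le_rfl, hx, by rw [mres_self]; exact hn⟩
  intro x hx
  obtain ⟨V, hV, hxV, m, hm⟩ := locSurj_of_epi (Abelian.factorThruImage f) U (k.app U y) x hx
  refine ⟨V, hV, hxV, m, ?_⟩
  have h1 : (Abelian.image.ι f).app V ((Abelian.factorThruImage f).app V m) = f.app V m :=
    DFunLike.congr_fun (congrArg AddCommGrpCat.Hom.hom
      (congrArg (fun t : M ⟶ N => t.app V) (Abelian.image.fac f))) m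
  rw [← h1, hm, app_mres, ← hy]
  exact congrArg _ (DFunLike.congr_fun (congrArg AddCommGrpCat.Hom.hom
      (congrArg (fun t => Scheme.Modules.Hom.app t U) hk)) y)

end Sheafify

end
end QLSing

namespace QLSing
noncomputable section

/-! ### Sheaves modelled on a base of open sets -/

variable {Y : Scheme.{0}}

/-- The family of open sets is a base, with respect to its order relation. -/
structure IsBase (𝓦 : OpenFamily Y) : Prop where
  cover : ∀ (U : Y.Opens), ∀ x ∈ U, ∃ a, x ∈ 𝓦.opens a ∧ 𝓦.opens a ≤ U
  refine : ∀ a b x, x ∈ 𝓦.opens a → x ∈ 𝓦.opens b → ∀ U : Y.Opens, x ∈ U →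
    ∃ c, 𝓦.le c a ∧ 𝓦.le c b ∧ x ∈ 𝓦.opens c ∧ 𝓦.opens c ≤ U
  trans : ∀ {a b c}, 𝓦.le b a → 𝓦.le c b → 𝓦.le c a

variable {𝓦 : OpenFamily Y}

/-- The relations of the local data are the graphs of maps. -/
structure LocalData.Functional (G : LocalData 𝓦) : Prop where
  res : ∀ {a b} (h : 𝓦.le a b) s, ∃ t, G.compat h s t
  uniq : ∀ {a b} (h : 𝓦.le a b) t, G.compat h 0 t → t = 0
  comp : ∀ {a b c} (h : 𝓦.le b a) (h' : 𝓦.le c b) (h'' : 𝓦.le c a) {s t u}, G.compat h s t →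
    G.compat h' t u → G.compat h'' s u

theorem LocalData.compat_neg {G : LocalData 𝓦} {a b} (h : 𝓦.le a b) {s t} (H : G.compat h s t) :
    G.compat h (-s) (-t) := by
  have := G.compat_smul h (-1) H
  rwa [map_neg, map_one, neg_one_smul, neg_one_smul] at this

theorem LocalData.compat_sub {G : LocalData 𝓦} {a b} (h : 𝓦.le a b) {s t s' t'}
    (H : G.compat h s t) (H' : G.compat h s' t') : G.compat h (s - s') (t - t') := by
  rw [sub_eq_add_neg, sub_eq_add_neg]
  exact G.compat_add h H (G.compat_neg h H')

theorem LocalData.Functional.eq {G : LocalData 𝓦} (hG : G.Functional) {a b} {h : 𝓦.le a b}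
    {s t t'} (H : G.compat h s t) (H' : G.compat h s t') : t = t' := by
  have := G.compat_sub h H H'
  rw [sub_self] at this
  exact eq_of_sub_eq_zero (hG.uniq h _ this)

/-- The sheaf `M` is associated with the local data `G`. -/
structure Model (G : LocalData 𝓦) (M : Y.Modules) where
  func : G.Functional
  η : ∀ a, G.obj a →ₗ[Γ(Y, 𝓦.opens a)] Γ(M, 𝓦.opens a)
  compat : ∀ {a b} (h : 𝓦.le a b) {s t}, G.compat h s t → mres M (𝓦.mono h) (η b s) = η a t
  inj : ∀ a s, η a s = 0 → ∀ x ∈ 𝓦.opens a, ∃ c, ∃ h : 𝓦.le c a, x ∈ 𝓦.opens c ∧ G.compat h s 0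
  surj : ∀ (U : Y.Opens) (z : Γ(M, U)), ∀ x ∈ U, ∃ a, ∃ h : 𝓦.opens a ≤ U, x ∈ 𝓦.opens a ∧
    ∃ t, η a t = mres M h z

section

variable {G G' G'' : LocalData 𝓦} {M M' M'' : Y.Modules} (hB : IsBase 𝓦)
include hB

theorem Model.surj_le (m : Model G M) (a) (z : Γ(M, 𝓦.opens a)) (x) (hx : x ∈ 𝓦.opens a) :
    ∃ c, ∃ h : 𝓦.le c a, x ∈ 𝓦.opens c ∧ ∃ t, m.η c t = mres M (𝓦.mono h) z := by
  obtain ⟨b, hb, hxb, t, ht⟩ := m.surj _ z x hx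
  obtain ⟨c, hca, hcb, hxc, -⟩ := hB.refine a b x hx hxb _ hx
  obtain ⟨t', ht'⟩ := m.func.res hcb t
  exact ⟨c, hca, hxc, t', by rw [← m.compat hcb ht', ht, mres_mres]⟩

theorem Model.exists_hom (m : Model G M) (m' : Model G' M') (φ : LocalData.Hom G G') :
    ∃ f : M ⟶ M', ∀ a s, f.app _ (m.η a s) = m'.η a (φ.app a s) := by
  let R : ∀ U : Y.Opens, Γ(M, U) → Γ(M', U) → Prop := fun U z w => ∀ x ∈ U,
    ∃ a, ∃ h : 𝓦.opens a ≤ U, x ∈ 𝓦.opens a ∧ ∃ s, m.η a s = mres M h z ∧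
      m'.η a (φ.app a s) = mres M' h w
  have shrink : ∀ {a c U} {z : Γ(M, U)} {w : Γ(M', U)} (h : 𝓦.opens a ≤ U) (hc : 𝓦.le c a) {s},
      m.η a s = mres M h z → m'.η a (φ.app a s) = mres M' h w →
      ∃ s', G.compat hc s s' ∧ m.η c s' = mres M ((𝓦.mono hc).trans h) z ∧
        m'.η c (φ.app c s') = mres M' ((𝓦.mono hc).trans h) w := by
    intro a c U z w h hc s e e'
    obtain ⟨s', hs'⟩ := m.func.res hc s
    exact ⟨s', hs', by rw [← m.compat hc hs', e, mres_mres],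
      by rw [← m'.compat hc (φ.compat hc hs'), e', mres_mres]⟩
  obtain ⟨f, hf⟩ := QLSing.exists_hom R
    (fun {U z z' w w'} H H' x hx => by
      obtain ⟨a, ha, hxa, s, e, e'⟩ := H x hx
      obtain ⟨b, hb, hxb, t, d, d'⟩ := H' x hx
      obtain ⟨c, hca, hcb, hxc, -⟩ := hB.refine a b x hxa hxb _ hx
      obtain ⟨s', -, e1, e2⟩ := shrink ha hca e e'
      obtain ⟨t', -, d1, d2⟩ := shrink hb hcb d d'
      exact ⟨c, (𝓦.mono hca).trans ha, hxc, s' + t', by rw [map_add, map_add, e1, d1],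
        by rw [map_add, map_add, map_add, e2, d2]⟩)
    (fun {U z w} r H x hx => by
      obtain ⟨a, ha, hxa, s, e, e'⟩ := H x hx
      exact ⟨a, ha, hxa, resHom ha r • s, by rw [map_smul, e, mres_smul],
        by rw [map_smul, map_smul, e', mres_smul]⟩)
    (fun {U V z w} h H x hx => by
      obtain ⟨a, ha, hxa, s, e, e'⟩ := H x (h hx)
      obtain ⟨c, hca, -, hxc, hcV⟩ := hB.refine a a x hxa hxa V hx
      obtain ⟨s', -, e1, e2⟩ := shrink ha hca e e'
      exact ⟨c, hcV, hxc, s', by rw [e1, mres_mres], by rw [e2, mres_mres]⟩)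
    (fun {U w} H => sec_ext fun x hx => by
      obtain ⟨a, ha, hxa, s, e, e'⟩ := H x hx
      rw [map_zero] at e
      obtain ⟨c, hca, hxc, h0⟩ := m.inj a s e x hxa
      have h1 := φ.compat hca h0
      rw [map_zero] at h1
      have h2 := m'.compat hca h1
      rw [e', mres_mres, map_zero] at h2
      exact ⟨_, _, hxc, by rw [h2, map_zero]⟩)
    (fun U z x hx => by
      obtain ⟨a, ha, hxa, t, ht⟩ := m.surj U z x hx
      exact ⟨_, ha, hxa, m'.η a (φ.app a t), fun x hx => ⟨a, le_rfl, hx, t,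
        by rw [mres_self, ht], by rw [mres_self]⟩⟩)
  exact ⟨f, fun a s => hf _ _ _ fun x hx => ⟨a, le_rfl, hx, s, by rw [mres_self],
    by rw [mres_self]⟩⟩

omit hB in
theorem Model.secInj (m : Model G M) (m' : Model G' M') (φ : LocalData.Hom G G') {f : M ⟶ M'}
    (hf : ∀ a s, f.app _ (m.η a s) = m'.η a (φ.app a s))
    (hφ : ∀ a s, φ.app a s = 0 → m.η a s = 0) : SecInj f := fun U z hz => sec_ext fun x hx => by
  obtain ⟨a, ha, hxa, s, hs⟩ := m.surj U z x hx
  have h1 := hf a s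
  rw [hs, app_mres, hz, map_zero] at h1
  obtain ⟨c, hca, hxc, h0⟩ := m'.inj a _ h1.symm x hxa
  obtain ⟨s', hs'⟩ := m.func.res hca s
  have h2 := m'.func.eq (φ.compat hca hs') h0
  refine ⟨_, (𝓦.mono hca).trans ha, hxc, ?_⟩
  rw [← mres_mres ha (𝓦.mono hca), ← hs, m.compat hca hs', hφ c s' h2, map_zero]

omit hB in
theorem Model.locSurj (m : Model G M) (m' : Model G' M') (φ : LocalData.Hom G G') {f : M ⟶ M'}
    (hf : ∀ a s, f.app _ (m.η a s) = m'.η a (φ.app a s))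
    (hφ : ∀ a t, ∃ s, m'.η a (φ.app a s) = m'.η a t) : LocSurj f := fun U z x hx => by
  obtain ⟨a, ha, hxa, t, ht⟩ := m'.surj U z x hx
  obtain ⟨s, hs⟩ := hφ a t
  exact ⟨_, ha, hxa, m.η a s, by rw [hf, hs, ht]⟩

theorem Model.nonempty_iso (m : Model G M) (m' : Model G' M') (φ : LocalData.Hom G G')
    (hi : ∀ a s, φ.app a s = 0 → m.η a s = 0) (hs : ∀ a t, ∃ s, m'.η a (φ.app a s) = m'.η a t) :
    Nonempty (M ≅ M') := by
  obtain ⟨f, hf⟩ := m.exists_hom hB m' φ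
  have := isIso_of_sec (m.secInj m' φ hf hi) (m.locSurj m' φ hf hs)
  exact ⟨asIso f⟩

theorem Model.exists_shortExact (m : Model G M) (m' : Model G' M') (m'' : Model G'' M'')
    (φ : LocalData.Hom G G') (ψ : LocalData.Hom G' G'') (hi : ∀ a s, φ.app a s = 0 → s = 0)
    (he : ∀ a t, ψ.app a t = 0 ↔ ∃ s, φ.app a s = t) (hs : ∀ a u, ∃ t, ψ.app a t = u) :
    ∃ (f : M ⟶ M') (g : M' ⟶ M'') (w : f ≫ g = 0), (ShortComplex.mk f g w).ShortExact := by
  obtain ⟨f, hf⟩ := m.exists_hom hB m' φ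
  obtain ⟨g, hg⟩ := m'.exists_hom hB m'' ψ
  refine ⟨f, g, ?_, shortExact_of_sec _ (m.secInj m' φ hf fun a s h => by
    rw [hi a s h, map_zero]) (m'.locSurj m'' ψ hg fun a t => ?_) fun U z hz x hx => ?_⟩
  · refine hom_ext_sec fun U z => sec_ext fun x hx => ?_
    obtain ⟨a, ha, hxa, s, hs⟩ := m.surj U z x hx
    refine ⟨_, ha, hxa, ?_⟩
    rw [← app_mres, ← app_mres, ← hs]
    change g.app _ (f.app _ _) = 0
    rw [hf, hg, (he a _).mpr ⟨s, rfl⟩, map_zero]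
  · obtain ⟨s, rfl⟩ := hs a t
    exact ⟨s, rfl⟩
  · obtain ⟨a, ha, hxa, t, ht⟩ := m'.surj U z x hx
    have h1 := hg a t
    rw [ht, app_mres, hz, map_zero] at h1
    obtain ⟨c, hca, hxc, h0⟩ := m''.inj a _ h1.symm x hxa
    obtain ⟨t', ht'⟩ := m'.func.res hca t
    obtain ⟨s, hs⟩ := (he c t').mp (m''.func.eq (ψ.compat hca ht') h0)
    refine ⟨_, (𝓦.mono hca).trans ha, hxc, m.η c s, ?_⟩
    rw [hf, hs, ← m'.compat hca ht', ht, mres_mres]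

/-- Change of the local data. -/
def Model.transfer (m : Model G M) (hG' : G'.Functional) (φ : LocalData.Hom G' G)
    (hi : ∀ a s, φ.app a s = 0 → ∀ x ∈ 𝓦.opens a, ∃ c, ∃ h : 𝓦.le c a, x ∈ 𝓦.opens c ∧
      G'.compat h s 0)
    (hs : ∀ a t, ∀ x ∈ 𝓦.opens a, ∃ c, ∃ h : 𝓦.le c a, x ∈ 𝓦.opens c ∧
      ∃ s, G.compat h t (φ.app c s)) : Model G' M where
  func := hG'
  η a := (m.η a).comp (φ.app a)
  compat h _ _ e := m.compat h (φ.compat h e)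
  inj a s h x hx := by
    obtain ⟨c, hc, hxc, h0⟩ := m.inj a _ h x hx
    obtain ⟨s', hs'⟩ := hG'.res hc s
    obtain ⟨d, hd, hxd, h1⟩ := hi c s' (m.func.eq (φ.compat hc hs') h0) x hxc
    exact ⟨d, hB.trans hc hd, hxd, hG'.comp hc hd _ hs' h1⟩
  surj U z x hx := by
    obtain ⟨a, ha, hxa, t, ht⟩ := m.surj U z x hx
    obtain ⟨c, hc, hxc, s, hs⟩ := hs a t x hxa
    refine ⟨c, (𝓦.mono hc).trans ha, hxc, s, ?_⟩
    change m.η c (φ.app c s) = _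
    rw [← m.compat hc hs, ht, mres_mres]

/-! ### The model of the sheaf given by local data -/

/-- The model of a sheaf of compatible families. -/
def Model.ofSec {𝒦 : OpenFamily Y} {H : LocalData 𝒦} (hG : G.Functional)
    (σ : ∀ a, G.obj a →ₗ[Γ(Y, 𝓦.opens a)] H.Sec (𝓦.opens a))
    (hσ : ∀ {a b} (h : 𝓦.le a b) {s t}, G.compat h s t → (σ b s).res (𝓦.mono h) = σ a t)
    (hinj : ∀ a s, σ a s = 0 → s = 0)
    (hsurj : ∀ (U : Y.Opens) (z : H.Sec U), ∀ x ∈ U, ∃ a, ∃ h : 𝓦.opens a ≤ U, x ∈ 𝓦.opens a ∧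
      ∃ t, σ a t = z.res h) : Model G H.sheaf where
  func := hG
  η a :=
    { toFun := fun s => toSh H.presheaf (𝓦.opens a) (σ a s)
      map_add' := fun s t => by rw [map_add]; exact map_add (toSh H.presheaf _) _ _
      map_smul' := fun r s => by rw [map_smul]; exact toSh_smul H.presheaf _ r _ }
  compat h s t H := by
    refine (toSh_res _ (𝓦.mono h) _).symm.trans ?_
    exact congrArg (toSh _ _) (hσ h H)
  inj a s hs x hx := by
    obtain ⟨V, hV, hxV, h0⟩ := toSh_inj _ _ hs x hx
    obtain ⟨c, hca, -, hxc, hcV⟩ := hB.refine a a x hx hx V hxV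
    obtain ⟨t, ht⟩ := hG.res hca s
    refine ⟨c, hca, hxc, ?_⟩
    have : t = 0 := hinj c t (by
      rw [← hσ hca ht]
      exact congrArg (LocalData.Sec.res hcV) h0)
    rwa [this] at ht
  surj U z x hx := by
    obtain ⟨V, hV, hxV, s, hs⟩ := toSh_surj _ z x hx
    obtain ⟨a, ha, hxa, t, ht⟩ := hsurj V s x hxV
    refine ⟨a, ha.trans hV, hxa, t, ?_⟩
    refine (congrArg (toSh _ _) ht).trans ((toSh_res H.presheaf ha s).trans ?_)
    rw [hs]
    exact mres_mres _ _ _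

end

/-- The family of affine open sets `v a`. -/
abbrev subFamily {K : Type} (v : K → Y.affineOpens) (le : K → K → Prop)
    (hle : ∀ {a b}, le a b → (v a).1 ≤ (v b).1) : OpenFamily Y where
  K := K
  le := le
  opens a := (v a).1
  mono := hle

section Restr

instance (H : LocalData (affineFamily Y)) (V : Y.affineOpens) : Module Γ(Y, V.1) (H.obj V) :=
  H.mod V

variable {K : Type} {v : K → Y.affineOpens} {le : K → K → Prop}
  {hle : ∀ {a b}, le a b → (v a).1 ≤ (v b).1}

instance (G : LocalData (subFamily v le hle)) (a : K) : Module Γ(Y, (v a).1) (G.obj a) :=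
  G.mod a

/-- Restriction of local data to a subfamily. -/
abbrev LocalData.restr (H : LocalData (affineFamily Y)) (v : K → Y.affineOpens)
    (le : K → K → Prop) (hle : ∀ {a b}, le a b → (v a).1 ≤ (v b).1) :
    LocalData (subFamily v le hle) where
  obj a := H.obj (v a)
  compat h s t := H.compat (hle h) s t
  compat_zero h := H.compat_zero (hle h)
  compat_add h _ _ _ _ := H.compat_add (hle h)
  compat_smul h r _ _ := H.compat_smul (hle h) r

/-- The relations of the local data are maps, that are compatible with composition, on the affine
open sets that are contained in some `v a`. -/
structure LocalData.Coherent (H : LocalData (affineFamily Y)) (v : K → Y.affineOpens) : Prop where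
  res : ∀ {V W : Y.affineOpens} (h : W.1 ≤ V.1) (a), V.1 ≤ (v a).1 → ∀ s, ∃ t, H.compat h s t
  uniq : ∀ {V W : Y.affineOpens} (h : W.1 ≤ V.1) (a), V.1 ≤ (v a).1 → ∀ t, H.compat h 0 t → t = 0
  self : ∀ {V : Y.affineOpens} (h : V.1 ≤ V.1) s, H.compat h s s
  comp : ∀ {U V W : Y.affineOpens} (h : V.1 ≤ U.1) (h' : W.1 ≤ V.1) {s t u}, H.compat h s t →
    H.compat h' t u → H.compat (h'.trans h) s u

variable {H : LocalData (affineFamily Y)} (hH : H.Coherent v)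
include hH

theorem LocalData.Coherent.eq {V W : Y.affineOpens} {h : W.1 ≤ V.1} (a) (hV : V.1 ≤ (v a).1)
    {s t t'} (e : H.compat h s t) (e' : H.compat h s t') : t = t' := by
  have := H.compat_sub h e e'
  rw [sub_self] at this
  exact eq_of_sub_eq_zero (hH.uniq h a hV _ this)

theorem LocalData.Coherent.functional : (H.restr v le hle).Functional where
  res h s := hH.res (hle h) _ le_rfl s
  uniq h t := hH.uniq (hle h) _ le_rfl t
  comp h h' _ _ _ _ e e' := hH.comp (hle h) (hle h') e e'

theorem LocalData.Coherent.exists_sec (a) : ∃ σ : H.obj (v a) →ₗ[Γ(Y, (v a).1)] H.Sec (v a).1,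
    ∀ s V hV, H.compat hV s ((σ s).val V hV) := by
  choose r hr using fun (V : Y.affineOpens) (hV : V.1 ≤ (v a).1) s => hH.res hV a le_rfl s
  refine ⟨⟨⟨fun s => ⟨fun V hV => r V hV s, fun {W V} h hV => ?_⟩, fun s t => ?_⟩, fun c s => ?_⟩,
    fun s V hV => hr V hV s⟩
  · obtain ⟨u, hu⟩ := hH.res h a hV (r V hV s)
    have := hH.eq a le_rfl (hH.comp hV h (hr V hV s) hu) (hr W _ s)
    rwa [this] at hu
  · exact LocalData.Sec.ext fun V hV =>
      hH.eq a le_rfl (hr V hV _) (H.compat_add hV (hr V hV s) (hr V hV t))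
  · exact LocalData.Sec.ext fun V hV =>
      hH.eq a le_rfl (hr V hV _) (H.compat_smul hV c (hr V hV s))

theorem Model.exists_restr (hB : IsBase (subFamily v le hle)) :
    ∃ m : Model (H.restr v le hle) H.sheaf, ∀ a s, ∃ z : H.Sec (v a).1,
      m.η a s = toSh H.presheaf (v a).1 z ∧ ∀ V hV, H.compat hV s (z.val V hV) := by
  choose σ hσ using hH.exists_sec
  refine ⟨Model.ofSec hB hH.functional σ (fun {a b} h {s t} e => ?_) (fun a s hs => ?_)
    fun U z x hx => ?_, fun a s => ⟨_, rfl, hσ a s⟩⟩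
  · refine LocalData.Sec.ext fun V hV => ?_
    exact hH.eq b le_rfl (hσ b s V (hV.trans (hle h))) (hH.comp (hle h) hV e (hσ a t V hV))
  · have h1 := hσ a s (v a) le_rfl
    rw [hs] at h1
    exact (hH.eq a le_rfl h1 (hH.self le_rfl s)).symm
  · obtain ⟨a, hxa, ha⟩ := hB.cover U x hx
    exact ⟨a, ha, hxa, z.val (v a) ha, LocalData.Sec.ext fun V hV =>
      hH.eq a le_rfl (hσ a _ V hV) (z.property hV ha)⟩

end Restr

end
end QLSing

namespace QLSing
noncomputable section

variable {Y : Scheme.{0}}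

/-! ### Models of cokernels -/

section Coker

variable {𝓦 : OpenFamily Y} {G G' : LocalData 𝓦} {M M' : Y.Modules}

/-- The cokernel of a homomorphism of local data. -/
abbrev cokerData (φ : LocalData.Hom G G') : LocalData 𝓦 where
  obj a := G'.obj a ⧸ LinearMap.range (φ.app a)
  compat h q r := ∃ s t, G'.compat h s t ∧ Submodule.Quotient.mk s = q ∧ Submodule.Quotient.mk t = r
  compat_zero h := ⟨0, 0, G'.compat_zero h, rfl, rfl⟩
  compat_add h := by
    rintro _ _ _ _ ⟨s, t, e, rfl, rfl⟩ ⟨s', t', e', rfl, rfl⟩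
    exact ⟨s + s', t + t', G'.compat_add h e e', rfl, rfl⟩
  compat_smul h r := by
    rintro _ _ ⟨s, t, e, rfl, rfl⟩
    exact ⟨r • s, _, G'.compat_smul h r e, rfl, rfl⟩

theorem cokerData_functional (φ : LocalData.Hom G G') (hG : G.Functional) (hG' : G'.Functional) :
    (cokerData φ).Functional where
  res h q := by
    obtain ⟨s, rfl⟩ := Submodule.Quotient.mk_surjective _ q
    obtain ⟨t, ht⟩ := hG'.res h s
    exact ⟨_, s, t, ht, rfl, rfl⟩
  uniq h := by
    rintro _ ⟨s, t, e, hs, rfl⟩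
    obtain ⟨u, rfl⟩ := (Submodule.Quotient.mk_eq_zero _).mp hs
    obtain ⟨u', hu'⟩ := hG.res h u
    exact (Submodule.Quotient.mk_eq_zero _).mpr ⟨u', hG'.eq (φ.compat h hu') e⟩
  comp h h' h'' := by
    rintro _ _ _ ⟨s, t, e, rfl, rfl⟩ ⟨t', u, e', ht, rfl⟩
    obtain ⟨w, hw⟩ := (Submodule.Quotient.eq _).mp ht
    obtain ⟨w', hw'⟩ := hG.res h' w
    refine ⟨s, u - φ.app _ w', hG'.comp h h' h'' e ?_, rfl, ?_⟩
    · have := G'.compat_sub h' e' (φ.compat h' hw')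
      rwa [hw, sub_sub_cancel] at this
    · exact (Submodule.Quotient.eq _).mpr ⟨-w', by rw [map_neg]; abel⟩

/-- The model of a cokernel. -/
def Model.coker (hB : IsBase 𝓦) (m : Model G M) (m' : Model G' M') (φ : LocalData.Hom G G') (f : M ⟶ M')
    (hf : ∀ a s, f.app _ (m.η a s) = m'.η a (φ.app a s)) :
    Model (cokerData φ) (Limits.cokernel f) where
  func := cokerData_functional φ m.func m'.func
  η a := Submodule.liftQ _
    { toFun := fun t => (Limits.cokernel.π f).app _ (m'.η a t)
      map_add' := fun s t => by rw [map_add, map_add]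
      map_smul' := fun r t => by rw [map_smul, Scheme.Modules.Hom.app_smul]; rfl } (by
    rintro _ ⟨s, rfl⟩
    change (Limits.cokernel.π f).app _ (m'.η a (φ.app a s)) = 0
    rw [← hf]
    exact DFunLike.congr_fun (congrArg AddCommGrpCat.Hom.hom
      (congrArg (fun t => Scheme.Modules.Hom.app t _) (Limits.cokernel.condition f))) (m.η a s))
  compat h := by
    rintro _ _ ⟨s, t, e, rfl, rfl⟩
    change mres _ _ ((Limits.cokernel.π f).app _ (m'.η _ s)) = (Limits.cokernel.π f).app _ (m'.η _ t)
    rw [← app_mres, m'.compat h e]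
  inj a q hq x hx := by
    obtain ⟨t, rfl⟩ := Submodule.Quotient.mk_surjective _ q
    obtain ⟨V, hV, hxV, z, hz⟩ := locExact_cokernel f _ (m'.η a t) hq x hx
    obtain ⟨b, hb, hxb, s, hs⟩ := m.surj V z x hxV
    obtain ⟨c, hca, hcb, hxc, -⟩ := hB.refine a b x hx hxb _ hx
    obtain ⟨s', hs'⟩ := m.func.res hcb s
    obtain ⟨t', ht'⟩ := m'.func.res hca t
    have h0 : m'.η c (t' - φ.app c s') = 0 := by
      rw [map_sub, ← hf, ← m'.compat hca ht', ← m.compat hcb hs', hs, app_mres, app_mres, hz,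
        mres_mres, mres_mres, sub_self]
    obtain ⟨d, hd, hxd, h1⟩ := m'.inj c _ h0 x hxc
    obtain ⟨s'', hs''⟩ := m.func.res hd s'
    obtain ⟨t'', ht''⟩ := m'.func.res hd t'
    refine ⟨d, hB.trans hca hd, hxd, t, t'', m'.func.comp hca hd _ ht' ht'', rfl, ?_⟩
    exact (Submodule.Quotient.mk_eq_zero _).mpr ⟨s'', (eq_of_sub_eq_zero
      (m'.func.eq (G'.compat_sub hd ht'' (φ.compat hd hs'')) h1)).symm⟩
  surj U z x hx := by
    obtain ⟨V, hV, hxV, w, hw⟩ := locSurj_of_epi (Limits.cokernel.π f) U z x hx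
    obtain ⟨a, ha, hxa, t, ht⟩ := m'.surj V w x hxV
    refine ⟨a, ha.trans hV, hxa, Submodule.Quotient.mk t, ?_⟩
    change (Limits.cokernel.π f).app _ (m'.η a t) = _
    rw [ht, app_mres, hw, mres_mres]

end Coker

/-! ### Models of ideal multiples and of twists -/

section Twist

open nonZeroDivisors

theorem exists_hom_span {B N : Type} [CommRing B] [AddCommGroup N] [Module B N] {E : Ideal B} {y : B}
    (hE : E = Ideal.span {y}) (hy : y ∈ B⁰) (t : N) :
    ∃ χ : E →ₗ[B] N, ∀ (r z : B) (h : z ∈ E), z = r * y → χ ⟨z, h⟩ = r • t := by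
  subst hE
  have hex : ∀ f : Ideal.span {y}, ∃ r, r * y = f.1 := fun f => Ideal.mem_span_singleton'.mp f.2
  choose c hc using hex
  have key : ∀ f r, r * y = f.1 → c f = r := fun f r h =>
    (mul_cancel_right_mem_nonZeroDivisors hy).mp ((hc f).trans h.symm)
  refine ⟨⟨⟨fun f => c f • t, fun f g => ?_⟩, fun r f => ?_⟩, fun r z h e => ?_⟩
  · rw [key (f + g) (c f + c g) (by rw [add_mul, hc, hc]; rfl), add_smul]
  · change c (r • f) • t = r • c f • t
    rw [key (r • f) (r * c f) (by rw [mul_assoc, hc]; rfl), mul_smul]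
  · exact congrArg (· • t) (key _ r e.symm)

theorem hom_span_apply {B N : Type} [CommRing B] [AddCommGroup N] [Module B N] {E : Ideal B}
    (χ : E →ₗ[B] N) {y z r : B} (hy : y ∈ E) (hz : z ∈ E) (e : z = r * y) :
    χ ⟨z, hz⟩ = r • χ ⟨y, hy⟩ := by
  rw [← map_smul]
  exact congrArg χ (Subtype.ext e)

variable {A : Type} [CommRing A] (π : Y ⟶ Spec (.of A)) (m : Ideal A)

/-- On the open sets `v a`, the ideal `m` generates a principal ideal that is generated by a
nonzerodivisor. -/
def CartierOn {K : Type} (v : K → Y.affineOpens) : Prop :=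
  ∀ a, ∃ x, excIdeal π m (v a).1 = Ideal.span {x} ∧
    ∀ (V : Y.Opens) (h : V ≤ (v a).1), resHom h x ∈ Γ(Y, V)⁰

variable {K : Type} {v : K → Y.affineOpens} {le : K → K → Prop}
  {hle : ∀ {a b}, le a b → (v a).1 ≤ (v b).1}

variable {π m} in
theorem CartierOn.exists_pow (hC : CartierOn π m v) (n : ℕ) (a) :
    ∃ y, excIdeal π m (v a).1 ^ n = Ideal.span {y} ∧ ∀ (V : Y.Opens) (h : V ≤ (v a).1),
      excIdeal π m V ^ n = Ideal.span {resHom h y} ∧ resHom h y ∈ Γ(Y, V)⁰ := by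
  obtain ⟨x, hx, hnzd⟩ := hC a
  refine ⟨x ^ n, by rw [hx, Ideal.span_singleton_pow], fun V h => ⟨?_, ?_⟩⟩
  · rw [← map_excIdeal π m h, hx, Ideal.map_span, Set.image_singleton, Ideal.span_singleton_pow,
      map_pow]
  · rw [map_pow]; exact pow_mem (hnzd V h) n

/-- The modules `Hom(ℐ_Cⁿ, G)`. -/
abbrev twistLocal (n : ℕ) (G : LocalData (subFamily v le hle)) :
    LocalData (subFamily v le hle) where
  obj a := ↥(excIdeal π m (v a).1 ^ n) →ₗ[Γ(Y, (v a).1)] G.obj a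
  compat h ψ χ := ∀ f, G.compat h (ψ f)
    (χ ⟨resHom (hle h) f.1, excIdeal_pow_le_comap π m (hle h) n f.2⟩)
  compat_zero h _ := G.compat_zero h
  compat_add h _ _ _ _ H H' f := G.compat_add h (H f) (H' f)
  compat_smul h r _ _ H f := G.compat_smul h r (H f)

variable {π m} {G : LocalData (subFamily v le hle)}

theorem twistLocal_compat {n : ℕ} {a b} (h : le a b) {y : Γ(Y, (v b).1)}
    (hy : excIdeal π m (v b).1 ^ n = Ideal.span {y})
    {ψ : (twistLocal π m n G).obj b} {χ : (twistLocal π m n G).obj a}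
    (H : ∀ hy hy', G.compat h (ψ ⟨y, hy⟩) (χ ⟨resHom (hle h) y, hy'⟩)) :
    (twistLocal π m n G).compat h ψ χ := fun f => by
  obtain ⟨f, hf⟩ := f
  obtain ⟨r, rfl⟩ := Ideal.mem_span_singleton'.mp (hy ▸ hf)
  have hy1 : y ∈ excIdeal π m (v b).1 ^ n := by rw [hy]; exact Ideal.mem_span_singleton_self y
  have hy2 := excIdeal_pow_le_comap π m (hle h) n hy1
  have := G.compat_smul h r (H hy1 hy2)
  rwa [← hom_span_apply ψ hy1 hf rfl, ← hom_span_apply χ hy2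
    (excIdeal_pow_le_comap π m (hle h) n hf) (map_mul _ _ _)] at this

theorem twistLocal_functional (hC : CartierOn π m v) (n : ℕ) (hG : G.Functional) :
    (twistLocal π m n G).Functional where
  res {a b} h ψ := by
    obtain ⟨y, hy, H⟩ := hC.exists_pow n b
    obtain ⟨t, ht⟩ := hG.res h (ψ ⟨y, by rw [hy]; exact Ideal.mem_span_singleton_self y⟩)
    obtain ⟨χ, hχ⟩ := exists_hom_span (H _ (hle h)).1 (H _ (hle h)).2 t
    refine ⟨χ, twistLocal_compat h hy fun hy hy' => ?_⟩
    rw [hχ 1 _ hy' (one_mul _).symm, one_smul]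
    exact ht
  uniq {a b} h χ e := by
    obtain ⟨y, hy, H⟩ := hC.exists_pow n b
    have hy1 : y ∈ excIdeal π m (v b).1 ^ n := by rw [hy]; exact Ideal.mem_span_singleton_self y
    have h0 := hG.uniq h _ (e ⟨y, hy1⟩)
    refine LinearMap.ext fun f => ?_
    obtain ⟨f, hf⟩ := f
    obtain ⟨r, rfl⟩ := Ideal.mem_span_singleton'.mp ((H _ (hle h)).1 ▸ hf)
    exact (χ.map_smul r ⟨_, excIdeal_pow_le_comap π m (hle h) n hy1⟩).trans
      (by rw [h0, smul_zero]; rfl)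
  comp h h' h'' _ _ _ e e' f := by
    have := hG.comp h h' h'' (e f) (e' _)
    convert this using 2
    exact Subtype.ext (resHom_resHom _ _ _).symm

theorem twistData_coherent (hC : CartierOn π m v) (n : ℕ) (M : Y.Modules) :
    (twistData π m n M).Coherent v where
  res {V W} h a hV := fun (ψ : ↥(excIdeal π m V.1 ^ n) →ₗ[Γ(Y, V.1)] Γ(M, V.1)) => by
    obtain ⟨y, -, H⟩ := hC.exists_pow n a
    have hy1 : resHom hV y ∈ excIdeal π m V.1 ^ n := by
      rw [(H _ hV).1]; exact Ideal.mem_span_singleton_self _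
    obtain ⟨χ, hχ⟩ := exists_hom_span (H W.1 (h.trans hV)).1 (H W.1 (h.trans hV)).2
      (mres M h (ψ ⟨_, hy1⟩))
    refine ⟨χ, fun ⟨f, hf⟩ => ?_⟩
    obtain ⟨r, rfl⟩ := Ideal.mem_span_singleton'.mp ((H _ hV).1 ▸ hf)
    rw [hom_span_apply ψ hy1 hf rfl]
    refine (mres_smul h r _).trans (hχ _ _ _ ?_).symm
    rw [map_mul, resHom_resHom]
  uniq {V W} h a hV := fun (χ : ↥(excIdeal π m W.1 ^ n) →ₗ[Γ(Y, W.1)] Γ(M, W.1)) e => by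
    obtain ⟨y, -, H⟩ := hC.exists_pow n a
    have hy1 : resHom hV y ∈ excIdeal π m V.1 ^ n := by
      rw [(H _ hV).1]; exact Ideal.mem_span_singleton_self _
    have h0 : χ ⟨resHom h (resHom hV y), _⟩ = 0 := (e ⟨_, hy1⟩).symm.trans (map_zero (mres M h))
    refine LinearMap.ext fun ⟨f, hf⟩ => ?_
    have hf' := hf
    rw [(H W.1 (h.trans hV)).1] at hf'
    obtain ⟨r, rfl⟩ := Ideal.mem_span_singleton'.mp hf'
    exact (hom_span_apply χ (excIdeal_pow_le_comap π m h n hy1) hf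
      (by rw [resHom_resHom])).trans (by rw [h0, smul_zero]; rfl)
  self {V} h := fun (s : ↥(excIdeal π m V.1 ^ n) →ₗ[Γ(Y, V.1)] Γ(M, V.1)) f => (mres_self h (s f)).trans (congrArg s (Subtype.ext (resHom_self h _).symm))
  comp {U V W} h h' := fun {s : ↥(excIdeal π m U.1 ^ n) →ₗ[Γ(Y, U.1)] Γ(M, U.1)} {t}
      {u : ↥(excIdeal π m W.1 ^ n) →ₗ[Γ(Y, W.1)] Γ(M, W.1)} e e' f => by
    refine (mres_mres h h' (s f)).symm.trans ((congrArg (mres M h') (e f)).trans ((e' _).trans ?_))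
    exact congrArg u (Subtype.ext (resHom_resHom _ _ _))

/-- The model of a twist. -/
theorem Model.nonempty_twist {M : Y.Modules} (hB : IsBase (subFamily v le hle))
    (hC : CartierOn π m v) (n : ℕ) (μ : Model G M) :
    Nonempty (Model (twistLocal π m n G) (twist π m n M)) := by
  obtain ⟨ν, -⟩ := Model.exists_restr (twistData_coherent hC n M) hB
  let φ : LocalData.Hom (twistLocal π m n G) ((twistData π m n M).restr v le hle) :=
    { app := fun a =>
        { toFun := fun ψ => (μ.η a).comp ψ
          map_add' := fun ψ χ => LinearMap.ext fun f => map_add (μ.η a) _ _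
          map_smul' := fun r ψ => LinearMap.ext fun f => map_smul (μ.η a) _ _ }
      compat := fun h _ _ e f => μ.compat h (e f) }
  refine ⟨ν.transfer hB (twistLocal_functional hC n μ.func) φ (fun a ψ hψ x hx => ?_)
    fun a (χ : ↥(excIdeal π m (v a).1 ^ n) →ₗ[Γ(Y, (v a).1)] Γ(M, (v a).1)) x hx => ?_⟩
  · obtain ⟨y, hy, H⟩ := hC.exists_pow n a
    obtain ⟨c, hc, hxc, h0⟩ := μ.inj a (ψ ⟨y, by rw [hy]; exact Ideal.mem_span_singleton_self y⟩)
      (LinearMap.congr_fun hψ _) x hx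
    exact ⟨c, hc, hxc, twistLocal_compat hc hy fun hy hy' => h0⟩
  · obtain ⟨y, hy, H⟩ := hC.exists_pow n a
    have hy1 : y ∈ excIdeal π m (v a).1 ^ n := by rw [hy]; exact Ideal.mem_span_singleton_self y
    obtain ⟨c, hc, hxc, t, ht⟩ := μ.surj_le hB a (χ ⟨y, hy1⟩) x hx
    obtain ⟨ψ, hψ⟩ := exists_hom_span (H _ (hle hc)).1 (H _ (hle hc)).2 t
    refine ⟨c, hc, hxc, ψ, fun ⟨f, hf⟩ => ?_⟩
    obtain ⟨r, rfl⟩ := Ideal.mem_span_singleton'.mp (hy ▸ hf)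
    rw [hom_span_apply χ hy1 hf rfl]
    refine (mres_smul (hle hc) r _).trans ?_
    refine Eq.trans ?_ (congrArg (μ.η c) (hψ (resHom (hle hc) r) _
      (excIdeal_pow_le_comap π m (hle hc) n hf) (map_mul _ _ _))).symm
    rw [map_smul, ht]

/-- The submodules `m G`. -/
abbrev idealMulLocal (G : LocalData (subFamily v le hle)) : LocalData (subFamily v le hle) where
  obj a := (excIdeal π m (v a).1 • ⊤ : Submodule Γ(Y, (v a).1) (G.obj a))
  compat h s t := G.compat h s.1 t.1
  compat_zero h := G.compat_zero h
  compat_add h _ _ _ _ H H' := G.compat_add h H H'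
  compat_smul h r _ _ H := G.compat_smul h r H

theorem compat_mem_excIdeal_smul (hG : G.Functional) {a b} (h : le a b) {s : G.obj b}
    (hs : s ∈ (excIdeal π m (v b).1 • ⊤ : Submodule Γ(Y, (v b).1) (G.obj b))) :
    ∃ t ∈ (excIdeal π m (v a).1 • ⊤ : Submodule Γ(Y, (v a).1) (G.obj a)), G.compat h s t := by
  refine Submodule.smul_induction_on hs (fun r hr s _ => ?_) ?_
  · obtain ⟨t, ht⟩ := hG.res h s
    exact ⟨_, Submodule.smul_mem_smul (excIdeal_le_comap π m (hle h) hr) trivial,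
      G.compat_smul h r ht⟩
  · rintro _ _ ⟨t, ht, e⟩ ⟨t', ht', e'⟩
    exact ⟨t + t', add_mem ht ht', G.compat_add h e e'⟩

theorem idealMulLocal_functional (hG : G.Functional) :
    (idealMulLocal (π := π) (m := m) G).Functional where
  res h s := by
    obtain ⟨t, ht, e⟩ := compat_mem_excIdeal_smul hG h s.2
    exact ⟨⟨t, ht⟩, e⟩
  uniq h t e := Subtype.ext (hG.uniq h _ e)
  comp h h' h'' _ _ _ e e' := hG.comp h h' h'' e e'

theorem Model.nonempty_idealMul {M : Y.Modules} (hB : IsBase (subFamily v le hle)) (μ : Model G M) :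
    Nonempty (Model (idealMulLocal (π := π) (m := m) G) (idealMul π m M)) := by
  obtain ⟨i, hi, hinj, hsurj⟩ : ∃ i : idealMul π m M ⟶ M,
      (∀ U s, i.app U (toSh (idealMulSub π m M).toPresheafOfModules U s) = s.1) ∧ SecInj i ∧
      ∀ (U : Y.Opens) (z : Γ(M, U)), (∀ x ∈ U, ∃ (V : Y.Opens) (h : V ≤ U), x ∈ V ∧
        mres M h z ∈ (excIdeal π m V • ⊤ : Submodule Γ(Y, V) Γ(M, V))) → ∃ y, i.app U y = z :=
    exists_sub_incl (idealMulSub π m M)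
  have hη : ∀ a (s : (idealMulLocal (π := π) (m := m) G).obj a), μ.η a s.1 ∈
      (excIdeal π m (v a).1 • ⊤ : Submodule Γ(Y, (v a).1) Γ(M, (v a).1)) := fun a s => by
    refine Submodule.smul_induction_on s.2 (fun r hr s _ => ?_) fun s t hs ht => ?_
    · rw [map_smul]; exact Submodule.smul_mem_smul hr trivial
    · rw [map_add]; exact add_mem hs ht
  choose y hy using fun a (s : (idealMulLocal (π := π) (m := m) G).obj a) =>
    hsurj (v a).1 (μ.η a s.1) fun x hx => ⟨_, le_rfl, hx, by rw [mres_self]; exact hη a s⟩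
  refine ⟨⟨idealMulLocal_functional μ.func, fun a =>
    ⟨⟨y a, fun s t => hinj.eq ?_⟩, fun r s => hinj.eq ?_⟩, fun {a b} h s t e => hinj.eq ?_,
    fun a s hs x hx => ?_, fun U z x hx => ?_⟩⟩
  · rw [map_add, hy, hy, hy]; exact map_add _ _ _
  · rw [RingHom.id_apply, Scheme.Modules.Hom.app_smul, hy, hy]; exact map_smul _ _ _
  · refine (app_mres i (hle h) (y b s)).trans ?_
    refine Eq.trans ?_ (hy a t).symm
    rw [hy]
    exact μ.compat h e
  · have h1 : μ.η a s.1 = 0 := by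
      rw [← hy, show y a s = 0 from hs, map_zero]
    exact μ.inj a s.1 h1 x hx
  · obtain ⟨V, hV, hxV, ⟨w, hw⟩, hs⟩ : ∃ (V : Y.Opens) (hV : V ≤ U), x ∈ V ∧
        ∃ s : (excIdeal π m V • ⊤ : Submodule Γ(Y, V) Γ(M, V)),
          i.app V (mres (idealMul π m M) hV z) = s.1 := by
      obtain ⟨V, hV, hxV, s, hs⟩ := toSh_surj _ z x hx
      exact ⟨V, hV, hxV, s, (congrArg (i.app V) hs.symm).trans (hi V s)⟩
    have key : ∀ w ∈ (excIdeal π m V • ⊤ : Submodule Γ(Y, V) Γ(M, V)),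
        ∃ a, ∃ h : (v a).1 ≤ V, x ∈ (v a).1 ∧ ∃ t : (idealMulLocal (π := π) (m := m) G).obj a,
          μ.η a t.1 = mres M h w := fun w hw => by
      refine Submodule.smul_induction_on hw (fun r hr w _ => ?_) ?_
      · obtain ⟨a, ha, hxa, t, ht⟩ := μ.surj V w x hxV
        exact ⟨a, ha, hxa, ⟨_, Submodule.smul_mem_smul (excIdeal_le_comap π m ha hr) trivial⟩, by
          rw [map_smul, ht, mres_smul]⟩
      · rintro w w' ⟨a, ha, hxa, t, ht⟩ ⟨b, hb, hxb, t', ht'⟩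
        obtain ⟨c, hca, hcb, hxc, -⟩ := hB.refine a b x hxa hxb _ hxa
        obtain ⟨u, hu⟩ := (idealMulLocal_functional μ.func).res hca t
        obtain ⟨u', hu'⟩ := (idealMulLocal_functional μ.func).res hcb t'
        refine ⟨c, (hle hca).trans ha, hxc, u + u', ?_⟩
        refine (map_add (μ.η c) u.1 u'.1).trans ?_
        rw [← μ.compat hca hu, ← μ.compat hcb hu', ht, ht', map_add, mres_mres, mres_mres]
    have k := key w hw
    obtain ⟨a, ha, hxa, t, ht⟩ := k
    have e2 : i.app (v a).1 (y a t) =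
        i.app (v a).1 (mres (idealMul π m M) (ha.trans hV) z) := by
      rw [hy, ht, ← show i.app V (mres (idealMul π m M) hV z) = w from hs]
      refine (congrArg (mres M ha) (app_mres i hV z)).trans ?_
      refine (mres_mres hV ha (i.app U z)).trans ?_
      exact (app_mres i (ha.trans hV) z).symm
    have e3 : y a t = mres (idealMul π m M) (ha.trans hV) z := hinj.eq e2
    exact ⟨a, ha.trans hV, hxa, t, e3⟩

end Twist

end
end QLSing

namespace QLSing
noncomputable section

/-! ### Charts of the blow-up -/

open nonZeroDivisors

variable {k P A Q B Q' B' : Type} [CommRing k] [CommRing P] [CommRing A] [CommRing Q] [CommRing B]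
  [CommRing Q'] [CommRing B']

/-- Affine charts `Q` of the blow-up of `P` in `𝔪` and `B` of the strict transform of `A`. -/
structure IsChart (κ : k →+* P) (p : P →+* A) (𝔪 : Ideal P) (a : P →+* Q) (b : A →+* B)
    (τ : Q →+* B) : Prop where
  comm : τ.comp a = b.comp p
  surj : Function.Surjective τ
  domQ : IsDomain Q
  domB : IsDomain B
  injQ : Function.Injective a
  injB : Function.Injective b
  coord : ∃ (ν : Type) (θ : MvPolynomial ν k →+* Q) (t : ν) (x : P), θ.comp MvPolynomial.C = a.comp κ ∧
    IsLoc θ ∧ θ (MvPolynomial.X t) = a x ∧ x ∈ 𝔪 ∧ 𝔪.map a = Ideal.span {a x} ∧ b (p x) ≠ 0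
  frac : ∀ z, ∃ n, ∃ r ∈ 𝔪 ^ n, ∃ q ∈ 𝔪 ^ n, (𝔪 ^ n).map a = Ideal.span {a q} ∧ a q * z = a r

variable {κ : k →+* P} {p : P →+* A} {𝔪 : Ideal P} {a : P →+* Q} {b : A →+* B} {τ : Q →+* B}

set_option linter.unusedSectionVars false

/-- The ideal of the exceptional divisor. -/
abbrev excB (p : P →+* A) (𝔪 : Ideal P) (b : A →+* B) : Ideal B := (𝔪.map p).map b

namespace IsChart

variable (h : IsChart κ p 𝔪 a b τ)
include h

theorem τ_a (r : P) : τ (a r) = b (p r) := DFunLike.congr_fun h.comm r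

theorem map_map : (𝔪.map a).map τ = excB p 𝔪 b := by
  rw [excB, Ideal.map_map, Ideal.map_map, h.comm]

theorem exc_pow_eq {n : ℕ} {q : P} (hq : (𝔪 ^ n).map a = Ideal.span {a q}) :
    excB p 𝔪 b ^ n = Ideal.span {b (p q)} := by
  rw [← h.map_map, ← Ideal.map_pow, ← Ideal.map_pow, hq, Ideal.map_span, Set.image_singleton,
    h.τ_a]

theorem mem_exc_pow {n : ℕ} {r : P} (hr : r ∈ 𝔪 ^ n) : b (p r) ∈ excB p 𝔪 b ^ n := by
  rw [← Ideal.map_pow, ← Ideal.map_pow]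
  exact Ideal.mem_map_of_mem _ (Ideal.mem_map_of_mem _ hr)

theorem mem_exc {r : P} (hr : r ∈ 𝔪) : b (p r) ∈ excB p 𝔪 b :=
  Ideal.mem_map_of_mem _ (Ideal.mem_map_of_mem _ hr)

theorem nzd {r : P} (hr : b (p r) ≠ 0) : b (p r) ∈ B⁰ := by
  have := h.domB
  exact mem_nonZeroDivisors_of_ne_zero hr

/-- An equation of the exceptional divisor. -/
theorem exists_eq : ∃ x ∈ 𝔪, 𝔪.map a = Ideal.span {a x} ∧ b (p x) ∈ B⁰ ∧
    (∀ n, (𝔪 ^ n).map a = Ideal.span {a (x ^ n)}) ∧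
    ∀ n, excB p 𝔪 b ^ n = Ideal.span {b (p (x ^ n))} := by
  obtain ⟨ν, θ, t, x, -, -, -, hx, hmx, hx0⟩ := h.coord
  have hn : ∀ n, (𝔪 ^ n).map a = Ideal.span {a (x ^ n)} := fun n => by
    rw [Ideal.map_pow, hmx, Ideal.span_singleton_pow, map_pow]
  exact ⟨x, hx, hmx, h.nzd hx0, hn, fun n => h.exc_pow_eq (hn n)⟩

theorem exists_frac (z : Q) : ∃ n, ∃ r ∈ 𝔪 ^ n, ∃ q ∈ 𝔪 ^ n, b (p q) ∈ B⁰ ∧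
    excB p 𝔪 b ^ n = Ideal.span {b (p q)} ∧ a q * z = a r := by
  obtain ⟨n, r, hr, q, hq, hmq, e⟩ := h.frac z
  obtain ⟨x, hx, -, hx0, -, hn⟩ := h.exists_eq
  refine ⟨n, r, hr, q, hq, h.nzd fun h0 => ?_, h.exc_pow_eq hmq, e⟩
  have h1 := hn n
  have := h.domB
  rw [h.exc_pow_eq hmq, h0, Ideal.span_singleton_eq_bot.mpr rfl, eq_comm,
    Ideal.span_singleton_eq_bot, map_pow, map_pow] at h1
  exact nonZeroDivisors.ne_zero (pow_mem hx0 n) h1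

theorem frac_nzd (z : Q) : ∃ s r, (b.comp p) s ∈ B⁰ ∧ a s * z = a r := by
  obtain ⟨n, r, hr, q, hq, h0, -, e⟩ := h.exists_frac z
  exact ⟨q, r, h0, e⟩

theorem fracB_nzd (z : B) : ∃ s r, b s ∈ B⁰ ∧ b s * z = b r := by
  obtain ⟨z, rfl⟩ := h.surj z
  obtain ⟨s, r, hs, e⟩ := h.frac_nzd z
  exact ⟨p s, p r, hs, by rw [← h.τ_a, ← map_mul, e, h.τ_a]⟩

theorem der_mem {F : P → B} (hF : IsDer κ (b.comp p) F) {c : B} (hc : c ∈ excB p 𝔪 b) (n : ℕ) :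
    ∀ r ∈ 𝔪 ^ n, c * F r ∈ excB p 𝔪 b ^ n := by
  have hadd : ∀ r s, F (r + s) = F r + F s := hF.map_add
  induction n with
  | zero => intro r _; simp
  | succ n ih =>
    intro r hr
    rw [pow_succ] at hr
    refine Submodule.mul_induction_on hr (fun s hs t ht => ?_) fun s t hs ht => ?_
    · rw [show F (s * t) = b (p s) * F t + b (p t) * F s from hF.map_mul s t]
      have h1 := Ideal.mul_mem_mul (h.mem_exc_pow hs) hc
      have h2 := Ideal.mul_mem_mul (ih s hs) (h.mem_exc ht)
      rw [← pow_succ] at h1 h2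
      have := add_mem (Ideal.mul_mem_right (F t) _ h1) h2
      convert this using 1; ring
    · rw [hadd, mul_add]; exact add_mem hs ht

theorem exists_der {F : P → B} (hF : IsDer κ (b.comp p) F) {c : B} (hc : c ∈ excB p 𝔪 b) :
    ∃ F' : Q → B, IsDer (a.comp κ) τ F' ∧ ∀ r, F' (a r) = c * F r := by
  have hcF : IsDer κ (b.comp p) (c • F) := (T0 κ (b.comp p)).smul_mem c hF
  refine exists_der_extension a rfl τ h.comm hcF (fun r hr => ?_) fun z => ?_
  · rw [← map_zero a] at hr
    rw [h.injQ hr, ← map_zero κ]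
    exact hcF.map_base 0
  · obtain ⟨n, r, hr, q, hq, h0, hE, e⟩ := h.exists_frac z
    have h1 := h.der_mem hF hc n r hr
    have h2 := Ideal.mul_mem_left _ (τ z) (h.der_mem hF hc n q hq)
    have h3 := sub_mem h1 h2
    rw [hE] at h3
    obtain ⟨y, hy⟩ := Ideal.mem_span_singleton'.mp h3
    exact ⟨q, r, y, h0, e, (mul_comm _ _).trans hy⟩

theorem exists_derB {F : A → B} (hF : IsDer (p.comp κ) b F) {c : B} (hc : c ∈ excB p 𝔪 b) :
    ∃ F' : B → B, IsDer (b.comp (p.comp κ)) (RingHom.id B) F' ∧ ∀ r, F' (b r) = c * F r := by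
  have hFp : IsDer κ (b.comp p) (fun r => F (p r)) :=
    ⟨fun r s => by rw [map_add, hF.map_add], fun r s => by rw [RingHom.map_mul, hF.map_mul]; rfl,
      fun s => hF.map_base s⟩
  have hcF : IsDer (p.comp κ) b (c • F) := (T0 (p.comp κ) b).smul_mem c hF
  refine exists_der_extension b rfl (RingHom.id B) (RingHom.id_comp b) hcF (fun r hr => ?_)
    fun z => ?_
  · rw [← map_zero b] at hr
    rw [h.injB hr, ← map_zero (p.comp κ)]
    exact hcF.map_base 0
  · obtain ⟨z, rfl⟩ := h.surj z
    obtain ⟨n, r, hr, q, hq, h0, hE, e⟩ := h.exists_frac z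
    have h1 := h.der_mem hFp hc n r hr
    have h2 := Ideal.mul_mem_left _ (τ z) (h.der_mem hFp hc n q hq)
    have h3 := sub_mem h1 h2
    rw [hE] at h3
    obtain ⟨y, hy⟩ := Ideal.mem_span_singleton'.mp h3
    exact ⟨p q, p r, y, h0, by rw [← h.τ_a, ← map_mul, e, h.τ_a], (mul_comm _ _).trans hy⟩

omit h in
theorem frac_nzd' {a' : P →+* Q'} {b' : A →+* B'} {τ' : Q' →+* B'} (h : IsChart κ p 𝔪 a b τ)
    (h' : IsChart κ p 𝔪 a' b' τ') (z : Q) : ∃ s r, (b'.comp p) s ∈ B'⁰ ∧ a s * z = a r := by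
  obtain ⟨s, r, hs, e⟩ := h.frac_nzd z
  refine ⟨s, r, h'.nzd fun h0 => ?_, e⟩
  have := h.domB
  rw [map_eq_zero_iff b' h'.injB] at h0
  refine nonZeroDivisors.ne_zero hs ?_
  rw [RingHom.comp_apply, h0, map_zero]

omit h in
theorem fracB_nzd' {a' : P →+* Q'} {b' : A →+* B'} {τ' : Q' →+* B'} (h : IsChart κ p 𝔪 a b τ)
    (h' : IsChart κ p 𝔪 a' b' τ') (z : B) : ∃ s r, b' s ∈ B'⁰ ∧ b s * z = b r := by
  obtain ⟨z, rfl⟩ := h.surj z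
  obtain ⟨s, r, hs, e⟩ := h.frac_nzd' h' z
  exact ⟨p s, p r, hs, by rw [← h.τ_a, ← map_mul, e, h.τ_a]⟩

/-- The ideal of the exceptional divisor is principal. -/
theorem exists_pow_eq (n : ℕ) : ∃ x ∈ 𝔪 ^ n, excB p 𝔪 b ^ n = Ideal.span {b (p x)} ∧
    b (p x) ∈ excB p 𝔪 b ^ n ∧ b (p x) ∈ B⁰ ∧ (𝔪 ^ n).map a = Ideal.span {a x} := by
  obtain ⟨x, hx, -, hx0, hm, hn⟩ := h.exists_eq
  refine ⟨x ^ n, Ideal.pow_mem_pow hx n, hn n, ?_, ?_, hm n⟩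
  · rw [hn n]; exact Ideal.mem_span_singleton_self _
  · rw [map_pow, map_pow]; exact pow_mem hx0 n

theorem isLocPoly : IsLocPoly (a.comp κ) := by
  obtain ⟨ν, θ, t, x, hθ, hl, -⟩ := h.coord
  exact ⟨ν, θ, hθ, hl⟩

/-- A coordinate that is an equation of the exceptional divisor, and derivations with given
value. -/
theorem exists_coord : ∃ x ∈ 𝔪, 𝔪.map a = Ideal.span {a x} ∧ b (p x) ∈ B⁰ ∧
    (∀ n, excB p 𝔪 b ^ n = Ideal.span {b (p (x ^ n))}) ∧
    ∀ y : B, ∃ D, IsDer (a.comp κ) τ D ∧ D (a x) = y := by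
  obtain ⟨ν, θ, t, x, hθ, hl, ht, hx, hmx, hx0⟩ := h.coord
  have hn : ∀ n, (𝔪 ^ n).map a = Ideal.span {a (x ^ n)} := fun n => by
    rw [Ideal.map_pow, hmx, Ideal.span_singleton_pow, map_pow]
  refine ⟨x, hx, hmx, h.nzd hx0, fun n => h.exc_pow_eq (hn n), fun y => ?_⟩
  obtain ⟨D, hD, hDt⟩ := hl.exists_der τ fun _ => y
  exact ⟨D, hθ ▸ hD, by rw [← ht, hDt]⟩

end IsChart

/-- Semilinear maps whose values are divisible by a nonzerodivisor. -/
theorem exists_div {N : Type} [AddCommGroup N] [Module P N] {σ : P →+* B} (φ : N →ₛₗ[σ] B) {y : B}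
    (hy : y ∈ B⁰) (hφ : ∀ n, ∃ c, y * c = φ n) : ∃ ψ : N →ₛₗ[σ] B, ∀ n, y * ψ n = φ n := by
  choose c hc using hφ
  refine ⟨⟨⟨c, fun m n => eq_of_mul_nzd hy ?_⟩, fun r n => eq_of_mul_nzd hy ?_⟩, hc⟩
  · rw [hc, map_add, mul_add, hc, hc]
  · change y * c (r • n) = y * (σ r * c n)
    rw [hc, LinearMap.map_smulₛₗ, smul_eq_mul, ← hc]; ring

/-- Homomorphisms on a principal ideal that vanish at the generator. -/
theorem hom_span_ext {N : Type} [AddCommGroup N] [Module B N] {E : Ideal B}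
    {y : B} (hE : E = Ideal.span {y}) (hy : y ∈ E) {χ : E →ₗ[B] N} (h0 : χ ⟨y, hy⟩ = 0) : χ = 0 := by
  refine LinearMap.ext fun ⟨f, hf⟩ => ?_
  have hf' := hf
  rw [hE] at hf'
  obtain ⟨w, rfl⟩ := Ideal.mem_span_singleton'.mp hf'
  exact (hom_span_apply χ hy hf rfl).trans (by rw [h0, smul_zero]; rfl)

/-- A homomorphism of local data from a family of functional relations. -/
theorem LocalData.exists_hom_of_rel {Y : Scheme.{0}} {𝒦 : OpenFamily Y} {G G' : LocalData 𝒦}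
    (R : ∀ c, G.obj c → G'.obj c → Prop)
    (add : ∀ {c s s' t t'}, R c s t → R c s' t' → R c (s + s') (t + t'))
    (smul : ∀ {c s t} (r : Γ(Y, 𝒦.opens c)), R c s t → R c (r • s) (r • t))
    (total : ∀ c s, ∃ t, R c s t) (uniq : ∀ {c t}, R c 0 t → t = 0)
    (nat : ∀ {c d} (h : 𝒦.le c d) {s s' t t'}, G.compat h s s' → R d s t → R c s' t' →
      G'.compat h t t') :
    ∃ φ : LocalData.Hom G G', ∀ c s t, R c s t ↔ φ.app c s = t := by
  choose f hf using total
  have eq : ∀ {c s t t'}, R c s t → R c s t' → t = t' := fun {c s t t'} H H' => by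
    have := add H (smul (-1) H')
    rw [neg_one_smul, neg_one_smul, add_neg_cancel] at this
    exact eq_of_sub_eq_zero ((sub_eq_add_neg _ _).trans (uniq this))
  refine ⟨⟨fun c => ⟨⟨f c, fun s t => eq (hf c _) (add (hf c s) (hf c t))⟩,
    fun r s => eq (hf c _) (smul r (hf c s))⟩, fun h _ _ e => nat h e (hf _ _) (hf _ _)⟩,
    fun c s t => ⟨fun H => eq (hf c s) H, ?_⟩⟩
  rintro rfl
  exact hf c s

end
end QLSing

namespace QLSing
noncomputable section

open nonZeroDivisors

variable {k P A Q B Q' B' : Type} [CommRing k] [CommRing P] [CommRing A] [CommRing Q] [CommRing B]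
  [CommRing Q'] [CommRing B'] {κ : k →+* P} {p : P →+* A} {𝔪 : Ideal P}
  {a : P →+* Q} {b : A →+* B} {τ : Q →+* B} {a' : P →+* Q'} {b' : A →+* B'} {τ' : Q' →+* B'}
  {α : Q →+* Q'} {β : B →+* B'}

/-! ### Derivations -/

/-- Derivations that preserve the ideal `E`. -/
abbrev derCSub (ι : k →+* B) (E : Ideal B) : Submodule B (B → B) where
  carrier := {D | ∀ y ∈ E, D y ∈ E} ∩ T0 ι (RingHom.id B)
  add_mem' := fun H H' => ⟨fun a ha => add_mem (H.1 a ha) (H'.1 a ha), add_mem H.2 H'.2⟩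
  zero_mem' := ⟨fun _ _ => zero_mem _, zero_mem _⟩
  smul_mem' := fun r _ H =>
      ⟨fun a ha => Ideal.mul_mem_left _ r (H.1 a ha), Submodule.smul_mem _ r H.2⟩

/-- `ψ(c)` restricts to `c F` on `A`. -/
def RelDer (κ : k →+* P) (p : P →+* A) (𝔪 : Ideal P) (b : A →+* B) (F : T0 (p.comp κ) b)
    (ψ : ↥(excB p 𝔪 b ^ 1) →ₗ[B] derCSub (b.comp (p.comp κ)) (excB p 𝔪 b)) : Prop :=
  ∀ r ∈ 𝔪, ∀ hr : b (p r) ∈ excB p 𝔪 b ^ 1, ∀ y, (ψ ⟨b (p r), hr⟩).1 (b y) = b (p r) * F.1 y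

namespace RelDer

theorem add {F F' : T0 (p.comp κ) b} {ψ ψ'} (H : RelDer κ p 𝔪 b F ψ) (H' : RelDer κ p 𝔪 b F' ψ') :
    RelDer κ p 𝔪 b (F + F') (ψ + ψ') := fun r hr h y =>
  (congrArg₂ _ (H r hr h y) (H' r hr h y)).trans (mul_add _ _ _).symm

theorem smul {F : T0 (p.comp κ) b} {ψ} (c : B) (H : RelDer κ p 𝔪 b F ψ) :
    RelDer κ p 𝔪 b (c • F) (c • ψ) := fun r hr h y =>
  (congrArg (c * ·) (H r hr h y)).trans (mul_left_comm _ _ _)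

variable (h : IsChart κ p 𝔪 a b τ)
include h

theorem total (F : T0 (p.comp κ) b) : ∃ ψ, RelDer κ p 𝔪 b F ψ := by
  obtain ⟨x, hx, h1, hx1, hx0, -⟩ := h.exists_pow_eq 1
  rw [pow_one] at hx
  have h1' : excB p 𝔪 b = Ideal.span {b (p x)} := by rw [← h1, pow_one]
  obtain ⟨F', hF', e⟩ := h.exists_derB F.2 (h.mem_exc hx)
  have hmem : F' ∈ derCSub (b.comp (p.comp κ)) (excB p 𝔪 b) := by
    refine ⟨fun y hy => ?_, hF'⟩
    rw [h1'] at hy ⊢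
    obtain ⟨y, rfl⟩ := Ideal.mem_span_singleton'.mp hy
    rw [show F' (y * b (p x)) = y * F' (b (p x)) + b (p x) * F' y from hF'.map_mul _ _, e]
    exact add_mem (Ideal.mul_mem_left _ _ (Ideal.mul_mem_right _ _
      (Ideal.mem_span_singleton_self _))) (Ideal.mul_mem_right _ _ (Ideal.mem_span_singleton_self _))
  obtain ⟨χ, hχ⟩ := exists_hom_span h1 hx0
    (⟨F', hmem⟩ : derCSub (b.comp (p.comp κ)) (excB p 𝔪 b))
  refine ⟨χ, fun r hr hr' y => ?_⟩
  have h2 := hr'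
  rw [h1] at h2
  obtain ⟨w, hw⟩ := Ideal.mem_span_singleton'.mp h2
  rw [hχ w _ hr' hw.symm]
  change w * F' (b y) = _
  rw [e, ← hw, mul_assoc]

theorem uniq {ψ} (H : RelDer κ p 𝔪 b 0 ψ) : ψ = 0 := by
  obtain ⟨x, hx, h1, hx1, hx0, -⟩ := h.exists_pow_eq 1
  rw [pow_one] at hx
  exact hom_span_ext h1 hx1 <| Subtype.ext <|
    der_ext b (RingHom.id_comp b) (ψ ⟨b (p x), hx1⟩).2.2
      (T0 (b.comp (p.comp κ)) (RingHom.id B)).zero_mem h.fracB_nzd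
      fun y => (H x hx hx1 y).trans (mul_zero _)

theorem inj {F : T0 (p.comp κ) b} (H : RelDer κ p 𝔪 b F 0) : F = 0 := by
  obtain ⟨x, hx, h1, hx1, hx0, -⟩ := h.exists_pow_eq 1
  rw [pow_one] at hx
  refine Subtype.ext (funext fun y => eq_of_mul_nzd hx0 ?_)
  exact (H x hx hx1 y).symm.trans (mul_zero _).symm

theorem surj (hp : Function.Surjective p) (hres : ∀ r, ∃ c, r - κ c ∈ 𝔪) (ψ) :
    ∃ F, RelDer κ p 𝔪 b F ψ := by
  obtain ⟨x, hx, h1, hx1, hx0, -⟩ := h.exists_pow_eq 1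
  rw [pow_one] at hx
  have hD1 : IsDer (b.comp (p.comp κ)) (RingHom.id B) (ψ ⟨b (p x), hx1⟩).1 := (ψ ⟨b (p x), hx1⟩).2.2
  have hD2 := (ψ ⟨b (p x), hx1⟩).2.1
  obtain ⟨D, hD⟩ : ∃ D, D = (ψ ⟨b (p x), hx1⟩).1 := ⟨_, rfl⟩
  rw [← hD] at hD1 hD2
  have hdiv : ∀ y : A, ∃ c, b (p x) * c = D (b y) := fun y => by
    obtain ⟨y, rfl⟩ := hp y
    obtain ⟨c, hc⟩ := hres y
    have h2 : D (b (p y)) = D (b (p (y - κ c))) + D (b (p (κ c))) := by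
      rw [← hD1.map_add, ← map_add, ← map_add, sub_add_cancel]
    have h3 : D (b (p (κ c))) = 0 := hD1.map_base c
    rw [h2, h3, add_zero]
    have h4 : D (b (p (y - κ c))) ∈ excB p 𝔪 b := hD2 _ (h.mem_exc hc)
    rw [← pow_one (excB p 𝔪 b), h1] at h4
    obtain ⟨w, hw⟩ := Ideal.mem_span_singleton'.mp h4
    exact ⟨w, (mul_comm _ _).trans hw⟩
  choose F hF using hdiv
  refine ⟨⟨F, ⟨fun y z => eq_of_mul_nzd hx0 ?_, fun y z => eq_of_mul_nzd hx0 ?_,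
    fun c => eq_of_mul_nzd hx0 ?_⟩⟩, fun r hr hr' y => ?_⟩
  · rw [mul_add, hF, hF, hF, map_add, hD1.map_add]
  · rw [hF, RingHom.map_mul, hD1.map_mul, mul_add, mul_left_comm, hF, mul_left_comm, hF]; rfl
  · rw [hF, mul_zero]; exact hD1.map_base c
  · have h2 := hr'
    rw [h1] at h2
    obtain ⟨w, hw⟩ := Ideal.mem_span_singleton'.mp h2
    rw [hom_span_apply ψ hx1 hr' hw.symm, ← hw]
    change w * (ψ ⟨b (p x), hx1⟩).1 (b y) = _
    rw [← hD, ← hF, mul_assoc]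

theorem nat (h' : IsChart κ p 𝔪 a' b' τ') (hβ : β.comp b = b') {F : T0 (p.comp κ) b}
    {F' : T0 (p.comp κ) b'} (hF : ∀ y, β (F.1 y) = F'.1 y) {ψ ψ'} (H : RelDer κ p 𝔪 b F ψ)
    (H' : RelDer κ p 𝔪 b' F' ψ') :
    ∃ x, excB p 𝔪 b ^ 1 = Ideal.span {x} ∧ ∀ hx hx' z, β ((ψ ⟨x, hx⟩).1 z) =
      (ψ' ⟨β x, hx'⟩).1 (β z) := by
  obtain ⟨x, hx, h1, hx1, hx0, -⟩ := h.exists_pow_eq 1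
  rw [pow_one] at hx
  have e : ∀ y, β (b y) = b' y := fun y => DFunLike.congr_fun hβ y
  refine ⟨b (p x), h1, fun hx1 hx2 z => ?_⟩
  obtain ⟨u, hu⟩ : ∃ u, u = β (b (p x)) := ⟨_, rfl⟩
  have hx2' := hx2
  rw [← hu] at hx2'
  have h3 : ψ' ⟨β (b (p x)), hx2⟩ = ψ' ⟨u, hx2'⟩ := congrArg ψ' (Subtype.ext hu.symm)
  rw [h3]
  rw [e] at hu
  subst hu
  have hD1 : IsDer (b.comp (p.comp κ)) (RingHom.id B) (ψ ⟨b (p x), hx1⟩).1 := (ψ ⟨b (p x), hx1⟩).2.2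
  have hD2 : IsDer (b'.comp (p.comp κ)) (RingHom.id B') (ψ' ⟨b' (p x), hx2'⟩).1 :=
    (ψ' ⟨b' (p x), hx2'⟩).2.2
  have e1 : IsDer (b.comp (p.comp κ)) β fun z => β ((ψ ⟨b (p x), hx1⟩).1 z) :=
    T0_comp (RingHom.comp_id β) hD1
  have e2 : IsDer (b.comp (p.comp κ)) β fun z => (ψ' ⟨b' (p x), hx2'⟩).1 (β z) :=
    ⟨fun u v => by rw [map_add, hD2.map_add], fun u v => by rw [RingHom.map_mul, hD2.map_mul]; rfl,
      fun c => (congrArg _ (e _)).trans (hD2.map_base c)⟩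
  refine congrFun (der_ext b hβ e1 e2 (h.fracB_nzd' h') fun y => ?_) z
  rw [H x hx hx1 y, map_mul, e, e, hF, H' x hx hx2' y]

end RelDer

end
end QLSing

namespace QLSing
noncomputable section

open nonZeroDivisors

/-! ### `T¹` of a quotient `R = P/I` of a localized polynomial ring -/

section KerPres

variable {k R R' P P' B B' : Type} [CommRing k] [CommRing R] [CommRing R'] [CommRing P]
  [CommRing P'] [CommRing B] [CommRing B'] {ι : k →+* R} {ι' : k →+* R'} {κ : k →+* P}
  {κ' : k →+* P'} {q : P →+* R} {q' : P' →+* R'} {φ : R →+* B} {φ' : R →+* B'}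

/-- The presentation of `P/I`, with the free module on the set `I`. -/
def kerPres (κ : k →+* P) (q : P →+* R) (h : q.comp κ = ι) (hq : Function.Surjective q) : Pres ι :=
  freePres κ q h hq (Subtype.val : RingHom.ker q → P)
    (by rw [Subtype.range_coe_subtype]; exact (Ideal.span_eq _).symm)

/-- The class of a homomorphism `I → B`. -/
def clK (h : q.comp κ = ι) (hq : Function.Surjective q) (φ : R →+* B) :
    (↥(RingHom.ker q) →ₛₗ[φ.comp q] B) →ₗ[B] T1 ι φ :=
  (kerPres κ q h hq).cl1 φ

variable (h : q.comp κ = ι) (hq : Function.Surjective q) (h' : q'.comp κ' = ι')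
  (hq' : Function.Surjective q')

theorem kerPres_good (hκ : IsLocPoly κ) : (kerPres κ q h hq).Good :=
  ⟨hκ, freePres_hasModLift⟩

theorem clK_surjective (hκ : IsLocPoly κ) : Function.Surjective (clK h hq φ) :=
  (kerPres_good h hq hκ).cl1_surjective

theorem clK_eq_zero (hκ : IsLocPoly κ) {ψ : ↥(RingHom.ker q) →ₛₗ[φ.comp q] B} :
    clK h hq φ ψ = 0 ↔ ∃ D : P → B, IsDer κ (φ.comp q) D ∧ ∀ f : RingHom.ker q, ψ f = D f :=
  (kerPres_good h hq hκ).cl1_eq_zero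

theorem clK_coeff {β : B →+* B'} (hβ : β.comp φ = φ') {ψ : ↥(RingHom.ker q) →ₛₗ[φ.comp q] B}
    {χ : ↥(RingHom.ker q) →ₛₗ[φ'.comp q] B'} (e : ∀ f, β (ψ f) = χ f) :
    T1.coeff ι β hβ (clK h hq φ ψ) = clK h hq φ' χ := by
  have h1 : β.comp (φ.comp q) = φ'.comp q := by rw [← hβ, RingHom.comp_assoc]
  have h2 : homCoeff β h1 ψ = χ := LinearMap.ext e
  rw [← h2]
  exact (kerPres κ q h hq).cl1_coeff β hβ h1 ψ

theorem clK_pull (hκ : IsLocPoly κ) {ρ : R →+* R'} {α : P →+* P'} (hα : q'.comp α = ρ.comp q)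
    (hακ : α.comp κ = κ') (hρ : ρ.comp ι = ι') {ϕ : R' →+* B} (hφ : ϕ.comp ρ = φ)
    {ψ : ↥(RingHom.ker q') →ₛₗ[ϕ.comp q'] B} {χ : ↥(RingHom.ker q) →ₛₗ[φ.comp q] B}
    (e : ∀ f f', α f.1 = f'.1 → χ f = ψ f') :
    T1.pull hρ hφ (clK h' hq' ϕ ψ) = clK h hq φ χ := by
  obtain ⟨l, hl⟩ := (kerPres_good h hq hκ).exists_lift_of (X' := kerPres κ' q' h' hq') hα hακ
  refine (l.cl1_pull hρ hφ ψ).trans (congrArg (clK h hq φ) (LinearMap.ext fun f => (e f _ ?_).symm))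
  change α f.1 = l.α f.1
  rw [hl]
  rfl

end KerPres

theorem isLocPoly_self {P : Type} [CommRing P] : IsLocPoly (RingHom.id P) := by
  refine ⟨Empty, MvPolynomial.eval₂Hom (RingHom.id P) fun x => x.elim, ?_, ?_, ?_⟩
  · exact RingHom.ext fun x => by simp
  · exact fun z => ⟨1, MvPolynomial.C z, by simp, by simp⟩
  · refine fun z hz => ⟨1, by simp, ?_⟩
    obtain ⟨c, rfl⟩ := MvPolynomial.C_surjective Empty z
    rw [show c = 0 by simpa using hz, map_zero, mul_zero]

variable {k P A Q B Q' B' : Type} [CommRing k] [CommRing P] [CommRing A] [CommRing Q] [CommRing B]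
  [CommRing Q'] [CommRing B'] {κ : k →+* P} {p : P →+* A} {𝔪 : Ideal P}
  {a : P →+* Q} {b : A →+* B} {τ : Q →+* B} {a' : P →+* Q'} {b' : A →+* B'} {τ' : Q' →+* B'}
  {α : Q →+* Q'} {β : B →+* B'}

/-! ### Normal modules -/

theorem clK_self_eq_zero (hp : Function.Surjective p) {φ : ↥(RingHom.ker p) →ₛₗ[b.comp p] B} :
    clK (RingHom.comp_id p) hp b φ = 0 ↔ φ = 0 := by
  refine ⟨fun h => ?_, fun h => by rw [h, map_zero]⟩
  obtain ⟨D, hD, e⟩ := (clK_eq_zero _ hp isLocPoly_self).mp h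
  exact LinearMap.ext fun f => (e f).trans (hD.map_base f.1)

/-- The order of the elements of `I` is at least two, and an element of order `n` is a
combination of elements of `I` with coefficients of order `n - 2`. -/
structure QuadraticKer (p : P →+* A) (𝔪 : Ideal P) : Prop where
  le_sq : RingHom.ker p ≤ 𝔪 ^ 2
  inf_le : ∀ n, RingHom.ker p ⊓ 𝔪 ^ n ≤ 𝔪 ^ (n - 2) * RingHom.ker p

namespace IsChart

variable (h : IsChart κ p 𝔪 a b τ)
include h

theorem a_mem_ker {f : P} (hf : f ∈ RingHom.ker p) : a f ∈ RingHom.ker τ := by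
  rw [RingHom.mem_ker, h.τ_a, RingHom.mem_ker.mp hf, map_zero]

theorem mem_ker_of_a {f : P} (hf : a f ∈ RingHom.ker τ) : f ∈ RingHom.ker p := by
  rw [RingHom.mem_ker, h.τ_a] at hf
  exact h.injB (hf.trans (map_zero b).symm)

/-- The map `I → J` of the ideals of `A` and `B`. -/
def kerMap : ↥(RingHom.ker p) →ₛₗ[a] ↥(RingHom.ker τ) where
  toFun f := ⟨a f.1, h.a_mem_ker f.2⟩
  map_add' _ _ := Subtype.ext (map_add a _ _)
  map_smul' _ _ := Subtype.ext (map_mul a _ _)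

theorem ker_frac (z : RingHom.ker τ) : ∃ s f, (b.comp p) s ∈ B⁰ ∧ a s • z = h.kerMap f := by
  obtain ⟨s, r, hs, e⟩ := h.frac_nzd z.1
  exact ⟨s, ⟨r, h.mem_ker_of_a (by rw [← e]; exact Ideal.mul_mem_left _ _ z.2)⟩, hs, Subtype.ext e⟩

theorem ker_frac' (h' : IsChart κ p 𝔪 a' b' τ') (z : RingHom.ker τ) :
    ∃ s f, (b'.comp p) s ∈ B'⁰ ∧ a s • z = h.kerMap f := by
  obtain ⟨s, r, hs, e⟩ := h.frac_nzd' h' z.1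
  exact ⟨s, ⟨r, h.mem_ker_of_a (by rw [← e]; exact Ideal.mul_mem_left _ _ z.2)⟩, hs, Subtype.ext e⟩

theorem apply_mem (φ : ↥(RingHom.ker p) →ₛₗ[b.comp p] B) (hQ : QuadraticKer p 𝔪) {n : ℕ}
    (f : RingHom.ker p) (hf : f.1 ∈ 𝔪 ^ n) : φ f ∈ excB p 𝔪 b ^ (n - 2) := by
  have key : ∀ r ∈ 𝔪 ^ (n - 2) * RingHom.ker p, ∃ hr : r ∈ RingHom.ker p,
      φ ⟨r, hr⟩ ∈ excB p 𝔪 b ^ (n - 2) := fun r hr => by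
    refine Submodule.mul_induction_on hr (fun s hs t ht => ⟨Ideal.mul_mem_left _ _ ht, ?_⟩) ?_
    · have := φ.map_smulₛₗ s ⟨t, ht⟩
      exact (congrArg (· ∈ _) this).mpr (Ideal.mul_mem_right _ _ (h.mem_exc_pow hs))
    · rintro s t ⟨hs, hs'⟩ ⟨ht, ht'⟩
      exact ⟨add_mem hs ht, (congrArg (· ∈ _) (φ.map_add ⟨s, hs⟩ ⟨t, ht⟩)).mpr (add_mem hs' ht')⟩
  exact (key f.1 (hQ.inf_le n ⟨f.2, hf⟩)).2

/-- A homomorphism `I → B` extends to `J → B` after multiplication with an element of `E²`. -/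
theorem exists_extend (hQ : QuadraticKer p 𝔪) (φ : ↥(RingHom.ker p) →ₛₗ[b.comp p] B) {c : B}
    (hc : c ∈ excB p 𝔪 b ^ 2) :
    ∃ φ' : ↥(RingHom.ker τ) →ₛₗ[τ] B, ∀ f, φ' (h.kerMap f) = c * φ f := by
  refine exists_semilinear_extension a τ h.comm h.kerMap (c • φ) (fun f hf => ?_) h.frac_nzd
    fun z => ?_
  · have : f = 0 := Subtype.ext (h.injQ ((Subtype.ext_iff.mp hf).trans (map_zero a).symm))
    rw [this, map_zero]
  · obtain ⟨n, r, hr, q, hq, h0, hE, e⟩ := h.exists_frac z.1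
    have hrk := h.mem_ker_of_a (by rw [← e]; exact Ideal.mul_mem_left _ _ z.2)
    have h1 := Ideal.mul_mem_mul hc (h.apply_mem φ hQ ⟨r, hrk⟩ hr)
    rw [← pow_add] at h1
    have h2 := Ideal.pow_le_pow_right (show n ≤ 2 + (n - 2) by omega) h1
    rw [hE] at h2
    obtain ⟨w, hw⟩ := Ideal.mem_span_singleton'.mp h2
    exact ⟨q, ⟨r, hrk⟩, w, h0, Subtype.ext e, (mul_comm _ _).trans hw⟩

end IsChart

/-- `ψ(c)` restricts to `c φ` on `I`, where `t` is the class of `φ`. -/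
def RelNormal (p : P →+* A) (hp : Function.Surjective p) (𝔪 : Ideal P) (a : P →+* Q) (b : A →+* B)
    (τ : Q →+* B) (t : T1 p b) (ψ : ↥(excB p 𝔪 b ^ 2) →ₗ[B] (↥(RingHom.ker τ) →ₛₗ[τ] B)) : Prop :=
  ∃ φ : ↥(RingHom.ker p) →ₛₗ[b.comp p] B, clK (RingHom.comp_id p) hp b φ = t ∧
    ∀ r ∈ 𝔪 ^ 2, ∀ hr : b (p r) ∈ excB p 𝔪 b ^ 2, ∀ f (g : RingHom.ker τ), a f.1 = g.1 →
      ψ ⟨b (p r), hr⟩ g = b (p r) * φ f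

namespace RelNormal

variable {hp : Function.Surjective p}

theorem add {t t' : T1 p b} {ψ ψ'} (H : RelNormal p hp 𝔪 a b τ t ψ)
    (H' : RelNormal p hp 𝔪 a b τ t' ψ') : RelNormal p hp 𝔪 a b τ (t + t') (ψ + ψ') := by
  obtain ⟨φ, rfl, H⟩ := H
  obtain ⟨φ', rfl, H'⟩ := H'
  exact ⟨φ + φ', map_add _ _ _, fun r hr h f g e =>
    (congrArg₂ _ (H r hr h f g e) (H' r hr h f g e)).trans (mul_add _ _ _).symm⟩

theorem smul {t : T1 p b} {ψ} (c : B) (H : RelNormal p hp 𝔪 a b τ t ψ) :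
    RelNormal p hp 𝔪 a b τ (c • t) (c • ψ) := by
  obtain ⟨φ, rfl, H⟩ := H
  exact ⟨c • φ, map_smul _ _ _, fun r hr h f g e =>
    (congrArg (c * ·) (H r hr h f g e)).trans (mul_left_comm _ _ _)⟩

variable (h : IsChart κ p 𝔪 a b τ)
include h

theorem total (hQ : QuadraticKer p 𝔪) (t : T1 p b) : ∃ ψ, RelNormal p hp 𝔪 a b τ t ψ := by
  obtain ⟨φ, rfl⟩ := clK_surjective (RingHom.comp_id p) hp isLocPoly_self t
  obtain ⟨x, hx, h1, hx1, hx0, -⟩ := h.exists_pow_eq 2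
  obtain ⟨φ', hφ'⟩ := h.exists_extend hQ φ hx1
  obtain ⟨χ, hχ⟩ := exists_hom_span h1 hx0 φ'
  refine ⟨χ, φ, rfl, fun r hr hr' f g e => ?_⟩
  have h2 := hr'
  rw [h1] at h2
  obtain ⟨w, hw⟩ := Ideal.mem_span_singleton'.mp h2
  rw [hχ w _ hr' hw.symm, ← hw, show g = h.kerMap f from Subtype.ext e.symm, LinearMap.smul_apply,
    hφ', smul_eq_mul, mul_assoc]

theorem uniq {ψ} (H : RelNormal p hp 𝔪 a b τ 0 ψ) : ψ = 0 := by
  obtain ⟨φ, h0, H⟩ := H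
  rw [clK_self_eq_zero] at h0
  subst h0
  obtain ⟨x, hx, h1, hx1, hx0, -⟩ := h.exists_pow_eq 2
  exact hom_span_ext h1 hx1 <| semilinear_ext a h.comm h.ker_frac fun f =>
    (H x hx hx1 f _ rfl).trans (mul_zero _)

theorem inj {t : T1 p b} (H : RelNormal p hp 𝔪 a b τ t 0) : t = 0 := by
  obtain ⟨φ, rfl, H⟩ := H
  obtain ⟨x, hx, h1, hx1, hx0, -⟩ := h.exists_pow_eq 2
  rw [clK_self_eq_zero]
  exact LinearMap.ext fun f => eq_of_mul_nzd hx0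
    ((H x hx hx1 f (h.kerMap f) rfl).symm.trans (mul_zero _).symm)

theorem surj (hQ : QuadraticKer p 𝔪) (ψ) : ∃ t, RelNormal p hp 𝔪 a b τ t ψ := by
  obtain ⟨x, hx, h1, hx1, hx0, hm⟩ := h.exists_pow_eq 2
  obtain ⟨φ, hφ⟩ := exists_div (homPull h.comm h.kerMap (ψ ⟨b (p x), hx1⟩)) hx0 fun f => by
    have h2 : a f.1 ∈ (𝔪 ^ 2).map a := Ideal.mem_map_of_mem a (hQ.le_sq f.2)
    rw [hm] at h2
    obtain ⟨z, hz⟩ := Ideal.mem_span_singleton'.mp h2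
    have hz0 : z ∈ RingHom.ker τ := by
      have h3 := h.a_mem_ker f.2
      rw [← hz, RingHom.mem_ker, map_mul, h.τ_a, mul_comm] at h3
      exact (mul_right_mem_nonZeroDivisors_eq_zero_iff hx0).mp ((mul_comm _ _).trans h3)
    refine ⟨ψ ⟨b (p x), hx1⟩ ⟨z, hz0⟩, ?_⟩
    have h4 := (ψ ⟨b (p x), hx1⟩).map_smulₛₗ (a x) ⟨z, hz0⟩
    rw [h.τ_a] at h4
    refine h4.symm.trans (congrArg _ (Subtype.ext ?_))
    exact (mul_comm _ _).trans hz
  refine ⟨_, φ, rfl, fun r hr hr' f g e => ?_⟩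
  have h2 := hr'
  rw [h1] at h2
  obtain ⟨w, hw⟩ := Ideal.mem_span_singleton'.mp h2
  rw [hom_span_apply ψ hx1 hr' hw.symm, ← hw, show g = h.kerMap f from Subtype.ext e.symm,
    mul_assoc, hφ]
  rfl

theorem nat (h' : IsChart κ p 𝔪 a' b' τ') (hα : α.comp a = a') (hβ : β.comp b = b')
    (hτ : τ'.comp α = β.comp τ) {t : T1 p b} {t' : T1 p b'} (ht : T1.coeff p β hβ t = t') {ψ ψ'}
    (H : RelNormal p hp 𝔪 a b τ t ψ) (H' : RelNormal p hp 𝔪 a' b' τ' t' ψ') :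
    ∃ x, excB p 𝔪 b ^ 2 = Ideal.span {x} ∧ ∀ hx hx' f g, g.1 = α f.1 → β (ψ ⟨x, hx⟩ f) =
      ψ' ⟨β x, hx'⟩ g := by
  obtain ⟨φ, rfl, H⟩ := H
  obtain ⟨φ', rfl, H'⟩ := H'
  have e : ∀ y, β (b y) = b' y := fun y => DFunLike.congr_fun hβ y
  have eφ : homCoeff β (by rw [← hβ, RingHom.comp_assoc]) φ = φ' := by
    rw [clK_coeff _ hp hβ (χ := homCoeff β (by rw [← hβ, RingHom.comp_assoc]) φ) fun _ => rfl,
      ← sub_eq_zero, ← map_sub, clK_self_eq_zero, sub_eq_zero] at ht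
    exact ht
  obtain ⟨x, hx, h1, hx1, hx0, -⟩ := h.exists_pow_eq 2
  refine ⟨b (p x), h1, fun hx1 hx2 f g hg => ?_⟩
  obtain ⟨u, hu⟩ : ∃ u, u = β (b (p x)) := ⟨_, rfl⟩
  have hx2' := hx2
  rw [← hu] at hx2'
  have h3 : ψ' ⟨β (b (p x)), hx2⟩ = ψ' ⟨u, hx2'⟩ := congrArg ψ' (Subtype.ext hu.symm)
  rw [h3]
  rw [e] at hu
  subst hu
  have hα' : ∀ z, τ' (α z) = β (τ z) := fun z => DFunLike.congr_fun hτ z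
  let m : ↥(RingHom.ker τ) →ₛₗ[α] ↥(RingHom.ker τ') :=
    { toFun := fun f => ⟨α f.1, by rw [RingHom.mem_ker, hα', RingHom.mem_ker.mp f.2, map_zero]⟩
      map_add' := fun _ _ => Subtype.ext (map_add α _ _)
      map_smul' := fun _ _ => Subtype.ext (map_mul α _ _) }
  have h4 : homCoeff β (σ' := τ'.comp α) hτ.symm (ψ ⟨b (p x), hx1⟩) =
      homPull rfl m (ψ' ⟨b' (p x), hx2'⟩) :=
    semilinear_ext a (σ := b'.comp p) (by rw [RingHom.comp_assoc, hα, h'.comm]) (h.ker_frac' h')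
      fun f => by
        refine (congrArg β (H x hx hx1 f (h.kerMap f) rfl)).trans ?_
        refine Eq.trans ?_ (H' x hx hx2' f (m (h.kerMap f)) (DFunLike.congr_fun hα f.1).symm).symm
        rw [map_mul, e, ← eφ]; rfl
  refine (DFunLike.congr_fun h4 f).trans ?_
  exact congrArg (ψ' ⟨b' (p x), hx2'⟩) (Subtype.ext hg.symm)

end RelNormal

end
end QLSing

namespace QLSing
noncomputable section

open nonZeroDivisors

set_option linter.unusedSectionVars false

variable {k P A Q B Q' B' : Type} [CommRing k] [CommRing P] [CommRing A] [CommRing Q] [CommRing B]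
  [CommRing Q'] [CommRing B'] {κ : k →+* P} {p : P →+* A} {𝔪 : Ideal P}
  {a : P →+* Q} {b : A →+* B} {τ : Q →+* B} {a' : P →+* Q'} {b' : A →+* B'} {τ' : Q' →+* B'}
  {α : Q →+* Q'} {β : B →+* B'}

/-! ### The exact sequence for `T¹` on a chart -/

/-- The restriction of a derivation to an ideal on which `σ` vanishes. -/
def derRes {κ : k →+* Q} {σ : Q →+* B} {D : Q → B} (hD : IsDer κ σ D) (J : Ideal Q)
    (hJ : ∀ z ∈ J, σ z = 0) : J →ₛₗ[σ] B where
  toFun z := D z.1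
  map_add' y z := hD.map_add _ _
  map_smul' c z := by
    refine (hD.map_mul c z.1).trans ?_
    rw [hJ _ z.2, zero_mul, add_zero]; rfl

theorem IsDer.map_zero' {κ : k →+* Q} {σ : Q →+* B} {D : Q → B} (hD : IsDer κ σ D) : D 0 = 0 := by
  rw [← map_zero κ]; exact hD.map_base 0

theorem IsDer.sub' {κ : k →+* Q} {σ : Q →+* B} {D D' : Q → B} (hD : IsDer κ σ D)
    (hD' : IsDer κ σ D') : IsDer κ σ fun z => D z - D' z :=
  (T0 κ σ).sub_mem hD hD'

theorem IsDer.add' {κ : k →+* Q} {σ : Q →+* B} {D D' : Q → B} (hD : IsDer κ σ D)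
    (hD' : IsDer κ σ D') : IsDer κ σ fun z => D z + D' z :=
  (T0 κ σ).add_mem hD hD'

theorem IsDer.smul' {κ : k →+* Q} {σ : Q →+* B} {D : Q → B} (c : B) (hD : IsDer κ σ D) :
    IsDer κ σ fun z => c * D z :=
  (T0 κ σ).smul_mem c hD

theorem IsDer.comp' {κ : k →+* P} {κ' : k →+* Q} {γ : P →+* Q} (hκ : γ.comp κ = κ') {σ : Q →+* B}
    {σ' : P →+* B} (hσ : σ.comp γ = σ') {D : Q → B} (hD : IsDer κ' σ D) :
    IsDer κ σ' fun z => D (γ z) := by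
  subst hκ hσ
  exact ⟨fun y z => by rw [RingHom.map_add, hD.map_add], fun y z => by rw [RingHom.map_mul, hD.map_mul]; rfl,
    hD.map_base⟩

/-- `Der(B) → Hom(E, B/E)`. -/
def thetaNormal (ι : k →+* B) (E : Ideal B) : T0 ι (RingHom.id B) →ₗ[B] E →ₗ[B] B ⧸ E where
  toFun D :=
    { toFun := fun f => Ideal.Quotient.mk _ (D.1 f.1)
      map_add' := fun f g => by
        rw [← map_add]; exact congrArg _ (IsDer.map_add D.2 f.1 g.1)
      map_smul' := fun r f => by
        have h1 : D.1 (r * f.1) = r * D.1 f.1 + f.1 * D.1 r := IsDer.map_mul D.2 r f.1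
        change Ideal.Quotient.mk _ (D.1 (r * f.1)) = _
        rw [h1, map_add, Ideal.Quotient.eq_zero_iff_mem.mpr (Ideal.mul_mem_right _ _ f.2),
          add_zero]
        rfl }
  map_add' _ _ := rfl
  map_smul' _ _ := rfl

namespace IsChart

theorem comm_base (h : IsChart κ p 𝔪 a b τ) : τ.comp (a.comp κ) = b.comp (p.comp κ) := by
  rw [← RingHom.comp_assoc, h.comm, RingHom.comp_assoc]

/-- The class of a homomorphism `J → B'`, for `β : B → B'`. -/
def clB (h : IsChart κ p 𝔪 a b τ) (β : B →+* B') :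
    (↥(RingHom.ker τ) →ₛₗ[β.comp τ] B') →ₗ[B'] T1 (b.comp (p.comp κ)) β :=
  clK h.comm_base h.surj β

/-- The class of a homomorphism `I → B`. -/
def clA (_ : IsChart κ p 𝔪 a b τ) (hp : Function.Surjective p) :
    (↥(RingHom.ker p) →ₛₗ[b.comp p] B) →ₗ[B] T1 (p.comp κ) b :=
  clK rfl hp b

variable (h : IsChart κ p 𝔪 a b τ)

theorem clB_surjective : Function.Surjective (h.clB β) :=
  clK_surjective _ _ h.isLocPoly

theorem clA_surjective (hκ : IsLocPoly κ) (hp : Function.Surjective p) :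
    Function.Surjective (h.clA hp) :=
  clK_surjective _ _ hκ

theorem clA_eq (hκ : IsLocPoly κ) {hp : Function.Surjective p}
    {φ φ' : ↥(RingHom.ker p) →ₛₗ[b.comp p] B} :
    h.clA hp φ = h.clA hp φ' ↔ ∃ D, IsDer κ (b.comp p) D ∧ ∀ f, φ f = φ' f + D f.1 := by
  rw [← sub_eq_zero, ← map_sub]
  refine (clK_eq_zero _ _ hκ).trans ?_
  simp only [LinearMap.sub_apply, sub_eq_iff_eq_add']

theorem clB_eq {φ φ' : ↥(RingHom.ker τ) →ₛₗ[β.comp τ] B'} :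
    h.clB β φ = h.clB β φ' ↔ ∃ D, IsDer (a.comp κ) (β.comp τ) D ∧ ∀ f, φ f = φ' f + D f.1 := by
  rw [← sub_eq_zero, ← map_sub]
  refine (clK_eq_zero _ _ h.isLocPoly).trans ?_
  simp only [LinearMap.sub_apply, sub_eq_iff_eq_add']

/-- Homomorphisms on `J` with the same class: it suffices that their difference on `I` is given by
a multiple of a derivation of `P` or by a derivation of `Q`. -/
theorem clB_eq_of (h' : IsChart κ p 𝔪 a' b' τ') (hα : α.comp a = a') (hβ : β.comp b = b')
    (hτ : τ'.comp α = β.comp τ) {φ φ' : ↥(RingHom.ker τ) →ₛₗ[β.comp τ] B'} {F : P → B'} {D : Q → B'}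
    (hF : IsDer κ (b'.comp p) F) (hD : IsDer (a.comp κ) (β.comp τ) D) {c : B'}
    (hc : c ∈ excB p 𝔪 b') (e : ∀ f, φ (h.kerMap f) = φ' (h.kerMap f) + c * F f.1 + D (a f.1)) :
    h.clB β φ = h.clB β φ' := by
  obtain ⟨F', hF', eF⟩ := h'.exists_der hF hc
  have hF'' : IsDer (a.comp κ) (β.comp τ) fun z => F' (α z) :=
    hF'.comp' (by rw [← RingHom.comp_assoc, hα]) hτ
  have hD2 := hF''.add' hD
  have hσ : (β.comp τ).comp a = b'.comp p := by
    rw [RingHom.comp_assoc, h.comm, ← RingHom.comp_assoc, hβ]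
  refine h.clB_eq.mpr ⟨_, hD2, fun f => ?_⟩
  have key : φ = φ' + derRes hD2 (RingHom.ker τ) fun z hz => by
      rw [RingHom.comp_apply, RingHom.mem_ker.mp hz, map_zero] :=
    semilinear_ext a hσ (h.ker_frac' h') fun f => by
      have h1 : F' (α (a f.1)) = c * F f.1 := by
        rw [← eF, ← hα]; rfl
      rw [e, add_assoc, ← h1]
      rfl
  exact DFunLike.congr_fun key f

/-- Derivations of `P` with values in `E` on `𝔪` can be divided by an equation of `E`. -/
theorem exists_der_div (hres : ∀ r, ∃ c, r - κ c ∈ 𝔪) {D : P → B} (hD : IsDer κ (b.comp p) D)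
    {x : B} (hx : x ∈ B⁰) (hE : ∀ r ∈ 𝔪, ∃ c, x * c = D r) :
    ∃ F, IsDer κ (b.comp p) F ∧ ∀ r, x * F r = D r := by
  have hdiv : ∀ r, ∃ c, x * c = D r := fun r => by
    obtain ⟨c, hc⟩ := hres r
    have h2 : D r = D (r - κ c) + D (κ c) := by
      rw [← hD.map_add, sub_add_cancel]
    rw [h2, hD.map_base, add_zero]
    exact hE _ hc
  choose F hF using hdiv
  refine ⟨F, ⟨fun y z => eq_of_mul_nzd hx ?_, fun y z => eq_of_mul_nzd hx ?_,
    fun c => eq_of_mul_nzd hx ?_⟩, hF⟩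
  · rw [mul_add, hF, hF, hF, hD.map_add]
  · rw [hF, hD.map_mul, mul_add, mul_left_comm, hF, mul_left_comm, hF]
  · rw [hF, mul_zero, hD.map_base]

/-- A homomorphism on `J`, restricted to `I`, is divisible by `x²`. -/
theorem exists_div_sq (hQ : QuadraticKer p 𝔪) (φ' : ↥(RingHom.ker τ) →ₛₗ[τ] B) {x : P}
    (hx0 : b (p x) ∈ B⁰) (hm : 𝔪.map a = Ideal.span {a x}) :
    ∃ φ : ↥(RingHom.ker p) →ₛₗ[b.comp p] B,
      ∀ f, b (p x) * (b (p x) * φ f) = φ' (h.kerMap f) := by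
  obtain ⟨φ, hφ⟩ := exists_div (y := b (p x) * b (p x)) (homPull h.comm h.kerMap φ')
      (mul_mem hx0 hx0) fun f => by
    have h2 : a f.1 ∈ (𝔪 ^ 2).map a := Ideal.mem_map_of_mem a (hQ.le_sq f.2)
    rw [Ideal.map_pow, hm, Ideal.span_singleton_pow] at h2
    obtain ⟨z, hz⟩ := Ideal.mem_span_singleton'.mp h2
    have hz0 : z ∈ RingHom.ker τ := by
      have h3 := h.a_mem_ker f.2
      rw [← hz, RingHom.mem_ker, map_mul, map_pow, h.τ_a] at h3
      exact (mul_right_mem_nonZeroDivisors_eq_zero_iff (pow_mem hx0 2)).mp h3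
    refine ⟨φ' ⟨z, hz0⟩, ?_⟩
    have h4 := φ'.map_smulₛₗ (a x ^ 2) ⟨z, hz0⟩
    rw [map_pow, h.τ_a, smul_eq_mul] at h4
    rw [← pow_two]
    refine h4.symm.trans (congrArg φ' (Subtype.ext ?_))
    exact (mul_comm _ _).trans hz
  exact ⟨φ, fun f => by rw [← mul_assoc, hφ]; rfl⟩

end IsChart

theorem exists_smul_of_mem {N : Type} [AddCommGroup N] [Module B N] {E : Ideal B} {x : B}
    (hE : E = Ideal.span {x}) {t : N} (ht : t ∈ (E • ⊤ : Submodule B N)) : ∃ u, t = x • u := by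
  subst hE
  refine Submodule.smul_induction_on ht (fun r hr u _ => ?_) ?_
  · obtain ⟨w, rfl⟩ := Ideal.mem_span_singleton'.mp hr
    exact ⟨w • u, by rw [smul_smul, mul_comm]⟩
  · rintro _ _ ⟨u, rfl⟩ ⟨v, rfl⟩
    exact ⟨u + v, (smul_add _ _ _).symm⟩

/-- The relation between `𝔪 T¹(A; B)` and `Hom(E, T¹(B; B))`. -/
def RelG (h : IsChart κ p 𝔪 a b τ) (hp : Function.Surjective p)
    (t : (excB p 𝔪 b • ⊤ : Submodule B (T1 (p.comp κ) b)))
    (ψ : ↥(excB p 𝔪 b ^ 1) →ₗ[B] T1 (b.comp (p.comp κ)) (RingHom.id B)) : Prop :=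
  ∃ φ : ↥(RingHom.ker p) →ₛₗ[b.comp p] B, h.clA hp φ = t.1 ∧
    ∀ r ∈ 𝔪, ∀ hr : b (p r) ∈ excB p 𝔪 b ^ 1, ∃ φ' : ↥(RingHom.ker τ) →ₛₗ[τ] B,
      (∀ f, φ' (h.kerMap f) = b (p r) * φ f) ∧ h.clB (RingHom.id B) φ' = ψ ⟨b (p r), hr⟩

namespace RelG

variable {h : IsChart κ p 𝔪 a b τ} {hp : Function.Surjective p}

theorem add {t t'} {ψ ψ'} (H : RelG h hp t ψ) (H' : RelG h hp t' ψ') :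
    RelG h hp (t + t') (ψ + ψ') := by
  obtain ⟨φ, e, H⟩ := H
  obtain ⟨φ', e', H'⟩ := H'
  refine ⟨φ + φ', (map_add _ _ _).trans (congrArg₂ _ e e'), fun r hr hr' => ?_⟩
  obtain ⟨χ, h1, h2⟩ := H r hr hr'
  obtain ⟨χ', h1', h2'⟩ := H' r hr hr'
  exact ⟨χ + χ', fun f => (congrArg₂ _ (h1 f) (h1' f)).trans (mul_add _ _ _).symm,
    (map_add (h.clB (RingHom.id B)) χ χ').trans (congrArg₂ _ h2 h2')⟩

theorem smul {t} {ψ} (c : B) (H : RelG h hp t ψ) : RelG h hp (c • t) (c • ψ) := by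
  obtain ⟨φ, e, H⟩ := H
  refine ⟨c • φ, (map_smul _ _ _).trans (congrArg (c • ·) e), fun r hr hr' => ?_⟩
  obtain ⟨χ, h1, h2⟩ := H r hr hr'
  exact ⟨c • χ, fun f => (congrArg (c * ·) (h1 f)).trans (mul_left_comm _ _ _),
    (map_smul (h.clB (RingHom.id B)) c χ).trans (congrArg (c • ·) h2)⟩

variable (h)

theorem mk {φ : ↥(RingHom.ker p) →ₛₗ[b.comp p] B} {t} (ht : h.clA hp φ = t.1) {x : P}
    (hE : excB p 𝔪 b ^ 1 = Ideal.span {b (p x)}) (hx1 : b (p x) ∈ excB p 𝔪 b ^ 1) {ψ}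
    {φ' : ↥(RingHom.ker τ) →ₛₗ[τ] B} (e : ∀ f, φ' (h.kerMap f) = b (p x) * φ f)
    (hψ : h.clB (RingHom.id B) φ' = ψ ⟨b (p x), hx1⟩) : RelG h hp t ψ := by
  refine ⟨φ, ht, fun r hr hr' => ?_⟩
  have h2 := hr'
  rw [hE] at h2
  obtain ⟨w, hw⟩ := Ideal.mem_span_singleton'.mp h2
  refine ⟨w • φ', fun f => ?_, ?_⟩
  · rw [← hw, LinearMap.smul_apply, e, smul_eq_mul, mul_assoc]
  · rw [hom_span_apply ψ hx1 hr' hw.symm, ← hψ]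
    exact map_smul (h.clB (RingHom.id B)) w φ'

theorem total (hκ : IsLocPoly κ) (hQ : QuadraticKer p 𝔪) (t) : ∃ ψ, RelG h hp t ψ := by
  obtain ⟨x, hx, h1, hx1, hx0, -⟩ := h.exists_pow_eq 1
  have h1' : excB p 𝔪 b = Ideal.span {b (p x)} := by rw [← h1, pow_one]
  have k := exists_smul_of_mem h1' t.2
  obtain ⟨u, hu⟩ := k
  obtain ⟨φ, rfl⟩ := h.clA_surjective hκ hp u
  have hx2 : b (p x) * b (p x) ∈ excB p 𝔪 b ^ 2 := by
    rw [pow_one] at hx1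
    rw [pow_two]; exact Ideal.mul_mem_mul hx1 hx1
  obtain ⟨φ', hφ'⟩ := h.exists_extend hQ φ hx2
  obtain ⟨ψ, hψ⟩ := exists_hom_span h1 hx0 (h.clB (RingHom.id B) φ')
  refine ⟨ψ, mk h (φ := b (p x) • φ) ((map_smul _ _ _).trans hu.symm) h1 hx1 (φ' := φ') (fun f => ?_) ?_⟩
  · rw [hφ', mul_assoc]; rfl
  · rw [hψ 1 _ hx1 (one_mul _).symm, one_smul]

theorem surj (hQ : QuadraticKer p 𝔪) (ψ) : ∃ t, RelG h hp t ψ := by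
  obtain ⟨x, hx, h1, hx1, hx0, hm⟩ := h.exists_pow_eq 1
  rw [pow_one] at hm
  obtain ⟨φ', hφ'⟩ := h.clB_surjective (ψ ⟨b (p x), hx1⟩)
  obtain ⟨φ, hφ⟩ := h.exists_div_sq hQ φ' hx0 hm
  refine ⟨⟨h.clA hp (b (p x) • φ), ?_⟩, mk h (φ := b (p x) • φ) rfl h1 hx1 (φ' := φ') (fun f => ?_) hφ'⟩
  · rw [map_smul]
    exact Submodule.smul_mem_smul (by simpa using hx1) trivial
  · exact (hφ f).symm

theorem nat (h' : IsChart κ p 𝔪 a' b' τ') (hκ : IsLocPoly κ) (hα : α.comp a = a')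
    (hβ : β.comp b = b') (hτ : τ'.comp α = β.comp τ) {t} {t'}
    (ht : T1.coeff (p.comp κ) β hβ t.1 = t'.1) {ψ ψ'} (H : RelG h hp t ψ) (H' : RelG h' hp t' ψ') :
    ∃ x, excB p 𝔪 b ^ 1 = Ideal.span {x} ∧ ∀ hx hx',
      T1.coeff (b.comp (p.comp κ)) (φ' := β) β (RingHom.comp_id _) (ψ ⟨x, hx⟩) =
        T1.pull (φ' := RingHom.id B') (by rw [← hβ, RingHom.comp_assoc]) (RingHom.id_comp _)
          (ψ' ⟨β x, hx'⟩) := by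
  obtain ⟨φ, e, H⟩ := H
  obtain ⟨χ, e', H'⟩ := H'
  have eβ : ∀ y, β (b y) = b' y := fun y => DFunLike.congr_fun hβ y
  have e1 : h'.clA hp (homCoeff β (by rw [← hβ, RingHom.comp_assoc]) φ) = h'.clA hp χ := by
    rw [e', ← ht, ← e]
    exact (clK_coeff rfl hp hβ fun _ => rfl).symm
  obtain ⟨D, hD, eD⟩ := (h'.clA_eq hκ).mp e1
  obtain ⟨x, hx, h1, hx1, hx0, hm⟩ := h.exists_pow_eq 1
  rw [pow_one] at hx
  refine ⟨b (p x), h1, fun hx1 hx2 => ?_⟩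
  have hx2' := hx2
  rw [eβ] at hx2'
  have h3 : ψ' ⟨β (b (p x)), hx2⟩ = ψ' ⟨b' (p x), hx2'⟩ := congrArg ψ' (Subtype.ext (eβ _))
  obtain ⟨φ', h4, h5⟩ := H x hx hx1
  obtain ⟨χ', h4', h5'⟩ := H' x hx hx2'
  rw [h3, ← h5, ← h5']
  have hα' : ∀ z, τ' (α z) = β (τ z) := fun z => DFunLike.congr_fun hτ z
  let m : ↥(RingHom.ker τ) →ₛₗ[α] ↥(RingHom.ker τ') :=
    { toFun := fun f => ⟨α f.1, by rw [RingHom.mem_ker, hα', RingHom.mem_ker.mp f.2, map_zero]⟩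
      map_add' := fun _ _ => Subtype.ext (map_add α _ _)
      map_smul' := fun _ _ => Subtype.ext (map_mul α _ _) }
  have hpull : T1.pull (φ' := RingHom.id B') (by rw [← hβ, RingHom.comp_assoc]) (RingHom.id_comp _)
      (h'.clB (RingHom.id B') χ') = h.clB β (homPull hτ m χ') :=
    clK_pull _ _ _ _ h.isLocPoly hτ (by rw [← RingHom.comp_assoc, hα]) _ _
      fun f f' e => congrArg χ' (Subtype.ext e)
  refine Eq.trans ?_ hpull.symm
  refine (clK_coeff _ _ _ (χ := homCoeff β rfl φ') fun _ => rfl).trans ?_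
  refine h.clB_eq_of h' hα hβ hτ hD (T0 (a.comp κ) (β.comp τ)).zero_mem (h'.mem_exc hx) fun f => ?_
  have h6 : χ' (m (h.kerMap f)) = χ' (h'.kerMap f) :=
    congrArg χ' (Subtype.ext (DFunLike.congr_fun hα f.1))
  have h7 : β (φ f) = χ f + D f.1 := eD f
  change β (φ' (h.kerMap f)) = χ' (m (h.kerMap f)) + b' (p x) * D f.1 + 0
  rw [h6, h4, h4', map_mul, eβ, h7]
  ring

theorem uniq (hκ : IsLocPoly κ) {ψ} (H : RelG h hp 0 ψ) : ψ = 0 := by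
  obtain ⟨φ, e, H⟩ := H
  obtain ⟨x, hx, h1, hx1, hx0, -⟩ := h.exists_pow_eq 1
  rw [pow_one] at hx
  obtain ⟨D, hD, eD⟩ := (h.clA_eq hκ).mp (e.trans (map_zero (h.clA hp)).symm)
  obtain ⟨φ', h4, h5⟩ := H x hx hx1
  refine hom_span_ext h1 hx1 ?_
  rw [← h5, ← map_zero (h.clB (RingHom.id B))]
  refine h.clB_eq_of h (RingHom.id_comp a) (RingHom.id_comp b) rfl hD
    (T0 (a.comp κ) τ).zero_mem (h.mem_exc hx) fun f => ?_
  change φ' (h.kerMap f) = 0 + b (p x) * D f.1 + 0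
  rw [h4, eD]
  simp

end RelG

end
end QLSing

namespace QLSing
noncomputable section

open nonZeroDivisors

set_option linter.unusedSectionVars false

variable {k P A Q B Q' B' : Type} [CommRing k] [CommRing P] [CommRing A] [CommRing Q] [CommRing B]
  [CommRing Q'] [CommRing B'] {κ : k →+* P} {p : P →+* A} {𝔪 : Ideal P}
  {a : P →+* Q} {b : A →+* B} {τ : Q →+* B} {a' : P →+* Q'} {b' : A →+* B'} {τ' : Q' →+* B'}
  {α : Q →+* Q'} {β : B →+* B'}

/-- `D` and `μ` are the components on `J` and on `E` of the extension of `φ`. -/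
structure RelFAt (h : IsChart κ p 𝔪 a b τ) (c : B) (φ : ↥(RingHom.ker p) →ₛₗ[b.comp p] B)
    (D : Q → B) (μ : ↥(excB p 𝔪 b) →ₗ[B] B ⧸ excB p 𝔪 b) : Prop where
  der : IsDer (a.comp κ) τ D
  onI : ∀ f : RingHom.ker p, D (a f.1) = c * φ f
  onE : ∀ d ∈ 𝔪, ∀ hd : b (p d) ∈ excB p 𝔪 b, μ ⟨b (p d), hd⟩ = Ideal.Quotient.mk _ (D (a d))

/-- `Hom(E, coker (Der(B) → Hom(E, B/E)))`. -/
abbrev HomA1 (κ : k →+* P) (p : P →+* A) (𝔪 : Ideal P) (b : A →+* B) : Type :=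
  ↥(excB p 𝔪 b ^ 1) →ₗ[B] (↥(excB p 𝔪 b) →ₗ[B] B ⧸ excB p 𝔪 b) ⧸
    LinearMap.range (thetaNormal (b.comp (p.comp κ)) (excB p 𝔪 b))

/-- The relation between `Hom(E, coker (Der(B) → Hom(E, B/E)))` and `𝔪 T¹(A; B)`. -/
def RelF (h : IsChart κ p 𝔪 a b τ) (hp : Function.Surjective p) (l : HomA1 κ p 𝔪 b)
    (t : (excB p 𝔪 b • ⊤ : Submodule B (T1 (p.comp κ) b))) : Prop :=
  ∃ φ : ↥(RingHom.ker p) →ₛₗ[b.comp p] B, h.clA hp φ = t.1 ∧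
    ∀ r ∈ 𝔪, ∀ hr : b (p r) ∈ excB p 𝔪 b ^ 1, ∃ D μ, RelFAt h (b (p r)) φ D μ ∧
      l ⟨b (p r), hr⟩ = Submodule.Quotient.mk μ

namespace RelF

variable {h : IsChart κ p 𝔪 a b τ} {hp : Function.Surjective p}

theorem add {l l' : HomA1 κ p 𝔪 b} {t t'} (H : RelF h hp l t) (H' : RelF h hp l' t') :
    RelF h hp (l + l') (t + t') := by
  obtain ⟨φ, e, H⟩ := H
  obtain ⟨φ', e', H'⟩ := H'
  refine ⟨φ + φ', (map_add _ _ _).trans (congrArg₂ _ e e'), fun r hr hr' => ?_⟩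
  obtain ⟨D, μ, h1, h2⟩ := H r hr hr'
  obtain ⟨D', μ', h1', h2'⟩ := H' r hr hr'
  refine ⟨_, μ + μ', ⟨h1.der.add' h1'.der, fun f => ?_, fun d hd hd' => ?_⟩,
    congrArg₂ (· + ·) h2 h2'⟩
  · rw [h1.onI, h1'.onI, ← mul_add]; rfl
  · rw [LinearMap.add_apply, h1.onE d hd, h1'.onE d hd, map_add]

theorem smul {l : HomA1 κ p 𝔪 b} {t} (c : B) (H : RelF h hp l t) : RelF h hp (c • l) (c • t) := by
  obtain ⟨φ, e, H⟩ := H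
  refine ⟨c • φ, (map_smul _ _ _).trans (congrArg (c • ·) e), fun r hr hr' => ?_⟩
  obtain ⟨D, μ, h1, h2⟩ := H r hr hr'
  refine ⟨_, c • μ, ⟨h1.der.smul' c, fun f => ?_, fun d hd hd' => ?_⟩, congrArg (c • ·) h2⟩
  · rw [h1.onI, LinearMap.smul_apply, smul_eq_mul, mul_left_comm]
  · rw [LinearMap.smul_apply, h1.onE d hd, map_mul]; rfl

variable (h)

theorem mk {l : HomA1 κ p 𝔪 b} {φ : ↥(RingHom.ker p) →ₛₗ[b.comp p] B} {t}
    (ht : h.clA hp φ = t.1) {x : P}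
    (hE : excB p 𝔪 b ^ 1 = Ideal.span {b (p x)}) (hx1 : b (p x) ∈ excB p 𝔪 b ^ 1)
    {D μ} (H : RelFAt h (b (p x)) φ D μ) (hl : l ⟨b (p x), hx1⟩ = Submodule.Quotient.mk μ) :
    RelF h hp l t := by
  refine ⟨φ, ht, fun r hr hr' => ?_⟩
  have h2 := hr'
  rw [hE] at h2
  obtain ⟨w, hw⟩ := Ideal.mem_span_singleton'.mp h2
  refine ⟨fun z => w * D z, w • μ, ⟨H.der.smul' w, fun f => ?_, fun d hd hd' => ?_⟩, ?_⟩
  · rw [H.onI, ← hw, mul_assoc]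
  · rw [LinearMap.smul_apply, H.onE d hd, map_mul]; rfl
  · rw [hom_span_apply l hx1 hr' hw.symm, hl]; rfl

include h in
theorem onE_of {x : P} (hm : 𝔪.map a = Ideal.span {a x})
    (hx1 : b (p x) ∈ excB p 𝔪 b) {D : Q → B} (hD : IsDer (a.comp κ) τ D)
    {μ : ↥(excB p 𝔪 b) →ₗ[B] B ⧸ excB p 𝔪 b}
    (hμ : μ ⟨b (p x), hx1⟩ = Ideal.Quotient.mk _ (D (a x))) {d : P} (hd : d ∈ 𝔪)
    (hd' : b (p d) ∈ excB p 𝔪 b) : μ ⟨b (p d), hd'⟩ = Ideal.Quotient.mk _ (D (a d)) := by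
  have h1 := Ideal.mem_map_of_mem a hd
  rw [hm] at h1
  obtain ⟨v, hv⟩ := Ideal.mem_span_singleton'.mp h1
  have h2 : b (p d) = τ v * b (p x) := by rw [← h.τ_a, ← hv, map_mul, h.τ_a]
  rw [hom_span_apply μ hx1 hd' h2, hμ, ← hv, hD.map_mul, map_add, h.τ_a,
    Ideal.Quotient.eq_zero_iff_mem.mpr (Ideal.mul_mem_right (D v) _ hx1), add_zero, map_mul]
  rfl

theorem total (hQ : QuadraticKer p 𝔪) (l : HomA1 κ p 𝔪 b) : ∃ t, RelF h hp l t := by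
  obtain ⟨x, hx, hm, hx0, hn, hD⟩ := h.exists_coord
  have h1 : excB p 𝔪 b ^ 1 = Ideal.span {b (p x)} := by simpa using hn 1
  have hx1 := h.mem_exc hx
  have hx1' : b (p x) ∈ excB p 𝔪 b ^ 1 := by rwa [pow_one]
  obtain ⟨μ, hμ⟩ := Submodule.mkQ_surjective _ (l ⟨b (p x), hx1'⟩)
  obtain ⟨y, hy⟩ := Ideal.Quotient.mk_surjective (μ ⟨b (p x), hx1⟩)
  obtain ⟨D, hD, hDx⟩ := hD y
  obtain ⟨φ, hφ⟩ := h.exists_div_sq hQ (derRes hD (RingHom.ker τ) fun z hz => hz) hx0 hm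
  refine ⟨⟨h.clA hp (b (p x) • φ), ?_⟩, mk h (φ := b (p x) • φ) (D := D) (μ := μ) rfl h1 hx1'
    ⟨hD, fun f => (hφ f).symm, fun d hd hd' =>
      onE_of h hm hx1 hD (by rw [hDx, hy]) hd hd'⟩ hμ.symm⟩
  rw [map_smul]
  exact Submodule.smul_mem_smul hx1 trivial

theorem nat (h' : IsChart κ p 𝔪 a' b' τ') (hκ : IsLocPoly κ) (hres : ∀ r, ∃ c, r - κ c ∈ 𝔪)
    (hα : α.comp a = a') (hβ : β.comp b = b') (hτ : τ'.comp α = β.comp τ)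
    {l : HomA1 κ p 𝔪 b} {l' : HomA1 κ p 𝔪 b'} {t} {t'} (H : RelF h hp l t) (H' : RelF h' hp l' t')
    (hle : excB p 𝔪 b ≤ (excB p 𝔪 b').comap β)
    (hl : ∀ x hx hx', ∃ μ μ', l ⟨x, hx⟩ = Submodule.Quotient.mk μ ∧
      l' ⟨β x, hx'⟩ = Submodule.Quotient.mk μ' ∧
      ∀ f : excB p 𝔪 b, Ideal.quotientMap _ β hle (μ f) = μ' ⟨β f.1, hle f.2⟩) :
    T1.coeff (p.comp κ) β hβ t.1 = t'.1 := by
  obtain ⟨φ, e, H⟩ := H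
  obtain ⟨χ, e', H'⟩ := H'
  have eβ : ∀ y, β (b y) = b' y := fun y => DFunLike.congr_fun hβ y
  have eα : ∀ y, α (a y) = a' y := fun y => DFunLike.congr_fun hα y
  rw [← e, ← e']
  refine (clK_coeff (χ := homCoeff β (by rw [← hβ, RingHom.comp_assoc]) φ) rfl hp hβ
    fun _ => rfl).trans ?_
  obtain ⟨x, hx, hm, hx0, hn, -⟩ := h.exists_coord
  obtain ⟨x', hx', hm', hx0', hn', -⟩ := h'.exists_coord
  have hx1 : b (p x) ∈ excB p 𝔪 b ^ 1 := by rw [pow_one]; exact h.mem_exc hx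
  have hx2 : b' (p x) ∈ excB p 𝔪 b' ^ 1 := by rw [pow_one]; exact h'.mem_exc hx
  obtain ⟨D, μ, r1, r2⟩ := H x hx hx1
  obtain ⟨D', μ', r1', r2'⟩ := H' x hx hx2
  obtain ⟨ν, ν', s1, s2, s3⟩ := hl (b (p x)) hx1 (by rw [eβ]; exact hx2)
  have s2' : l' ⟨b' (p x), hx2⟩ = Submodule.Quotient.mk ν' :=
    (congrArg l' (Subtype.ext (eβ _).symm)).trans s2
  obtain ⟨θ, hθ⟩ := (Submodule.Quotient.eq _).mp (s1.symm.trans r2)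
  obtain ⟨θ', hθ'⟩ := (Submodule.Quotient.eq _).mp (s2'.symm.trans r2')
  have hθd : IsDer (b.comp (p.comp κ)) (RingHom.id B) θ.1 := θ.2
  have hθd' : IsDer (b'.comp (p.comp κ)) (RingHom.id B') θ'.1 := θ'.2
  have hσ : (β.comp τ).comp a = b'.comp p := by
    rw [RingHom.comp_assoc, h.comm, ← RingHom.comp_assoc, hβ]
  have d1 : IsDer (a.comp κ) (β.comp τ) fun z => β (D z) := T0_comp rfl r1.der
  have d2 : IsDer (a.comp κ) (β.comp τ) fun z => β (θ.1 (τ z)) :=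
    T0_comp rfl (hθd.comp' h.comm_base (RingHom.id_comp τ))
  have d3 : IsDer (a.comp κ) (β.comp τ) fun z => D' (α z) :=
    r1'.der.comp' (by rw [← RingHom.comp_assoc, hα]) hτ
  have d4 : IsDer (a.comp κ) (β.comp τ) fun z => θ'.1 (τ' (α z)) :=
    (hθd'.comp' h'.comm_base (RingHom.id_comp τ')).comp' (by rw [← RingHom.comp_assoc, hα]) hτ
  have d5 := ((d1.add' d2).sub' (d3.add' d4)).comp' rfl hσ
  have hx0' : b' (p x) ∈ B'⁰ := h'.nzd fun h0 => by
    have := h.domB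
    rw [map_eq_zero_iff b' h'.injB] at h0
    rw [h0, map_zero] at hx0
    have := h.domB
    exact nonZeroDivisors.ne_zero hx0 rfl
  have hE : excB p 𝔪 b' = Ideal.span {b' (p x)} := by
    have h1 : (excB p 𝔪 b).map β = excB p 𝔪 b' := by rw [excB, Ideal.map_map, hβ]
    have h2 := hn 1
    rw [pow_one, pow_one] at h2
    rw [← h1, show excB p 𝔪 b = Ideal.span {b (p x)} from h2, Ideal.map_span, Set.image_singleton, eβ]
  obtain ⟨F, hF, eF⟩ := IsChart.exists_der_div hres d5 hx0' fun r hr => by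
    have hr1 := h.mem_exc hr
    have hr2 := h'.mem_exc hr
    have e1 : ν ⟨b (p r), hr1⟩ = Ideal.Quotient.mk _ (D (a r) + θ.1 (b (p r))) := by
      rw [map_add, ← r1.onE r hr hr1]
      exact (sub_eq_iff_eq_add'.mp (LinearMap.congr_fun hθ ⟨b (p r), hr1⟩).symm)
    have e2 : ν' ⟨b' (p r), hr2⟩ = Ideal.Quotient.mk _ (D' (a' r) + θ'.1 (b' (p r))) := by
      rw [map_add, ← r1'.onE r hr hr2]
      exact (sub_eq_iff_eq_add'.mp (LinearMap.congr_fun hθ' ⟨b' (p r), hr2⟩).symm)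
    have e3 : ν' ⟨β (b (p r)), hle hr1⟩ = ν' ⟨b' (p r), hr2⟩ := congrArg ν' (Subtype.ext (eβ _))
    have e4 := (s3 ⟨b (p r), hr1⟩).trans (e3.trans e2)
    rw [e1, Ideal.quotientMap_mk, Ideal.Quotient.eq, hE] at e4
    obtain ⟨c, hc⟩ := Ideal.mem_span_singleton'.mp e4
    refine ⟨c, (mul_comm _ _).trans (hc.trans ?_)⟩
    rw [eα, h.τ_a, h'.τ_a, map_add]
  refine (h'.clA_eq hκ).mpr ⟨F, hF, fun f => eq_of_mul_nzd hx0' ?_⟩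
  have hf1 : τ (a f.1) = 0 := h.a_mem_ker f.2
  have hf2 : τ' (a' f.1) = 0 := h'.a_mem_ker f.2
  rw [mul_add, eF]
  change b' (p x) * β (φ f) = _
  rw [eα, hf1, hf2, hθd.map_zero', hθd'.map_zero', map_zero, r1.onI, r1'.onI, map_mul, eβ]
  ring

/-- The map from `Hom(E, 𝒜¹)` is injective. -/
theorem inj (hκ : IsLocPoly κ) {l : HomA1 κ p 𝔪 b} (H : RelF h hp l 0) : l = 0 := by
  obtain ⟨φ, e, H⟩ := H
  obtain ⟨x, hx, hm, hx0, hn, -⟩ := h.exists_coord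
  have h1 : excB p 𝔪 b ^ 1 = Ideal.span {b (p x)} := by simpa using hn 1
  have hE : excB p 𝔪 b = Ideal.span {b (p x)} := by rw [← h1, pow_one]
  have hx1 := h.mem_exc hx
  have hx1' : b (p x) ∈ excB p 𝔪 b ^ 1 := by rwa [pow_one]
  obtain ⟨F, hF, eF⟩ := (h.clA_eq hκ).mp (e.trans (map_zero (h.clA hp)).symm)
  obtain ⟨F', hF', eF'⟩ := h.exists_der hF hx1
  obtain ⟨D, μ, r1, r2⟩ := H x hx hx1'
  have hd := r1.der.sub' hF'
  have h0 : derRes hd (RingHom.ker τ) (fun z hz => hz) = 0 :=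
    semilinear_ext a h.comm h.ker_frac fun f => by
      change D (a f.1) - F' (a f.1) = 0
      rw [r1.onI, eF', eF, LinearMap.zero_apply, zero_add, sub_self]
  have hker : ∀ z, τ z = 0 → D z - F' z = 0 := fun z hz => DFunLike.congr_fun h0 ⟨z, hz⟩
  obtain ⟨θ, hθ, eθ⟩ := exists_der_extension τ h.comm_base (RingHom.id B) (RingHom.id_comp τ) hd hker
    fun z => by
      obtain ⟨y, rfl⟩ := h.surj z
      have e1 : D 1 - F' 1 = 0 := by
        have := hd.map_base 1
        rwa [map_one] at this
      exact ⟨1, y, D y - F' y, by rw [map_one]; exact one_mem _, by rw [map_one, one_mul], by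
        rw [map_one, one_mul, e1, mul_zero, sub_zero]⟩
  refine hom_span_ext h1 hx1' ?_
  rw [r2]
  refine (Submodule.Quotient.mk_eq_zero _).mpr ⟨⟨θ, hθ⟩, ?_⟩
  rw [← sub_eq_zero]
  refine hom_span_ext hE hx1 ?_
  rw [LinearMap.sub_apply, r1.onE x hx hx1]
  change Ideal.Quotient.mk _ (θ (b (p x))) - _ = 0
  rw [← h.τ_a, eθ, ← map_sub, Ideal.Quotient.eq_zero_iff_mem, eF', sub_sub_cancel_left, hE]
  exact neg_mem (Ideal.mul_mem_right _ _ (Ideal.mem_span_singleton_self _))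

/-- The composition of the maps of the exact sequence is zero. -/
theorem comp_eq_zero (hκ : IsLocPoly κ) {l : HomA1 κ p 𝔪 b} {t ψ} (H : RelF h hp l t)
    (H' : RelG h hp t ψ) : ψ = 0 := by
  obtain ⟨φ, e, H⟩ := H
  obtain ⟨χ, e', H'⟩ := H'
  obtain ⟨x, hx, h1, hx1, hx0, -⟩ := h.exists_pow_eq 1
  rw [pow_one] at hx
  obtain ⟨F, hF, eF⟩ := (h.clA_eq hκ).mp (e'.trans e.symm)
  obtain ⟨D, μ, r1, r2⟩ := H x hx hx1
  obtain ⟨φ', h4, h5⟩ := H' x hx hx1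
  refine hom_span_ext h1 hx1 ?_
  rw [← h5, ← map_zero (h.clB (RingHom.id B))]
  refine h.clB_eq_of h (RingHom.id_comp a) (RingHom.id_comp b) rfl hF r1.der (h.mem_exc hx) fun f => ?_
  change φ' (h.kerMap f) = 0 + b (p x) * F f.1 + D (a f.1)
  rw [h4, eF, r1.onI]
  ring

/-- The kernel of the map to `Hom(E, T¹(B; B))`. -/
theorem exists_of_relG {t} (H : RelG h hp t 0) : ∃ l, RelF h hp l t := by
  obtain ⟨φ, e, H⟩ := H
  obtain ⟨x, hx, hm, hx0, hn, -⟩ := h.exists_coord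
  have h1 : excB p 𝔪 b ^ 1 = Ideal.span {b (p x)} := by simpa using hn 1
  have hE : excB p 𝔪 b = Ideal.span {b (p x)} := by rw [← h1, pow_one]
  have hx1 := h.mem_exc hx
  have hx1' : b (p x) ∈ excB p 𝔪 b ^ 1 := by rwa [pow_one]
  obtain ⟨φ', h4, h5⟩ := H x hx hx1'
  obtain ⟨D, hD, eD⟩ := h.clB_eq.mp (h5.trans (map_zero (h.clB (RingHom.id B))).symm)
  obtain ⟨μ, hμ⟩ := exists_hom_span hE hx0 (Ideal.Quotient.mk (excB p 𝔪 b) (D (a x)))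
  obtain ⟨l, hl⟩ := exists_hom_span h1 hx0
    (Submodule.Quotient.mk (p := LinearMap.range (thetaNormal (b.comp (p.comp κ)) (excB p 𝔪 b))) μ)
  refine ⟨l, mk h (D := D) (μ := μ) e h1 hx1' ⟨hD, fun f => ?_, fun d hd hd' => ?_⟩ ?_⟩
  · rw [← h4]
    exact ((eD (h.kerMap f)).trans (zero_add _)).symm
  · exact onE_of h hm hx1 hD (by rw [hμ 1 _ hx1 (one_mul _).symm, one_smul]) hd hd'
  · rw [hl 1 _ hx1' (one_mul _).symm, one_smul]

end RelF

end
end QLSing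

namespace QLSing
noncomputable section

/-! ### `T²` of a quotient of a localized polynomial ring -/

section FreeQuot

variable {P Q N : Type} [CommRing P] [CommRing Q] [AddCommGroup N] {ν : Type}

/-- The quotient of the free module by the trivial relations between the `v i`. -/
abbrev FreeQuot (v : ν → P) : Type := (ν →₀ P) ⧸ freeRel₀ v

namespace FreeQuot

variable (v : ν → P) (w : ν → Q)

/-- The map to `P`. -/
def j : FreeQuot v →ₗ[P] P :=
  (freeRel₀ v).liftQ (Finsupp.linearCombination P v) (freeRel₀_le v)

/-- The basis elements. -/
def of (i : ν) : FreeQuot v := Submodule.Quotient.mk (Finsupp.single i 1)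

/-- The relations modulo the trivial relations. -/
def rel : Submodule P (FreeQuot v) :=
  (LinearMap.ker (Finsupp.linearCombination P v)).map (freeRel₀ v).mkQ

theorem j_of (i : ν) : j v (of v i) = v i := by
  change Finsupp.linearCombination P v (Finsupp.single i 1) = v i
  simp

theorem mem_rel {u : FreeQuot v} : u ∈ rel v ↔ j v u = 0 := by
  constructor
  · rintro ⟨z, hz, rfl⟩; exact hz
  · intro h
    obtain ⟨z, rfl⟩ := Submodule.Quotient.mk_surjective _ u
    exact ⟨z, h, rfl⟩

theorem peiffer (x y : FreeQuot v) : j v x • y = j v y • x := by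
  obtain ⟨x, rfl⟩ := Submodule.Quotient.mk_surjective _ x
  obtain ⟨y, rfl⟩ := Submodule.Quotient.mk_surjective _ y
  exact (Submodule.Quotient.eq _).mpr (Submodule.subset_span ⟨x, y, rfl⟩)

variable {v w}

theorem induction {p : FreeQuot v → Prop} (of : ∀ i, p (of v i)) (add : ∀ x y, p x → p y → p (x + y))
    (smul : ∀ (c : P) x, p x → p (c • x)) (zero : p 0) (u : FreeQuot v) : p u := by
  obtain ⟨z, rfl⟩ := Submodule.Quotient.mk_surjective _ u
  induction z using Finsupp.induction_linear with
  | zero => exact zero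
  | add x y hx hy => exact add _ _ hx hy
  | single i c =>
    have := smul c _ (of i)
    rwa [FreeQuot.of, ← Submodule.Quotient.mk_smul, Finsupp.smul_single, smul_eq_mul, mul_one] at this

theorem exists_hom [Module Q N] (σ : P →+* Q) (n : ν → N)
    (h : ∀ i j, σ (v i) • n j = σ (v j) • n i) :
    ∃ χ : FreeQuot v →ₛₗ[σ] N, ∀ i, χ (of v i) = n i := by
  let χ₀ : (ν →₀ P) →ₛₗ[σ] N :=
    { toFun := fun z => z.sum fun i c => σ c • n i
      map_add' := fun z w => Finsupp.sum_add_index' (by simp) (by simp [add_smul])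
      map_smul' := fun c z => by
        rw [Finsupp.sum_smul_index' (by simp), Finsupp.smul_sum]
        exact Finset.sum_congr rfl fun i _ => by
          change σ (c * z i) • n i = σ c • σ (z i) • n i
          rw [map_mul, mul_smul] }
  have e0 : ∀ i c, χ₀ (Finsupp.single i c) = σ c • n i := fun i c =>
    Finsupp.sum_single_index (h := fun i c => σ c • n i) (by rw [map_zero, zero_smul])
  have key : ∀ x y : ν →₀ P, σ (Finsupp.linearCombination P v x) • χ₀ y =
      σ (Finsupp.linearCombination P v y) • χ₀ x := by
    intro x y
    induction x using Finsupp.induction_linear with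
    | zero => simp
    | add x x' hx hx' => simp only [map_add, add_smul, smul_add, hx, hx']
    | single i c =>
      induction y using Finsupp.induction_linear with
      | zero => simp
      | add y y' hy hy' => simp only [map_add, add_smul, smul_add, hy, hy']
      | single j d =>
        rw [e0, e0]
        simp only [Finsupp.linearCombination_single, smul_eq_mul, map_mul, smul_smul]
        rw [mul_right_comm, mul_smul, h, smul_smul]
        congr 1; ring
  refine ⟨Submodule.liftQ _ χ₀ (Submodule.span_le.mpr ?_), fun i => ?_⟩
  · rintro _ ⟨x, y, rfl⟩
    change χ₀ _ = 0
    rw [map_sub, LinearMap.map_smulₛₗ, LinearMap.map_smulₛₗ, key, sub_self]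
  · change χ₀ (Finsupp.single i 1) = _
    rw [e0, map_one, one_smul]

theorem hom_ext [Module Q N] {σ : P →+* Q} {χ χ' : FreeQuot v →ₛₗ[σ] N}
    (h : ∀ i, χ (of v i) = χ' (of v i)) : χ = χ' :=
  LinearMap.ext fun u => induction (p := fun u => χ u = χ' u) h
    (fun x y hx hy => by rw [map_add, map_add, hx, hy])
    (fun c x hx => by rw [LinearMap.map_smulₛₗ, LinearMap.map_smulₛₗ, hx]) (by simp) u

theorem exists_scale (α : P →+* Q) (c c' : Q) (h : ∀ i, α (v i) = c * w i) :
    ∃ m : FreeQuot v →ₛₗ[α] FreeQuot w, (∀ i, m (of v i) = c' • of w i) ∧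
      ∀ u, c * j w (m u) = c' * α (j v u) := by
  obtain ⟨m, hm⟩ := exists_hom α (fun i => c' • of w i) fun i k => by
    have := peiffer w (of w i) (of w k)
    rw [j_of, j_of] at this
    rw [h i, h k, smul_smul, smul_smul, mul_right_comm c, mul_right_comm c (w k), mul_smul, this,
      ← mul_smul]
  refine ⟨m, hm, fun u => ?_⟩
  refine induction (p := fun u => c * j w (m u) = c' * α (j v u)) (fun i => ?_) (fun x y hx hy => ?_) (fun r x hx => ?_) (by simp) u
  · rw [hm, map_smul, j_of, j_of, h, smul_eq_mul]; ring
  · simp only [map_add, mul_add, hx, hy]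
  · rw [LinearMap.map_smulₛₗ, map_smul, map_smul, smul_eq_mul, smul_eq_mul, map_mul, mul_left_comm,
      hx]; ring

end FreeQuot

end FreeQuot

section

variable {k R R' P P' B B' ν ν' : Type} [CommRing k] [CommRing R] [CommRing R'] [CommRing P]
  [CommRing P'] [CommRing B] [CommRing B'] {ι : k →+* R} {ι' : k →+* R'} {κ : k →+* P}
  {κ' : k →+* P'} {q : P →+* R} {q' : P' →+* R'} {φ : R →+* B} {φ' : R →+* B'} {v : ν → P}
  {v' : ν' → P'}

/-- The class of a homomorphism on the relations. -/
def clR (h : q.comp κ = ι) (hq : Function.Surjective q)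
    (hv : RingHom.ker q = Ideal.span (Set.range v)) (φ : R →+* B) :
    (↥(FreeQuot.rel v) →ₛₗ[φ.comp q] B) →ₗ[B] T2 ι φ :=
  (freePres κ q h hq v hv).cl2 φ

variable (h : q.comp κ = ι) (hq : Function.Surjective q) (h' : q'.comp κ' = ι')
  (hq' : Function.Surjective q') (hv : RingHom.ker q = Ideal.span (Set.range v))
  (hv' : RingHom.ker q' = Ideal.span (Set.range v'))

theorem freePres_good (hκ : IsLocPoly κ) : (freePres κ q h hq v hv).Good :=
  ⟨hκ, freePres_hasModLift⟩

theorem clR_surjective (hκ : IsLocPoly κ) : Function.Surjective (clR h hq hv φ) :=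
  (freePres_good h hq hv hκ).cl2_surjective

theorem clR_eq (hκ : IsLocPoly κ) {ψ ψ' : ↥(FreeQuot.rel v) →ₛₗ[φ.comp q] B} :
    clR h hq hv φ ψ = clR h hq hv φ ψ' ↔
      ∃ χ : FreeQuot v →ₛₗ[φ.comp q] B, ∀ r : FreeQuot.rel v, ψ r = ψ' r + χ r := by
  rw [← sub_eq_zero, ← map_sub]
  refine (freePres_good h hq hv hκ).cl2_eq_zero.trans ?_
  refine exists_congr fun χ => forall_congr' fun r => ?_
  exact sub_eq_iff_eq_add'

theorem clR_coeff {β : B →+* B'} (hβ : β.comp φ = φ') {ψ : ↥(FreeQuot.rel v) →ₛₗ[φ.comp q] B}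
    {χ : ↥(FreeQuot.rel v) →ₛₗ[φ'.comp q] B'} (e : ∀ f, β (ψ f) = χ f) :
    T2.coeff ι β hβ (clR h hq hv φ ψ) = clR h hq hv φ' χ := by
  have h1 : β.comp (φ.comp q) = φ'.comp q := by rw [← hβ, RingHom.comp_assoc]
  have h2 : homCoeff β h1 ψ = χ := LinearMap.ext e
  rw [← h2]
  exact (freePres κ q h hq v hv).cl2_coeff β hβ h1 ψ

theorem clR_pull {ρ : R →+* R'} {α : P →+* P'} (hα : q'.comp α = ρ.comp q)
    (hακ : α.comp κ = κ') (hρ : ρ.comp ι = ι') {ϕ : R' →+* B} (hφ : ϕ.comp ρ = φ)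
    {ψ : ↥(FreeQuot.rel v') →ₛₗ[ϕ.comp q'] B} {χ : ↥(FreeQuot.rel v) →ₛₗ[φ.comp q] B}
    (m : FreeQuot v →ₛₗ[α] FreeQuot v') (hm : ∀ u, FreeQuot.j v' (m u) = α (FreeQuot.j v u))
    (e : ∀ r r', m r.1 = r'.1 → χ r = ψ r') :
    T2.pull hρ hφ (clR h' hq' hv' ϕ ψ) = clR h hq hv φ χ := by
  let l : Lift (freePres κ q h hq v hv) (freePres κ' q' h' hq' v' hv') ρ :=
    { α := α, base := hακ, comm := hα, m := m, comm_m := hm }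
  exact (l.cl2_pull hρ hφ ψ).trans
    (congrArg (clR h hq hv φ) (LinearMap.ext fun r => (e r _ rfl).symm))

end

end
end QLSing

namespace QLSing
noncomputable section

open nonZeroDivisors

set_option linter.unusedSectionVars false

variable {k P A Q B Q' B' : Type} [CommRing k] [CommRing P] [CommRing A] [CommRing Q] [CommRing B]
  [CommRing Q'] [CommRing B'] {κ : k →+* P} {p : P →+* A} {𝔪 : Ideal P}
  {a : P →+* Q} {b : A →+* B} {τ : Q →+* B} {a' : P →+* Q'} {b' : A →+* B'} {τ' : Q' →+* B'}
  {α : Q →+* Q'} {β : B →+* B'} {n : ℕ} {f : Fin n → P} {x : P} {g : Fin n → Q}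
  {x' : P} {g' : Fin n → Q'}

/-! ### The isomorphism for `T²` on a chart -/

/-- The relations have linear entries, and relations of order `N` are combinations of relations with
coefficients of order `N - 1`. -/
structure LinearRel (f : Fin n → P) (𝔪 : Ideal P) : Prop where
  mem : ∀ ρ ∈ relModule f, ∀ i, ρ i ∈ 𝔪
  mem_smul : ∀ N, ∀ ρ ∈ relModule f, (∀ i, ρ i ∈ 𝔪 ^ N) → ρ ∈ 𝔪 ^ (N - 1) • relModule f

namespace FreeQuot

/-- The class of a vector. -/
def ofVec (f : Fin n → P) : (Fin n → P) →ₗ[P] FreeQuot f :=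
  (freeRel₀ f).mkQ ∘ₗ (Finsupp.linearEquivFunOnFinite P P (Fin n)).symm.toLinearMap

theorem ofVec_apply (ρ : Fin n → P) : ofVec f ρ = ∑ i, ρ i • of f i := by
  change (freeRel₀ f).mkQ ((Finsupp.linearEquivFunOnFinite P P (Fin n)).symm ρ) = _
  rw [← Finsupp.univ_sum_single ((Finsupp.linearEquivFunOnFinite P P (Fin n)).symm ρ), map_sum]
  refine Finset.sum_congr rfl fun i _ => ?_
  rw [of, ← Submodule.Quotient.mk_smul, Finsupp.smul_single, smul_eq_mul, mul_one]
  rfl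

theorem exists_ofVec (u : FreeQuot f) : ∃ ρ, ofVec f ρ = u := by
  obtain ⟨z, rfl⟩ := Submodule.Quotient.mk_surjective _ u
  exact ⟨Finsupp.linearEquivFunOnFinite P P (Fin n) z, congrArg (freeRel₀ f).mkQ
    ((Finsupp.linearEquivFunOnFinite P P (Fin n)).symm_apply_apply z)⟩

theorem j_ofVec (ρ : Fin n → P) : j f (ofVec f ρ) = Fintype.linearCombination P f ρ := by
  rw [ofVec_apply, map_sum, Fintype.linearCombination_apply]
  exact Finset.sum_congr rfl fun i _ => by rw [map_smul, j_of]

theorem ofVec_mem_rel {ρ : Fin n → P} : ofVec f ρ ∈ rel f ↔ ρ ∈ relModule f := by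
  rw [mem_rel, j_ofVec]; rfl

theorem map_ofVec {α : P →+* Q} {g : Fin n → Q} {m : FreeQuot f →ₛₗ[α] FreeQuot g} {c : Q}
    (hm : ∀ i, m (of f i) = c • of g i) (ρ : Fin n → P) :
    m (ofVec f ρ) = c • ofVec g fun i => α (ρ i) := by
  rw [ofVec_apply, ofVec_apply, map_sum, Finset.smul_sum]
  exact Finset.sum_congr rfl fun i _ => by rw [LinearMap.map_smulₛₗ, hm, smul_comm]

end FreeQuot

open FreeQuot

/-- Equations of the strict transform. -/
structure StrictEq (h : IsChart κ p 𝔪 a b τ) (f : Fin n → P) (x : P) (g : Fin n → Q) : Prop where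
  mem : x ∈ 𝔪
  map_eq : 𝔪.map a = Ideal.span {a x}
  nzd : b (p x) ∈ B⁰
  pow_eq : ∀ N, excB p 𝔪 b ^ N = Ideal.span {b (p (x ^ N))}
  eq : ∀ i, a (f i) = a (x ^ 2) * g i

namespace IsChart

variable (h : IsChart κ p 𝔪 a b τ)
include h

theorem eq_of_x_mul (hx : b (p x) ∈ B⁰) {N : ℕ} {y z : Q} (e : a (x ^ N) * y = a (x ^ N) * z) :
    y = z := by
  have := h.domQ
  have hx0 : a x ≠ 0 := fun h0 => by
    have h1 := h.τ_a x
    rw [h0, map_zero] at h1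
    rw [← h1] at hx
    have := h.domB
    exact nonZeroDivisors.ne_zero hx rfl
  rw [map_pow] at e
  exact mul_left_cancel₀ (pow_ne_zero N hx0) e

theorem exists_strictEq (hQ : QuadraticKer p 𝔪) (hf : RingHom.ker p = Ideal.span (Set.range f)) :
    ∃ x g, StrictEq h f x g := by
  obtain ⟨x, hx, hm, hx0, hn, hn'⟩ := h.exists_eq
  have key : ∀ i, ∃ z, a (f i) = a (x ^ 2) * z := fun i => by
    have h1 : f i ∈ RingHom.ker p := by rw [hf]; exact Ideal.subset_span ⟨i, rfl⟩
    have h2 := Ideal.mem_map_of_mem a (hQ.le_sq h1)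
    rw [hn] at h2
    obtain ⟨z, hz⟩ := Ideal.mem_span_singleton'.mp h2
    exact ⟨z, by rw [← hz, mul_comm]⟩
  choose g hg using key
  exact ⟨x, g, hx, hm, hx0, hn', hg⟩

theorem g_mem (hf : RingHom.ker p = Ideal.span (Set.range f)) (hg : StrictEq h f x g) (i : Fin n) :
    g i ∈ RingHom.ker τ := by
  have h1 : a (f i) ∈ RingHom.ker τ :=
    h.a_mem_ker (by rw [hf]; exact Ideal.subset_span ⟨i, rfl⟩)
  rw [hg.eq, RingHom.mem_ker, map_mul, h.τ_a, map_pow, map_pow] at h1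
  exact (mul_left_mem_nonZeroDivisors_eq_zero_iff (pow_mem hg.nzd 2)).mp h1

/-- The strict transforms of the generators of `I` generate `J`. -/
theorem ker_eq_span (hQ : QuadraticKer p 𝔪) (hf : RingHom.ker p = Ideal.span (Set.range f))
    (hg : StrictEq h f x g) : RingHom.ker τ = Ideal.span (Set.range g) := by
  refine le_antisymm (fun z hz => ?_) (Ideal.span_le.mpr ?_)
  · obtain ⟨N, r, hr, q, hq, hmq, e⟩ := h.frac z
    have hrk := h.mem_ker_of_a (by rw [← e]; exact Ideal.mul_mem_left _ _ hz)
    have h1 := hQ.inf_le N ⟨hrk, hr⟩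
    have hm : (𝔪 ^ N).map a = Ideal.span {a (x ^ N)} := by
      rw [Ideal.map_pow, hg.map_eq, Ideal.span_singleton_pow, map_pow]
    have h2 : ∀ r ∈ 𝔪 ^ (N - 2) * RingHom.ker p, ∃ y ∈ Ideal.span (Set.range g), a r = a q * y := by
      intro r hr
      refine Submodule.mul_induction_on hr (fun s hs t ht => ?_) ?_
      · rw [hf] at ht
        refine Submodule.span_induction (p := fun t _ => ∃ y ∈ Ideal.span (Set.range g),
          a (s * t) = a q * y) ?_ ?_ ?_ ?_ ht
        · rintro _ ⟨i, rfl⟩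
          have h3 := Ideal.mem_map_of_mem a (Ideal.mul_mem_mul hs (Ideal.pow_mem_pow hg.mem 2))
          rw [← pow_add] at h3
          have h4 := Ideal.map_mono (f := a) (Ideal.pow_le_pow_right (show N ≤ N - 2 + 2 by omega)) h3
          rw [hmq] at h4
          obtain ⟨w, hw⟩ := Ideal.mem_span_singleton'.mp h4
          refine ⟨w * g i, Ideal.mul_mem_left _ _ (Ideal.subset_span ⟨i, rfl⟩), ?_⟩
          rw [map_mul, hg.eq, ← mul_assoc, ← map_mul, ← hw]; ring
        · exact ⟨0, zero_mem _, by simp⟩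
        · rintro u v _ _ ⟨y, hy, e⟩ ⟨z, hz, e'⟩
          exact ⟨y + z, add_mem hy hz, by rw [mul_add, map_add, e, e', mul_add]⟩
        · rintro c u _ ⟨y, hy, e⟩
          exact ⟨a c * y, Ideal.mul_mem_left _ _ hy, by
            rw [smul_eq_mul, mul_left_comm, map_mul, e]; ring⟩
      · rintro u v ⟨y, hy, e⟩ ⟨z, hz, e'⟩
        exact ⟨y + z, add_mem hy hz, by rw [map_add, e, e', mul_add]⟩
    obtain ⟨y, hy, e'⟩ := h2 r h1
    have hq1 : a (x ^ N) ∈ (𝔪 ^ N).map a := by rw [hm]; exact Ideal.mem_span_singleton_self _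
    rw [hmq] at hq1
    obtain ⟨w, hw⟩ := Ideal.mem_span_singleton'.mp hq1
    have : z = y := h.eq_of_x_mul hg.nzd (N := N) (by
      rw [← hw, mul_assoc, e, e', mul_assoc])
    rw [this]; exact hy
  · rintro _ ⟨i, rfl⟩
    exact h.g_mem hf hg i

/-- Common denominators. -/
theorem exists_common_frac (z : Fin n → Q) : ∃ N, ∃ q ∈ 𝔪 ^ N, b (p q) ∈ B⁰ ∧
    (𝔪 ^ N).map a = Ideal.span {a q} ∧ ∃ r : Fin n → P, (∀ i, r i ∈ 𝔪 ^ N) ∧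
      ∀ i, a q * z i = a (r i) := by
  suffices H : ∀ s : Finset (Fin n), ∃ N, ∃ q ∈ 𝔪 ^ N, b (p q) ∈ B⁰ ∧
      (𝔪 ^ N).map a = Ideal.span {a q} ∧ ∀ i ∈ s, ∃ r ∈ 𝔪 ^ N, a q * z i = a r by
    obtain ⟨N, q, hq, h0, hm, H⟩ := H Finset.univ
    choose r hr e using fun i => H i (Finset.mem_univ i)
    exact ⟨N, q, hq, h0, hm, r, hr, e⟩
  intro s
  induction s using Finset.induction_on with
  | empty => exact ⟨0, 1, by simp, by simp, by simp [Ideal.map_top], by simp⟩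
  | insert i s _ ih =>
    obtain ⟨N, q, hq, h0, hm, H⟩ := ih
    obtain ⟨N', r', hr', q', hq', hm', e'⟩ := h.frac (z i)
    have h0' : b (p q') ∈ B⁰ := by
      obtain ⟨x, hx, -, hx0, -, hn⟩ := h.exists_eq
      refine h.nzd fun h0 => ?_
      have h1 := hn N'
      have := h.domB
      rw [h.exc_pow_eq hm', h0, Ideal.span_singleton_eq_bot.mpr rfl, eq_comm,
        Ideal.span_singleton_eq_bot, map_pow, map_pow] at h1
      exact nonZeroDivisors.ne_zero (pow_mem hx0 N') h1
    refine ⟨N + N', q * q', ?_, ?_, ?_, fun k hk => ?_⟩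
    · rw [pow_add]; exact Ideal.mul_mem_mul hq hq'
    · rw [map_mul, map_mul]; exact mul_mem h0 h0'
    · rw [pow_add, Ideal.map_mul, hm, hm', Ideal.span_singleton_mul_span_singleton, map_mul]
    · rw [Finset.mem_insert] at hk
      rcases hk with rfl | hk
      · exact ⟨q * r', by rw [pow_add]; exact Ideal.mul_mem_mul hq hr', by
          rw [map_mul, map_mul, mul_assoc, e']⟩
      · obtain ⟨r, hr, e⟩ := H k hk
        exact ⟨q' * r, by rw [add_comm, pow_add]; exact Ideal.mul_mem_mul hq' hr, by
          rw [map_mul, map_mul, mul_right_comm, e, mul_comm]⟩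

end IsChart

namespace StrictEq

variable {h : IsChart κ p 𝔪 a b τ} (hg : StrictEq h f x g)
include hg

theorem exists_Γ : ∃ Γ : FreeQuot f →ₛₗ[a] FreeQuot g, (∀ i, Γ (of f i) = of g i) ∧
    ∀ u, a (x ^ 2) * j g (Γ u) = a (j f u) := by
  obtain ⟨m, hm, hj⟩ := exists_scale a (a (x ^ 2)) 1 hg.eq
  exact ⟨m, fun i => by rw [hm, one_smul], fun u => by rw [hj, one_mul]⟩

/-- The map of free modules that sends the basis to the basis. -/
def Γ : FreeQuot f →ₛₗ[a] FreeQuot g := hg.exists_Γ.choose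

theorem Γ_of (i : Fin n) : hg.Γ (of f i) = of g i := hg.exists_Γ.choose_spec.1 i

theorem j_Γ (u) : a (x ^ 2) * j g (hg.Γ u) = a (j f u) := hg.exists_Γ.choose_spec.2 u

theorem Γ_mem {u} (hu : u ∈ rel f) : hg.Γ u ∈ rel g := by
  rw [mem_rel] at hu ⊢
  refine h.eq_of_x_mul hg.nzd (N := 2) ?_
  rw [hg.j_Γ, hu, map_zero, mul_zero]

theorem mem_of_Γ {u} (hu : hg.Γ u ∈ rel g) : u ∈ rel f := by
  rw [mem_rel] at hu ⊢
  have := hg.j_Γ u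
  rw [hu, mul_zero] at this
  exact h.injQ (this.symm.trans (map_zero a).symm)

/-- The map of relations. -/
def relMap : ↥(rel f) →ₛₗ[a] ↥(rel g) :=
  hg.Γ.restrict fun _ hu => hg.Γ_mem hu

theorem Γ_ofVec (ρ : Fin n → P) : hg.Γ (ofVec f ρ) = ofVec g fun i => a (ρ i) := by
  rw [map_ofVec (c := 1) fun i => by rw [hg.Γ_of, one_smul], one_smul]

theorem rel_frac (h' : IsChart κ p 𝔪 a' b' τ') (z : rel g) :
    ∃ s u, (b'.comp p) s ∈ B'⁰ ∧ a s • z = hg.relMap u := by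
  obtain ⟨ζ, hζ⟩ := exists_ofVec z.1
  obtain ⟨N, q, hq, h0, hmq, r, hr, e⟩ := h.exists_common_frac ζ
  have e1 : hg.Γ (ofVec f r) = a q • z.1 := by
    rw [hg.Γ_ofVec, ← hζ, ← map_smul]
    exact congrArg _ (funext fun i => (e i).symm)
  refine ⟨q, ⟨ofVec f r, hg.mem_of_Γ (by rw [e1]; exact Submodule.smul_mem _ _ z.2)⟩, ?_,
    Subtype.ext e1.symm⟩
  refine h'.nzd fun h1 => ?_
  have := h.domB
  rw [map_eq_zero_iff b' h'.injB] at h1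
  exact nonZeroDivisors.ne_zero h0 (by rw [h1, map_zero])

theorem exists_hom {σ : Q →+* B'} {σ' : P →+* B'} (hσ : σ.comp a = σ') (h0 : ∀ i, σ (g i) = 0)
    (χ : FreeQuot f →ₛₗ[σ'] B') : ∃ χ' : FreeQuot g →ₛₗ[σ] B', ∀ u, χ' (hg.Γ u) = χ u := by
  obtain ⟨χ', hχ'⟩ := FreeQuot.exists_hom (v := g) σ (fun i => χ (of f i)) fun i k => by
    rw [h0, h0, zero_smul, zero_smul]
  exact ⟨χ', fun u => DFunLike.congr_fun (hom_ext (χ := homPull hσ hg.Γ χ') (χ' := χ) fun i =>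
    (congrArg χ' (hg.Γ_of i)).trans (hχ' i)) u⟩

theorem apply_mem (hL : LinearRel f 𝔪) (φ : ↥(rel f) →ₛₗ[b.comp p] B) {N : ℕ} {ρ : Fin n → P}
    (hρ : ∀ i, ρ i ∈ 𝔪 ^ N) (hu : ofVec f ρ ∈ rel f) : φ ⟨ofVec f ρ, hu⟩ ∈ excB p 𝔪 b ^ (N - 1) := by
  have key : ∀ ρ ∈ 𝔪 ^ (N - 1) • relModule f, ∃ hu : ofVec f ρ ∈ rel f,
      φ ⟨ofVec f ρ, hu⟩ ∈ excB p 𝔪 b ^ (N - 1) := fun ρ hρ => by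
    refine Submodule.smul_induction_on hρ (fun s hs t ht => ?_) ?_
    · have ht' := ofVec_mem_rel.mpr ht
      have h1 : ofVec f (s • t) = s • ofVec f t := map_smul _ _ _
      refine ⟨by rw [h1]; exact Submodule.smul_mem _ _ ht', ?_⟩
      have h2 : φ ⟨ofVec f (s • t), by rw [h1]; exact Submodule.smul_mem _ _ ht'⟩ =
          b (p s) * φ ⟨ofVec f t, ht'⟩ :=
        (congrArg φ (Subtype.ext h1)).trans (φ.map_smulₛₗ s ⟨ofVec f t, ht'⟩)
      exact (congrArg (· ∈ _) h2).mpr (Ideal.mul_mem_right _ _ (h.mem_exc_pow hs))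
    · rintro s t ⟨hs, hs'⟩ ⟨ht, ht'⟩
      have h1 : ofVec f (s + t) = ofVec f s + ofVec f t := map_add _ _ _
      refine ⟨by rw [h1]; exact add_mem hs ht, ?_⟩
      have h2 : φ ⟨ofVec f (s + t), by rw [h1]; exact add_mem hs ht⟩ =
          φ ⟨ofVec f s, hs⟩ + φ ⟨ofVec f t, ht⟩ :=
        (congrArg φ (Subtype.ext h1)).trans (φ.map_add ⟨ofVec f s, hs⟩ ⟨ofVec f t, ht⟩)
      exact (congrArg (· ∈ _) h2).mpr (add_mem hs' ht')
  exact (key ρ (hL.mem_smul N ρ (ofVec_mem_rel.mp hu) hρ)).2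

theorem exists_smul_mem_freeRel₀ {z : Fin n →₀ Q} (hz : z ∈ freeRel₀ g) :
    ∃ s, b (p s) ∈ B⁰ ∧ ∃ w ∈ freeRel₀ f, ∀ i, a s * z i = a (w i) := by
  refine Submodule.span_induction ?_ ⟨1, by simp, 0, zero_mem _, by simp⟩ ?_ ?_ hz
  · rintro _ ⟨y, z, rfl⟩
    obtain ⟨N, q, -, h0, -, r, -, e⟩ := h.exists_common_frac y
    obtain ⟨N', q', -, h0', -, r', -, e'⟩ := h.exists_common_frac z
    let r₁ : Fin n →₀ P := Finsupp.equivFunOnFinite.symm r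
    let r₂ : Fin n →₀ P := Finsupp.equivFunOnFinite.symm r'
    have key : ∀ (y : Fin n →₀ Q) (q : P) (r : Fin n → P), (∀ i, a q * y i = a (r i)) →
        a (x ^ 2) * (a q * Finsupp.linearCombination Q g y) =
          a (Finsupp.linearCombination P f (Finsupp.equivFunOnFinite.symm r)) := fun y q r e => by
      rw [Finsupp.linearCombination_apply, Finsupp.linearCombination_apply,
        Finsupp.sum_fintype _ _ (by simp), Finsupp.sum_fintype _ _ (by simp), map_sum,
        Finset.mul_sum, Finset.mul_sum]
      refine Finset.sum_congr rfl fun i _ => ?_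
      rw [smul_eq_mul, smul_eq_mul, map_mul, hg.eq, Finsupp.equivFunOnFinite_symm_apply_apply,
        ← e]
      ring
    refine ⟨x ^ 2 * (q * q'), ?_, Finsupp.linearCombination P f r₁ • r₂ -
      Finsupp.linearCombination P f r₂ • r₁, Submodule.subset_span ⟨_, _, rfl⟩, fun i => ?_⟩
    · simp only [map_mul, map_pow]
      exact mul_mem (pow_mem hg.nzd 2) (mul_mem h0 h0')
    · have k1 := key y q r e
      have k2 := key z q' r' e'
      simp only [Finsupp.sub_apply, Finsupp.smul_apply, smul_eq_mul, map_sub, map_mul]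
      change _ = a (Finsupp.linearCombination P f r₁) * a (r' i) -
        a (Finsupp.linearCombination P f r₂) * a (r i)
      rw [← k1, ← k2, ← e, ← e']
      ring
  · rintro y z _ _ ⟨s, hs, w, hw, e⟩ ⟨s', hs', w', hw', e'⟩
    refine ⟨s * s', by rw [map_mul, map_mul]; exact mul_mem hs hs', s' • w + s • w',
      add_mem (Submodule.smul_mem _ _ hw) (Submodule.smul_mem _ _ hw'), fun i => ?_⟩
    simp only [Finsupp.add_apply, Finsupp.smul_apply, smul_eq_mul, map_add, map_mul, ← e, ← e']
    ring
  · rintro c z _ ⟨s, hs, w, hw, e⟩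
    obtain ⟨t, r, ht, e'⟩ := h.frac_nzd c
    refine ⟨t * s, by rw [map_mul, map_mul]; exact mul_mem ht hs, r • w,
      Submodule.smul_mem _ _ hw, fun i => ?_⟩
    simp only [Finsupp.smul_apply, smul_eq_mul, map_mul, ← e, ← e']
    ring

theorem exists_smul_eq_zero {u} (hu : hg.Γ u = 0) : ∃ s, b (p s) ∈ B⁰ ∧ s • u = 0 := by
  obtain ⟨ρ, rfl⟩ := exists_ofVec u
  rw [hg.Γ_ofVec] at hu
  obtain ⟨s, hs, w, hw, e⟩ := hg.exists_smul_mem_freeRel₀ ((Submodule.Quotient.mk_eq_zero _).mp hu)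
  refine ⟨s, hs, ?_⟩
  rw [← map_smul]
  refine (Submodule.Quotient.mk_eq_zero _).mpr ?_
  convert hw using 1
  exact Finsupp.ext fun i => h.injQ ((map_mul a _ _).trans (e i))

theorem exists_extend (hL : LinearRel f 𝔪) (φ : ↥(rel f) →ₛₗ[b.comp p] B) {c : B}
    (hc : c ∈ excB p 𝔪 b) : ∃ φ' : ↥(rel g) →ₛₗ[τ] B, ∀ u, φ' (hg.relMap u) = c * φ u := by
  refine exists_semilinear_extension a τ h.comm hg.relMap (c • φ) (fun u hu => ?_) h.frac_nzd
    fun z => ?_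
  · obtain ⟨s, hs, h0⟩ := hg.exists_smul_eq_zero (Subtype.ext_iff.mp hu)
    have h1 := φ.map_smulₛₗ s u
    rw [show s • u = 0 from Subtype.ext h0, map_zero] at h1
    have h2 : φ u = 0 := (mul_left_mem_nonZeroDivisors_eq_zero_iff hs).mp h1.symm
    rw [LinearMap.smul_apply, h2, smul_zero]
  · obtain ⟨ζ, hζ⟩ := exists_ofVec z.1
    obtain ⟨N, q, hq, h0, hmq, r, hr, e⟩ := h.exists_common_frac ζ
    have e1 : hg.Γ (ofVec f r) = a q • z.1 := by
      rw [hg.Γ_ofVec, ← hζ, ← map_smul]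
      exact congrArg _ (funext fun i => (e i).symm)
    have hu := hg.mem_of_Γ (by rw [e1]; exact Submodule.smul_mem _ _ z.2)
    have h1 := Ideal.mul_mem_mul (hg.apply_mem hL φ hr hu) hc
    rw [← pow_succ] at h1
    have h2 := Ideal.pow_le_pow_right (show N ≤ N - 1 + 1 by omega) h1
    rw [h.exc_pow_eq hmq] at h2
    obtain ⟨w, hw⟩ := Ideal.mem_span_singleton'.mp h2
    exact ⟨q, ⟨_, hu⟩, w, h0, Subtype.ext e1.symm, (mul_comm _ _).trans
      (hw.trans (mul_comm _ _))⟩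

end StrictEq

end
end QLSing

namespace QLSing
noncomputable section

open nonZeroDivisors FreeQuot

set_option linter.unusedSectionVars false

variable {k P A Q B Q' B' : Type} [CommRing k] [CommRing P] [CommRing A] [CommRing Q] [CommRing B]
  [CommRing Q'] [CommRing B'] {κ : k →+* P} {p : P →+* A} {𝔪 : Ideal P}
  {a : P →+* Q} {b : A →+* B} {τ : Q →+* B} {a' : P →+* Q'} {b' : A →+* B'} {τ' : Q' →+* B'}
  {α : Q →+* Q'} {β : B →+* B'} {n : ℕ} {f : Fin n → P} {x : P} {g : Fin n → Q}
  {x' : P} {g' : Fin n → Q'}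

/-- The class of a homomorphism on the relations of `f` in `T²(A; B)`. -/
def clRA (κ : k →+* P) (hp : Function.Surjective p) (hf : RingHom.ker p = Ideal.span (Set.range f))
    (b : A →+* B) : (↥(rel f) →ₛₗ[b.comp p] B) →ₗ[B] T2 (p.comp κ) b :=
  clR rfl hp hf b

/-- The class of a homomorphism on the relations of `g` in `T²(B; B')`. -/
def IsChart.clRB (h : IsChart κ p 𝔪 a b τ) (hv : RingHom.ker τ = Ideal.span (Set.range g))
    (β : B →+* B') : (↥(rel g) →ₛₗ[β.comp τ] B') →ₗ[B'] T2 (b.comp (p.comp κ)) β :=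
  clR h.comm_base h.surj hv β

/-- The relation between `𝔪 T²(A; B)` and `Hom(E², T²(B; B))`. -/
def RelH {h : IsChart κ p 𝔪 a b τ} (hg : StrictEq h f x g) (hp : Function.Surjective p)
    (hf : RingHom.ker p = Ideal.span (Set.range f)) (hv : RingHom.ker τ = Ideal.span (Set.range g))
    (t : (excB p 𝔪 b • ⊤ : Submodule B (T2 (p.comp κ) b)))
    (ψ : ↥(excB p 𝔪 b ^ 2) →ₗ[B] T2 (b.comp (p.comp κ)) (RingHom.id B)) : Prop :=
  ∃ (φ : ↥(rel f) →ₛₗ[b.comp p] B) (φ' : ↥(rel g) →ₛₗ[τ] B), clRA κ hp hf b φ = t.1 ∧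
    (∀ u, φ' (hg.relMap u) = φ u) ∧
    ∀ hx : b (p (x ^ 2)) ∈ excB p 𝔪 b ^ 2, h.clRB hv (RingHom.id B) φ' = ψ ⟨b (p (x ^ 2)), hx⟩

namespace StrictEq

variable {h : IsChart κ p 𝔪 a b τ} (hg : StrictEq h f x g)
include hg

theorem mem_sq : b (p (x ^ 2)) ∈ excB p 𝔪 b ^ 2 := by
  rw [hg.pow_eq]; exact Ideal.mem_span_singleton_self _

theorem nzd_sq : b (p (x ^ 2)) ∈ B⁰ := by
  rw [map_pow, map_pow]; exact pow_mem hg.nzd 2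

end StrictEq

namespace RelH

variable {h : IsChart κ p 𝔪 a b τ} {hg : StrictEq h f x g} {hp : Function.Surjective p}
  {hf : RingHom.ker p = Ideal.span (Set.range f)} {hv : RingHom.ker τ = Ideal.span (Set.range g)}

theorem add {t t'} {ψ ψ'} (H : RelH hg hp hf hv t ψ) (H' : RelH hg hp hf hv t' ψ') :
    RelH hg hp hf hv (t + t') (ψ + ψ') := by
  obtain ⟨φ, χ, e, H, h1⟩ := H
  obtain ⟨φ', χ', e', H', h1'⟩ := H'
  exact ⟨φ + φ', χ + χ', (map_add _ _ _).trans (congrArg₂ _ e e'),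
    fun u => congrArg₂ (· + ·) (H u) (H' u), fun hx =>
    (map_add (h.clRB hv (RingHom.id B)) χ χ').trans (congrArg₂ (· + ·) (h1 hx) (h1' hx))⟩

theorem smul {t} {ψ} (c : B) (H : RelH hg hp hf hv t ψ) : RelH hg hp hf hv (c • t) (c • ψ) := by
  obtain ⟨φ, χ, e, H, h1⟩ := H
  exact ⟨c • φ, c • χ, (map_smul _ _ _).trans (congrArg (c • ·) e),
    fun u => congrArg (c • ·) (H u), fun hx =>
    (map_smul (h.clRB hv (RingHom.id B)) c χ).trans (congrArg (c • ·) (h1 hx))⟩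

theorem total (hκ : IsLocPoly κ) (hL : LinearRel f 𝔪) (t) : ∃ ψ, RelH hg hp hf hv t ψ := by
  have h1 : excB p 𝔪 b = Ideal.span {b (p x)} := by simpa using hg.pow_eq 1
  have k := exists_smul_of_mem h1 t.2
  obtain ⟨u, hu⟩ := k
  obtain ⟨φ, hφ⟩ := clR_surjective (φ := b) (κ := κ) rfl hp hf hκ u
  obtain ⟨φ', hφ'⟩ := hg.exists_extend hL φ (h.mem_exc hg.mem)
  obtain ⟨ψ, hψ⟩ := exists_hom_span (hg.pow_eq 2) hg.nzd_sq (h.clRB hv (RingHom.id B) φ')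
  refine ⟨ψ, b (p x) • φ, φ', ?_, hφ', fun hx => ?_⟩
  · rw [map_smul, hu, ← hφ]; rfl
  · rw [hψ 1 _ hx (one_mul _).symm, one_smul]

theorem nat {h' : IsChart κ p 𝔪 a' b' τ'} {hg' : StrictEq h' f x' g'}
    {hv' : RingHom.ker τ' = Ideal.span (Set.range g')} (hκ : IsLocPoly κ) (hα : α.comp a = a')
    (hβ : β.comp b = b') (hτ : τ'.comp α = β.comp τ) {t} {t'}
    (ht : T2.coeff (p.comp κ) β hβ t.1 = t'.1) {ψ ψ'} (H : RelH hg hp hf hv t ψ)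
    (H' : RelH hg' hp hf hv' t' ψ') :
    ∃ y, excB p 𝔪 b ^ 2 = Ideal.span {y} ∧ ∀ hy hy',
      T2.coeff (b.comp (p.comp κ)) (φ' := β) β (RingHom.comp_id _) (ψ ⟨y, hy⟩) =
        T2.pull (φ' := RingHom.id B') (by rw [← hβ, RingHom.comp_assoc]) (RingHom.id_comp _)
          (ψ' ⟨β y, hy'⟩) := by
  obtain ⟨φ, χ, e, H, h1⟩ := H
  obtain ⟨φ', χ', e', H', h1'⟩ := H'
  have eβ : ∀ y, β (b y) = b' y := fun y => DFunLike.congr_fun hβ y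
  have eα : ∀ y, α (a y) = a' y := fun y => DFunLike.congr_fun hα y
  have eτ : ∀ y, τ' (α y) = β (τ y) := fun y => DFunLike.congr_fun hτ y
  have dom := h'.domQ
  have hx0 : a' x' ≠ 0 := fun h0 => by
    have e1 := h'.τ_a x'
    rw [h0, map_zero] at e1
    have e2 := hg'.nzd
    rw [← e1] at e2
    have := h'.domB
    exact nonZeroDivisors.ne_zero e2 rfl
  have hE : 𝔪.map a' = Ideal.span {a' x} := by
    rw [← hα, ← Ideal.map_map, hg.map_eq, Ideal.map_span, Set.image_singleton]; rfl
  obtain ⟨v, hv1⟩ : ∃ v, v * a' x' = a' x := Ideal.mem_span_singleton'.mp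
    (by rw [← hg'.map_eq]; exact Ideal.mem_map_of_mem _ hg.mem)
  obtain ⟨u, hu1⟩ : ∃ u, u * a' x = a' x' := Ideal.mem_span_singleton'.mp
    (by rw [← hE]; exact Ideal.mem_map_of_mem _ hg'.mem)
  have huv : u * v = 1 := mul_right_cancel₀ hx0 (by rw [mul_assoc, hv1, hu1, one_mul])
  have hgg : ∀ i, α (g i) = u ^ 2 * g' i := fun i => by
    have e1 := congrArg α (hg.eq i)
    rw [map_mul, eα, eα, hg'.eq, map_pow, map_pow, ← hv1] at e1
    have e2 := mul_left_cancel₀ (pow_ne_zero 2 hx0)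
      (e1.trans (show _ = a' x' ^ 2 * (v ^ 2 * α (g i)) by ring))
    rw [e2, ← mul_assoc, ← mul_pow, huv, one_pow, one_mul]
  obtain ⟨m, hm, hj⟩ := exists_scale α (u ^ 2) (u ^ 2) hgg
  have hj' : ∀ z, j g' (m z) = α (j g z) := fun z => by
    have e1 := congrArg (v ^ 2 * ·) (hj z)
    simp only [← mul_assoc, ← mul_pow, mul_comm v, huv, one_pow, one_mul] at e1
    exact e1
  have hmΓ : ∀ z, m (hg.Γ z) = u ^ 2 • hg'.Γ z := fun z => by
    obtain ⟨ρ, rfl⟩ := exists_ofVec z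
    rw [hg.Γ_ofVec, map_ofVec hm, hg'.Γ_ofVec]
    simp only [eα]
  have hmem : ∀ z ∈ rel g, m z ∈ rel g' := fun z hz => by
    rw [mem_rel] at hz ⊢
    rw [hj', hz, map_zero]
  have k1 : T2.coeff (p.comp κ) β hβ (clRA κ hp hf b φ) = clRA κ hp hf b'
      (homCoeff β (by rw [← hβ, RingHom.comp_assoc]) φ) := clR_coeff rfl hp hf hβ fun _ => rfl
  rw [← e, k1, ← e'] at ht
  obtain ⟨θ, hθ⟩ := (clR_eq rfl hp hf hκ).mp ht
  obtain ⟨θ', hθ'⟩ := hg.exists_hom (σ := β.comp τ)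
    (by rw [RingHom.comp_assoc, h.comm, ← hβ, RingHom.comp_assoc])
    (fun i => (congrArg β (h.g_mem hf hg i)).trans (map_zero β)) θ
  let χ₁ : ↥(rel g) →ₛₗ[β.comp τ] B' := homCoeff β rfl χ
  let χ₂ : ↥(rel g) →ₛₗ[β.comp τ] B' :=
    homPull hτ (m.restrict hmem) (τ' v ^ 2 • χ')
  have key : χ₁ = χ₂ + θ'.domRestrict (rel g) := semilinear_ext a
    (by rw [RingHom.comp_assoc, h.comm, ← hβ, RingHom.comp_assoc]) (hg.rel_frac h') fun w => by
    have e1 : χ₁ (hg.relMap w) = β (φ w) := congrArg β (H w)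
    have e2 : χ₂ (hg.relMap w) = φ' w := by
      have e3 : m.restrict hmem (hg.relMap w) = u ^ 2 • hg'.relMap w := Subtype.ext (hmΓ w.1)
      have e4 : χ' (m.restrict hmem (hg.relMap w)) = τ' (u ^ 2) * φ' w := by
        rw [e3, LinearMap.map_smulₛₗ, H', smul_eq_mul]
      refine (congrArg (τ' v ^ 2 * ·) e4).trans ?_
      rw [← map_pow, ← mul_assoc, ← map_mul, ← mul_pow, mul_comm v, huv, one_pow, map_one, one_mul]
    rw [LinearMap.add_apply, e1, e2]
    exact (hθ w).trans (congrArg (φ' w + ·) (hθ' w.1).symm)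
  refine ⟨b (p (x ^ 2)), hg.pow_eq 2, fun hy hy' => ?_⟩
  have e5 : ψ' ⟨β (b (p (x ^ 2))), hy'⟩ = h'.clRB hv' (RingHom.id B') (τ' v ^ 2 • χ') := by
    rw [map_smul, h1' hg'.mem_sq]
    exact hom_span_apply ψ' hg'.mem_sq hy' (by
      rw [eβ, ← h'.τ_a, map_pow, ← hv1, map_pow, map_mul, h'.τ_a, map_pow, map_pow, mul_pow])
  rw [e5, ← h1 hy]
  have k2 : T2.coeff (b.comp (p.comp κ)) (φ' := β) β (RingHom.comp_id _)
      (h.clRB hv (RingHom.id B) χ) = h.clRB hv β χ₁ :=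
    clR_coeff h.comm_base h.surj hv (RingHom.comp_id _) fun _ => rfl
  have k3 : T2.pull (φ' := RingHom.id B') (by rw [← hβ, RingHom.comp_assoc])
      (RingHom.id_comp _) (h'.clRB hv' (RingHom.id B') (τ' v ^ 2 • χ')) = h.clRB hv β χ₂ :=
    clR_pull h.comm_base h.surj h'.comm_base h'.surj hv hv' hτ
      (by rw [← RingHom.comp_assoc, hα]) _ _ m hj' fun r r' e =>
      congrArg (τ' v ^ 2 • χ') (Subtype.ext e)
  refine k2.trans (Eq.trans ?_ k3.symm)
  refine (clR_eq _ _ _ h.isLocPoly).mpr ⟨θ', fun r => ?_⟩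
  rw [key]; rfl

theorem uniq (hκ : IsLocPoly κ) {ψ} (H : RelH hg hp hf hv 0 ψ) : ψ = 0 := by
  obtain ⟨φ, χ, e, H, h1⟩ := H
  obtain ⟨θ, hθ⟩ := (clR_eq rfl hp hf hκ).mp (e.trans (map_zero (clRA κ hp hf b)).symm)
  obtain ⟨θ', hθ'⟩ := hg.exists_hom h.comm (h.g_mem hf hg) θ
  refine hom_span_ext (hg.pow_eq 2) hg.mem_sq ?_
  rw [← h1 hg.mem_sq, ← map_zero (h.clRB hv (RingHom.id B))]
  refine (clR_eq _ _ _ h.isLocPoly).mpr ⟨θ', fun r => ?_⟩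
  have key : χ = θ'.domRestrict (rel g) := semilinear_ext a h.comm (hg.rel_frac h) fun u => by
    rw [H, hθ]
    exact (zero_add _).trans (hθ' _).symm
  rw [key]
  exact (zero_add _).symm

theorem inj (hκ : IsLocPoly κ) {t} (H : RelH hg hp hf hv t 0) : t = 0 := by
  obtain ⟨φ, χ, e, H, h1⟩ := H
  obtain ⟨θ, hθ⟩ := (clR_eq h.comm_base h.surj hv h.isLocPoly).mp
    ((h1 hg.mem_sq).trans (map_zero (h.clRB hv (RingHom.id B))).symm)
  refine Subtype.ext (e.symm.trans (Eq.trans ?_ (map_zero (clRA κ hp hf b))))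
  refine (clR_eq rfl hp hf hκ).mpr ⟨homPull h.comm hg.Γ θ, fun u => ?_⟩
  rw [← H, hθ]
  rfl

theorem surj (hL : LinearRel f 𝔪) (ψ) : ∃ t, RelH hg hp hf hv t ψ := by
  obtain ⟨χ, hχ⟩ := clR_surjective (φ := RingHom.id B) h.comm_base h.surj hv h.isLocPoly
    (ψ ⟨b (p (x ^ 2)), hg.mem_sq⟩)
  obtain ⟨φ, hφ⟩ := exists_div (homPull h.comm hg.relMap χ) hg.nzd fun u => by
    obtain ⟨u, hu⟩ := u
    obtain ⟨ρ, rfl⟩ := exists_ofVec u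
    have h1 := hL.mem ρ (ofVec_mem_rel.mp hu)
    have h2 : ∀ i, ∃ z, z * a x = a (ρ i) := fun i => Ideal.mem_span_singleton'.mp
      (by rw [← hg.map_eq]; exact Ideal.mem_map_of_mem _ (h1 i))
    choose z hz using h2
    have h3 : hg.Γ (ofVec f ρ) = a x • ofVec g z := by
      rw [hg.Γ_ofVec, ← map_smul]
      exact congrArg _ (funext fun i => (hz i).symm.trans (mul_comm _ _))
    have h4 : ofVec g z ∈ rel g := by
      have h5 := hg.Γ_mem hu
      rw [h3, mem_rel, map_smul] at h5
      rw [mem_rel]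
      refine h.eq_of_x_mul hg.nzd (N := 1) ?_
      rw [pow_one, mul_zero]; exact h5
    refine ⟨χ ⟨_, h4⟩, ?_⟩
    have h5 : hg.relMap ⟨ofVec f ρ, hu⟩ = a x • ⟨ofVec g z, h4⟩ := Subtype.ext h3
    exact ((congrArg χ h5).trans ((χ.map_smulₛₗ _ _).trans
      (congrArg (· * χ ⟨ofVec g z, h4⟩) (h.τ_a x)))).symm
  refine ⟨⟨clRA κ hp hf b (b (p x) • φ), ?_⟩, b (p x) • φ, χ, rfl, fun u => (hφ u).symm, fun _ => hχ⟩
  rw [map_smul]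
  exact Submodule.smul_mem_smul (h.mem_exc hg.mem) trivial

end RelH

end
end QLSing

namespace QLSing
noncomputable section

/-! ### Consequences of the definition of QL-rings -/

section StandardBasis

variable {P M : Type} [CommRing P] [IsLocalRing P] [AddCommGroup M] [Module P M]

open IsLocalRing

theorem IsStandardBasis.inf_le [IsNoetherianRing P] [Module.Finite P M] {N : Submodule P M} {d t : ℕ}
    {v : Fin t → M} (h : IsStandardBasis N d v) (i : ℕ) :
    N ⊓ (maximalIdeal P ^ i • ⊤ : Submodule P M) ≤ maximalIdeal P ^ (i - d) • N := by
  by_cases hi : i ≤ d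
  · rw [Nat.sub_eq_zero_of_le hi, pow_zero, Ideal.one_eq_top, Submodule.top_smul]
    exact inf_le_left
  have key : ∀ K, N ⊓ (maximalIdeal P ^ i • ⊤ : Submodule P M) ≤
      maximalIdeal P ^ (i - d) • N ⊔ N ⊓ (maximalIdeal P ^ (i + K) • ⊤ : Submodule P M) := by
    intro K
    induction K with
    | zero => exact le_sup_right
    | succ K ih =>
      refine ih.trans (sup_le le_sup_left fun z hz => ?_)
      have h1 := h.initial _ z hz.1 hz.2
      rw [if_pos (by omega)] at h1
      obtain ⟨a, ha, ha'⟩ := h1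
      have hv : ∀ j, v j ∈ N := fun j => by
        rw [← h.span_eq]; exact Submodule.subset_span ⟨j, rfl⟩
      have h2 : ∑ j, a j • v j ∈ maximalIdeal P ^ (i - d) • N := sum_mem fun j _ =>
        Submodule.smul_mem_smul (Ideal.pow_le_pow_right (by omega) (ha j)) (hv j)
      rw [← add_sub_cancel (∑ j, a j • v j) z]
      exact Submodule.add_mem_sup h2
        ⟨sub_mem hz.1 (sum_mem fun j _ => N.smul_mem _ (hv j)), ha'⟩
  obtain ⟨k, hk⟩ := (maximalIdeal P).exists_pow_inf_eq_pow_smul N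
  refine (key k).trans (sup_le le_rfl ?_)
  rw [inf_comm, hk _ (by omega)]
  exact Submodule.smul_mono (Ideal.pow_le_pow_right (by omega)) inf_le_right

end StandardBasis

theorem mem_smul_top_pi {P : Type} [CommRing P] {n : ℕ} {J : Ideal P} {ρ : Fin n → P} :
    ρ ∈ (J • ⊤ : Submodule P (Fin n → P)) ↔ ∀ i, ρ i ∈ J := by
  refine ⟨fun h => ?_, fun h => ?_⟩
  · refine Submodule.smul_induction_on h (fun r hr z _ i => ?_) fun x y hx hy i => ?_
    · exact J.mul_mem_right _ hr
    · exact add_mem (hx i) (hy i)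
  · rw [pi_eq_sum_univ' ρ]
    exact sum_mem fun i _ => Submodule.smul_mem_smul (h i) trivial

section LocPoly

variable {e : ℕ}

instance : IsNoetherianRing (LocPoly e) :=
  IsLocalization.isNoetherianRing (originIdeal e).primeCompl (Localization.AtPrime (originIdeal e)) inferInstance

instance : IsDomain (LocPoly e) :=
  IsLocalization.isDomain_of_le_nonZeroDivisors (Localization.AtPrime (originIdeal e))
    (originIdeal e).primeCompl_le_nonZeroDivisors

/-- The map from the polynomial ring to its localization. -/
def toLocPoly (e : ℕ) : MvPolynomial (Fin e) ℂ →+* LocPoly e :=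
  algebraMap (MvPolynomial (Fin e) ℂ) (Localization.AtPrime (originIdeal e))

theorem toLocPoly_comp_C : (toLocPoly e).comp MvPolynomial.C = algebraMap ℂ (LocPoly e) :=
  (IsScalarTower.algebraMap_eq ℂ (MvPolynomial (Fin e) ℂ)
    (Localization.AtPrime (originIdeal e))).symm

theorem isLoc_toLocPoly : IsLoc (toLocPoly e) where
  surj z := by
    obtain ⟨⟨p, s⟩, h⟩ := IsLocalization.surj (originIdeal e).primeCompl
      (S := Localization.AtPrime (originIdeal e)) z
    exact ⟨s, p, IsLocalization.map_units (Localization.AtPrime (originIdeal e)) s,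
      (mul_comm _ _).trans h⟩
  ker p h := by
    obtain ⟨s, hs⟩ := (IsLocalization.map_eq_zero_iff (originIdeal e).primeCompl
      (Localization.AtPrime (originIdeal e)) p).mp h
    exact ⟨s, IsLocalization.map_units (Localization.AtPrime (originIdeal e)) s, hs⟩

theorem isUnit_toLocPoly {p : MvPolynomial (Fin e) ℂ} :
    IsUnit (toLocPoly e p) ↔ MvPolynomial.constantCoeff p ≠ 0 :=
  IsLocalization.AtPrime.isUnit_to_map_iff (Localization.AtPrime (originIdeal e))
    (originIdeal e) p

theorem isLocPoly_base : IsLocPoly (algebraMap ℂ (LocPoly e)) :=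
  ⟨_, toLocPoly e, toLocPoly_comp_C, isLoc_toLocPoly⟩

theorem toLocPoly_injective : Function.Injective (toLocPoly e) :=
  IsLocalization.injective (Localization.AtPrime (originIdeal e))
    (originIdeal e).primeCompl_le_nonZeroDivisors

/-- The coordinates. -/
def coordX (i : Fin e) : LocPoly e := toLocPoly e (MvPolynomial.X i)

theorem sub_mem_span_X (p : MvPolynomial (Fin e) ℂ) :
    p - MvPolynomial.C (MvPolynomial.constantCoeff p) ∈
      Ideal.span (Set.range (MvPolynomial.X : Fin e → MvPolynomial (Fin e) ℂ)) := by
  induction p using MvPolynomial.induction_on with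
  | C c => simp
  | add p q hp hq =>
    rw [map_add, map_add, add_sub_add_comm]; exact add_mem hp hq
  | mul_X p i _ =>
    rw [map_mul, MvPolynomial.constantCoeff_X, mul_zero, map_zero, sub_zero]
    exact Ideal.mul_mem_left _ _ (Ideal.subset_span ⟨i, rfl⟩)

theorem maximalIdeal_eq : IsLocalRing.maximalIdeal (LocPoly e) = Ideal.span (Set.range coordX) := by
  refine le_antisymm (fun z hz => ?_) (Ideal.span_le.mpr ?_)
  · obtain ⟨s, p, hs, hz'⟩ := isLoc_toLocPoly.surj z
    have h1 : ¬ IsUnit (toLocPoly e p) := by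
      rw [← hz']; exact fun h => hz (isUnit_of_mul_isUnit_right h)
    rw [isUnit_toLocPoly, not_not] at h1
    have h2 := Ideal.mem_map_of_mem (toLocPoly e) (sub_mem_span_X p)
    rw [h1, map_zero, sub_zero, Ideal.map_span, ← Set.range_comp, ← hz'] at h2
    exact (Ideal.unit_mul_mem_iff_mem _ hs).mp h2
  · rintro _ ⟨i, rfl⟩
    change ¬ IsUnit (toLocPoly e _)
    rw [isUnit_toLocPoly, not_not, MvPolynomial.constantCoeff_X]

theorem exists_sub_mem (z : LocPoly e) :
    ∃ c, z - algebraMap ℂ (LocPoly e) c ∈ IsLocalRing.maximalIdeal (LocPoly e) := by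
  obtain ⟨s, p, hs, hz⟩ := isLoc_toLocPoly.surj z
  have hs' := isUnit_toLocPoly.mp hs
  refine ⟨MvPolynomial.constantCoeff p / MvPolynomial.constantCoeff s, ?_⟩
  rw [← Ideal.unit_mul_mem_iff_mem _ hs, mul_sub, hz, ← toLocPoly_comp_C, RingHom.comp_apply,
    ← map_mul, ← map_sub]
  change ¬ IsUnit (toLocPoly e _)
  rw [isUnit_toLocPoly, not_not, map_sub, map_mul, MvPolynomial.constantCoeff_C,
    mul_div_cancel₀ _ hs', sub_self]

variable {I : Ideal (LocPoly e)}

theorem ker_projA : RingHom.ker (projA I) = I := Ideal.mk_ker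

theorem IsQL.exists_eq (hI : IsQL I) : ∃ (n : ℕ) (f : Fin n → LocPoly e),
    RingHom.ker (projA I) = Ideal.span (Set.range f) ∧
    QuadraticKer (projA I) (IsLocalRing.maximalIdeal (LocPoly e)) ∧
    LinearRel f (IsLocalRing.maximalIdeal (LocPoly e)) := by
  obtain ⟨n, s, f, r, hf, hr, -, -⟩ := hI.exists_basis
  refine ⟨n, f, ker_projA.trans hf.span_eq.symm, ⟨?_, fun i => ?_⟩, ⟨?_, fun N ρ hρ hN => ?_⟩⟩
  · rw [ker_projA, ← hf.span_eq]
    refine Submodule.span_le.mpr ?_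
    rintro _ ⟨j, rfl⟩
    simpa using (hf.ord_eq j).1
  · have := hf.inf_le i
    rw [ker_projA]
    simpa using this
  · rw [← hr.span_eq]
    intro ρ hρ i
    refine Submodule.span_induction ?_ (zero_mem _) (fun x y _ _ hx hy => ?_) (fun c x _ hx => ?_) hρ
    · rintro _ ⟨j, rfl⟩
      have := mem_smul_top_pi.mp (hr.ord_eq j).1 i
      rwa [pow_one] at this
    · exact add_mem hx hy
    · exact Ideal.mul_mem_left _ _ hx
  · exact hr.inf_le N ⟨hρ, mem_smul_top_pi.mpr hN⟩

theorem IsQL.isDomain (hI : IsQL I) : IsDomain (RingA I) :=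
  have := hI.isPrime
  Ideal.Quotient.isDomain I

end LocPoly

end
end QLSing

namespace QLSing
noncomputable section

/-! ### Construction of charts -/

open nonZeroDivisors IsLocalRing

section Coordinates

variable {e : ℕ} {Q : Type} [CommRing Q]

/-- The substitution `X_j ↦ X_i X_j` for `j ≠ i`. -/
def chartSubst (i : Fin e) : MvPolynomial (Fin e) ℂ →+* MvPolynomial (Fin e) ℂ :=
  MvPolynomial.eval₂Hom MvPolynomial.C fun j =>
    if j = i then MvPolynomial.X i else MvPolynomial.X i * MvPolynomial.X j

/-- The coordinates of a chart: `x_i` and the `y_j` with `j ≠ i`. -/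
def chartCoord (a : LocPoly e →+* Q) (i : Fin e) (y : Fin e → Q) : MvPolynomial (Fin e) ℂ →+* Q :=
  MvPolynomial.eval₂Hom (a.comp (algebraMap ℂ (LocPoly e))) fun j =>
    if j = i then a (coordX i) else y j

theorem chartSubst_X_self (i : Fin e) : chartSubst i (.X i) = .X i := by
  simp [chartSubst]

theorem chartSubst_X {i j : Fin e} (h : j ≠ i) : chartSubst i (.X j) = .X i * .X j := by
  simp [chartSubst, h]

theorem exists_chartSubst (i : Fin e) (p : MvPolynomial (Fin e) ℂ) :
    ∃ n q, chartSubst i q = .X i ^ n * p := by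
  induction p using MvPolynomial.induction_on with
  | C c => exact ⟨0, .C c, by simp [chartSubst]⟩
  | add p p' hp hp' =>
    obtain ⟨n, q, h⟩ := hp
    obtain ⟨n', q', h'⟩ := hp'
    refine ⟨n + n', .X i ^ n' * q + .X i ^ n * q', ?_⟩
    rw [map_add, map_mul, map_mul, map_pow, map_pow, chartSubst_X_self, h, h']
    ring
  | mul_X p j hp =>
    obtain ⟨n, q, h⟩ := hp
    by_cases hj : j = i
    · subst hj
      exact ⟨n, q * .X j, by rw [map_mul, chartSubst_X_self, h, mul_assoc]⟩
    · refine ⟨n + 1, q * .X j, ?_⟩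
      rw [map_mul, chartSubst_X hj, h]
      ring

variable {a : LocPoly e →+* Q} {i : Fin e} {y : Fin e → Q}

theorem chartCoord_X_self : chartCoord a i y (.X i) = a (coordX i) := by
  simp [chartCoord]

theorem chartCoord_C : (chartCoord a i y).comp MvPolynomial.C = a.comp (algebraMap ℂ (LocPoly e)) :=
  MvPolynomial.eval₂Hom_comp_C _ _

theorem chartCoord_subst (hy : ∀ j, a (coordX i) * y j = a (coordX j)) (p : MvPolynomial (Fin e) ℂ) :
    chartCoord a i y (chartSubst i p) = a (toLocPoly e p) := by
  refine DFunLike.congr_fun (f := (chartCoord a i y).comp (chartSubst i))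
    (g := a.comp (toLocPoly e)) (MvPolynomial.ringHom_ext (fun c => ?_) fun j => ?_) p
  · rw [RingHom.comp_apply, RingHom.comp_apply, ← RingHom.comp_apply (toLocPoly e),
      toLocPoly_comp_C, ← RingHom.comp_apply a, ← chartCoord_C (i := i) (y := y)]
    simp [chartSubst]
  · by_cases hj : j = i
    · subst hj
      rw [RingHom.comp_apply, chartSubst_X_self, chartCoord_X_self]; rfl
    · rw [RingHom.comp_apply, chartSubst_X hj, map_mul, chartCoord_X_self]
      refine Eq.trans ?_ (hy j)
      simp [chartCoord, hj]

theorem exists_chartCoord_of_mem (hy : ∀ j, a (coordX i) * y j = a (coordX j)) (n : ℕ) {r : LocPoly e}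
    (hr : r ∈ maximalIdeal (LocPoly e) ^ n) : ∃ s p, IsUnit (toLocPoly e s) ∧
      a (toLocPoly e s) * a r = a (coordX i) ^ n * chartCoord a i y p := by
  have h1 : ∀ r ∈ maximalIdeal (LocPoly e), ∃ s p, IsUnit (toLocPoly e s) ∧
      a (toLocPoly e s) * a r = a (coordX i) * chartCoord a i y p := by
    intro r hr
    rw [maximalIdeal_eq] at hr
    refine Submodule.span_induction ?_ ⟨1, 0, by simp, by simp⟩ ?_ ?_ hr
    · rintro _ ⟨j, rfl⟩
      by_cases hj : j = i
      · subst hj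
        exact ⟨1, 1, by simp, by simp⟩
      · exact ⟨1, .X j, by simp, by rw [map_one, map_one, one_mul, ← hy]; simp [chartCoord, hj]⟩
    · rintro r r' _ _ ⟨s, p, hs, e⟩ ⟨s', p', hs', e'⟩
      refine ⟨s * s', chartSubst i s' * p + chartSubst i s * p', by rw [map_mul]; exact hs.mul hs', ?_⟩
      simp only [map_add, map_mul, chartCoord_subst hy]
      linear_combination a (toLocPoly _ s') * e + a (toLocPoly _ s) * e'
    · rintro c r _ ⟨s, p, hs, e⟩
      obtain ⟨s', p', hs', e'⟩ := isLoc_toLocPoly.surj c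
      refine ⟨s' * s, chartSubst i p' * p, by rw [map_mul]; exact hs'.mul hs, ?_⟩
      have e2 := congrArg a e'
      simp only [smul_eq_mul, map_mul, chartCoord_subst hy] at e2 ⊢
      linear_combination a (toLocPoly _ p') * e + a (toLocPoly _ s) * a r * e2
  refine Submodule.pow_induction_on_left' _ (C := fun n r _ => ∃ s p, IsUnit (toLocPoly e s) ∧
      a (toLocPoly e s) * a r = a (coordX i) ^ n * chartCoord a i y p) (fun c => ?_)
    (fun r r' n _ _ => ?_) (fun m hm n r _ => ?_) hr
  · obtain ⟨s', p', hs', e'⟩ := isLoc_toLocPoly.surj c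
    exact ⟨s', chartSubst i p', hs', by
      rw [← map_mul, Algebra.algebraMap_self_apply, e', chartCoord_subst hy, pow_zero, one_mul]⟩
  · rintro ⟨s, p, hs, e⟩ ⟨s', p', hs', e'⟩
    refine ⟨s * s', chartSubst i s' * p + chartSubst i s * p', by rw [map_mul]; exact hs.mul hs', ?_⟩
    simp only [map_add, map_mul, chartCoord_subst hy]
    linear_combination a (toLocPoly _ s') * e + a (toLocPoly _ s) * e'
  · rintro ⟨s, p, hs, e⟩
    obtain ⟨s', p', hs', e'⟩ := h1 m hm
    refine ⟨s' * s, p' * p, by rw [map_mul]; exact hs'.mul hs, ?_⟩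
    simp only [map_mul, pow_succ]
    linear_combination a (toLocPoly _ s) * a r * e' + a (coordX i) * chartCoord a i y p' * e

theorem isLoc_chartCoord [IsDomain Q] (hinj : Function.Injective a) (h0 : a (coordX i) ≠ 0)
    (hy : ∀ j, a (coordX i) * y j = a (coordX j))
    (frac : ∀ z, ∃ n, ∃ r ∈ maximalIdeal (LocPoly e) ^ n, a (coordX i) ^ n * z = a r) :
    IsLoc (chartCoord a i y) where
  surj z := by
    obtain ⟨n, r, hr, hz⟩ := frac z
    obtain ⟨s, p, hs, e1⟩ := exists_chartCoord_of_mem hy n hr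
    refine ⟨chartSubst i s, p, by rw [chartCoord_subst hy]; exact hs.map a, ?_⟩
    refine mul_left_cancel₀ (pow_ne_zero n h0) ?_
    rw [chartCoord_subst hy, mul_left_comm, hz, e1]
  ker p hp := by
    obtain ⟨n, q, hq⟩ := exists_chartSubst i p
    have h1 := congrArg (chartCoord a i y) hq
    rw [map_mul, hp, mul_zero, chartCoord_subst hy, map_eq_zero_iff a hinj,
      map_eq_zero_iff _ toLocPoly_injective] at h1
    rw [h1, map_zero] at hq
    have h2 := (mul_eq_zero.mp hq.symm).resolve_left (pow_ne_zero n (MvPolynomial.X_ne_zero i))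
    exact ⟨1, by simp, by rw [h2, mul_zero]⟩

end Coordinates

variable {e : ℕ} {A Q B Q' B' : Type} [CommRing A] [CommRing Q] [CommRing B] [CommRing Q']
  [CommRing B']

theorem IsChart.of_frac {p : LocPoly e →+* A} {a : LocPoly e →+* Q} {b : A →+* B} {τ : Q →+* B}
    (hp : Function.Surjective p) (comm : τ.comp a = b.comp p) [domQ : IsDomain Q] [domB : IsDomain B]
    (injQ : Function.Injective a) (injB : Function.Injective b) (i : Fin e) (y : Fin e → Q)
    (hy : ∀ j, a (coordX i) * y j = a (coordX j)) (h0 : b (p (coordX i)) ≠ 0)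
    (frac : ∀ z, ∃ n, ∃ r ∈ maximalIdeal (LocPoly e) ^ n, a (coordX i) ^ n * z = a r)
    (fracB : ∀ z, ∃ n, ∃ r ∈ (maximalIdeal (LocPoly e)).map p ^ n, b (p (coordX i)) ^ n * z = b r) :
    IsChart (algebraMap ℂ (LocPoly e)) p (maximalIdeal (LocPoly e)) a b τ := by
  have hx : coordX i ∈ maximalIdeal (LocPoly e) := by
    rw [maximalIdeal_eq]; exact Ideal.subset_span ⟨i, rfl⟩
  have hτ : ∀ r, τ (a r) = b (p r) := fun r => DFunLike.congr_fun comm r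
  have h1 : a (coordX i) ≠ 0 := fun h => h0 (by rw [← hτ, h, map_zero])
  have hm : (maximalIdeal (LocPoly e)).map a = Ideal.span {a (coordX i)} := by
    refine le_antisymm ?_ (Ideal.span_le.mpr (Set.singleton_subset_iff.mpr
      (Ideal.mem_map_of_mem _ hx)))
    rw [maximalIdeal_eq, Ideal.map_span, Ideal.span_le]
    rintro _ ⟨_, ⟨j, rfl⟩, rfl⟩
    exact Ideal.mem_span_singleton'.mpr ⟨y j, by rw [mul_comm, hy]⟩
  have hmn : ∀ n, (maximalIdeal (LocPoly e) ^ n).map a = Ideal.span {a (coordX i) ^ n} := fun n => by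
    rw [Ideal.map_pow, hm, Ideal.span_singleton_pow]
  refine ⟨comm, fun w => ?_, domQ, domB, injQ, injB, ⟨_, chartCoord a i y, i, coordX i, chartCoord_C,
    isLoc_chartCoord injQ h1 hy frac, chartCoord_X_self, hx, hm, h0⟩, fun z => ?_⟩
  · obtain ⟨n, r, hr, hw⟩ := fracB w
    rw [← Ideal.map_pow, Ideal.mem_map_iff_of_surjective p hp] at hr
    obtain ⟨r, hr, rfl⟩ := hr
    have h2 := Ideal.mem_map_of_mem a hr
    rw [hmn] at h2
    obtain ⟨z, hz⟩ := Ideal.mem_span_singleton'.mp h2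
    refine ⟨z, mul_left_cancel₀ (pow_ne_zero n h0) ?_⟩
    rw [hw, ← hτ, ← hτ, ← hz, map_mul, map_pow, mul_comm]
  · obtain ⟨n, r, hr, hz⟩ := frac z
    exact ⟨n, r, hr, coordX i ^ n, Ideal.pow_mem_pow hx n, by rw [hmn, map_pow],
      by rw [map_pow, hz]⟩

theorem IsAway.injective [IsDomain B] [Nontrivial B'] {β : B →+* B'} {g : B} (h : IsAway β g) :
    Function.Injective β := by
  rw [injective_iff_map_eq_zero]
  intro b hb
  obtain ⟨n, hn⟩ := h.ker b hb
  refine (mul_eq_zero.mp hn).resolve_left (pow_ne_zero n fun h0 => ?_)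
  have := h.unit
  rw [h0, map_zero] at this
  exact not_isUnit_zero this

theorem IsChart.away {k P : Type} [CommRing k] [CommRing P] {κ : k →+* P} {p : P →+* A}
    {𝔪 : Ideal P} {a : P →+* Q} {b : A →+* B} {τ : Q →+* B} {τ' : Q' →+* B'} {α : Q →+* Q'}
    {β : B →+* B'} {g : Q} (h : IsChart κ p 𝔪 a b τ) (hα : IsAway α g) (hβ : IsAway β (τ g))
    [domQ : IsDomain Q'] [domB : IsDomain B'] (hτ : τ'.comp α = β.comp τ) :
    IsChart κ p 𝔪 (α.comp a) (β.comp b) τ' := by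
  have := h.domQ
  have := h.domB
  have eτ : ∀ z, τ' (α z) = β (τ z) := fun z => DFunLike.congr_fun hτ z
  obtain ⟨ν, θ, t, x, h1, h2, h3, h4, h5, h6⟩ := h.coord
  refine ⟨?_, fun w => ?_, domQ, domB, hα.injective.comp h.injQ, hβ.injective.comp h.injB,
    ⟨ν, α.comp θ, t, x, ?_, h2.comp hα.isLoc, congrArg α h3, h4, ?_, ?_⟩, fun z => ?_⟩
  · rw [← RingHom.comp_assoc, hτ, RingHom.comp_assoc, h.comm, RingHom.comp_assoc]
  · obtain ⟨n, b₀, e⟩ := hβ.surj w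
    obtain ⟨z, rfl⟩ := h.surj b₀
    obtain ⟨u, hu⟩ := hα.unit.pow n
    refine ⟨↑u⁻¹ * α z, (hβ.unit.pow n).mul_left_cancel ?_⟩
    rw [← map_pow, e, map_mul, eτ, ← mul_assoc, map_pow, ← eτ, ← map_pow, ← hu, ← map_mul,
      Units.mul_inv, map_one, one_mul]
  · rw [RingHom.comp_assoc, h1, RingHom.comp_assoc]
  · rw [← Ideal.map_map, h5, Ideal.map_span, Set.image_singleton]; rfl
  · exact fun h0 => h6 ((map_eq_zero_iff β hβ.injective).mp h0)
  · obtain ⟨n, z₁, e1⟩ := hα.surj z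
    obtain ⟨N, r, hr, q, hq, hmq, e2⟩ := h.frac z₁
    obtain ⟨N', r', hr', q', hq', hmq', e3⟩ := h.frac (g ^ n)
    have e4 : α (a (q * r')) * z = α (a (q' * r)) := by
      rw [map_mul a, map_mul a, ← e2, ← e3]
      simp only [map_mul]
      rw [← e1]; ring
    refine ⟨N + N', q' * r, ?_, q * r', ?_, ?_, e4⟩
    · rw [add_comm, pow_add]; exact Ideal.mul_mem_mul hq' hr
    · rw [pow_add]; exact Ideal.mul_mem_mul hq hr'
    · have e5 : α (a (q * r')) = α (a (q * q')) * α (g ^ n) := by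
        rw [map_mul a, ← e3, map_mul a, map_mul, map_mul, map_mul]; ring
      rw [RingHom.comp_apply, e5, map_pow α, Ideal.span_singleton_mul_right_unit (hα.unit.pow n),
        ← Ideal.map_map, pow_add, Ideal.map_mul, hmq, hmq', Ideal.span_singleton_mul_span_singleton,
        Ideal.map_span, Set.image_singleton, map_mul a, map_mul α]

theorem finPres_of_finiteType {p : LocPoly e →+* A} (hp : Function.Surjective p) {b : A →+* B}
    (hb : b.FiniteType) : FinPres (b.comp (p.comp (algebraMap ℂ (LocPoly e)))) := by
  let := b.toAlgebra
  have hb' : Algebra.FiniteType A B := hb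
  obtain ⟨m, f, hf⟩ := Algebra.FiniteType.iff_quotient_mvPolynomial''.mp hb'
  let y : Fin (e + m) → B := Fin.addCases (fun i => b (p (coordX i))) fun j => f (.X j)
  let θ : MvPolynomial (Fin (e + m)) ℂ →+* B :=
    MvPolynomial.eval₂Hom (b.comp (p.comp (algebraMap ℂ (LocPoly e)))) y
  have hθ : ∀ q : MvPolynomial (Fin e) ℂ,
      θ (MvPolynomial.rename (Fin.castAdd m) q) = b (p (toLocPoly e q)) := fun q => by
    refine DFunLike.congr_fun (f := θ.comp (MvPolynomial.rename (Fin.castAdd m)).toRingHom)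
      (g := (b.comp p).comp (toLocPoly e)) (MvPolynomial.ringHom_ext (fun c => ?_) fun j => ?_) q
    · have := DFunLike.congr_fun (toLocPoly_comp_C (e := e)) c
      rw [RingHom.comp_apply] at this
      simp [θ, this]
    · simp [θ, y, coordX]
  refine ⟨e + m, LocAt θ, inferInstance, toLocAt θ, fromLocAt θ, ?_, isLoc_toLocAt θ, ?_, ?_⟩
  · exact IsLocalization.isNoetherianRing ((IsUnit.submonoid B).comap θ) _ inferInstance
  · have hA : ∀ r : A, ∃ z, fromLocAt θ z = b r := fun r => by
      obtain ⟨r, rfl⟩ := hp r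
      obtain ⟨s, q, hs, e1⟩ := isLoc_toLocPoly.surj r
      have hs' : IsUnit (θ (MvPolynomial.rename (Fin.castAdd m) s)) := by
        rw [hθ]; exact (hs.map p).map b
      obtain ⟨u, hu⟩ := isUnit_toLocAt hs'
      refine ⟨↑u⁻¹ * toLocAt θ (MvPolynomial.rename (Fin.castAdd m) q), hs'.mul_left_cancel ?_⟩
      rw [map_mul, ← mul_assoc, ← fromLocAt_apply θ, ← hu, ← map_mul, Units.mul_inv, map_one,
        one_mul, fromLocAt_apply, hu, fromLocAt_apply, hθ, hθ, ← e1]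
      simp
    intro w
    obtain ⟨w, rfl⟩ := hf w
    induction w using MvPolynomial.induction_on with
    | C c =>
      obtain ⟨z, hz⟩ := hA c
      exact ⟨z, hz.trans (f.commutes c).symm⟩
    | add p q hp hq =>
      obtain ⟨z, hz⟩ := hp
      obtain ⟨z', hz'⟩ := hq
      exact ⟨z + z', by rw [map_add, map_add, hz, hz']⟩
    | mul_X p j hp =>
      obtain ⟨z, hz⟩ := hp
      refine ⟨z * toLocAt θ (.X (Fin.natAdd e j)), ?_⟩
      rw [map_mul, map_mul, hz, fromLocAt_apply]
      simp [θ, y]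
  · rw [← RingHom.comp_assoc, fromLocAt_comp]
    exact MvPolynomial.eval₂Hom_comp_C _ _

end
end QLSing

namespace QLSing
noncomputable section

section ToSec

variable {A : Type} [CommRing A] {Y : Scheme.{0}}

theorem toSec_eq (π : Y ⟶ Spec (.of A)) {U : Y.Opens} (ψ : A →+* Γ(Y, U))
    (h : U.ι ≫ π = U.toSpecΓ ≫ Spec.map (CommRingCat.ofHom ψ)) : toSec π U = ψ := by
  have h1 := congrArg Scheme.Hom.appTop h
  rw [Scheme.Hom.comp_appTop, Scheme.Hom.comp_appTop, Scheme.Opens.toSpecΓ_appTop] at h1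
  have h2 : (Scheme.ΓSpecIso (.of A)).inv ≫ π.appTop ≫ U.ι.appTop = CommRingCat.ofHom ψ ≫ U.topIso.inv := by
    rw [h1, ← Scheme.ΓSpecIso_inv_naturality_assoc]
    simp
  have h3 : U.ι.appTop ≫ U.topIso.hom = Y.presheaf.map (homOfLE (le_top (a := U))).op := by
    rw [Scheme.Opens.ι_appTop]
    exact (Y.presheaf.map_comp _ _).symm.trans (congrArg Y.presheaf.map (Subsingleton.elim _ _))
  have h4 : (Scheme.ΓSpecIso (.of A)).inv ≫ π.appTop ≫ Y.presheaf.map (homOfLE (le_top (a := U))).op =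
      CommRingCat.ofHom ψ := by
    rw [← h3, ← Category.assoc, ← Category.assoc, Category.assoc _ π.appTop, h2, Category.assoc,
      Iso.inv_hom_id, Category.comp_id]
  exact congrArg CommRingCat.Hom.hom h4

theorem app_comp_toSec {Z : Scheme.{0}} {R : Type} [CommRing R] {π : Y ⟶ Spec (.of A)} {ρ : Z ⟶ Spec (.of R)} (j : Y ⟶ Z) (p : R →+* A)
    (h : j ≫ ρ = π ≫ Spec.map (CommRingCat.ofHom p)) (U : Z.Opens) :
    (j.app U).hom.comp (toSec ρ U) = (toSec π (j ⁻¹ᵁ U)).comp p := by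
  have h1 := congrArg Scheme.Hom.appTop h
  rw [Scheme.Hom.comp_appTop, Scheme.Hom.comp_appTop] at h1
  have h2 : (Scheme.ΓSpecIso (.of R)).inv ≫ ρ.appTop ≫ j.appTop =
      CommRingCat.ofHom p ≫ (Scheme.ΓSpecIso (.of A)).inv ≫ π.appTop := by
    rw [h1, ← Scheme.ΓSpecIso_inv_naturality_assoc]
  have h3 : Z.presheaf.map (homOfLE (le_top (a := U))).op ≫ j.app U =
      j.appTop ≫ Y.presheaf.map (homOfLE (le_top (a := j ⁻¹ᵁ U))).op := j.naturality _
  have h4 : ((Scheme.ΓSpecIso (.of R)).inv ≫ ρ.appTop) ≫ Z.presheaf.map (homOfLE (le_top (a := U))).op ≫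
      j.app U = CommRingCat.ofHom p ≫ ((Scheme.ΓSpecIso (.of A)).inv ≫ π.appTop) ≫
        Y.presheaf.map (homOfLE (le_top (a := j ⁻¹ᵁ U))).op := by
    rw [h3, ← Category.assoc, Category.assoc _ ρ.appTop, h2, Category.assoc]
  exact congrArg CommRingCat.Hom.hom h4

end ToSec

variable {R : Type} [CommRing R] (J : Ideal R)

theorem algebraMap_zero_surjective : Function.Surjective (algebraMap R (reesPiece J 0)) := fun z => by
  refine ⟨(z.1 : Polynomial R).coeff 0, Subtype.ext (Subtype.ext (Polynomial.ext fun i => ?_))⟩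
  by_cases hi : i = 0
  · subst hi; exact Polynomial.coeff_C_zero
  · exact (Polynomial.coeff_C_of_ne_zero hi).trans (z.2 i hi).symm

instance [IsNoetherianRing R] : LocallyOfFiniteType (blowupπ J) := by
  have : IsScalarTower R (reesPiece J 0) (reesAlgebra J) :=
    ⟨fun r z w => smul_mul_assoc r (z : reesAlgebra J) w⟩
  have : Algebra.FiniteType (reesPiece J 0) (reesAlgebra J) :=
    Algebra.FiniteType.of_restrictScalars_finiteType R _ _
  have h2 : ∀ g : CommRingCat.of R ⟶ CommRingCat.of (reesPiece J 0), Function.Surjective g.hom →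
      LocallyOfFiniteType (Spec.map g) := fun g hg => by
    rw [HasRingHomProperty.Spec_iff (P := @LocallyOfFiniteType)]
    exact RingHom.FiniteType.of_surjective _ hg
  have := h2 (CommRingCat.ofHom (algebraMap R (reesPiece J 0))) (algebraMap_zero_surjective J)
  have h3 : LocallyOfFiniteType (Proj.toSpecZero (reesPiece J)) := inferInstance
  exact MorphismProperty.comp_mem @LocallyOfFiniteType _ _ h3 this

theorem finiteType_toSec {A : Type} [CommRing A] {Y : Scheme.{0}} (π : Y ⟶ Spec (.of A)) [LocallyOfFiniteType π]
    {U : Y.Opens} (hU : IsAffineOpen U) : (toSec π U).FiniteType :=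
  (π.finiteType_appLE (isAffineOpen_top _) hU le_top).comp
    (RingHom.FiniteType.of_surjective (Scheme.ΓSpecIso (.of A)).inv.hom
      (ConcreteCategory.bijective_of_isIso (Scheme.ΓSpecIso (.of A)).inv).2)

variable {J}

/-- The element `x t` of the Rees algebra. -/
def degOne {x : R} (hx : x ∈ J) : reesAlgebra J :=
  ⟨.monomial 1 x, reesAlgebra.monomial_mem.mpr (by rwa [pow_one])⟩

theorem degOne_mem {x : R} (hx : x ∈ J) : degOne hx ∈ reesPiece J 1 :=
  fun _ hi => Polynomial.coeff_monomial_of_ne _ hi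

open HomogeneousLocalization

variable {x : R} (hx : x ∈ J)

/-- The ring map from `R` to a chart of the blow-up. -/
def toAway : R →+* Away (reesPiece J) (degOne hx) :=
  (fromZeroRingHom (reesPiece J) _).comp (algebraMap R (reesPiece J 0))

theorem val_toAway (r : R) : (toAway hx r).val = algebraMap _ _ (algebraMap R (reesAlgebra J) r) :=
  rfl

theorem degOne_pow_mul (n : ℕ) {r : R} {s : reesAlgebra J} (hs : s ∈ reesPiece J n)
    (hr : (s : Polynomial R).coeff n = r) :
    algebraMap R (reesAlgebra J) x ^ n * s = degOne hx ^ n * algebraMap R (reesAlgebra J) r := by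
  have h1 : (s : Polynomial R) = .monomial n r := Polynomial.ext fun i => by
    by_cases hi : i = n
    · subst hi; rw [hr, Polynomial.coeff_monomial_same]
    · rw [hs i hi, Polynomial.coeff_monomial_of_ne _ hi]
  refine Subtype.ext ?_
  change Polynomial.C x ^ n * (s : Polynomial R) = Polynomial.monomial 1 x ^ n * Polynomial.C r
  rw [h1, Polynomial.monomial_pow, ← map_pow, Polynomial.C_mul_monomial, Polynomial.monomial_mul_C,
    one_mul]

theorem away_eq (n : ℕ) {r : R} {s : reesAlgebra J} (hs : s ∈ reesPiece J (n • 1))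
    (hr : (s : Polynomial R).coeff n = r) :
    toAway hx x ^ n * Away.mk _ (degOne_mem hx) n s hs = toAway hx r := by
  apply val_injective
  rw [val_mul, val_pow, val_toAway, val_toAway, Away.val_mk]
  have h1 : s ∈ reesPiece J n := by simpa using hs
  have h2 := degOne_pow_mul hx n h1 hr
  refine (IsLocalization.map_units (Localization (Submonoid.powers (degOne hx)))
    (⟨degOne hx ^ n, n, rfl⟩ : Submonoid.powers (degOne hx))).mul_left_cancel ?_
  rw [← map_mul, ← h2, mul_left_comm, Localization.mk_eq_mk', IsLocalization.mk'_spec'_mk, map_mul, map_pow]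

theorem toAway_frac (z : Away (reesPiece J) (degOne hx)) :
    ∃ n, ∃ r ∈ J ^ n, toAway hx x ^ n * z = toAway hx r := by
  obtain ⟨n, s, hs, rfl⟩ := Away.mk_surjective _ (degOne_mem hx) z
  exact ⟨n, (s : Polynomial R).coeff n, s.2 n, away_eq hx n hs rfl⟩

theorem toAway_div {r : R} (hr : r ∈ J) : ∃ y, toAway hx x * y = toAway hx r := by
  refine ⟨Away.mk _ (degOne_mem hx) 1 (degOne hr) (degOne_mem hr), ?_⟩
  exact (congrArg (· * _) (pow_one (toAway hx x)).symm).trans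
    (away_eq hx 1 (degOne_mem hr) (Polynomial.coeff_monomial_same 1 r))

theorem degOne_ne_zero (h0 : x ≠ 0) : degOne hx ≠ 0 := fun h =>
  h0 (by simpa [degOne] using congrArg (fun s : reesAlgebra J => (s : Polynomial R).coeff 1) h)

theorem toAway_injective [IsDomain R] (h0 : x ≠ 0) : Function.Injective (toAway hx) := by
  intro r s h
  have h1 := congrArg HomogeneousLocalization.val h
  rw [val_toAway, val_toAway] at h1
  have h2 := IsLocalization.injective (Localization (Submonoid.powers (degOne hx)))
    (powers_le_nonZeroDivisors_of_noZeroDivisors (degOne_ne_zero hx h0)) h1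
  exact Polynomial.C_injective (congrArg Subtype.val h2)

theorem isDomain_away [IsDomain R] (h0 : x ≠ 0) : IsDomain (Away (reesPiece J) (degOne hx)) := by
  have : IsDomain (Localization (Submonoid.powers (degOne hx))) :=
    IsLocalization.isDomain_localization
      (powers_le_nonZeroDivisors_of_noZeroDivisors (degOne_ne_zero hx h0))
  let ν : Away (reesPiece J) (degOne hx) →+* Localization (Submonoid.powers (degOne hx)) :=
    { toFun := HomogeneousLocalization.val
      map_one' := val_one
      map_mul' := val_mul
      map_zero' := val_zero
      map_add' := val_add }
  exact Function.Injective.isDomain ν (val_injective _)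

/-- The open set where `x` generates the ideal of the exceptional divisor. -/
def chartOpen : (blowup J).Opens := Proj.basicOpen (reesPiece J) (degOne hx)

theorem isAffineOpen_chartOpen : IsAffineOpen (chartOpen hx) :=
  Proj.isAffineOpen_basicOpen _ _ (degOne_mem hx) one_pos

/-- The sections over `chartOpen`. -/
def awaySec : Away (reesPiece J) (degOne hx) →+* Γ(blowup J, chartOpen hx) :=
  (Proj.awayToSection (reesPiece J) (degOne hx)).hom

theorem awaySec_bijective : Function.Bijective (awaySec hx) := by
  have := (Proj.basicOpenIsoAway (reesPiece J) (degOne hx) (degOne_mem hx) one_pos).isIso_hom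
  exact ConcreteCategory.bijective_of_isIso
    (Proj.basicOpenIsoAway (reesPiece J) (degOne hx) (degOne_mem hx) one_pos).hom

theorem toSec_chartOpen : toSec (blowupπ J) (chartOpen hx) = (awaySec hx).comp (toAway hx) := by
  refine toSec_eq _ _ ?_
  have h1 := Proj.awayι_toSpecZero (reesPiece J) (degOne hx) (degOne_mem hx) one_pos
  rw [← Proj.basicOpenIsoSpec_inv_ι, Category.assoc, Iso.inv_comp_eq, Proj.basicOpenIsoSpec_hom] at h1
  change (Proj.basicOpen (reesPiece J) (degOne hx)).ι ≫ Proj.toSpecZero (reesPiece J) ≫ _ = _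
  rw [← Category.assoc, h1, Proj.basicOpenToSpec, Category.assoc, Category.assoc, ← Spec.map_comp,
    ← Spec.map_comp]
  rfl

theorem iSup_chartOpen {ι : Type} {x : ι → R} (hx : ∀ i, x i ∈ J) (hJ : J = Ideal.span (Set.range x)) :
    ⨆ i, chartOpen (hx i) = ⊤ := by
  refine Proj.iSup_basicOpen_eq_top (reesPiece J) (fun i => degOne (hx i)) ?_
  refine (HomogeneousIdeal.toIdeal_irrelevant_le _).mpr fun n hn s hs => ?_
  obtain ⟨n, rfl⟩ := Nat.exists_eq_add_of_lt hn
  rw [zero_add] at hs hn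
  have key : ∀ r ∈ J ^ (n + 1), ∃ s ∈ Ideal.span (Set.range fun i => degOne (hx i)),
      (s : Polynomial R) = .monomial (n + 1) r := fun r hr => by
    rw [pow_succ'] at hr
    refine Submodule.mul_induction_on hr (fun m hm u hu => ?_) ?_
    · let u' : reesAlgebra J := ⟨.monomial n u, reesAlgebra.monomial_mem.mpr hu⟩
      rw [hJ] at hm
      refine Submodule.span_induction (p := fun m _ => ∃ s ∈ Ideal.span (Set.range fun i =>
        degOne (hx i)), (s : Polynomial R) = .monomial (n + 1) (m * u)) ?_ ?_ ?_ ?_ hm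
      · rintro _ ⟨i, rfl⟩
        refine ⟨u' * degOne (hx i), Ideal.mul_mem_left _ _ (Ideal.subset_span ⟨i, rfl⟩), ?_⟩
        change Polynomial.monomial n u * Polynomial.monomial 1 (x i) = _
        rw [Polynomial.monomial_mul_monomial, mul_comm]
      · exact ⟨0, zero_mem _, by simp⟩
      · rintro m m' _ _ ⟨s, hs, e⟩ ⟨s', hs', e'⟩
        exact ⟨s + s', add_mem hs hs', by rw [add_mul, map_add, ← e, ← e']; rfl⟩
      · rintro c m _ ⟨s, hs, e⟩
        refine ⟨algebraMap R _ c * s, Ideal.mul_mem_left _ _ hs, ?_⟩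
        change Polynomial.C c * (s : Polynomial R) = _
        rw [e, Polynomial.C_mul_monomial, smul_mul_assoc]; rfl
    · rintro m m' ⟨s, hs, e⟩ ⟨s', hs', e'⟩
      exact ⟨s + s', add_mem hs hs', by rw [map_add, ← e, ← e']; rfl⟩
  obtain ⟨s', hs', e⟩ := key _ (s.2 (n + 1))
  have : s = s' := Subtype.ext (Polynomial.ext fun i => by
    rw [e]
    by_cases hi : i = n + 1
    · subst hi; rw [Polynomial.coeff_monomial_same]
    · rw [Polynomial.coeff_monomial_of_ne _ hi]; exact hs i hi)
  rw [this]; exact hs'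

variable {S : Type} [CommRing S] {φ : R →+* S} (hφ : Function.Surjective φ)

theorem away_map_algebraMap (s : reesAlgebra J) (r : R) :
    Away.map (reesMap φ J) s (fromZeroRingHom (reesPiece J) _ (algebraMap R (reesPiece J 0) r)) =
      fromZeroRingHom (reesPiece (J.map φ)) _ (algebraMap S (reesPiece (J.map φ) 0) (φ r)) := by
  refine val_injective _ ?_
  change Localization.mk (reesMap φ J (algebraMap R (reesAlgebra J) r)) ⟨reesMap φ J 1, _⟩ =
    Localization.mk (algebraMap S (reesAlgebra (J.map φ)) (φ r)) ⟨1, _⟩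
  refine congrArg₂ Localization.mk (Subtype.ext (Polynomial.map_C φ)) (Subtype.ext (map_one _))

theorem awayι_comp_blowupMap {n : ℕ} (hn : 0 < n) (s : reesAlgebra J) (hs : s ∈ reesPiece J n) :
    Proj.awayι (reesPiece (J.map φ)) (reesMap φ J s) ((reesMap φ J).2 hs) hn ≫
      Proj.map (reesMap φ J) (irrelevant_le_map_reesMap hφ J) ≫ Proj.toSpecZero (reesPiece J) ≫
        Spec.map (CommRingCat.ofHom (algebraMap R (reesPiece J 0))) =
    Proj.awayι (reesPiece (J.map φ)) (reesMap φ J s) ((reesMap φ J).2 hs) hn ≫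
      Proj.toSpecZero (reesPiece (J.map φ)) ≫
        Spec.map (CommRingCat.ofHom (algebraMap S (reesPiece (J.map φ) 0))) ≫
          Spec.map (CommRingCat.ofHom φ) := by
  rw [Proj.awayι_comp_map_assoc _ _ hn _ hs, Proj.awayι_toSpecZero_assoc,
    Proj.awayι_toSpecZero_assoc, ← Spec.map_comp, ← Spec.map_comp, ← Spec.map_comp, ← Spec.map_comp]
  exact congrArg Spec.map (CommRingCat.hom_ext (RingHom.ext fun r => away_map_algebraMap s r))

theorem blowupMap_comp :
    blowupMap hφ J ≫ blowupπ J = blowupπ (J.map φ) ≫ Spec.map (CommRingCat.ofHom φ) :=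
  Eq.trans ((Proj.mapAffineOpenCover (reesMap φ J)
    (irrelevant_le_map_reesMap hφ J)).openCover.hom_ext _ _ fun s =>
      awayι_comp_blowupMap hφ s.1.2 s.2.1 s.2.2) (Category.assoc _ _ _).symm

theorem preimage_chartOpen : blowupMap hφ J ⁻¹ᵁ chartOpen hx = chartOpen (Ideal.mem_map_of_mem φ hx) := by
  have : reesMap φ J (degOne hx) = degOne (Ideal.mem_map_of_mem φ hx) := Subtype.ext (Polynomial.map_monomial _)
  change Proj.basicOpen _ (reesMap φ J (degOne hx)) = _
  rw [this]; rfl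

end
end QLSing

namespace QLSing
noncomputable section

/-! ### The charts of the blow-up of a QL-singularity -/

open nonZeroDivisors IsLocalRing

section Functions

variable {Y : Scheme.{0}}

theorem fun_ext {U : Y.Opens} {s t : Γ(Y, U)}
    (h : ∀ x ∈ U, ∃ (V : Y.Opens) (hV : V ≤ U), x ∈ V ∧ resHom hV s = resHom hV t) : s = t := by
  choose V hV hx e using h
  refine TopCat.Sheaf.eq_of_locally_eq' Y.sheaf (fun x : U => V x.1 x.2) U
    (fun x => homOfLE (hV x.1 x.2)) (fun x hxU => ?_) s t fun x => e x.1 x.2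
  exact Opens.mem_iSup.mpr ⟨⟨x, hxU⟩, hx x hxU⟩

theorem fun_glue {U : Y.Opens} {ι : Type} (V : ι → Y.Opens) (hV : ∀ i, V i ≤ U)
    (hU : ∀ x ∈ U, ∃ i, x ∈ V i) (s : ∀ i, Γ(Y, V i))
    (h : ∀ i j, resHom (U := V i) (V := V i ⊓ V j) inf_le_left (s i) =
      resHom (U := V j) (V := V i ⊓ V j) inf_le_right (s j)) :
    ∃ t : Γ(Y, U), ∀ i, resHom (hV i) t = s i := by
  obtain ⟨t, ht, -⟩ := TopCat.Sheaf.existsUnique_gluing' Y.sheaf V U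
    (fun i => homOfLE (hV i)) (fun x hx => by
      obtain ⟨i, hi⟩ := hU x hx
      exact Opens.mem_iSup.mpr ⟨i, hi⟩) s fun i j => h i j
  exact ⟨t, ht⟩

theorem IsAway.isDomain {B B' : Type} [CommRing B] [CommRing B'] [IsDomain B] [Nontrivial B']
    {β : B →+* B'} {g : B} (h : IsAway β g) : IsDomain B' := by
  have : NoZeroDivisors B' := ⟨fun {z w} e => by
    obtain ⟨n, b, hb⟩ := h.surj z
    obtain ⟨m, c, hc⟩ := h.surj w
    have h1 : β (b * c) = 0 := by rw [map_mul, ← hb, ← hc, mul_mul_mul_comm, e, mul_zero]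
    rw [map_eq_zero_iff β h.injective, mul_eq_zero] at h1
    refine h1.imp (fun h0 => ?_) fun h0 => ?_
    · rw [h0, map_zero, map_pow] at hb
      exact (h.unit.pow n).mul_right_eq_zero.mp hb
    · rw [h0, map_zero, map_pow] at hc
      exact (h.unit.pow m).mul_right_eq_zero.mp hc⟩
  exact NoZeroDivisors.to_isDomain B'

end Functions

/-- The properties of the open set where `x` generates the exceptional ideal. -/
structure ChartProps {R : Type} [CommRing R] {Y : Scheme.{0}} (π : Y ⟶ Spec (.of R)) (J : Ideal R)
    (x : R) (U : Y.Opens) : Prop where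
  aff : IsAffineOpen U
  dom : IsDomain Γ(Y, U)
  inj : Function.Injective (toSec π U)
  frac : ∀ z, ∃ n, ∃ r ∈ J ^ n, toSec π U x ^ n * z = toSec π U r
  div : ∀ r ∈ J, ∃ y, toSec π U x * y = toSec π U r

theorem chartProps_chartOpen {R : Type} [CommRing R] [IsDomain R] {J : Ideal R} {x : R} (hx : x ∈ J)
    (h0 : x ≠ 0) : ChartProps (blowupπ J) J x (chartOpen hx) := by
  have e := toSec_chartOpen hx
  have hb := awaySec_bijective hx
  have := isDomain_away hx h0
  refine ⟨isAffineOpen_chartOpen hx, ?_, ?_, fun z => ?_, fun r hr => ?_⟩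
  · exact Function.Injective.isDomain (RingEquiv.ofBijective (awaySec hx) hb).symm
      (RingEquiv.injective _)
  · rw [e]
    exact hb.1.comp (toAway_injective hx h0)
  · obtain ⟨z, rfl⟩ := hb.2 z
    obtain ⟨n, r, hr, h1⟩ := toAway_frac hx z
    exact ⟨n, r, hr, by
      rw [e, RingHom.comp_apply, RingHom.comp_apply, ← h1, map_mul]
      exact congrArg (· * awaySec hx z) (map_pow (awaySec hx) (toAway hx x) n).symm⟩
  · obtain ⟨y, hy⟩ := toAway_div hx hr
    exact ⟨awaySec hx y, by rw [e, RingHom.comp_apply, RingHom.comp_apply, ← hy, map_mul]⟩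

variable {e : ℕ} (I : Ideal (LocPoly e))

/-- The blow-up morphism of `Spec P`. -/
abbrev piP (e : ℕ) : blowup (maximalIdeal (LocPoly e)) ⟶ Spec (.of (LocPoly e)) :=
  blowupπ (maximalIdeal (LocPoly e))

/-- `W` and its inverse image in `X̂` are charts. -/
abbrev IsChartOpen (W : (blowup (maximalIdeal (LocPoly e))).Opens) : Prop :=
  IsChart (algebraMap ℂ (LocPoly e)) (projA I) (maximalIdeal (LocPoly e)) (toSec (piP e) W)
    (toSec (piX I) (embX I ⁻¹ᵁ W)) ((embX I).app W).hom

/-- A chart of `X̂` and `M`. -/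
structure Chart where
  W : (blowup (maximalIdeal (LocPoly e))).Opens
  affW : IsAffineOpen W
  affV : IsAffineOpen (embX I ⁻¹ᵁ W)
  isChart : IsChartOpen I W

variable {I}

/-- The underlying open set of `X̂`. -/
def chartV (c : Chart I) : (Xhat I).affineOpens := ⟨embX I ⁻¹ᵁ c.W, c.affV⟩

/-- The order relation of charts. -/
def chartLe (c d : Chart I) : Prop := c.W ≤ d.W

theorem chartV_mono {c d : Chart I} (h : chartLe c d) : (chartV c).1 ≤ (chartV d).1 :=
  (Opens.map (embX I).base).monotone h

variable (I) in
theorem embX_comp : embX I ≫ piP e = piX I ≫ Spec.map (CommRingCat.ofHom (projA I)) :=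
  blowupMap_comp (projA_surjective I)

theorem embX_toSec (W : (blowup (maximalIdeal (LocPoly e))).Opens) :
    ((embX I).app W).hom.comp (toSec (piP e) W) = (toSec (piX I) (embX I ⁻¹ᵁ W)).comp (projA I) :=
  app_comp_toSec (embX I) (projA I) (embX_comp I) W

theorem coordX_mem (i : Fin e) : coordX i ∈ maximalIdeal (LocPoly e) := by
  rw [maximalIdeal_eq]; exact Ideal.subset_span ⟨i, rfl⟩

/-- The standard charts. -/
def stdChart [IsDomain (RingA I)] (i : Fin e) (h0 : projA I (coordX i) ≠ 0) : Chart I :=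
  have h1 : coordX i ≠ 0 := fun h => h0 (by rw [h, map_zero])
  have hP := chartProps_chartOpen (coordX_mem i) h1
  have hA : ChartProps (piX I) (maxA I) (projA I (coordX i)) (embX I ⁻¹ᵁ chartOpen (coordX_mem i)) := by
    have h2 := preimage_chartOpen (coordX_mem i) (projA_surjective I)
    have h3 := chartProps_chartOpen (Ideal.mem_map_of_mem (projA I) (coordX_mem i)) h0
    rw [← h2] at h3
    exact h3
  { W := chartOpen (coordX_mem i)
    affW := hP.aff
    affV := hA.aff
    isChart := by
      choose y hy using fun j => hP.div (coordX j) (coordX_mem j)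
      have := hP.dom
      have := hA.dom
      exact IsChart.of_frac (projA_surjective I) (embX_toSec _) hP.inj hA.inj i y hy
        (fun h => h0 (hA.inj (h.trans (map_zero _).symm))) hP.frac hA.frac }

theorem exists_stdChart [IsDomain (RingA I)] (x : Xhat I) : ∃ i h0, x ∈ (chartV (stdChart (I := I) i h0)).1 := by
  have h1 := iSup_chartOpen (x := fun i => projA I (coordX i)) (J := maxA I)
    (fun i => Ideal.mem_map_of_mem _ (coordX_mem i))
    (by rw [maxA, maximalIdeal_eq, Ideal.map_span, ← Set.range_comp]; rfl)
  have h2 : x ∈ (⊤ : (Xhat I).Opens) := trivial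
  rw [← h1] at h2
  obtain ⟨i, hi⟩ := Opens.mem_iSup.mp h2
  have h3 := preimage_chartOpen (coordX_mem i) (projA_surjective I)
  refine ⟨i, fun h0 => ?_, ?_⟩
  · have h4 : degOne (Ideal.mem_map_of_mem (projA I) (coordX_mem i)) = 0 := Subtype.ext (by
      change Polynomial.monomial 1 _ = 0
      rw [h0, map_zero])
    have h5 : chartOpen (Ideal.mem_map_of_mem (projA I) (coordX_mem i)) = ⊥ := by
      rw [chartOpen, h4]
      exact Proj.basicOpen_zero _
    exact (h5.le hi : x ∈ (⊥ : (Xhat I).Opens))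
  · exact h3.ge hi

/-- Basic open subsets of charts are charts. -/
theorem exists_basicChart (c : Chart I) (g : Γ(blowup (maximalIdeal (LocPoly e)), c.W)) (x : Xhat I)
    (hx : x ∈ embX I ⁻¹ᵁ (Scheme.basicOpen _ g)) :
    ∃ d : Chart I, d.W = Scheme.basicOpen _ g := by
  have h1 : embX I ⁻¹ᵁ (Scheme.basicOpen _ g) = (Xhat I).basicOpen ((embX I).app c.W g) :=
    Scheme.preimage_basicOpen _ _
  have hle := Scheme.basicOpen_le _ g
  have hα := isAway_basicOpen c.affW g
  have hβ : IsAway (resHom ((Opens.map (embX I).base).monotone hle)) ((embX I).app c.W g) := by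
    have h2 := isAway_basicOpen c.affV ((embX I).app c.W g)
    have : ∀ (V : (Xhat I).Opens) (hV : V ≤ embX I ⁻¹ᵁ c.W),
      V = (Xhat I).basicOpen ((embX I).app c.W g) → IsAway (resHom hV) ((embX I).app c.W g) := by
        rintro V hV rfl; exact h2
    exact this _ _ h1
  have hc := c.isChart
  have := hc.domQ
  have := hc.domB
  have : Nonempty (Scheme.basicOpen _ g) := ⟨⟨(embX I) x, hx⟩⟩
  have : Nonempty (embX I ⁻¹ᵁ (Scheme.basicOpen _ g)) := ⟨⟨x, hx⟩⟩
  have := hα.isDomain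
  have := hβ.isDomain
  refine ⟨⟨Scheme.basicOpen _ g, c.affW.basicOpen g, h1 ▸ c.affV.basicOpen _, ?_⟩, rfl⟩
  have key := hc.away hα hβ (τ' := ((embX I).app (Scheme.basicOpen _ g)).hom)
    (congrArg CommRingCat.Hom.hom ((embX I).naturality (homOfLE hle).op))
  rw [resHom_comp_toSec, resHom_comp_toSec] at key
  exact key

theorem exists_chart_le (c : Chart I) {U : (Xhat I).Opens} {x : Xhat I} (hx : x ∈ (chartV c).1)
    (hxU : x ∈ U) : ∃ d, chartLe d c ∧ x ∈ (chartV d).1 ∧ (chartV d).1 ≤ U := by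
  obtain ⟨f, hf, hxf⟩ := c.affV.exists_basicOpen_le (V := U) ⟨x, hxU⟩ hx
  obtain ⟨g, rfl⟩ := c.isChart.surj f
  have h1 : embX I ⁻¹ᵁ (Scheme.basicOpen _ g) = (Xhat I).basicOpen ((embX I).app c.W g) :=
    Scheme.preimage_basicOpen _ _
  obtain ⟨d, hd⟩ := exists_basicChart c g x (h1.ge hxf)
  have h2 : (chartV d).1 = (Xhat I).basicOpen ((embX I).app c.W g) := by
    rw [← h1, ← hd]; rfl
  exact ⟨d, hd.le.trans (Scheme.basicOpen_le _ g), h2.ge hxf, h2.le.trans hf⟩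

/-- The family of the charts of `X̂`. -/
abbrev chartFamily (I : Ideal (LocPoly e)) : OpenFamily (Xhat I) :=
  subFamily (K := Chart I) chartV chartLe chartV_mono

theorem isBase_chartFamily [IsDomain (RingA I)] : IsBase (chartFamily I) where
  cover U x hx := by
    obtain ⟨i, h0, hi⟩ := exists_stdChart x
    obtain ⟨d, -, h1, h2⟩ := exists_chart_le _ hi hx
    exact ⟨d, h1, h2⟩
  refine c d x hc hd U hxU := by
    obtain ⟨f, g, h1, h2⟩ := exists_basicOpen_le_affine_inter c.affW d.affW (embX I x) ⟨hc, hd⟩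
    obtain ⟨a, ha⟩ := exists_basicChart c f x h2
    obtain ⟨b, hb, h3, h4⟩ := exists_chart_le a (U := U) (show x ∈ embX I ⁻¹ᵁ a.W by rw [ha]; exact h2) hxU
    refine ⟨b, hb.trans (ha.le.trans (Scheme.basicOpen_le _ f)), hb.trans (ha.le.trans ?_), h3, h4⟩
    rw [h1]
    exact Scheme.basicOpen_le _ g
  trans h h' := h'.trans h

theorem cartierOn_chartV : CartierOn (piX I) (maxA I) (chartV (I := I)) := fun c => by
  obtain ⟨x, hx, -, h0, -, hn⟩ := c.isChart.exists_eq
  refine ⟨toSec (piX I) (chartV c).1 (projA I x), ?_, fun V hV => ?_⟩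
  · have := hn 1
    rwa [pow_one, pow_one] at this
  · rw [mem_nonZeroDivisors_iff_right]
    refine fun z hz => fun_ext fun y hy => ?_
    obtain ⟨d, -, hyd, hdV⟩ := exists_chart_le c (hV hy) hy
    refine ⟨_, hdV, hyd, ?_⟩
    have h1 := congrArg (resHom hdV) hz
    have : IsDomain Γ(Xhat I, (chartV d).1) := d.isChart.domB
    rw [map_mul, map_zero, ← RingHom.comp_apply (resHom hV), resHom_comp_toSec,
      ← RingHom.comp_apply (resHom hdV), resHom_comp_toSec] at h1
    rw [map_zero]
    refine (mul_eq_zero.mp h1).resolve_right fun h2 => ?_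
    have h3 : projA I x = 0 := d.isChart.injB (h2.trans (map_zero _).symm)
    rw [h3, map_zero] at h0
    have : IsDomain Γ(Xhat I, embX I ⁻¹ᵁ c.W) := c.isChart.domB
    exact nonZeroDivisors.ne_zero h0 rfl

theorem resHom_embX {W W' : (blowup (maximalIdeal (LocPoly e))).Opens} (h : W' ≤ W) :
    ((embX I).app W').hom.comp (resHom h) =
      (resHom ((Opens.map (embX I).base).monotone h)).comp ((embX I).app W).hom :=
  congrArg CommRingCat.Hom.hom ((embX I).naturality (homOfLE h).op)

end
end QLSing

namespace QLSing
noncomputable section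

/-! ### Coherence of the local data -/

open nonZeroDivisors

section Algebra

variable {k R B : Type} [CommRing k] [CommRing R] [CommRing B] {ι : k →+* R} {φ : R →+* B}

theorem T1.coeff_id {β : B →+* B} (hβ : ∀ b, β b = b) (h : β.comp φ = φ) (s : T1 ι φ) :
    T1.coeff ι β h s = s := by
  obtain rfl : β = RingHom.id B := RingHom.ext hβ
  obtain ⟨x, rfl⟩ := Submodule.Quotient.mk_surjective _ s
  rfl

theorem T2.coeff_id {β : B →+* B} (hβ : ∀ b, β b = b) (h : β.comp φ = φ) (s : T2 ι φ) :
    T2.coeff ι β h s = s := by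
  obtain rfl : β = RingHom.id B := RingHom.ext hβ
  obtain ⟨x, rfl⟩ := Submodule.Quotient.mk_surjective _ s
  rfl

theorem T1.coeff_eq_pull {ρ : R →+* R} (hρ : ∀ r, ρ r = r) (h : ρ.comp (RingHom.id R) = ρ)
    (h' : ρ.comp ι = ι) (h'' : (RingHom.id R).comp ρ = ρ) (s : T1 ι (RingHom.id R)) :
    T1.coeff ι ρ h s = T1.pull h' h'' s := by
  obtain rfl : ρ = RingHom.id R := RingHom.ext hρ
  rw [T1.coeff_id (fun _ => rfl)]
  exact (T1.pull_bijective isLoc_id h' h'').1 (T1.pull_pull h' h' h' rfl h'' h'' h'' s).symm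

theorem T2.coeff_eq_pull {ρ : R →+* R} (hρ : ∀ r, ρ r = r) (h : ρ.comp (RingHom.id R) = ρ)
    (h' : ρ.comp ι = ι) (h'' : (RingHom.id R).comp ρ = ρ) (s : T2 ι (RingHom.id R)) :
    T2.coeff ι ρ h s = T2.pull h' h'' s := by
  obtain rfl : ρ = RingHom.id R := RingHom.ext hρ
  rw [T2.coeff_id (fun _ => rfl)]
  exact (T2.pull_bijective isLoc_id h' h'').1 (T2.pull_pull h' h' h' rfl h'' h'' h'' s).symm

end Algebra

variable {k A : Type} [CommRing k] [CommRing A] {Y : Scheme.{0}} (ι : k →+* A)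
  (π : Y ⟶ Spec (.of A)) {K : Type} (v : K → Y.affineOpens)

theorem relT0Data_coherent : (relT0Data ι π).Coherent v where
  res h _ _ s := ⟨T0.coeff ι (resHom h) (resHom_comp_toSec π h) s, fun _ => rfl⟩
  uniq h _ _ t e := Subtype.ext (funext fun a => (e a).symm.trans (map_zero _))
  self h s a := resHom_self h _
  comp h h' _ _ _ e e' a := (resHom_resHom h h' _).symm.trans ((congrArg _ (e a)).trans (e' a))

theorem relT1Data_coherent : (relT1Data ι π).Coherent v where
  res _ _ _ s := ⟨_, rfl⟩
  uniq h _ _ t e := e.symm.trans (LinearMap.map_zero _)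
  self h s := T1.coeff_id (resHom_self h) (resHom_comp_toSec π h) s
  comp {U V W} h h' := fun {s : T1 ι (toSec π U.1)} {t u} e e' =>
    (T1.coeff_coeff (resHom_comp h h') (resHom_comp_toSec π h) (resHom_comp_toSec π h')
      (resHom_comp_toSec π (h'.trans h)) s).symm.trans ((congrArg _ e).trans e')

theorem relT2Data_coherent : (relT2Data ι π).Coherent v where
  res _ _ _ s := ⟨_, rfl⟩
  uniq h _ _ t e := e.symm.trans (LinearMap.map_zero _)
  self h s := T2.coeff_id (resHom_self h) (resHom_comp_toSec π h) s
  comp {U V W} h h' := fun {s : T2 ι (toSec π U.1)} {t u} e e' =>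
    (T2.coeff_coeff (resHom_comp h h') (resHom_comp_toSec π h) (resHom_comp_toSec π h')
      (resHom_comp_toSec π (h'.trans h)) s).symm.trans ((congrArg _ e).trans e')

section Finite

variable (hF : ∀ V : Y.affineOpens, FinPres ((toSec π V.1).comp ι))
include hF

theorem thetaData_coherent : (thetaData ι π).Coherent v where
  res {V W} h _ _ := fun (s : T0 ((toSec π V.1).comp ι) (RingHom.id Γ(Y, V.1))) => by
    obtain ⟨t, ht⟩ := (T0.pull_bijective_of_isOpenLoc (isOpenLoc_resHom V.2 W.2 h)
      (resHom_comp_toSec_comp ι π h) (hF V) (hF W) (RingHom.id_comp _)).2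
      (T0.coeff _ (resHom h) (RingHom.comp_id _) s)
    exact ⟨t, fun a => (congrFun (congrArg Subtype.val ht) a).symm⟩
  uniq {V W} h _ _ := fun (t : T0 ((toSec π W.1).comp ι) (RingHom.id Γ(Y, W.1))) e =>
    (T0.pull_bijective_of_isOpenLoc (isOpenLoc_resHom V.2 W.2 h)
      (resHom_comp_toSec_comp ι π h) (hF V) (hF W) (RingHom.id_comp _)).1
      (Subtype.ext (funext fun a => (e a).symm.trans (map_zero _)))
  self {V} h := fun (s : T0 ((toSec π V.1).comp ι) (RingHom.id Γ(Y, V.1))) a =>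
    (resHom_self h _).trans (congrArg s.1 (resHom_self h a).symm)
  comp {U V W} h h' := fun {s t} {u : T0 ((toSec π W.1).comp ι) (RingHom.id Γ(Y, W.1))} e e' a =>
    (resHom_resHom h h' _).symm.trans ((congrArg _ (e a)).trans ((e' _).trans
      (congrArg u.1 (resHom_resHom h h' a))))

theorem derCData_coherent (m : Ideal A) : (derCData π m ι).Coherent v where
  res {V W} h a hV := fun (s : derCSub ((toSec π V.1).comp ι) (excIdeal π m V.1)) => by
    obtain ⟨t, ht⟩ : ∃ t : T0 ((toSec π W.1).comp ι) (RingHom.id Γ(Y, W.1)), _ :=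
      (thetaData_coherent ι π v hF).res h a hV
        (⟨s.1, s.2.2⟩ : T0 ((toSec π V.1).comp ι) (RingHom.id Γ(Y, V.1)))
    refine ⟨⟨t.1, fun y hy => ?_, t.2⟩, ht⟩
    rw [← map_excIdeal π m h, Ideal.map] at hy
    refine Submodule.span_induction ?_ ?_ ?_ ?_ hy
    · rintro _ ⟨y, hy, rfl⟩
      exact (ht y).symm ▸ excIdeal_le_comap π m h (s.2.1 y hy)
    · rw [IsDer.map_zero' t.2]; exact zero_mem _
    · intro y z _ _ hy hz
      rw [IsDer.map_add t.2]; exact add_mem hy hz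
    · intro c y hy' hy
      rw [smul_eq_mul, IsDer.map_mul t.2]
      refine add_mem (Ideal.mul_mem_left _ _ hy) (Ideal.mul_mem_right _ _ ?_)
      rw [← map_excIdeal π m h]; exact hy'
  uniq {V W} h a hV := fun (t : derCSub ((toSec π W.1).comp ι) (excIdeal π m W.1)) e =>
    Subtype.ext (congrArg (Subtype.val : T0 ((toSec π W.1).comp ι) (RingHom.id Γ(Y, W.1)) → _)
      ((thetaData_coherent ι π v hF).uniq h a hV
        (⟨t.1, t.2.2⟩ : T0 ((toSec π W.1).comp ι) (RingHom.id Γ(Y, W.1))) e))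
  self {V} h := fun (s : derCSub ((toSec π V.1).comp ι) (excIdeal π m V.1)) a =>
    (resHom_self h _).trans (congrArg s.1 (resHom_self h a).symm)
  comp {U V W} h h' := fun {s t} {u : derCSub ((toSec π W.1).comp ι) (excIdeal π m W.1)} e e' a =>
    (resHom_resHom h h' _).symm.trans ((congrArg _ (e a)).trans ((e' _).trans
      (congrArg u.1 (resHom_resHom h h' a))))

theorem absT1Data_coherent : (absT1Data ι π).Coherent v where
  res {V W} h _ _ s := by
    obtain ⟨t, ht⟩ := (T1.pull_bijective_of_isOpenLoc (isOpenLoc_resHom V.2 W.2 h)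
      (resHom_comp_toSec_comp ι π h) (hF V) (hF W) (RingHom.id_comp _)).2
      (T1.coeff _ (resHom h) (RingHom.comp_id _) s)
    exact ⟨t, ht.symm⟩
  uniq {V W} h _ _ t e := (T1.pull_bijective_of_isOpenLoc (isOpenLoc_resHom V.2 W.2 h)
      (resHom_comp_toSec_comp ι π h) (hF V) (hF W) (RingHom.id_comp _)).1
      (e.symm.trans ((map_zero _).trans (map_zero _).symm))
  self {V} h s := T1.coeff_eq_pull (resHom_self h) _ _ _ s
  comp {U V W} h h' s t u e e' := by
    refine (T1.coeff_coeff (ψ' := resHom h) (resHom_comp h h') (RingHom.comp_id _)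
      (resHom_comp h h') (RingHom.comp_id _) s).symm.trans ((congrArg _ e).trans ?_)
    refine (T1.coeff_pull (resHom_comp_toSec_comp ι π h) (RingHom.id_comp _) (resHom_comp h h')
      (resHom_comp h h') (RingHom.comp_id _) t).trans ((congrArg _ e').trans ?_)
    exact T1.pull_pull _ _ _ (resHom_comp h h') _ _ _ u

theorem absT2Data_coherent : (absT2Data ι π).Coherent v where
  res {V W} h _ _ s := by
    obtain ⟨t, ht⟩ := (T2.pull_bijective_of_isOpenLoc (isOpenLoc_resHom V.2 W.2 h)
      (resHom_comp_toSec_comp ι π h) (hF V) (hF W) (RingHom.id_comp _)).2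
      (T2.coeff _ (resHom h) (RingHom.comp_id _) s)
    exact ⟨t, ht.symm⟩
  uniq {V W} h _ _ t e := (T2.pull_bijective_of_isOpenLoc (isOpenLoc_resHom V.2 W.2 h)
      (resHom_comp_toSec_comp ι π h) (hF V) (hF W) (RingHom.id_comp _)).1
      (e.symm.trans ((map_zero _).trans (map_zero _).symm))
  self {V} h s := T2.coeff_eq_pull (resHom_self h) _ _ _ s
  comp {U V W} h h' s t u e e' := by
    refine (T2.coeff_coeff (ψ' := resHom h) (resHom_comp h h') (RingHom.comp_id _)
      (resHom_comp h h') (RingHom.comp_id _) s).symm.trans ((congrArg _ e).trans ?_)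
    refine (T2.coeff_pull (resHom_comp_toSec_comp ι π h) (RingHom.id_comp _) (resHom_comp h h')
      (resHom_comp h h') (RingHom.comp_id _) t).trans ((congrArg _ e').trans ?_)
    exact T2.pull_pull _ _ _ (resHom_comp h h') _ _ _ u

end Finite

theorem normalCData_coherent {m : Ideal A} {v} (hC : CartierOn π m v) :
    (normalCData π m).Coherent (K := K) v where
  res {V W} h a hV := fun (ψ : ↥(excIdeal π m V.1) →ₗ[Γ(Y, V.1)] Γ(Y, V.1) ⧸ excIdeal π m V.1) => by
    obtain ⟨y, -, H⟩ := hC.exists_pow 1 a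
    simp only [pow_one] at H
    have hy1 : resHom hV y ∈ excIdeal π m V.1 := by
      rw [(H _ hV).1]; exact Ideal.mem_span_singleton_self _
    obtain ⟨χ, hχ⟩ := exists_hom_span (H W.1 (h.trans hV)).1 (H W.1 (h.trans hV)).2
      (Ideal.quotientMap _ (resHom h) (excIdeal_le_comap π m h) (ψ ⟨_, hy1⟩))
    refine ⟨χ, fun ⟨f, hf⟩ => ?_⟩
    obtain ⟨r, rfl⟩ := Ideal.mem_span_singleton'.mp ((H _ hV).1 ▸ hf)
    rw [hom_span_apply ψ hy1 hf rfl, Algebra.smul_def, map_mul]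
    refine Eq.trans ?_ (hχ (resHom h r) _ _ ?_).symm
    · rw [Algebra.smul_def]; rfl
    · rw [map_mul, resHom_resHom]
  uniq {V W} h a hV := fun (χ : ↥(excIdeal π m W.1) →ₗ[Γ(Y, W.1)] Γ(Y, W.1) ⧸ excIdeal π m W.1) e => by
    obtain ⟨y, -, H⟩ := hC.exists_pow 1 a
    simp only [pow_one] at H
    have hy1 : resHom hV y ∈ excIdeal π m V.1 := by
      rw [(H _ hV).1]; exact Ideal.mem_span_singleton_self _
    exact hom_span_ext (y := resHom h (resHom hV y))
      (by rw [resHom_resHom]; exact (H W.1 (h.trans hV)).1) _ ((e ⟨_, hy1⟩).symm.trans (map_zero _))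
  self {V} h := fun (ψ : ↥(excIdeal π m V.1) →ₗ[Γ(Y, V.1)] Γ(Y, V.1) ⧸ excIdeal π m V.1) f => by
    have h1 : ∀ q, Ideal.quotientMap _ (resHom h) (excIdeal_le_comap π m h) q = q := fun q => by
      obtain ⟨q, rfl⟩ := Ideal.Quotient.mk_surjective q
      exact congrArg _ (resHom_self h q)
    exact (h1 _).trans (congrArg ψ (Subtype.ext (resHom_self h _).symm))
  comp {U V W} h h' := fun
      {s : ↥(excIdeal π m U.1) →ₗ[Γ(Y, U.1)] Γ(Y, U.1) ⧸ excIdeal π m U.1} {t}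
      {u : ↥(excIdeal π m W.1) →ₗ[Γ(Y, W.1)] Γ(Y, W.1) ⧸ excIdeal π m W.1} e e' f => by
    have h1 : ∀ q, Ideal.quotientMap _ (resHom h') (excIdeal_le_comap π m h')
        (Ideal.quotientMap _ (resHom h) (excIdeal_le_comap π m h) q) =
        Ideal.quotientMap _ (resHom (h'.trans h)) (excIdeal_le_comap π m (h'.trans h)) q := fun q => by
      obtain ⟨q, rfl⟩ := Ideal.Quotient.mk_surjective q
      exact congrArg _ (resHom_resHom h h' q)
    exact (h1 _).symm.trans ((congrArg _ (e f)).trans ((e' _).trans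
      (congrArg u (Subtype.ext (resHom_resHom h h' _)))))

end
end QLSing

namespace QLSing
noncomputable section

/-! ### The isomorphisms and the exact sequence -/

open nonZeroDivisors IsLocalRing

section Parts

variable {e : ℕ} {I : Ideal (LocPoly e)}

instance : IsNoetherianRing (RingA I) := Ideal.Quotient.isNoetherianRing I

instance : LocallyOfFiniteType (piX I) :=
  inferInstanceAs (LocallyOfFiniteType (blowupπ (maxA I)))

theorem finPres_toSec (V : (Xhat I).affineOpens) : FinPres ((toSec (piX I) V.1).comp (baseC I)) :=
  finPres_of_finiteType (projA_surjective I) (finiteType_toSec (piX I) V.2)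

variable (I) in
/-- Restriction of local data to the charts. -/
abbrev onCharts (H : LocalData (affineFamily (Xhat I))) : LocalData (chartFamily I) :=
  H.restr chartV chartLe chartV_mono

variable [IsDomain (RingA I)]

theorem exists_model {H : LocalData (affineFamily (Xhat I))} (hH : H.Coherent (chartV (I := I))) :
    Nonempty (Model (onCharts I H) H.sheaf) := by
  obtain ⟨m, -⟩ := Model.exists_restr (le := chartLe) (hle := chartV_mono) hH isBase_chartFamily
  exact ⟨m⟩

theorem exists_model_twist {G : LocalData (chartFamily I)} {M : (Xhat I).Modules} (n : ℕ)
    (m : Model G M) :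
    Nonempty (Model (twistLocal (piX I) (maxA I) n G) (twistC I n M)) :=
  Model.nonempty_twist isBase_chartFamily cartierOn_chartV n m

theorem exists_model_mMul {G : LocalData (chartFamily I)} {M : (Xhat I).Modules} (m : Model G M) :
    Nonempty (Model (idealMulLocal (π := piX I) (m := maxA I) G) (mMul I M)) :=
  Model.nonempty_idealMul isBase_chartFamily m

set_option maxHeartbeats 1000000 in
theorem nonempty_iso_F0 : Nonempty (F0 I ≅ twistC I 1 (derC I)) := by
  obtain ⟨m⟩ := exists_model (I := I) (relT0Data_coherent (baseC I) (piX I) chartV)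
  obtain ⟨m₁⟩ := exists_model (I := I) (derCData_coherent (baseC I) (piX I) chartV finPres_toSec (maxA I))
  obtain ⟨m'⟩ := exists_model_twist 1 m₁
  obtain ⟨φ, hφ⟩ := LocalData.exists_hom_of_rel
    (G := onCharts I (relT0Data (baseC I) (piX I)))
    (G' := twistLocal (piX I) (maxA I) 1 (onCharts I (derCData (piX I) (maxA I) (baseC I))))
    (fun c s t => RelDer (algebraMap ℂ (LocPoly e)) (projA I) (maximalIdeal (LocPoly e))
      (toSec (piX I) (chartV c).1) s t)
    (fun H H' => RelDer.add H H') (fun r H => RelDer.smul r H)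
    (fun c s => RelDer.total c.isChart s) (fun {c t} H => RelDer.uniq c.isChart H)
    (fun {c d} h {s s' t t'} hs H H' => by
      obtain ⟨x, hx, e⟩ := RelDer.nat (F := s) (F' := s') (ψ := t) (ψ' := t') d.isChart c.isChart
        (resHom_comp_toSec (piX I) (chartV_mono h)) hs H H'
      exact twistLocal_compat (n := 1) (G := onCharts I (derCData (piX I) (maxA I) (baseC I)))
        (a := c) (b := d) (ψ := t) (χ := t') h hx fun hy hy' z => e hy hy' z)
  refine m.nonempty_iso isBase_chartFamily m' φ (fun c s hs => ?_) fun c t => ?_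
  · rw [RelDer.inj c.isChart ((hφ c s 0).mpr hs)]; exact map_zero _
  · obtain ⟨s, hs⟩ := RelDer.surj c.isChart (projA_surjective I) exists_sub_mem t
    exact ⟨s, congrArg _ ((hφ c s t).mp hs)⟩

set_option maxHeartbeats 1000000 in
theorem nonempty_iso_F2 (hI : IsQL I) : Nonempty (mMul I (F2 I) ≅ twistC I 2 (TX2 I)) := by
  obtain ⟨n, f, hf, hQ, hL⟩ := hI.exists_eq
  choose x g hg using fun c : Chart I => c.isChart.exists_strictEq hQ hf
  have hv := fun c : Chart I => c.isChart.ker_eq_span hQ hf (hg c)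
  obtain ⟨m₀⟩ := exists_model (I := I) (relT2Data_coherent (baseC I) (piX I) chartV)
  obtain ⟨m⟩ := exists_model_mMul m₀
  obtain ⟨m₁⟩ := exists_model (I := I) (absT2Data_coherent (baseC I) (piX I) chartV finPres_toSec)
  obtain ⟨m'⟩ := exists_model_twist 2 m₁
  obtain ⟨φ, hφ⟩ := LocalData.exists_hom_of_rel
    (G := idealMulLocal (π := piX I) (m := maxA I) (onCharts I (relT2Data (baseC I) (piX I))))
    (G' := twistLocal (piX I) (maxA I) 2 (onCharts I (absT2Data (baseC I) (piX I))))
    (fun c s t => RelH (hg c) (projA_surjective I) hf (hv c) s t)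
    (fun H H' => RelH.add H H') (fun r H => RelH.smul r H)
    (fun c s => RelH.total isLocPoly_base hL s) (fun {c t} H => RelH.uniq isLocPoly_base H)
    (fun {c d} h {s s' t t'} hs H H' => by
      obtain ⟨x, hx, e⟩ := RelH.nat isLocPoly_base (resHom_comp_toSec (piP e) h)
        (resHom_comp_toSec (piX I) (chartV_mono h)) (resHom_embX h) hs H H'
      exact twistLocal_compat (n := 2) (G := onCharts I (absT2Data (baseC I) (piX I)))
        (a := c) (b := d) (ψ := t) (χ := t') h hx e)
  refine m.nonempty_iso isBase_chartFamily m' φ (fun c s hs => ?_) fun c t => ?_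
  · rw [RelH.inj isLocPoly_base ((hφ c s 0).mpr hs)]; exact map_zero _
  · obtain ⟨s, hs⟩ := RelH.surj (hg := hg c) (hp := projA_surjective I) (hf := hf) (hv := hv c) hL t
    exact ⟨s, congrArg _ ((hφ c s t).mp hs)⟩

end Parts

end
end QLSing

namespace QLSing
noncomputable section

/-! ### The exact sequence -/

open nonZeroDivisors IsLocalRing

theorem RelF.uniq {k P A Q B : Type} [CommRing k] [CommRing P] [CommRing A] [CommRing Q]
    [CommRing B] {κ : k →+* P} {p : P →+* A} {𝔪 : Ideal P} {a : P →+* Q} {b : A →+* B} {τ : Q →+* B}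
    {h : IsChart κ p 𝔪 a b τ} {hp : Function.Surjective p} (hκ : IsLocPoly κ)
    (hres : ∀ r, ∃ c, r - κ c ∈ 𝔪) {t} (H : RelF h hp 0 t) : t = 0 := by
  have H0 := RelF.smul 0 H
  rw [zero_smul, zero_smul] at H0
  have := RelF.nat h h hκ hres (RingHom.id_comp a) (RingHom.id_comp b) (RingHom.comp_id τ) H H0
    (Ideal.comap_id _).ge fun x hx hx' => ⟨0, 0, rfl, rfl, fun f => map_zero _⟩
  rw [T1.coeff_id fun _ => rfl] at this
  exact Subtype.ext this

variable {e : ℕ} {I : Ideal (LocPoly e)}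

variable (I) in
/-- The map `Θ → 𝒪_C(C)` on the charts. -/
abbrev thetaToNormalCharts : LocalData.Hom (onCharts I (thetaData (baseC I) (piX I)))
    (onCharts I (normalCData (piX I) (maxA I))) where
  app c := thetaToNormalCApp (piX I) (maxA I) (baseC I) (chartV c).1
  compat h _ _ H := (thetaToNormalC (piX I) (maxA I) (baseC I)).compat (chartV_mono h) H

theorem exists_model_A1 [IsDomain (RingA I)] : Nonempty (Model (cokerData (thetaToNormalCharts I)) (A1 I)) := by
  have hN := normalCData_coherent _ (cartierOn_chartV (I := I))
  obtain ⟨m, hm⟩ := Model.exists_restr (le := chartLe) (hle := chartV_mono)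
    (thetaData_coherent (baseC I) (piX I) chartV finPres_toSec) isBase_chartFamily
  obtain ⟨m', hm'⟩ := Model.exists_restr (le := chartLe) (hle := chartV_mono) hN isBase_chartFamily
  refine ⟨Model.coker isBase_chartFamily m m' (thetaToNormalCharts I)
    ((sheafify (Xhat I)).map (thetaToNormalC (piX I) (maxA I) (baseC I)).presheaf) fun c s => ?_⟩
  obtain ⟨z, hz, hv⟩ := hm c s
  obtain ⟨z', hz', hv'⟩ := hm' c ((thetaToNormalCharts I).app c s)
  rw [hz, hz']
  refine (toSh_map _ _ _).trans (congrArg _ ?_)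
  refine LocalData.Sec.ext fun V hV => ?_
  exact hN.eq c le_rfl ((thetaToNormalC (piX I) (maxA I) (baseC I)).compat hV (hv V hV)) (hv' V hV)

set_option maxHeartbeats 2000000 in
theorem exists_hom_A1 (hI : IsQL I) : ∃ φ : LocalData.Hom
    (twistLocal (piX I) (maxA I) 1 (cokerData (thetaToNormalCharts I)))
    (idealMulLocal (π := piX I) (m := maxA I) (onCharts I (relT1Data (baseC I) (piX I)))),
    ∀ (c : Chart I) s t, RelF c.isChart (projA_surjective I) s t ↔ φ.app c s = t := by
  obtain ⟨n, f, hf, hQ, hL⟩ := hI.exists_eq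
  refine LocalData.exists_hom_of_rel
    (G := twistLocal (piX I) (maxA I) 1 (cokerData (thetaToNormalCharts I)))
    (G' := idealMulLocal (π := piX I) (m := maxA I) (onCharts I (relT1Data (baseC I) (piX I))))
    (fun c s t => RelF c.isChart (projA_surjective I) s t) ?_ ?_ ?_ ?_ ?_
  · intro c s s' t t' H H'
    exact RelF.add (l := s) (l' := s') (t := t) (t' := t') H H'
  · intro c s t r H
    exact RelF.smul (l := s) (t := t) r H
  · intro c s
    exact RelF.total c.isChart hQ s
  · intro c t H
    exact RelF.uniq isLocPoly_base exists_sub_mem H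
  · intro c d h s s' t t' hs H H'
    refine RelF.nat (l := s) (l' := s') (t := t) (t' := t') d.isChart c.isChart isLocPoly_base
        exists_sub_mem (resHom_comp_toSec (piP e) h)
        (resHom_comp_toSec (piX I) (chartV_mono h)) (resHom_embX h) H H'
        (excIdeal_le_comap (piX I) (maxA I) (chartV_mono h)) ?_
    intro x hx hx'
    obtain ⟨μ, μ', e, e1, e2⟩ := hs ⟨x, hx⟩
    exact ⟨μ, μ', Eq.symm e1, Eq.symm e2, e⟩

set_option maxHeartbeats 2000000 in
theorem exists_hom_TX1 (hI : IsQL I) : ∃ φ : LocalData.Hom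
    (idealMulLocal (π := piX I) (m := maxA I) (onCharts I (relT1Data (baseC I) (piX I))))
    (twistLocal (piX I) (maxA I) 1 (onCharts I (absT1Data (baseC I) (piX I)))),
    ∀ (c : Chart I) s t, RelG c.isChart (projA_surjective I) s t ↔ φ.app c s = t := by
  obtain ⟨n, f, hf, hQ, hL⟩ := hI.exists_eq
  exact LocalData.exists_hom_of_rel
    (G := idealMulLocal (π := piX I) (m := maxA I) (onCharts I (relT1Data (baseC I) (piX I))))
    (G' := twistLocal (piX I) (maxA I) 1 (onCharts I (absT1Data (baseC I) (piX I))))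
    (fun c s t => RelG c.isChart (projA_surjective I) s t)
    (fun H H' => RelG.add H H') (fun r H => RelG.smul r H)
    (fun c s => RelG.total c.isChart isLocPoly_base hQ s)
    (fun {c t} H => RelG.uniq c.isChart isLocPoly_base H)
    (fun {c d} h {s s' t t'} hs H H' => by
      obtain ⟨x, hx, e⟩ := RelG.nat (t := s) (t' := s') (ψ := t) (ψ' := t') d.isChart c.isChart isLocPoly_base
        (resHom_comp_toSec (piP e) h) (resHom_comp_toSec (piX I) (chartV_mono h)) (resHom_embX h)
        hs H H'
      exact twistLocal_compat (n := 1) (G := onCharts I (absT1Data (baseC I) (piX I)))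
        (a := c) (b := d) (ψ := t) (χ := t') h hx e)

set_option maxHeartbeats 1000000 in
theorem exists_shortExact_F1 [IsDomain (RingA I)] (hI : IsQL I) :
    ∃ (f : twistC I 1 (A1 I) ⟶ mMul I (F1 I)) (g : mMul I (F1 I) ⟶ twistC I 1 (TX1 I))
      (w : f ≫ g = 0), (ShortComplex.mk f g w).ShortExact := by
  obtain ⟨m₁⟩ := exists_model_A1 (I := I)
  obtain ⟨m⟩ := exists_model_twist 1 m₁
  obtain ⟨m₂⟩ := exists_model (I := I) (relT1Data_coherent (baseC I) (piX I) chartV)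
  obtain ⟨m'⟩ := exists_model_mMul m₂
  obtain ⟨m₃⟩ := exists_model (I := I) (absT1Data_coherent (baseC I) (piX I) chartV finPres_toSec)
  obtain ⟨m''⟩ := exists_model_twist 1 m₃
  obtain ⟨φ, hφ⟩ := exists_hom_A1 hI
  obtain ⟨ψ, hψ⟩ := exists_hom_TX1 hI
  obtain ⟨n, f, hf, hQ, hL⟩ := hI.exists_eq
  refine m.exists_shortExact isBase_chartFamily m' m'' φ ψ (fun c s hs => ?_) (fun c t => ?_)
    fun c u => ?_
  · exact RelF.inj c.isChart isLocPoly_base ((hφ c s 0).mpr hs)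
  · constructor
    · intro h
      obtain ⟨l, hl⟩ := RelF.exists_of_relG c.isChart ((hψ c t 0).mpr h)
      exact ⟨l, (hφ c l t).mp hl⟩
    · rintro ⟨s, hs⟩
      exact RelF.comp_eq_zero c.isChart isLocPoly_base ((hφ c s t).mpr hs) ((hψ c t _).mpr rfl)
  · obtain ⟨t, ht⟩ := RelG.surj (hp := projA_surjective I) c.isChart hQ u
    exact ⟨t, (hψ c t u).mp ht⟩

end
end QLSing

namespace QLSing
noncomputable section

/-! ### The normal sheaf on the charts -/

open nonZeroDivisors IsLocalRing

variable {e : ℕ} {I : Ideal (LocPoly e)}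

variable (I) in
/-- The restriction of functions from `M` to `X̂`. -/
abbrev tau (W : (blowup (maximalIdeal (LocPoly e))).Opens) :
    Γ(blowup (maximalIdeal (LocPoly e)), W) →+* Γ(Xhat I, embX I ⁻¹ᵁ W) :=
  ((embX I).app W).hom

variable (I) in
theorem pre {W W' : (blowup (maximalIdeal (LocPoly e))).Opens} (h : W' ≤ W) :
    embX I ⁻¹ᵁ W' ≤ embX I ⁻¹ᵁ W :=
  (Opens.map (embX I).base).monotone h

theorem tau_resHom {W W' : (blowup (maximalIdeal (LocPoly e))).Opens} (h : W' ≤ W) (q) :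
    tau I W' (resHom h q) = resHom (pre I h) (tau I W q) :=
  DFunLike.congr_fun (resHom_embX h) q

theorem resHom_mem_ker {W W' : (blowup (maximalIdeal (LocPoly e))).Opens} (h : W' ≤ W) {q}
    (hq : q ∈ RingHom.ker (tau I W)) : resHom h q ∈ RingHom.ker (tau I W') := by
  rw [RingHom.mem_ker, tau_resHom, RingHom.mem_ker.mp hq, map_zero]

theorem exists_chart_le' (c : Chart I) {W : (blowup (maximalIdeal (LocPoly e))).Opens} {x : Xhat I}
    (hx : x ∈ embX I ⁻¹ᵁ c.W) (hxW : x ∈ embX I ⁻¹ᵁ W) :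
    ∃ d : Chart I, d.W ≤ c.W ∧ x ∈ embX I ⁻¹ᵁ d.W ∧ d.W ≤ W := by
  obtain ⟨g, hg, hxg⟩ := c.affW.exists_basicOpen_le (V := W) ⟨embX I x, hxW⟩ hx
  obtain ⟨d, hd⟩ := exists_basicChart c g x hxg
  refine ⟨d, hd.le.trans (Scheme.basicOpen_le _ g), ?_, hd.le.trans hg⟩
  rw [hd]; exact hxg

theorem resHom_injective (c : Chart I) {W : (blowup (maximalIdeal (LocPoly e))).Opens}
    (h : W ≤ c.W) {x : Xhat I} (hx : x ∈ embX I ⁻¹ᵁ W) :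
    Function.Injective (resHom h) := by
  obtain ⟨d, hdc, hxd, hdW⟩ := exists_chart_le' c (pre I h hx) hx
  refine (injective_iff_map_eq_zero _).mpr fun z hz => ?_
  have h1 : resHom hdc z = 0 := by rw [← resHom_resHom h hdW, hz, map_zero]
  obtain ⟨s, r, hs, hz'⟩ := c.isChart.frac_nzd z
  have h2 := congrArg (resHom hdc) hz'
  rw [map_mul, h1, mul_zero, ← RingHom.comp_apply, resHom_comp_toSec] at h2
  have hr : r = 0 := d.isChart.injQ (h2.symm.trans (map_zero _).symm)
  rw [hr, map_zero] at hz'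
  have := c.isChart.domQ
  refine (mul_eq_zero.mp hz').resolve_left fun h0 => ?_
  have hs0 : s = 0 := c.isChart.injQ (h0.trans (map_zero _).symm)
  have := c.isChart.domB
  rw [hs0, map_zero] at hs
  exact nonZeroDivisors.ne_zero hs rfl

theorem resHom_pre_injective (c : Chart I) {W : (blowup (maximalIdeal (LocPoly e))).Opens}
    (h : W ≤ c.W) {x : Xhat I} (hx : x ∈ embX I ⁻¹ᵁ W) :
    Function.Injective (resHom (pre I h)) := by
  obtain ⟨d, hdc, hxd, hdW⟩ := exists_chart_le' c (pre I h hx) hx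
  refine (injective_iff_map_eq_zero _).mpr fun z hz => ?_
  have h1 : resHom (pre I hdc) z = 0 := by
    rw [← resHom_resHom (pre I h) (pre I hdW), hz, map_zero]
  obtain ⟨s, r, hs, hz'⟩ := c.isChart.fracB_nzd z
  have h2 := congrArg (resHom (pre I hdc)) hz'
  rw [map_mul, h1, mul_zero, ← RingHom.comp_apply, resHom_comp_toSec] at h2
  have hr : r = 0 := d.isChart.injB (h2.symm.trans (map_zero _).symm)
  rw [hr, map_zero, mul_comm] at hz'
  exact (mem_nonZeroDivisors_iff_right.mp hs) _ hz'

/-- Functions on an affine open set are, locally, fractions of functions on a chart. -/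
theorem exists_local_frac (c : Chart I) {W : (blowup (maximalIdeal (LocPoly e))).Opens}
    (hW : IsAffineOpen W) {x : Xhat I} (hc : x ∈ embX I ⁻¹ᵁ c.W) (hx : x ∈ embX I ⁻¹ᵁ W)
    (q : Γ(blowup (maximalIdeal (LocPoly e)), W)) :
    ∃ (W₀ : (blowup (maximalIdeal (LocPoly e))).Opens) (h₀ : W₀ ≤ c.W) (h : W₀ ≤ W)
      (r q₁ : Γ(blowup (maximalIdeal (LocPoly e)), c.W)), IsAffineOpen W₀ ∧ x ∈ embX I ⁻¹ᵁ W₀ ∧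
      IsUnit (resHom (pre I h₀) (tau I c.W r)) ∧ resHom h₀ q₁ = resHom h₀ r * resHom h q ∧
      (q ∈ RingHom.ker (tau I W) → q₁ ∈ RingHom.ker (tau I c.W)) := by
  obtain ⟨f, g, h1, hxf⟩ := exists_basicOpen_le_affine_inter c.affW hW (embX I x) ⟨hc, hx⟩
  have hα := isAway_basicOpen c.affW f
  have h₀ := Scheme.basicOpen_le _ f
  have h : Scheme.basicOpen _ f ≤ W := h1.le.trans (Scheme.basicOpen_le _ g)
  obtain ⟨n, b, hb⟩ := hα.surj (resHom h q)
  have e1 : resHom h₀ b = resHom h₀ (f ^ n) * resHom h q := by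
    rw [← hb, map_pow, mul_comm]
  refine ⟨_, h₀, h, f ^ n, b, c.affW.basicOpen f, hxf, ?_, e1, fun h0 => ?_⟩
  · rw [← tau_resHom, map_pow]
    exact (hα.unit.pow n).map _
  · refine resHom_pre_injective c h₀ hxf ?_
    rw [← tau_resHom h₀, e1, map_mul, tau_resHom h, RingHom.mem_ker.mp h0, map_zero, mul_zero,
      map_zero]

instance (c : Chart I) : Module Γ(Xhat I, (chartV c).1)
    (↥(RingHom.ker (tau I c.W)) →ₛₗ[tau I c.W] Γ(Xhat I, embX I ⁻¹ᵁ c.W)) :=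
  LinearMap.module (S := Γ(Xhat I, embX I ⁻¹ᵁ c.W)) (M₂ := Γ(Xhat I, embX I ⁻¹ᵁ c.W))

/-- The normal data on the charts. -/
abbrev normalCharts (I : Ideal (LocPoly e)) : LocalData (chartFamily I) where
  obj c := ↥(RingHom.ker (tau I c.W)) →ₛₗ[tau I c.W] Γ(Xhat I, embX I ⁻¹ᵁ c.W)
  compat {c d} h ψ χ := ∀ (f : ↥(RingHom.ker (tau I d.W))) (g : ↥(RingHom.ker (tau I c.W))),
    g.1 = resHom h f.1 → resHom (pre I h) (ψ f) = χ g
  compat_zero _ _ _ _ := map_zero _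
  compat_add _ _ _ _ _ H H' f g e := (map_add _ _ _).trans (congrArg₂ _ (H f g e) (H' f g e))
  compat_smul _ _ _ _ H f g e := (map_mul _ _ _).trans (congrArg _ (H f g e))

section Ext

/-- `y` is the value at `f` of the extension of `s`. -/
def IsExt (c : Chart I) (s : ↥(RingHom.ker (tau I c.W)) →ₛₗ[tau I c.W] Γ(Xhat I, embX I ⁻¹ᵁ c.W))
    (W : (blowup (maximalIdeal (LocPoly e))).Opens) (f : ↥(RingHom.ker (tau I W)))
    (y : Γ(Xhat I, embX I ⁻¹ᵁ W)) : Prop :=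
  ∀ (W₀) (h₀ : W₀ ≤ c.W) (h : W₀ ≤ W) (f₀ : ↥(RingHom.ker (tau I c.W))) (r),
    resHom h₀ f₀.1 = resHom h₀ r * resHom h f.1 →
    resHom (pre I h₀) (tau I c.W r) * resHom (pre I h) y = resHom (pre I h₀) (s f₀)

variable {c : Chart I} {s : ↥(RingHom.ker (tau I c.W)) →ₛₗ[tau I c.W] Γ(Xhat I, embX I ⁻¹ᵁ c.W)}
  {W : (blowup (maximalIdeal (LocPoly e))).Opens} {f : ↥(RingHom.ker (tau I W))}

theorem mul_apply_eq {W₀ : (blowup (maximalIdeal (LocPoly e))).Opens} (h₀ : W₀ ≤ c.W) {x : Xhat I}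
    (hx : x ∈ embX I ⁻¹ᵁ W₀) {f₀ f₁ : ↥(RingHom.ker (tau I c.W))} {r₀ r₁}
    (H : resHom h₀ (r₁ * f₀.1) = resHom h₀ (r₀ * f₁.1)) :
    tau I c.W r₁ * s f₀ = tau I c.W r₀ * s f₁ := by
  have h1 : r₁ • f₀ = r₀ • f₁ := Subtype.ext (resHom_injective c h₀ hx H)
  exact (s.map_smulₛₗ r₁ f₀).symm.trans ((congrArg s h1).trans (s.map_smulₛₗ r₀ f₁))

theorem isExt_of_local {y : Γ(Xhat I, embX I ⁻¹ᵁ W)} (H : ∀ x ∈ embX I ⁻¹ᵁ W,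
    ∃ (W₀ : _) (h₀ : W₀ ≤ c.W) (h : W₀ ≤ W) (f₀ : ↥(RingHom.ker (tau I c.W))) (r : _),
      x ∈ embX I ⁻¹ᵁ W₀ ∧ IsUnit (resHom (pre I h₀) (tau I c.W r)) ∧
      resHom h₀ f₀.1 = resHom h₀ r * resHom h f.1 ∧
      resHom (pre I h₀) (tau I c.W r) * resHom (pre I h) y = resHom (pre I h₀) (s f₀)) :
    IsExt c s W f y := fun W₀ h₀ h f₀ r e => fun_ext fun x hx => by
  obtain ⟨W₁, h₁, h', f₁, r₁, hx₁, hu, e₁, e₂⟩ := H x (pre I h hx)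
  have k := mul_apply_eq (s := s) (W₀ := W₀ ⊓ W₁) (f₀ := f₀) (f₁ := f₁) (r₀ := r) (r₁ := r₁)
    (inf_le_left.trans h₀) ⟨hx, hx₁⟩ (by
      have e' := congrArg (resHom (inf_le_left (a := W₀) (b := W₁))) e
      have e₁' := congrArg (resHom (inf_le_right (a := W₀) (b := W₁))) e₁
      simp only [map_mul, resHom_resHom] at e' e₁' ⊢
      rw [e', e₁', mul_left_comm])
  refine ⟨embX I ⁻¹ᵁ (W₀ ⊓ W₁), pre I inf_le_left, ⟨hx, hx₁⟩, ?_⟩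
  have k' := congrArg (resHom (pre I (inf_le_left.trans h₀ : W₀ ⊓ W₁ ≤ c.W))) k
  have e₂' := congrArg (resHom (pre I (inf_le_right : W₀ ⊓ W₁ ≤ W₁))) e₂
  have hu' := hu.map (resHom (pre I (inf_le_right : W₀ ⊓ W₁ ≤ W₁)))
  simp only [map_mul, resHom_resHom] at k' e₂' hu' ⊢
  refine hu'.mul_left_cancel ?_
  rw [k', ← e₂', mul_left_comm]

theorem inv_mul_eq_inv_mul {R : Type} [CommRing R] {r r' u u' s s' : R} (h : r * u = 1)
    (h' : r' * u' = 1) (e : r' * s = r * s') : u * s = u' * s' := by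
  linear_combination u * u' * e + u' * s' * h - u * s * h'

theorem IsExt.uniq (hW : IsAffineOpen W) (hV : embX I ⁻¹ᵁ W ≤ embX I ⁻¹ᵁ c.W)
    {y y' : Γ(Xhat I, embX I ⁻¹ᵁ W)} (H : IsExt c s W f y) (H' : IsExt c s W f y') : y = y' :=
  fun_ext fun x hx => by
    obtain ⟨W₀, h₀, h, r, q, -, hx₀, hu, e, hq⟩ := exists_local_frac c hW (hV hx) hx f.1
    refine ⟨_, pre I h, hx₀, hu.mul_left_cancel ?_⟩
    exact (H W₀ h₀ h ⟨q, hq f.2⟩ r e).trans (H' W₀ h₀ h ⟨q, hq f.2⟩ r e).symm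

theorem exists_isExt (hW : IsAffineOpen W) (hV : embX I ⁻¹ᵁ W ≤ embX I ⁻¹ᵁ c.W) :
    ∃ y, IsExt c s W f y := by
  choose W₀ h₀ h r q _ hx₀ hu e hq using fun x : ↥(embX I ⁻¹ᵁ W) =>
    exists_local_frac c hW (hV x.2) x.2 f.1
  obtain ⟨y, hy⟩ := fun_glue (U := embX I ⁻¹ᵁ W) (fun x => embX I ⁻¹ᵁ (W₀ x))
    (fun x => pre I (h x)) (fun x hx => ⟨⟨x, hx⟩, hx₀ _⟩)
    (fun x => ((hu x).unit⁻¹ : _) * resHom (pre I (h₀ x)) (s ⟨q x, hq x f.2⟩)) fun i j =>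
      fun_ext fun x hx => ⟨_, le_rfl, hx, by
        congr 1
        have k := mul_apply_eq (s := s) (W₀ := W₀ i ⊓ W₀ j) (f₀ := ⟨q i, hq i f.2⟩)
          (f₁ := ⟨q j, hq j f.2⟩) (r₀ := r i) (r₁ := r j) (inf_le_left.trans (h₀ i)) hx (by
            have e' := congrArg (resHom (inf_le_left (a := W₀ i) (b := W₀ j))) (e i)
            have e₁' := congrArg (resHom (inf_le_right (a := W₀ i) (b := W₀ j))) (e j)
            simp only [map_mul, resHom_resHom] at e' e₁' ⊢
            rw [e', e₁', mul_left_comm])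
        have k' := congrArg (resHom (pre I (inf_le_left.trans (h₀ i) : W₀ i ⊓ W₀ j ≤ c.W))) k
        have hi' := congrArg (resHom (pre I (inf_le_left : W₀ i ⊓ W₀ j ≤ _))) (hu i).mul_val_inv
        have hj' := congrArg (resHom (pre I (inf_le_right : W₀ i ⊓ W₀ j ≤ _))) (hu j).mul_val_inv
        change resHom (pre I (inf_le_left : W₀ i ⊓ W₀ j ≤ _)) _ =
          resHom (pre I (inf_le_right : W₀ i ⊓ W₀ j ≤ _)) _
        simp only [map_mul, map_one, resHom_resHom] at k' hi' hj' ⊢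
        exact inv_mul_eq_inv_mul hi' hj' k'⟩
  refine ⟨y, isExt_of_local fun x hx => ⟨_, h₀ ⟨x, hx⟩, h _, ⟨q ⟨x, hx⟩, hq _ f.2⟩, r _, hx₀ _, hu _, e _, ?_⟩⟩
  rw [hy ⟨x, hx⟩, ← mul_assoc, (hu _).mul_val_inv, one_mul]

end Ext

end
end QLSing

namespace QLSing
noncomputable section

open nonZeroDivisors IsLocalRing

variable {e : ℕ} {I : Ideal (LocPoly e)}

namespace IsExt

variable {c : Chart I} {s s' : ↥(RingHom.ker (tau I c.W)) →ₛₗ[tau I c.W] Γ(Xhat I, embX I ⁻¹ᵁ c.W)}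
  {W : (blowup (maximalIdeal (LocPoly e))).Opens} {f f' : ↥(RingHom.ker (tau I W))}
  {y y' : Γ(Xhat I, embX I ⁻¹ᵁ W)}

theorem smul_add (hW : IsAffineOpen W) (hV : embX I ⁻¹ᵁ W ≤ embX I ⁻¹ᵁ c.W)
    (q : Γ(blowup (maximalIdeal (LocPoly e)), W)) (H : IsExt c s W f y) (H' : IsExt c s W f' y') :
    IsExt c s W (q • f + f') (tau I W q * y + y') := isExt_of_local fun x hx => by
  obtain ⟨W₁, hc₁, h₁, r₁, g₁, -, hx₁, hu₁, e₁, hg₁⟩ := exists_local_frac c hW (hV hx) hx f.1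
  obtain ⟨W₂, hc₂, h₂, r₂, g₂, -, hx₂, hu₂, e₂, hg₂⟩ := exists_local_frac c hW (hV hx) hx f'.1
  obtain ⟨W₃, hc₃, h₃, r₃, g₃, -, hx₃, hu₃, e₃, -⟩ := exists_local_frac c hW (hV hx) hx q
  have a₁ := H W₁ hc₁ h₁ ⟨g₁, hg₁ f.2⟩ r₁ e₁
  have a₂ := H' W₂ hc₂ h₂ ⟨g₂, hg₂ f'.2⟩ r₂ e₂
  have a₃ := congrArg (tau I W₃) e₃
  rw [map_mul, tau_resHom, tau_resHom, tau_resHom] at a₃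
  have i₁ : W₁ ⊓ W₂ ⊓ W₃ ≤ W₁ := inf_le_left.trans inf_le_left
  have i₂ : W₁ ⊓ W₂ ⊓ W₃ ≤ W₂ := inf_le_left.trans inf_le_right
  have i₃ : W₁ ⊓ W₂ ⊓ W₃ ≤ W₃ := inf_le_right
  replace e₁ := congrArg (resHom i₁) e₁
  replace e₂ := congrArg (resHom i₂) e₂
  replace e₃ := congrArg (resHom i₃) e₃
  replace a₁ := congrArg (resHom (pre I i₁)) a₁
  replace a₂ := congrArg (resHom (pre I i₂)) a₂
  replace a₃ := congrArg (resHom (pre I i₃)) a₃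
  replace hu₁ := hu₁.map (resHom (pre I i₁))
  replace hu₂ := hu₂.map (resHom (pre I i₂))
  replace hu₃ := hu₃.map (resHom (pre I i₃))
  refine ⟨W₁ ⊓ W₂ ⊓ W₃, i₁.trans hc₁, i₁.trans h₁, (r₂ * g₃) • ⟨g₁, hg₁ f.2⟩ +
    (r₁ * r₃) • ⟨g₂, hg₂ f'.2⟩, r₁ * r₂ * r₃, ⟨⟨hx₁, hx₂⟩, hx₃⟩, ?_, ?_, ?_⟩
  · simp only [map_mul, resHom_resHom] at hu₁ hu₂ hu₃ ⊢
    exact (hu₁.mul hu₂).mul hu₃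
  · change resHom _ (r₂ * g₃ * g₁ + r₁ * r₃ * g₂) = _ * resHom _ (q * f.1 + f'.1)
    simp only [map_mul, map_add, resHom_resHom] at e₁ e₂ e₃ ⊢
    rw [e₁, e₂, e₃]; ring
  · rw [s.map_add, s.map_smulₛₗ, s.map_smulₛₗ, smul_eq_mul, smul_eq_mul]
    simp only [map_mul, map_add, resHom_resHom] at a₁ a₂ a₃ ⊢
    rw [← a₁, ← a₂, a₃]; ring

theorem add_left (H : IsExt c s W f y) (H' : IsExt c s' W f y') :
    IsExt c (s + s') W f (y + y') := fun W₀ h₀ h f₀ r e => by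
  rw [map_add, mul_add, H W₀ h₀ h f₀ r e, H' W₀ h₀ h f₀ r e, ← map_add]; rfl

theorem smul_left (hV : embX I ⁻¹ᵁ W ≤ embX I ⁻¹ᵁ c.W) (b : Γ(Xhat I, embX I ⁻¹ᵁ c.W))
    (H : IsExt c s W f y) : IsExt c (b • s) W f (resHom hV b * y) := fun W₀ h₀ h f₀ r e => by
  rw [map_mul, mul_left_comm, H W₀ h₀ h f₀ r e, resHom_resHom, ← map_mul]; rfl

theorem res {W' : (blowup (maximalIdeal (LocPoly e))).Opens} (h : W' ≤ W) (H : IsExt c s W f y)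
    {g : ↥(RingHom.ker (tau I W'))} (hg : g.1 = resHom h f.1) :
    IsExt c s W' g (resHom (pre I h) y) := fun W₀ h₀ h' f₀ r e => by
  rw [hg, resHom_resHom] at e
  rw [resHom_resHom]
  exact H W₀ h₀ (h'.trans h) f₀ r e

theorem chart_res {d : Chart I} (h : d.W ≤ c.W)
    {t : ↥(RingHom.ker (tau I d.W)) →ₛₗ[tau I d.W] Γ(Xhat I, embX I ⁻¹ᵁ d.W)}
    (ht : ∀ (f : ↥(RingHom.ker (tau I c.W))) (g : ↥(RingHom.ker (tau I d.W))),
      g.1 = resHom h f.1 → resHom (pre I h) (s f) = t g) (hW : IsAffineOpen W)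
    (hV : embX I ⁻¹ᵁ W ≤ embX I ⁻¹ᵁ d.W) (H : IsExt c s W f y) : IsExt d t W f y :=
  isExt_of_local fun x hx => by
    obtain ⟨W₁, hc₁, h₁, r₁, g₁, -, hx₁, hu₁, e₁, hg₁⟩ :=
      exists_local_frac c hW (pre I h (hV hx)) hx f.1
    have hg := resHom_mem_ker h (hg₁ f.2)
    have a₁ := H W₁ hc₁ h₁ ⟨g₁, hg₁ f.2⟩ r₁ e₁
    have a₂ := ht ⟨g₁, hg₁ f.2⟩ ⟨_, hg⟩ rfl
    have i₁ : W₁ ⊓ d.W ≤ W₁ := inf_le_left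
    have i₂ : W₁ ⊓ d.W ≤ d.W := inf_le_right
    replace e₁ := congrArg (resHom i₁) e₁
    replace a₁ := congrArg (resHom (pre I i₁)) a₁
    replace a₂ := congrArg (resHom (pre I i₂)) a₂
    replace hu₁ := hu₁.map (resHom (pre I i₁))
    refine ⟨W₁ ⊓ d.W, i₂, i₁.trans h₁, ⟨_, hg⟩, resHom h r₁, ⟨hx₁, hV hx⟩, ?_, ?_, ?_⟩
    · rw [tau_resHom]
      simp only [resHom_resHom] at hu₁ ⊢
      exact hu₁
    · simp only [map_mul, resHom_resHom] at e₁ ⊢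
      exact e₁
    · rw [← a₂, tau_resHom]
      simp only [map_mul, resHom_resHom] at a₁ ⊢
      exact a₁

theorem self (f : ↥(RingHom.ker (tau I c.W))) : IsExt c s c.W f (s f) := fun W₀ h₀ h f₀ r e => by
  by_cases hx : ∃ x, x ∈ embX I ⁻¹ᵁ W₀
  · obtain ⟨x, hx⟩ := hx
    have := mul_apply_eq (s := s) (f₀ := f₀) (f₁ := f) (r₁ := 1) (r₀ := r) h₀ hx (by
      rw [one_mul, e, map_mul])
    rw [← map_mul, ← this, map_one, one_mul]
  · exact fun_ext fun x hx' => (hx ⟨x, hx'⟩).elim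

end IsExt

/-- `ψ` is an extension of `s`. -/
def IsExtHom (c : Chart I)
    (s : ↥(RingHom.ker (tau I c.W)) →ₛₗ[tau I c.W] Γ(Xhat I, embX I ⁻¹ᵁ c.W))
    (W : (blowup (maximalIdeal (LocPoly e))).Opens)
    (ψ : ↥(RingHom.ker (tau I W)) →ₛₗ[tau I W] Γ(Xhat I, embX I ⁻¹ᵁ W)) : Prop :=
  ∀ f, IsExt c s W f (ψ f)

/-- A homomorphism on a chart extends uniquely to the affine open sets. -/
theorem exists_extHom (c : Chart I)
    (s : ↥(RingHom.ker (tau I c.W)) →ₛₗ[tau I c.W] Γ(Xhat I, embX I ⁻¹ᵁ c.W))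
    {W : (blowup (maximalIdeal (LocPoly e))).Opens} (hW : IsAffineOpen W)
    (hV : embX I ⁻¹ᵁ W ≤ embX I ⁻¹ᵁ c.W) :
    ∃ ψ : ↥(RingHom.ker (tau I W)) →ₛₗ[tau I W] Γ(Xhat I, embX I ⁻¹ᵁ W),
      IsExtHom c s W ψ := by
  choose ψ hψ using fun f : ↥(RingHom.ker (tau I W)) => exists_isExt (s := s) (f := f) hW hV
  have hadd : ∀ f f', ψ (f + f') = ψ f + ψ f' := fun f f' => by
    have := IsExt.smul_add hW hV 1 (hψ f) (hψ f')
    rw [one_smul, map_one, one_mul] at this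
    exact (hψ _).uniq hW hV this
  have h0 : ψ 0 = 0 := by simpa using hadd 0 0
  refine ⟨⟨⟨ψ, hadd⟩, fun q f => ?_⟩, hψ⟩
  have := IsExt.smul_add hW hV q (hψ f) (hψ 0)
  rw [h0, add_zero, add_zero] at this
  exact (hψ _).uniq hW hV this

theorem exists_normalSec (c : Chart I) : ∃ σ : (normalCharts I).obj c →ₗ[Γ(Xhat I, (chartFamily I).opens c)]
    (normalData (embX I)).Sec ((chartFamily I).opens c),
    ∀ s (W : (blowup (maximalIdeal (LocPoly e))).affineOpens) (hV : embX I ⁻¹ᵁ W.1 ≤ (chartV c).1),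
      IsExtHom c s W.1 ((σ s).val W hV) := by
  choose ψ hψ using fun (s : (normalCharts I).obj c)
    (W : (blowup (maximalIdeal (LocPoly e))).affineOpens)
    (hV : embX I ⁻¹ᵁ W.1 ≤ (chartV c).1) => exists_extHom c s W.2 hV
  refine ⟨⟨⟨fun s => ⟨fun W hV => ψ s W hV, fun {W W'} h hV f g hg => ?_⟩, fun s t => ?_⟩,
    fun b s => ?_⟩, fun s W hV f => hψ s W hV f⟩
  · exact ((hψ s W' hV f).res h hg).uniq W.2 ((pre I h).trans hV) (hψ s W _ g)
  · refine LocalData.Sec.ext fun W hV => LinearMap.ext fun f => ?_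
    exact (hψ (s + t) W hV f).uniq W.2 hV ((hψ s W hV f).add_left (hψ t W hV f))
  · refine LocalData.Sec.ext fun W hV => LinearMap.ext fun f => ?_
    exact (hψ (b • s) W hV f).uniq W.2 hV ((hψ s W hV f).smul_left hV b)

theorem normalCharts_functional : (normalCharts I).Functional where
  res {d c} h s := by
    obtain ⟨t, ht⟩ := exists_extHom c s d.affW (pre I h)
    exact ⟨t, fun f g hg => (((IsExt.self f).res h hg).uniq d.affW (pre I h) (ht g))⟩
  uniq {d c} h t ht := LinearMap.ext fun f => by
    have h1 : IsExt d t d.W f 0 := IsExt.chart_res h ht d.affW le_rfl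
      (fun W₀ h₀ h' f₀ r _ => by rw [map_zero, mul_zero]; exact (map_zero _).symm)
    exact (IsExt.self f).uniq d.affW le_rfl h1
  comp {a b c} h h' h'' {s t u} e e' f g hg := by
    have h1 := resHom_mem_ker h f.2
    refine Eq.trans ?_ (e' ⟨_, h1⟩ g (hg.trans (resHom_resHom h h' f.1).symm))
    refine Eq.trans ?_ (congrArg _ (e f ⟨_, h1⟩ rfl))
    exact (resHom_resHom (pre I h) (pre I h') (s f)).symm

variable [IsDomain (RingA I)]

theorem exists_model_normal : Nonempty (Model (normalCharts I) (normalSheaf I)) := by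
  choose σ hσ using exists_normalSec (I := I)
  refine ⟨Model.ofSec isBase_chartFamily normalCharts_functional σ (fun {d c} h {s t} ht => ?_)
    (fun c s hs => ?_) fun U z x hx => ?_⟩
  · refine LocalData.Sec.ext fun W hV => LinearMap.ext fun f => ?_
    exact ((hσ c s W (hV.trans (pre I h)) f).chart_res h ht W.2 hV).uniq W.2 hV (hσ d t W hV f)
  · refine LinearMap.ext fun f => ?_
    refine (IsExt.self f).uniq c.affW le_rfl (y' := 0) ?_
    have := hσ c s ⟨c.W, c.affW⟩ le_rfl f
    rw [hs] at this
    exact this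
  · obtain ⟨c, hxc, hc⟩ := isBase_chartFamily.cover U x hx
    refine ⟨c, hc, hxc, z.val ⟨c.W, c.affW⟩ hc, ?_⟩
    refine LocalData.Sec.ext fun W hV => LinearMap.ext fun f => ?_
    refine (hσ c _ W hV f).uniq W.2 hV (isExt_of_local fun x hx => ?_)
    obtain ⟨W₁, hc₁, h₁, r₁, g₁, ha, hx₁, hu₁, e₁, hg₁⟩ := exists_local_frac c W.2 (hV hx) hx f.1
    refine ⟨W₁, hc₁, h₁, ⟨g₁, hg₁ f.2⟩, r₁, hx₁, hu₁, e₁, ?_⟩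
    have k₁ := resHom_mem_ker hc₁ (hg₁ f.2)
    have k₂ := resHom_mem_ker h₁ f.2
    have a₁ := z.property (b := ⟨c.W, c.affW⟩) (a := ⟨W₁, ha⟩) hc₁ hc ⟨g₁, hg₁ f.2⟩ ⟨_, k₁⟩ rfl
    have a₂ := z.property (b := W) (a := ⟨W₁, ha⟩) h₁ (hV.trans hc) f ⟨_, k₂⟩ rfl
    refine Eq.trans ?_ a₁.symm
    refine (congrArg (_ * ·) a₂).trans ?_
    have k₃ : (⟨_, k₁⟩ : ↥(RingHom.ker (tau I W₁))) = resHom hc₁ r₁ • ⟨_, k₂⟩ := Subtype.ext e₁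
    refine Eq.trans ?_ (congrArg _ k₃.symm)
    refine Eq.trans ?_ (LinearMap.map_smulₛₗ _ _ _).symm
    rw [← tau_resHom]; rfl

set_option maxHeartbeats 2000000 in
theorem nonempty_iso_NA (hI : IsQL I) : Nonempty (NA I ≅ twistC I 2 (normalSheaf I)) := by
  obtain ⟨n, f, hf, hQ, hL⟩ := hI.exists_eq
  obtain ⟨m⟩ := exists_model (I := I) (relT1Data_coherent (projA I) (piX I) chartV)
  obtain ⟨m₁⟩ := exists_model_normal (I := I)
  obtain ⟨m'⟩ := exists_model_twist 2 m₁
  obtain ⟨φ, hφ⟩ := LocalData.exists_hom_of_rel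
    (G := onCharts I (relT1Data (projA I) (piX I)))
    (G' := twistLocal (piX I) (maxA I) 2 (normalCharts I))
    (fun c s t => RelNormal (projA I) (projA_surjective I) (maximalIdeal (LocPoly e))
      (toSec (piP e) c.W) (toSec (piX I) (chartV c).1) (tau I c.W) s t)
    (fun H H' => RelNormal.add H H') (fun r H => RelNormal.smul r H)
    (fun c s => RelNormal.total c.isChart hQ s) (fun {c t} H => RelNormal.uniq c.isChart H)
    (fun {c d} h {s s' t t'} hs H H' => by
      obtain ⟨x, hx, e⟩ := RelNormal.nat (t := s) (t' := s') (ψ := t) (ψ' := t') d.isChart c.isChart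
        (resHom_comp_toSec (piP e) h) (resHom_comp_toSec (piX I) (chartV_mono h)) (resHom_embX h)
        hs H H'
      exact twistLocal_compat (n := 2) (G := normalCharts I)
        (a := c) (b := d) (ψ := t) (χ := t') h hx e)
  refine m.nonempty_iso isBase_chartFamily m' φ (fun c s hs => ?_) fun c t => ?_
  · rw [RelNormal.inj c.isChart ((hφ c s 0).mpr hs)]; exact map_zero _
  · obtain ⟨s, hs⟩ := RelNormal.surj (hp := projA_surjective I) c.isChart hQ t
    exact ⟨s, congrArg _ ((hφ c s t).mp hs)⟩

end
end QLSing

namespace QLSing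
noncomputable section

/-! ### Twists of sheaves with finite support -/

open nonZeroDivisors IsLocalRing

theorem Model.nonempty_iso_of_local {Y : Scheme.{0}} {𝓦 : OpenFamily Y} {G G' : LocalData 𝓦}
    {M M' : Y.Modules} (hB : IsBase 𝓦) (m : Model G M) (m' : Model G' M') (φ : LocalData.Hom G G')
    (H : ∀ x : Y, ∃ U : Y.Opens, x ∈ U ∧ ∀ a, 𝓦.opens a ≤ U →
      (∀ s, φ.app a s = 0 → m.η a s = 0) ∧ ∀ t, ∃ s, m'.η a (φ.app a s) = m'.η a t) :
    Nonempty (M ≅ M') := by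
  obtain ⟨f, hf⟩ := m.exists_hom hB m' φ
  have h1 : SecInj f := fun U z hz => sec_ext fun x hx => by
    obtain ⟨V, hxV, hV⟩ := H x
    obtain ⟨a, ha, hxa, s, hs⟩ := m.surj U z x hx
    have h1 := hf a s
    rw [hs, app_mres, hz, map_zero] at h1
    obtain ⟨b, hba, hxb, h0⟩ := m'.inj a _ h1.symm x hxa
    obtain ⟨c, hca, hcb, hxc, hcV⟩ := hB.refine a b x hxa hxb V hxV
    obtain ⟨s₁, hs₁⟩ := m.func.res hba s
    obtain ⟨s₂, hs₂⟩ := m.func.res hcb s₁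
    have h2 := m'.func.eq (φ.compat hba hs₁) h0
    have h3 := φ.compat hcb hs₂
    rw [h2] at h3
    refine ⟨_, (𝓦.mono hca).trans ha, hxc, ?_⟩
    rw [← mres_mres ha (𝓦.mono hca), ← hs, m.compat hca (m.func.comp hba hcb hca hs₁ hs₂),
      (hV c hcV).1 s₂ (m'.func.uniq hcb _ h3), map_zero]
  have h2 : LocSurj f := fun U z x hx => by
    obtain ⟨V, hxV, hV⟩ := H x
    obtain ⟨a, ha, hxa, t, ht⟩ := m'.surj U z x hx
    obtain ⟨c, hca, -, hxc, hcV⟩ := hB.refine a a x hxa hxa V hxV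
    obtain ⟨t', ht'⟩ := m'.func.res hca t
    obtain ⟨s, hs⟩ := (hV c hcV).2 t'
    refine ⟨_, (𝓦.mono hca).trans ha, hxc, m.η c s, ?_⟩
    rw [hf, hs, ← m'.compat hca ht', ht, mres_mres]
  have := isIso_of_sec h1 h2
  exact ⟨asIso f⟩

section Eval

variable {Y : Scheme.{0}} {A : Type} [CommRing A] (π : Y ⟶ Spec (.of A)) (m : Ideal A) {K : Type}
  {v : K → Y.affineOpens} {le : K → K → Prop} {hle : ∀ {a b}, le a b → (v a).1 ≤ (v b).1}

theorem toSec_pow_mem {x : A} (hx : x ∈ m) (n : ℕ) (V : Y.Opens) :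
    toSec π V x ^ n ∈ excIdeal π m V ^ n :=
  Ideal.pow_mem_pow (Ideal.mem_map_of_mem _ hx) n

theorem resHom_toSec_pow (x : A) (n : ℕ) {U V : Y.Opens} (h : V ≤ U) :
    resHom h (toSec π U x ^ n) = toSec π V x ^ n := by
  rw [map_pow, ← resHom_comp_toSec π h]; rfl

/-- The evaluation of homomorphisms at `xⁿ`. -/
abbrev evalPow {x : A} (hx : x ∈ m) (n : ℕ) (G : LocalData (subFamily v le hle)) :
    LocalData.Hom (twistLocal π m n G) G where
  app a :=
    { toFun := fun ψ => ψ ⟨_, toSec_pow_mem π m hx n (v a).1⟩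
      map_add' := fun _ _ => rfl
      map_smul' := fun _ _ => rfl }
  compat {a b} h ψ χ H := by
    have e : (⟨resHom (hle h) (toSec π (v b).1 x ^ n), excIdeal_pow_le_comap π m (hle h) n
        (toSec_pow_mem π m hx n (v b).1)⟩ : ↥(excIdeal π m (v a).1 ^ n)) =
        ⟨_, toSec_pow_mem π m hx n (v a).1⟩ := Subtype.ext (resHom_toSec_pow π x n (hle h))
    have h1 := H ⟨_, toSec_pow_mem π m hx n (v b).1⟩
    rw [e] at h1
    exact h1

variable {π m}

theorem Model.nonempty_iso_twist {G : LocalData (subFamily v le hle)} {M : Y.Modules}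
    (hB : IsBase (subFamily v le hle)) (hC : CartierOn π m v) (μ : Model G M) (n : ℕ) {x : A}
    (hx : x ∈ m) (H : ∀ z : Y, ∃ U : Y.Opens, z ∈ U ∧ ∀ a, (v a).1 ≤ U → Subsingleton Γ(M, (v a).1) ∨
      excIdeal π m (v a).1 = Ideal.span {toSec π (v a).1 x} ∧ toSec π (v a).1 x ∈ Γ(Y, (v a).1)⁰) :
    Nonempty (twist π m n M ≅ M) := by
  obtain ⟨μ'⟩ := Model.nonempty_twist hB hC n μ
  refine μ'.nonempty_iso_of_local hB μ (evalPow π m hx n G) fun z => ?_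
  obtain ⟨U, hzU, hU⟩ := H z
  refine ⟨U, hzU, fun a ha => ?_⟩
  obtain h0 | ⟨h1, h2⟩ := hU a ha
  · refine ⟨fun s _ => sec_ext fun z hz => ?_, fun t => ⟨0, h0.elim _ _⟩⟩
    obtain ⟨y, hy, -⟩ := hC.exists_pow n a
    have hy1 : y ∈ excIdeal π m (v a).1 ^ n := by rw [hy]; exact Ideal.mem_span_singleton_self y
    obtain ⟨c, hca, hzc, h1⟩ := μ.inj a (s ⟨y, hy1⟩) (h0.elim _ _) z hz
    refine ⟨_, hle hca, hzc, ?_⟩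
    rw [μ'.compat (t := 0) hca (twistLocal_compat hca hy fun _ _ => h1), map_zero, map_zero]
  · have h3 : excIdeal π m (v a).1 ^ n = Ideal.span {toSec π (v a).1 x ^ n} := by
      rw [h1, Ideal.span_singleton_pow]
    refine ⟨fun s hs => ?_, fun t => ?_⟩
    · rw [hom_span_ext h3 _ hs, map_zero]
    · obtain ⟨χ, hχ⟩ := exists_hom_span h3 (pow_mem h2 n) t
      refine ⟨χ, congrArg _ ((hχ 1 _ _ (one_mul _).symm).trans (one_smul _ _))⟩

end Eval

/-- The homogeneous prime ideal of a point of the blow-up. -/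
def pointIdeal {R : Type} [CommRing R] {J : Ideal R} (z : blowup J) : Ideal (reesAlgebra J) :=
  (show ProjectiveSpectrum (reesPiece J) from z).asHomogeneousIdeal.toIdeal

theorem mem_chartOpen {R : Type} [CommRing R] {J : Ideal R} {x : R} {hx : x ∈ J} {z : blowup J} :
    z ∈ chartOpen hx ↔ degOne hx ∉ pointIdeal z := Iff.rfl

theorem ChartProps.map_eq_span {R : Type} [CommRing R] {Y : Scheme.{0}} {π : Y ⟶ Spec (.of R)}
    {J : Ideal R} {x : R} {U : Y.Opens} (h : ChartProps π J x U) (hx : x ∈ J) {V : Y.Opens}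
    (hV : V ≤ U) : J.map (toSec π V) = Ideal.span {toSec π V x} := by
  refine le_antisymm (Ideal.map_le_iff_le_comap.mpr fun r hr => ?_)
    ((Ideal.span_singleton_le_iff_mem _).mpr (Ideal.mem_map_of_mem _ hx))
  obtain ⟨y, hy⟩ := h.div r hr
  rw [← resHom_comp_toSec π hV]
  exact Ideal.mem_span_singleton'.mpr ⟨resHom hV y, by
    rw [RingHom.comp_apply, RingHom.comp_apply, ← hy, map_mul, mul_comm]⟩

section Forms

variable {e : ℕ} {I : Ideal (LocPoly e)}

/-- The linear form with the given coefficients. -/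
def linForm (l : Fin e → ℂ) : LocPoly e := ∑ i, l i • coordX i

theorem linForm_mem (l : Fin e → ℂ) : linForm l ∈ maximalIdeal (LocPoly e) :=
  sum_mem fun i _ => by
    rw [Algebra.smul_def]; exact Ideal.mul_mem_left _ _ (coordX_mem i)

variable (I) in
theorem linForm_mem_maxA (l : Fin e → ℂ) : projA I (linForm l) ∈ maxA I :=
  Ideal.mem_map_of_mem _ (linForm_mem l)

variable (I) in
theorem coordX_mem_maxA (i : Fin e) : projA I (coordX i) ∈ maxA I :=
  Ideal.mem_map_of_mem _ (coordX_mem i)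

theorem linForm_single (i : Fin e) : linForm (Pi.single i 1) = coordX i := by
  rw [linForm, Finset.sum_eq_single i (fun j _ hj => by rw [Pi.single_eq_of_ne hj, zero_smul])
    fun h => (h (Finset.mem_univ i)).elim, Pi.single_eq_same, one_smul]

theorem linForm_add (l l' : Fin e → ℂ) : linForm (l + l') = linForm l + linForm l' := by
  simp only [linForm, Pi.add_apply, add_smul, Finset.sum_add_distrib]

theorem linForm_smul (c : ℂ) (l : Fin e → ℂ) :
    linForm (c • l) = algebraMap ℂ (LocPoly e) c * linForm l := by
  rw [← Algebra.smul_def]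
  simp only [linForm, Pi.smul_apply, smul_assoc, Finset.smul_sum]

theorem exists_mem_chartOpen (z : Xhat I) :
    ∃ i, z ∈ chartOpen (coordX_mem_maxA I i) := by
  have h1 := iSup_chartOpen (x := fun i => projA I (coordX i)) (J := maxA I)
    (coordX_mem_maxA I)
    (by rw [maxA, maximalIdeal_eq, Ideal.map_span, ← Set.range_comp]; rfl)
  have h2 : z ∈ (⊤ : (Xhat I).Opens) := trivial
  rw [← h1] at h2
  exact Opens.mem_iSup.mp h2

/-- The coefficients of the linear forms that vanish at a point. -/
def linFormsAt (z : Xhat I) : Submodule ℂ (Fin e → ℂ) where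
  carrier := {l | degOne (linForm_mem_maxA I l) ∈ pointIdeal z}
  add_mem' {l l'} h h' := by
    have e : degOne (linForm_mem_maxA I (l + l')) =
        degOne (linForm_mem_maxA I l) +
          degOne (linForm_mem_maxA I l') := Subtype.ext (by
      change Polynomial.monomial 1 _ = Polynomial.monomial 1 _ + Polynomial.monomial 1 _
      rw [linForm_add, map_add, map_add])
    exact (congrArg (· ∈ pointIdeal z) e).mpr (add_mem h h')
  zero_mem' := by
    have e : degOne (linForm_mem_maxA I 0) = 0 := Subtype.ext (by
      change Polynomial.monomial 1 _ = 0
      simp [linForm])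
    exact (congrArg (· ∈ pointIdeal z) e).mpr (zero_mem _)
  smul_mem' c l h := by
    have e : degOne (linForm_mem_maxA I (c • l)) =
        algebraMap _ _ (projA I (algebraMap ℂ (LocPoly e) c)) *
          degOne (linForm_mem_maxA I l) := Subtype.ext (by
      change Polynomial.monomial 1 _ = Polynomial.C _ * Polynomial.monomial 1 _
      rw [linForm_smul, map_mul, Polynomial.C_mul_monomial])
    exact (congrArg (· ∈ pointIdeal z) e).mpr (Ideal.mul_mem_left _ _ h)

theorem linFormsAt_ne_top (z : Xhat I) : linFormsAt z ≠ ⊤ := fun h => by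
  obtain ⟨i, hi⟩ := exists_mem_chartOpen z
  have h1 : (Pi.single i 1 : Fin e → ℂ) ∈ linFormsAt z := h ▸ trivial
  have : ∀ (x : LocPoly _) (hx : x ∈ maximalIdeal (LocPoly _)), x = coordX i →
      z ∈ chartOpen (show projA I x ∈ maxA I from Ideal.mem_map_of_mem _ hx) := by
    rintro _ _ rfl; exact hi
  exact mem_chartOpen.mp (this _ (linForm_mem _) (linForm_single i)) h1

theorem exists_linForm {Z : Set (Xhat I)} (hZ : Z.Finite) :
    ∃ l : Fin e → ℂ, ∀ z ∈ Z, z ∈ chartOpen (linForm_mem_maxA I l) := by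
  have := hZ.to_subtype
  by_contra! h
  obtain ⟨z, hz⟩ := Subspace.exists_eq_top_of_iUnion_eq_univ (p := fun z : Z => linFormsAt z.1)
    (Set.eq_univ_of_forall fun l => by
      obtain ⟨z, hz, hl⟩ := h l
      exact Set.mem_iUnion.mpr ⟨⟨z, hz⟩, not_not.mp hl⟩)
  exact linFormsAt_ne_top _ hz

theorem nonempty_iso_twist_of_finite [IsDomain (RingA I)] {H : LocalData (affineFamily (Xhat I))}
    (hH : H.Coherent (chartV (I := I))) (hs : HasFiniteSupport H.sheaf) (n : ℕ) :
    Nonempty (twistC I n H.sheaf ≅ H.sheaf) := by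
  obtain ⟨Z, hZ, hZc, hZ0⟩ := hs
  obtain ⟨l, hl⟩ := exists_linForm hZ
  obtain ⟨μ⟩ := exists_model hH
  have hx := linForm_mem_maxA I l
  refine Model.nonempty_iso_twist isBase_chartFamily cartierOn_chartV μ n hx fun z => ?_
  by_cases hz : z ∈ Z
  · refine ⟨_, hl z hz, fun c hc => ?_⟩
    have h0 : projA I (linForm l) ≠ 0 := fun h0 => by
      have h1 := hl z hz
      rw [mem_chartOpen] at h1
      refine h1 ?_
      have e : degOne hx = 0 := Subtype.ext (by
        change Polynomial.monomial 1 _ = 0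
        rw [h0, map_zero])
      rw [e]
      exact zero_mem _
    have hP := chartProps_chartOpen hx h0
    have : IsDomain Γ(Xhat I, (chartV c).1) := c.isChart.domB
    exact .inr ⟨hP.map_eq_span hx hc, mem_nonZeroDivisors_of_ne_zero fun h =>
      h0 (c.isChart.injB (h.trans (map_zero _).symm))⟩
  · exact ⟨⟨Zᶜ, hZc.isOpen_compl⟩, hz, fun c hc => .inl (hZ0 _ (Set.disjoint_left.mpr fun x hx => hc hx))⟩

end Forms

end
end QLSing

theorem mainTheorem6 (e : ℕ) (I : Ideal (QLSing.LocPoly e)) (hI : QLSing.IsQL I) :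
    Nonempty (QLSing.F0 I ≅ QLSing.twistC I 1 (QLSing.derC I)) ∧
    Nonempty (QLSing.NA I ≅ QLSing.twistC I 2 (QLSing.normalSheaf I)) ∧
    (∃ (f : QLSing.twistC I 1 (QLSing.A1 I) ⟶ QLSing.mMul I (QLSing.F1 I))
      (g : QLSing.mMul I (QLSing.F1 I) ⟶ QLSing.twistC I 1 (QLSing.TX1 I)) (w : f ≫ g = 0),
      (ShortComplex.mk f g w).ShortExact) ∧
    Nonempty (QLSing.mMul I (QLSing.F2 I) ≅ QLSing.twistC I 2 (QLSing.TX2 I)) ∧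
    (QLSing.HasFiniteSupport (QLSing.TX2 I) →
      Nonempty (QLSing.mMul I (QLSing.F2 I) ≅ QLSing.TX2 I)) := by
  have := hI.isDomain
  refine ⟨QLSing.nonempty_iso_F0, QLSing.nonempty_iso_NA hI, QLSing.exists_shortExact_F1 hI,
    QLSing.nonempty_iso_F2 hI, fun hs => ?_⟩
  obtain ⟨α⟩ := QLSing.nonempty_iso_F2 hI
  obtain ⟨β⟩ := QLSing.nonempty_iso_twist_of_finite
    (QLSing.absT2Data_coherent (QLSing.baseC I) (QLSing.piX I) QLSing.chartV QLSing.finPres_toSec)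
    hs 2
  exact ⟨α.trans β⟩
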